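/- **Setting.** Let $p,q\ge 2$, $n=p+q$, and $[x,y]=\sum_{i=1}^n\lambda_ix_iy_i$ on $\mathbb R^n$ (row vectors), $\lambda_1=\dots=\lambda_p=-1$, $\lambda_{p+1}=\dots=\lambda_n=1$, $I=\mathrm{diag}(\lambda_i)$. Let $G=\mathrm{SO}_0(p,q)$ act on rows from the right, with Lie algebra $\mathfrak g$. Put $\langle\xi,\eta\rangle=\sum_{i=2}^{n-1}\lambda_i\xi_i\eta_i$ on $\mathbb R^{n-2}$, $s^\pm=(1,0,\dots,0,\pm1)$, $$u(\xi)=(1+\langle\xi,\xi\rangle,2\xi,-1+\langle\xi,\xi\rangle),\quad v(\eta)=(1+\langle\eta,\eta\rangle,2\eta,1-\langle\eta,\eta\rangle),$$ $$N(\xi,\eta)=-\tfrac12[u(\xi),v(\eta)]=1-2\langle\xi,\eta\rangle+\langle\xi,\xi\rangle\langle\eta,\eta\rangle .$$ Let $z(x,y)=I y'x/[x,y]$, where $y'$ is the transpose of the row $y$, $z^0=z(s^-,s^+)$, and $G/H=\Omega=\{g^{-1}z^0g: g\in G\}$, with local coordinates $\xi,\eta$ ($N(\xi,\eta)\neq0$)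 given by $z(\xi,\eta)=z(u(\xi),v(\eta))$. $S(G/H)$ is the algebra of restrictions to $\Omega$ of complex polynomials in the matrix entries. For $\sigma\in\mathbb C$, $\varepsilon\in\{0,1\}$, put $t^{\sigma,\varepsilon}=|t|^\sigma(\operatorname{sgn}t)^\varepsilon$, $\Phi_{\sigma,\varepsilon}=N^{\sigma,\varepsilon}$. Let $T_{\sigma,\varepsilon}$ be the representation of $G$ by translations $f(x)\mapsto f(xg)$ on functions on the cone $[x,x]=0$, $x\ne0$, that satisfy $f(tx)=t^{\sigma,\varepsilon}f(x)$, realized on functions of $\xi$ or of $\eta$ through $f(u(\xi))$ or $f(v(\eta))$, and also the corresponding representation of $\mathfrak g$ and of its enveloping algebra $\mathrm{Env}(\mathfrak g)$. For $X\in \mathrm{Env}(\mathfrak g)$ the operator $T_{\sigma,\varepsilon}(X)$ has - the covariant symbol $\Phi_{\sigma,\varepsilon}^{-1}\,(T_{\sigma,\varepsilon}(X)\otimes1)\Phi_{\sigma,\varepsilon}$, acting in $\xi$; - the contravariant symbol $\Phi_{\sigma',\varepsilon}^{-1}\,(1\otimes T_{\sigma',\varepsilon}(X))\Phi_{\sigma',\varepsilon}$,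 acting in $\eta$, where $\sigma'=2-n-\sigma$. The Berezin transform $\mathcal B=\mathcal B_{\sigma,\varepsilon}$ takes the contravariant symbol of each $T_{\sigma,\varepsilon}(X)$ to its covariant symbol; the product $F_1*F_2$ of the covariant symbols of two operators is the covariant symbol of their product. $\Delta_2,\Delta_4$ are the $G$-invariant differential operators on $G/H$ that at $z^0$, in the coordinates $\xi,\eta$, are $\langle\partial_\xi,\partial_\eta\rangle$ and $\langle\partial_\xi,\partial_\xi\rangle\langle\partial_\eta,\partial_\eta\rangle$. The Poisson bracket is the $G$-invariant one that at $z^0$ is $\{F_1,F_2\}=\frac12\left(\langle\partial_\eta F_1,\partial_\xi F_2\rangle-\langle\partial_\xi F_1,\partial_\eta F_2\rangle\right)$. Let $A_t$, $t=(t_1,t_2)$, be the $n\times n$ matrix with entries $t_1$ at $(1,n-1),(n-1,1)$, entries $t_2$ at $(2,n),(n,2)$ and zeros elsewhere, and let $U=\exp\mathfrak n$, where $\mathfrak n$ is the sum of the root spaces of the roots of $\{A_t\}$ in $\mathfrak g$ that are positive in the lexicographical order. For $F\in S(G/H)$ invariant under $z\mapsto\nu^{-1}z\nu$, $\nu\in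 U$ (for short: $U$-invariant), put $f(t)=F(e^{-A_t}z^0e^{A_t})$. Let $$D_1=\left[\tfrac{\partial}{\partial t_1}+\tfrac{\partial}{\partial t_2}+n-3\right]^2-(2n-7),\qquad D_2=\left[\tfrac{\partial}{\partial t_1}-\tfrac{\partial}{\partial t_2}+1\right]^2-(2n-7).$$ Call $\sigma$ generic if neither $\sigma$ nor $\sigma+\frac n2$ is an integer. **Theorem.** For every $\varepsilon$ and every generic $\sigma$, the Berezin transform $\mathcal B$ and the product $*$ are well defined, as a linear and a bilinear map on the whole of $S(G/H)$, uniquely determined by the above, and: 1. On $U$-invariant $F\in S(G/H)$ the operators $\Delta_2,\Delta_4$ have the radial parts $\frac12\{D_1+D_2-(n-4)(n-6)\}$ and $D_1D_2+2(n-4)^3$, acting on $f(t)$. 2. $\mathcal B$ is expressed in terms of the Laplace operators by $$\mathcal B=\frac{\Gamma(-\sigma+\frac{a+b}2)\,\Gamma(3-n-\sigma-\frac{a+b}2)\,\Gamma(2-\frac n2-\sigma+\frac{a-b}2)\,\Gamma(1-\frac n2-\sigma-\frac{a-b}2)}{\Gamma(-\sigma)\,\Gamma(3-n-\sigma)\,\Gamma(2-\frac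 n2-\sigma)\,\Gamma(1-\frac n2-\sigma)},$$ where $$D_1=(a+b)^2+2(n-3)(a+b)+(n-4)^2,\qquad D_2=(a-b)^2+2(a-b)-2(n-4).$$ That is: $S(G/H)$ is spanned by the functions $F$ for which there are $a,b\in\mathbb C$ such that, with these numbers $D_1,D_2$, $\Delta_2F=\frac12\{D_1+D_2-(n-4)(n-6)\}F$ and $\Delta_4F=\{D_1D_2+2(n-4)^3\}F$; and $\mathcal B$ multiplies each such $F$ by the ratio above. Also, $\mathcal B$ multiplies by this ratio every $U$-invariant $F\in S(G/H)$ whose $f(t)$ is an eigenfunction of the operators $D_1,D_2$ with these numbers as eigenvalues. 3. As $\sigma\to-\infty$ through generic real numbers, $\mathcal B\sim1-\frac1{2\sigma}\Delta_2$: for all $F\in S(G/H)$ and $z\in G/H$, $(\mathcal BF)(z)=F(z)-\frac1{2\sigma}(\Delta_2F)(z)+O(\sigma^{-2})$. 4. (Correspondence principle.) As $\sigma\to-\infty$ through generic real numbers, for all $F_1,F_2\in S(G/H)$, pointwise on $G/H$, $$F_1*F_2\to F_1F_2,\qquad-\sigma\,(F_1*F_2-F_2*F_1)\to\{F_1,F_2\}.$$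 -/

import Mathlib

open Filter Topology Asymptotics

noncomputable section

namespace ParaHermitian

/-! Throughout, `n = m + 2 = p + q`; vectors of `ℝⁿ` are rows, indexed by `Fin (m + 2)`, and the
coordinates `ξ`, `η` are rows of length `n - 2 = m`. -/

/-- The signs `-1, …, -1` (`p` times), `+1, …, +1` of the form on `ℝⁿ`. -/
def lam (p : ℕ) {m : ℕ} (i : Fin (m + 2)) : ℝ := if (i : ℕ) < p then -1 else 1

/-- The signs of the form on `ℝⁿ⁻²`, i.e. `lam` without its first and last entries. -/
def lamMid (p : ℕ) {m : ℕ} (i : Fin m) : ℝ := lam p i.succ.castSucc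

/-- `[x, y]` on `ℝⁿ`. -/
def form (p : ℕ) {m : ℕ} (x y : Fin (m + 2) → ℝ) : ℝ := ∑ i, lam p i * x i * y i

/-- `⟨ξ, η⟩` on `ℝⁿ⁻²`. -/
def formMid (p : ℕ) {m : ℕ} (ξ η : Fin m → ℝ) : ℝ := ∑ i, lamMid p i * ξ i * η i

/-- The Gram matrix `I` of `[x, y]`. -/
def gram (p m : ℕ) : Matrix (Fin (m + 2)) (Fin (m + 2)) ℝ := Matrix.diagonal (lam p)

/-- The group `SO₀(p, q)`, acting on rows from the right: the connected component of the identity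
in the group of matrices of determinant one that preserve the form. -/
def SO₀ (p m : ℕ) : Set (Matrix (Fin (m + 2)) (Fin (m + 2)) ℝ) :=
  connectedComponentIn {g | g * gram p m * g.transpose = gram p m ∧ g.det = 1} 1

/-- The space of its Lie algebra: the matrices `X` with `X' I + I X = 0`. -/
abbrev lieAlg (p m : ℕ) : Submodule ℝ (Matrix (Fin (m + 2)) (Fin (m + 2)) ℝ) :=
  skewAdjointMatricesSubmodule (gram p m)

/-- The row `(a, ξ, b)`. -/
def row {m : ℕ} (a : ℝ) (ξ : Fin m → ℝ) (b : ℝ) : Fin (m + 2) → ℝ :=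
  Fin.cons a (Fin.snoc (α := fun _ => ℝ) ξ b)

/-- The middle part of a row. -/
def middle {m : ℕ} (x : Fin (m + 2) → ℝ) : Fin m → ℝ := fun i => x i.succ.castSucc

/-- The point `s⁺ = (1, 0, …, 0, 1)` of the cone. -/
def sPlus (m : ℕ) : Fin (m + 2) → ℝ := row 1 0 1

/-- The point `s⁻ = (1, 0, …, 0, -1)` of the cone. -/
def sMinus (m : ℕ) : Fin (m + 2) → ℝ := row 1 0 (-1)

/-- The point of the section `Γ⁻ = {[x, s⁺] = -2}` of the cone with coordinates `ξ`. -/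
def uVec (p : ℕ) {m : ℕ} (ξ : Fin m → ℝ) : Fin (m + 2) → ℝ :=
  row (1 + formMid p ξ ξ) (2 • ξ) (-1 + formMid p ξ ξ)

/-- The point of the section `Γ⁺ = {[x, s⁻] = -2}` of the cone with coordinates `η`. -/
def vVec (p : ℕ) {m : ℕ} (η : Fin m → ℝ) : Fin (m + 2) → ℝ :=
  row (1 + formMid p η η) (2 • η) (1 - formMid p η η)

/-- `N(ξ, η) = -[u(ξ), v(η)] / 2 = 1 - 2 ⟨ξ, η⟩ + ⟨ξ, ξ⟩ ⟨η, η⟩`. -/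
def N (p : ℕ) {m : ℕ} (ξ η : Fin m → ℝ) : ℝ :=
  1 - 2 * formMid p ξ η + formMid p ξ ξ * formMid p η η

/-- `t^{σ, ε} = |t|^σ (sgn t)^ε`. -/
def powSgn (t : ℝ) (σ : ℂ) (ε : Fin 2) : ℂ :=
  ((|t| : ℝ) : ℂ) ^ σ * ((Real.sign t : ℝ) : ℂ) ^ (ε : ℕ)

/-- `Φ_{σ, ε}(ξ, η) = N(ξ, η)^{σ, ε}`. -/
def Phi (p : ℕ) {m : ℕ} (σ : ℂ) (ε : Fin 2) (ξ η : Fin m → ℝ) : ℂ := powSgn (N p ξ η) σ ε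

/-! ### The representations `T_{σ, ε}` of the cone on functions on the sections -/

/-- `(T_{σ, ε}(g) φ)(ξ) = φ(ξ̃) {-[u g, s⁺] / 2}^{σ, ε}` on functions on `Γ⁻`, where `ξ̃` are the
coordinates of the point `-2 u g / [u g, s⁺]` of `Γ⁻`, `u = u(ξ)`. -/
def groupMinus (p : ℕ) {m : ℕ} (σ : ℂ) (ε : Fin 2)
    (g : Matrix (Fin (m + 2)) (Fin (m + 2)) ℝ) (φ : (Fin m → ℝ) → ℂ) (ξ : Fin m → ℝ) : ℂ :=
  let x := Matrix.vecMul (uVec p ξ) g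
  φ ((1 / 2 : ℝ) • middle ((-2 / form p x (sPlus m)) • x)) *
    powSgn (-(1 / 2) * form p x (sPlus m)) σ ε

/-- `T_{σ, ε}(g)` on functions on `Γ⁺`; here `s⁻` takes the place of `s⁺`. -/
def groupPlus (p : ℕ) {m : ℕ} (σ : ℂ) (ε : Fin 2)
    (g : Matrix (Fin (m + 2)) (Fin (m + 2)) ℝ) (ψ : (Fin m → ℝ) → ℂ) (η : Fin m → ℝ) : ℂ :=
  let y := Matrix.vecMul (vVec p η) g
  ψ ((1 / 2 : ℝ) • middle ((-2 / form p y (sMinus m)) • y)) *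
    powSgn (-(1 / 2) * form p y (sMinus m)) σ ε

/-- `T_{σ, ε}(X) = d/ds T_{σ, ε}(exp sX)` at `s = 0`, on functions on `Γ⁻`. -/
def algMinus (p : ℕ) {m : ℕ} (σ : ℂ) (ε : Fin 2) (X : lieAlg p m) (φ : (Fin m → ℝ) → ℂ) :
    (Fin m → ℝ) → ℂ :=
  fun ξ => deriv (fun s : ℝ =>
    groupMinus p σ ε (NormedSpace.exp (s • (X : Matrix (Fin (m + 2)) (Fin (m + 2)) ℝ))) φ ξ) 0

/-- `T_{σ, ε}(X) = d/ds T_{σ, ε}(exp sX)` at `s = 0`, on functions on `Γ⁺`. -/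
def algPlus (p : ℕ) {m : ℕ} (σ : ℂ) (ε : Fin 2) (X : lieAlg p m) (ψ : (Fin m → ℝ) → ℂ) :
    (Fin m → ℝ) → ℂ :=
  fun η => deriv (fun s : ℝ =>
    groupPlus p σ ε (NormedSpace.exp (s • (X : Matrix (Fin (m + 2)) (Fin (m + 2)) ℝ))) ψ η) 0

/-- `T_{σ, ε}(X₁ ⋯ X_r) = T_{σ, ε}(X₁) ∘ ⋯ ∘ T_{σ, ε}(X_r)` on functions on `Γ⁻`. The list
`[X₁, …, X_r]` stands for the element `X₁ ⋯ X_r` of the enveloping algebra; these elements span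
the enveloping algebra. -/
def envMinus (p : ℕ) {m : ℕ} (σ : ℂ) (ε : Fin 2) (w : List (lieAlg p m))
    (φ : (Fin m → ℝ) → ℂ) : (Fin m → ℝ) → ℂ :=
  w.foldr (algMinus p σ ε) φ

/-- `T_{σ, ε}(X₁ ⋯ X_r)` on functions on `Γ⁺`. -/
def envPlus (p : ℕ) {m : ℕ} (σ : ℂ) (ε : Fin 2) (w : List (lieAlg p m))
    (ψ : (Fin m → ℝ) → ℂ) : (Fin m → ℝ) → ℂ :=
  w.foldr (algPlus p σ ε) ψ

/-- The covariant symbol `Φ(ξ, η)⁻¹ D_ξ Φ(ξ, η)`, `Φ = Φ_{σ, ε}`, of `D = T_{σ, ε}(X₁ ⋯ X_r)`. -/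
def covSymbol (p : ℕ) {m : ℕ} (σ : ℂ) (ε : Fin 2) (w : List (lieAlg p m))
    (ξ η : Fin m → ℝ) : ℂ :=
  (Phi p σ ε ξ η)⁻¹ * envMinus p σ ε w (fun ξ' => Phi p σ ε ξ' η) ξ

/-- The contravariant symbol of `D = T_{σ, ε}(X₁ ⋯ X_r)`. With `σ' = 2 - n - σ`, the operator with
contravariant symbol `F` is `c A_{σ', ε}` composed with the integral operator with kernel
`F(u, v) Φ_{σ', ε}(u, v)`, and `c A_{σ', ε} A_{σ, ε} = 1` where `A_{σ, ε}` has the kernel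
`Φ_{σ', ε}` and intertwines `T_{σ, ε}` with `T_{σ', ε}`. So `F` is the contravariant symbol of `D`
when `F Φ_{σ', ε} = T_{σ', ε}(X₁ ⋯ X_r) Φ_{σ', ε}`, the operator acting in the second variable. -/
def contraSymbol (p : ℕ) {m : ℕ} (σ : ℂ) (ε : Fin 2) (w : List (lieAlg p m))
    (ξ η : Fin m → ℝ) : ℂ :=
  (Phi p (-(m : ℂ) - σ) ε ξ η)⁻¹ *
    envPlus p (-(m : ℂ) - σ) ε w (fun η' => Phi p (-(m : ℂ) - σ) ε ξ η') η

/-! ### The space `G/H` and the polynomials on it -/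

/-- The matrix `y* x / [x, y]`, where `y* = I y'`. -/
def proj (p : ℕ) {m : ℕ} (x y : Fin (m + 2) → ℝ) : Matrix (Fin (m + 2)) (Fin (m + 2)) ℝ :=
  (form p x y)⁻¹ • Matrix.vecMulVec (Matrix.mulVec (gram p m) y) x

/-- The initial point `z⁰`; its stabilizer in `SO₀(p, q)` is `H`. -/
def z₀ (p m : ℕ) : Matrix (Fin (m + 2)) (Fin (m + 2)) ℝ := proj p (sMinus m) (sPlus m)

/-- `Ω = G/H`, as the orbit of `z⁰` under `z ↦ g⁻¹ z g`. -/
def Omega (p m : ℕ) : Set (Matrix (Fin (m + 2)) (Fin (m + 2)) ℝ) :=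
  {z | ∃ g ∈ SO₀ p m, z = g⁻¹ * z₀ p m * g}

/-- The point `z(ξ, η)` of `Ω` with the local coordinates `ξ, η`, `N(ξ, η) ≠ 0`. -/
def zMat (p : ℕ) {m : ℕ} (ξ η : Fin m → ℝ) : Matrix (Fin (m + 2)) (Fin (m + 2)) ℝ :=
  proj p (uVec p ξ) (vVec p η)

/-- `S(G/H)`: restrictions to `Ω` of complex polynomials in the matrix entries. -/
def polyOmega (p m : ℕ) : Subalgebra ℂ (Omega p m → ℂ) :=
  (MvPolynomial.aeval (R := ℂ)
    (fun (ij : Fin (m + 2) × Fin (m + 2)) (z : Omega p m) =>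
      ((z.1 ij.1 ij.2 : ℝ) : ℂ))).range

/-- A function on `Ω`, evaluated at a matrix (zero outside of `Ω`). -/
def ev {p m : ℕ} (F : Omega p m → ℂ) : Matrix (Fin (m + 2)) (Fin (m + 2)) ℝ → ℂ :=
  Function.extend Subtype.val F 0

/-- `F` is the function `f(ξ, η)` in the local coordinates `ξ, η`. -/
def HasCoord {p m : ℕ} (F : Omega p m → ℂ) (f : (Fin m → ℝ) → (Fin m → ℝ) → ℂ) : Prop :=
  ∀ ξ η, N p ξ η ≠ 0 → ev F (zMat p ξ η) = f ξ η

/-! ### Invariant differential operators and the Poisson bracket -/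

/-- `F(g⁻¹ z(ξ, η) g)`, where `g ∈ G` is some element with `z = g⁻¹ z⁰ g`. The choice of `g` does
not affect the definitions below, since `H` acts on `(ξ, η)` by `ξ ↦ c ξ h`, `η ↦ c⁻¹ η h` with
`h` preserving `⟨ξ, η⟩`. -/
def translate {p m : ℕ} (F : Omega p m → ℂ) (z : Omega p m) (ξ η : Fin m → ℝ) : ℂ :=
  ev F (z.2.choose⁻¹ * zMat p ξ η * z.2.choose)

/-- `Δ₂`: the `G`-invariant operator which at `z⁰` is `⟨∂/∂ξ, ∂/∂η⟩` in the coordinates `ξ, η`. -/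
def laplace₂ {p m : ℕ} (F : Omega p m → ℂ) : Omega p m → ℂ := fun z =>
  ∑ i : Fin m, (lamMid p i : ℂ) *
    deriv (fun s : ℝ => deriv (fun t : ℝ =>
      translate F z (Pi.single i s) (Pi.single i t)) 0) 0

/-- `Δ₄`: the `G`-invariant operator which at `z⁰` is `⟨∂/∂ξ, ∂/∂ξ⟩ ⟨∂/∂η, ∂/∂η⟩` in the
coordinates `ξ, η`. -/
def laplace₄ {p m : ℕ} (F : Omega p m → ℂ) : Omega p m → ℂ := fun z =>
  ∑ i : Fin m, ∑ j : Fin m, (lamMid p i : ℂ) * (lamMid p j : ℂ) *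
    iteratedDeriv 2 (fun s : ℝ => iteratedDeriv 2 (fun t : ℝ =>
      translate F z (Pi.single i s) (Pi.single j t)) 0) 0

/-- The `G`-invariant Poisson bracket on `G/H`, which at `z⁰` is
`½ (⟨∂F₁/∂η, ∂F₂/∂ξ⟩ - ⟨∂F₁/∂ξ, ∂F₂/∂η⟩)`. It is the orbit bracket normalized by
`{tr(zX), tr(zY)} = -tr(z[X, Y])` for `X, Y` in the Lie algebra. -/
def poisson {p m : ℕ} (F₁ F₂ : Omega p m → ℂ) : Omega p m → ℂ := fun z =>
  (1 / 2) * ∑ i : Fin m, (lamMid p i : ℂ) *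
    (deriv (fun t : ℝ => translate F₁ z 0 (Pi.single i t)) 0 *
        deriv (fun s : ℝ => translate F₂ z (Pi.single i s) 0) 0 -
      deriv (fun s : ℝ => translate F₁ z (Pi.single i s) 0) 0 *
        deriv (fun t : ℝ => translate F₂ z 0 (Pi.single i t)) 0)

/-! ### Horospherical coordinates and radial parts -/

/-- The element `A_t` of the Cartan subspace. -/
def cartan (m : ℕ) (t₁ t₂ : ℝ) : Matrix (Fin (m + 2)) (Fin (m + 2)) ℝ := fun i j =>
  if ((i : ℕ) = 0 ∧ (j : ℕ) = m) ∨ ((i : ℕ) = m ∧ (j : ℕ) = 0) then t₁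
  else if ((i : ℕ) = 1 ∧ (j : ℕ) = m + 1) ∨ ((i : ℕ) = m + 1 ∧ (j : ℕ) = 1) then t₂
  else 0

/-- The sum `𝔫` of the root spaces of the positive roots in the lexicographical order. -/
def nilp (p m : ℕ) : Submodule ℝ (Matrix (Fin (m + 2)) (Fin (m + 2)) ℝ) :=
  Submodule.span ℝ {X | X ∈ lieAlg p m ∧ ∃ α₁ α₂ : ℝ, (0 < α₁ ∨ (α₁ = 0 ∧ 0 < α₂)) ∧
    ∀ t₁ t₂ : ℝ, cartan m t₁ t₂ * X - X * cartan m t₁ t₂ = (α₁ * t₁ + α₂ * t₂) • X}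

/-- `F(n⁻¹ z n) = F(z)` for all `n ∈ N = exp 𝔫`. -/
def NInvariant {p m : ℕ} (F : Omega p m → ℂ) : Prop :=
  ∀ X ∈ nilp p m, ∀ z : Omega p m, ev F (NormedSpace.exp (-X) * z.1 * NormedSpace.exp X) = F z

/-- The function `F(z)`, `z = a⁻¹ z⁰ a`, `a = exp A_t`, of `t = (t₁, t₂)`. -/
def radialFun {p m : ℕ} (F : Omega p m → ℂ) (t₁ t₂ : ℝ) : ℂ :=
  ev F (NormedSpace.exp (-cartan m t₁ t₂) * z₀ p m * NormedSpace.exp (cartan m t₁ t₂))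

/-- The operator `∂/∂t₁ + κ ∂/∂t₂ + c`. -/
def firstOrder (κ c : ℂ) (f : ℝ → ℝ → ℂ) : ℝ → ℝ → ℂ := fun t₁ t₂ =>
  deriv (fun s => f s t₂) t₁ + κ * deriv (fun s => f t₁ s) t₂ + c * f t₁ t₂

/-- `D₁ = (∂/∂t₁ + ∂/∂t₂ + n - 3)² - (2n - 7)`. -/
def opD₁ (n : ℂ) (f : ℝ → ℝ → ℂ) : ℝ → ℝ → ℂ := fun t₁ t₂ =>
  firstOrder 1 (n - 3) (firstOrder 1 (n - 3) f) t₁ t₂ - (2 * n - 7) * f t₁ t₂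

/-- `D₂ = (∂/∂t₁ - ∂/∂t₂ + 1)² - (2n - 7)`. -/
def opD₂ (n : ℂ) (f : ℝ → ℝ → ℂ) : ℝ → ℝ → ℂ := fun t₁ t₂ =>
  firstOrder (-1) 1 (firstOrder (-1) 1 f) t₁ t₂ - (2 * n - 7) * f t₁ t₂

/-- The value of `D₁` in terms of the variables `a, b`. -/
def d₁ (n a b : ℂ) : ℂ := (a + b) ^ 2 + 2 * (n - 3) * (a + b) + (n - 4) ^ 2

/-- The value of `D₂` in terms of the variables `a, b`. -/
def d₂ (n a b : ℂ) : ℂ := (a - b) ^ 2 + 2 * (a - b) - 2 * (n - 4)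

/-- `F` is a joint eigenfunction of `Δ₂ = ½ {D₁ + D₂ - (n - 4)(n - 6)}` and
`Δ₄ = D₁ D₂ + 2 (n - 4)³` with the values of `D₁, D₂` given by `a, b`. -/
def JointEigen {p m : ℕ} (n a b : ℂ) (F : Omega p m → ℂ) : Prop :=
  laplace₂ F = (1 / 2 * (d₁ n a b + d₂ n a b - (n - 4) * (n - 6))) • F ∧
  laplace₄ F = (d₁ n a b * d₂ n a b + 2 * (n - 4) ^ 3) • F

/-! ### The Berezin transform and the multiplication of symbols -/

/-- `σ` is generic: neither `σ` nor `σ + n/2` is an integer. -/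
def Generic (n σ : ℂ) : Prop := ∀ k : ℤ, σ ≠ k ∧ σ + n / 2 ≠ k

/-- `B` is the Berezin transform: it takes the contravariant symbol of every operator
`T_{σ, ε}(X)`, `X ∈ Env 𝔤`, to its covariant symbol. -/
def IsBerezin {p m : ℕ} (σ : ℂ) (ε : Fin 2) (B : polyOmega p m →ₗ[ℂ] polyOmega p m) : Prop :=
  ∀ w : List (lieAlg p m), ∃ F : polyOmega p m,
    HasCoord F.1 (contraSymbol p σ ε w) ∧ HasCoord (B F).1 (covSymbol p σ ε w)

/-- `M` is the multiplication `F₁ * F₂` of covariant symbols given by the multiplication of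
operators. -/
def IsStar {p m : ℕ} (σ : ℂ) (ε : Fin 2)
    (M : polyOmega p m →ₗ[ℂ] polyOmega p m →ₗ[ℂ] polyOmega p m) : Prop :=
  ∀ w₁ w₂ : List (lieAlg p m), ∃ F₁ F₂ : polyOmega p m,
    HasCoord F₁.1 (covSymbol p σ ε w₁) ∧ HasCoord F₂.1 (covSymbol p σ ε w₂) ∧
      HasCoord (M F₁ F₂).1 (covSymbol p σ ε (w₁ ++ w₂))

/-- The ratio of Gamma functions. -/
def gammaRatio (n σ a b : ℂ) : ℂ :=
  (Complex.Gamma (-σ + (a + b) / 2) * Complex.Gamma (3 - n - σ - (a + b) / 2) *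
      Complex.Gamma (2 - n / 2 - σ + (a - b) / 2) *
      Complex.Gamma (1 - n / 2 - σ - (a - b) / 2)) /
    (Complex.Gamma (-σ) * Complex.Gamma (3 - n - σ) * Complex.Gamma (2 - n / 2 - σ) *
      Complex.Gamma (1 - n / 2 - σ))

/-- `σ → -∞` through the generic real numbers. -/
def toMinusInfty (n : ℂ) : Filter ℝ := atBot ⊓ 𝓟 {σ : ℝ | Generic n σ}

end ParaHermitian

end

open ParaHermitian Filter Topology Asymptotics

noncomputable section

namespace ParaHermitian

open Matrix

/-- The real `n × n` matrices, `n = m + 2`. -/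
abbrev Mat (m : ℕ) := Matrix (Fin (m + 2)) (Fin (m + 2)) ℝ

/-- The rows of `ℝⁿ`. -/
abbrev Row (m : ℕ) := Fin (m + 2) → ℝ

/-! ### Linear algebra of the form -/

section Form

variable {p m : ℕ}

theorem lam_mul_self (i : Fin (m + 2)) : lam p i * lam p i = 1 := by
  unfold lam; split_ifs <;> norm_num

theorem lamMid_mul_self (i : Fin m) : lamMid p i * lamMid p i = 1 := lam_mul_self _

theorem form_add_left (x x' y : Row m) : form p (x + x') y = form p x y + form p x' y := by
  simp [form, mul_add, add_mul, Finset.sum_add_distrib]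

theorem form_add_right (x y y' : Row m) : form p x (y + y') = form p x y + form p x y' := by
  simp [form, mul_add, Finset.sum_add_distrib]

theorem form_smul_left (c : ℝ) (x y : Row m) : form p (c • x) y = c * form p x y := by
  simp only [form, Finset.mul_sum, Pi.smul_apply, smul_eq_mul]
  exact Finset.sum_congr rfl fun i _ => by ring

theorem form_smul_right (c : ℝ) (x y : Row m) : form p x (c • y) = c * form p x y := by
  simp only [form, Finset.mul_sum, Pi.smul_apply, smul_eq_mul]
  exact Finset.sum_congr rfl fun i _ => by ring

theorem form_neg_left (x y : Row m) : form p (-x) y = -form p x y := by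
  rw [← neg_one_smul ℝ x, form_smul_left]; ring

theorem form_neg_right (x y : Row m) : form p x (-y) = -form p x y := by
  rw [← neg_one_smul ℝ y, form_smul_right]; ring

theorem form_sub_left (x x' y : Row m) : form p (x - x') y = form p x y - form p x' y := by
  rw [sub_eq_add_neg, form_add_left, form_neg_left]; ring

theorem form_sub_right (x y y' : Row m) : form p x (y - y') = form p x y - form p x y' := by
  rw [sub_eq_add_neg, form_add_right, form_neg_right]; ring

theorem form_comm (x y : Row m) : form p x y = form p y x :=
  Finset.sum_congr rfl fun i _ => by ring

theorem form_zero_left (y : Row m) : form p 0 y = 0 := by simp [form]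

theorem form_zero_right (y : Row m) : form p y 0 = 0 := by simp [form]

theorem form_single_right (x : Row m) (i : Fin (m + 2)) :
    form p x (Pi.single i 1) = lam p i * x i := by
  simp only [form]
  rw [Finset.sum_eq_single i] <;> simp +contextual

theorem form_eq_dotProduct (x y : Row m) : form p x y = x ⬝ᵥ (gram p m *ᵥ y) := by
  simp only [form, gram, dotProduct, mulVec_diagonal]
  exact Finset.sum_congr rfl fun i _ => by ring

theorem formMid_smul_left (c : ℝ) (x y : Fin m → ℝ) : formMid p (c • x) y = c * formMid p x y := by
  simp only [formMid, Finset.mul_sum, Pi.smul_apply, smul_eq_mul]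
  exact Finset.sum_congr rfl fun i _ => by ring

theorem formMid_smul_right (c : ℝ) (x y : Fin m → ℝ) : formMid p x (c • y) = c * formMid p x y := by
  simp only [formMid, Finset.mul_sum, Pi.smul_apply, smul_eq_mul]
  exact Finset.sum_congr rfl fun i _ => by ring

theorem formMid_zero_left (y : Fin m → ℝ) : formMid p 0 y = 0 := by simp [formMid]

theorem formMid_zero_right (y : Fin m → ℝ) : formMid p y 0 = 0 := by simp [formMid]

theorem formMid_single_right (x : Fin m → ℝ) (i : Fin m) (t : ℝ) :
    formMid p x (Pi.single i t) = lamMid p i * x i * t := by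
  simp only [formMid]
  rw [Finset.sum_eq_single i] <;> simp +contextual

theorem row_zero (a b : ℝ) (ξ : Fin m → ℝ) : row a ξ b 0 = a := rfl

theorem row_last (a b : ℝ) (ξ : Fin m → ℝ) : row a ξ b (Fin.last (m + 1)) = b := by
  rw [← Fin.succ_last]; simp [row, -Fin.succ_last]

theorem row_mid (a b : ℝ) (ξ : Fin m → ℝ) (i : Fin m) : row a ξ b i.succ.castSucc = ξ i := by
  rw [← Fin.succ_castSucc]; simp [row]

theorem middle_row (a b : ℝ) (ξ : Fin m → ℝ) : middle (row a ξ b) = ξ := funext fun i => row_mid a b ξ i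

theorem row_ext {x y : Row m} (h0 : x 0 = y 0) (h1 : middle x = middle y)
    (h2 : x (Fin.last (m + 1)) = y (Fin.last (m + 1))) : x = y := by
  funext i
  refine Fin.cases h0 (fun j => ?_) i
  refine Fin.lastCases ?_ (fun k => ?_) j
  · simpa using h2
  · rw [Fin.succ_castSucc]; exact congrFun h1 k

theorem row_eta (x : Row m) : row (x 0) (middle x) (x (Fin.last (m + 1))) = x :=
  row_ext rfl (middle_row _ _ _) (row_last _ _ _)

theorem sum_row (f : Row m) :
    ∑ i, f i = f 0 + ∑ i : Fin m, f i.succ.castSucc + f (Fin.last (m + 1)) := by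
  rw [Fin.sum_univ_succ, Fin.sum_univ_castSucc]
  exact (add_assoc _ _ _).symm

theorem row_add (a b a' b' : ℝ) (ξ ξ' : Fin m → ℝ) :
    row a ξ b + row a' ξ' b' = row (a + a') (ξ + ξ') (b + b') := by
  refine row_ext rfl ?_ ?_
  · rw [middle_row]; funext i; simp [middle, row_mid, -Fin.castSucc_succ]
  · simp [row_last]

theorem row_smul (c a b : ℝ) (ξ : Fin m → ℝ) : c • row a ξ b = row (c * a) (c • ξ) (c * b) := by
  refine row_ext rfl ?_ ?_
  · rw [middle_row]; funext i; simp [middle, row_mid, -Fin.castSucc_succ]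
  · simp [row_last]

theorem middle_smul (c : ℝ) (x : Row m) : middle (c • x) = c • middle x := rfl

variable (hp : 2 ≤ p) (hm : p ≤ m)

include hp in
theorem lam_first : lam p (0 : Fin (m + 2)) = -1 := if_pos (by simp; omega)

include hm in
theorem lam_last : lam p (Fin.last (m + 1)) = 1 := if_neg (by simp; omega)

include hp hm in
theorem form_row (a b a' b' : ℝ) (ξ ξ' : Fin m → ℝ) :
    form p (row a ξ b) (row a' ξ' b') = -(a * a') + formMid p ξ ξ' + b * b' := by
  rw [form, sum_row, lam_first hp, lam_last hm]
  simp only [row_zero, row_last, row_mid, formMid, lamMid]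
  ring

include hp hm in
theorem form_sPlus (x : Row m) : form p x (sPlus m) = -x 0 + x (Fin.last (m + 1)) := by
  conv_lhs => rw [← row_eta x, sPlus, form_row hp hm]
  rw [formMid_zero_right]; ring

include hp hm in
theorem form_sMinus (x : Row m) : form p x (sMinus m) = -x 0 - x (Fin.last (m + 1)) := by
  conv_lhs => rw [← row_eta x, sMinus, form_row hp hm]
  rw [formMid_zero_right]; ring

include hp hm in
theorem form_sMinus_sPlus : form p (sMinus m) (sPlus m) = -2 := by
  rw [sPlus, sMinus, form_row hp hm, formMid_zero_right]; norm_num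

include hp hm in
theorem form_sPlus_sPlus : form p (sPlus m) (sPlus m) = 0 := by
  rw [sPlus, form_row hp hm, formMid_zero_right]; norm_num

include hp hm in
theorem form_sMinus_sMinus : form p (sMinus m) (sMinus m) = 0 := by
  rw [sMinus, form_row hp hm, formMid_zero_right]; norm_num

theorem uVec_eq (ξ : Fin m → ℝ) :
    uVec p ξ = sMinus m + (2 : ℝ) • row 0 ξ 0 + formMid p ξ ξ • sPlus m := by
  simp only [uVec, sMinus, sPlus, row_add, row_smul]
  congr 1
  · ring
  · funext i; simp
  · ring

theorem vVec_eq (ξ : Fin m → ℝ) :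
    vVec p ξ = sPlus m + (2 : ℝ) • row 0 ξ 0 + formMid p ξ ξ • sMinus m := by
  simp only [vVec, sMinus, sPlus, row_add, row_smul]
  congr 1
  · ring
  · funext i; simp
  · ring

theorem uVec_zero : uVec p (0 : Fin m → ℝ) = sMinus m := by
  simp [uVec, sMinus, formMid_zero_left]

theorem vVec_zero : vVec p (0 : Fin m → ℝ) = sPlus m := by
  simp [vVec, sPlus, formMid_zero_left]

include hp hm in
theorem form_uVec_self (ξ : Fin m → ℝ) : form p (uVec p ξ) (uVec p ξ) = 0 := by
  rw [uVec, form_row hp hm, ← Nat.cast_smul_eq_nsmul ℝ, formMid_smul_left, formMid_smul_right]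
  push_cast; ring

include hp hm in
theorem form_vVec_self (ξ : Fin m → ℝ) : form p (vVec p ξ) (vVec p ξ) = 0 := by
  rw [vVec, form_row hp hm, ← Nat.cast_smul_eq_nsmul ℝ, formMid_smul_left, formMid_smul_right]
  push_cast; ring

include hp hm in
theorem form_uVec_vVec (ξ η : Fin m → ℝ) : form p (uVec p ξ) (vVec p η) = -2 * N p ξ η := by
  rw [uVec, vVec, form_row hp hm, ← Nat.cast_smul_eq_nsmul ℝ, ← Nat.cast_smul_eq_nsmul ℝ,
    formMid_smul_left, formMid_smul_right, N]
  push_cast; ring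

include hp hm in
theorem form_uVec_sPlus (ξ : Fin m → ℝ) : form p (uVec p ξ) (sPlus m) = -2 := by
  rw [uVec, sPlus, form_row hp hm, formMid_zero_right]; ring

include hp hm in
theorem form_vVec_sMinus (ξ : Fin m → ℝ) : form p (vVec p ξ) (sMinus m) = -2 := by
  rw [vVec, sMinus, form_row hp hm, formMid_zero_right]; ring

include hp hm in
theorem eq_smul_uVec {x : Row m} (hx : form p x x = 0) (h : form p x (sPlus m) ≠ 0) :
    x = (-(1 / 2) * form p x (sPlus m)) •
      uVec p ((1 / 2 : ℝ) • middle ((-2 / form p x (sPlus m)) • x)) := by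
  set a := form p x (sPlus m) with ha
  rw [form_sPlus hp hm] at ha
  rw [← row_eta x, form_row hp hm] at hx
  set q := formMid p (middle x) (middle x)
  have hq : formMid p ((1 / 2 : ℝ) • middle ((-2 / a) • x)) ((1 / 2 : ℝ) • middle ((-2 / a) • x))
      = q / a ^ 2 := by
    rw [middle_smul, smul_smul, formMid_smul_left, formMid_smul_right]; field_simp; rfl
  rw [uVec, hq, row_smul]
  have hqa : q = -a * (x 0 + x (Fin.last (m + 1))) := by rw [ha]; linear_combination hx
  refine row_ext ?_ ?_ ?_
  · rw [row_zero, hqa]; field_simp; rw [ha]; ring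
  · rw [middle_row, ← Nat.cast_smul_eq_nsmul ℝ]; funext i
    simp only [Pi.smul_apply, middle_smul, smul_eq_mul]
    field_simp; push_cast; ring
  · rw [row_last, hqa]; field_simp; rw [ha]; ring

include hp hm in
theorem eq_smul_vVec {x : Row m} (hx : form p x x = 0) (h : form p x (sMinus m) ≠ 0) :
    x = (-(1 / 2) * form p x (sMinus m)) •
      vVec p ((1 / 2 : ℝ) • middle ((-2 / form p x (sMinus m)) • x)) := by
  set a := form p x (sMinus m) with ha
  rw [form_sMinus hp hm] at ha
  rw [← row_eta x, form_row hp hm] at hx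
  set q := formMid p (middle x) (middle x)
  have hq : formMid p ((1 / 2 : ℝ) • middle ((-2 / a) • x)) ((1 / 2 : ℝ) • middle ((-2 / a) • x))
      = q / a ^ 2 := by
    rw [middle_smul, smul_smul, formMid_smul_left, formMid_smul_right]; field_simp; rfl
  rw [vVec, hq, row_smul]
  have hqa : q = -a * (x 0 - x (Fin.last (m + 1))) := by rw [ha]; linear_combination hx
  refine row_ext ?_ ?_ ?_
  · rw [row_zero, hqa]; field_simp; rw [ha]; ring
  · rw [middle_row, ← Nat.cast_smul_eq_nsmul ℝ]; funext i
    simp only [Pi.smul_apply, middle_smul, smul_eq_mul]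
    field_simp; push_cast; ring
  · rw [row_last, hqa]; field_simp; rw [ha]; ring

include hp hm in
/-- The section of the cone through `s⁺` separates null vectors from zero. -/
theorem exists_form_vVec_ne_zero {x : Row m} (hx : x ≠ 0) :
    ∃ η, form p x (vVec p η) ≠ 0 := by
  by_contra! H
  have key : ∀ η, form p x (sPlus m) + 2 * formMid p (middle x) η
      + formMid p η η * form p x (sMinus m) = 0 := by
    intro η
    have := H η
    rw [vVec_eq, form_add_right, form_add_right, form_smul_right, form_smul_right] at this
    rw [← this]
    congr 2
    conv_rhs => rw [← row_eta x, form_row hp hm]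
    ring
  have h0 : form p x (sPlus m) = 0 := by simpa [formMid_zero_right, formMid_zero_left] using key 0
  have h1 : ∀ i : Fin m, middle x i = 0 ∧ form p x (sMinus m) = 0 := by
    intro i
    have e1 := key (Pi.single i 1)
    have e2 := key (Pi.single i (-1))
    simp only [formMid_single_right, h0, Pi.single_eq_same] at e1 e2
    have h3 := lamMid_mul_self (p := p) i
    have h3 : lamMid p i ≠ 0 := fun h => by simp [h] at h3
    constructor
    · have : lamMid p i * middle x i = 0 := by linarith
      simpa [h3] using this
    · have : lamMid p i * form p x (sMinus m) = 0 := by linarith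
      simpa [h3] using this
  have h2 := (h1 ⟨0, by omega⟩).2
  rw [form_sPlus hp hm] at h0
  rw [form_sMinus hp hm] at h2
  refine hx (row_ext ?_ (funext fun i => (h1 i).1) ?_) <;> simp <;> linarith

include hp hm in
theorem exists_form_uVec_ne_zero {x : Row m} (hx : x ≠ 0) :
    ∃ η, form p x (uVec p η) ≠ 0 := by
  by_contra! H
  have key : ∀ η, form p x (sMinus m) + 2 * formMid p (middle x) η
      + formMid p η η * form p x (sPlus m) = 0 := by
    intro η
    have := H η
    rw [uVec_eq, form_add_right, form_add_right, form_smul_right, form_smul_right] at this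
    rw [← this]
    congr 2
    conv_rhs => rw [← row_eta x, form_row hp hm]
    ring
  have h0 : form p x (sMinus m) = 0 := by simpa [formMid_zero_right, formMid_zero_left] using key 0
  have h1 : ∀ i : Fin m, middle x i = 0 ∧ form p x (sPlus m) = 0 := by
    intro i
    have e1 := key (Pi.single i 1)
    have e2 := key (Pi.single i (-1))
    simp only [formMid_single_right, h0, Pi.single_eq_same] at e1 e2
    have h3 := lamMid_mul_self (p := p) i
    have h3 : lamMid p i ≠ 0 := fun h => by simp [h] at h3
    constructor
    · have : lamMid p i * middle x i = 0 := by linarith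
      simpa [h3] using this
    · have : lamMid p i * form p x (sPlus m) = 0 := by linarith
      simpa [h3] using this
  have h2 := (h1 ⟨0, by omega⟩).2
  rw [form_sMinus hp hm] at h0
  rw [form_sPlus hp hm] at h2
  refine hx (row_ext ?_ (funext fun i => (h1 i).1) ?_) <;> simp <;> linarith

end Form

section Exponential

variable {ι : Type*} [Fintype ι] [DecidableEq ι]

theorem hasSum_matrix_exp (X : Matrix ι ι ℝ) :
    HasSum (fun k : ℕ => ((k.factorial : ℝ)⁻¹) • X ^ k) (NormedSpace.exp X) := by
  let _ : NormedRing (Matrix ι ι ℝ) := Matrix.linftyOpNormedRing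
  let _ : NormedAlgebra ℝ (Matrix ι ι ℝ) := Matrix.linftyOpNormedAlgebra
  exact NormedSpace.exp_series_hasSum_exp' (𝕂 := ℝ) X

theorem hasDerivAt_matrix_exp (X : Matrix ι ι ℝ) (s : ℝ) (a b : ι) :
    HasDerivAt (fun s : ℝ => NormedSpace.exp (s • X) a b) ((NormedSpace.exp (s • X) * X) a b) s := by
  let _ : NormedRing (Matrix ι ι ℝ) := Matrix.linftyOpNormedRing
  let _ : NormedAlgebra ℝ (Matrix ι ι ℝ) := Matrix.linftyOpNormedAlgebra
  have h := hasDerivAt_exp_smul_const (𝕂 := ℝ) X s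
  let e : Matrix ι ι ℝ →L[ℝ] ℝ := LinearMap.toContinuousLinearMap
    ((LinearMap.proj b : (ι → ℝ) →ₗ[ℝ] ℝ) ∘ₗ (LinearMap.proj a : (ι → ι → ℝ) →ₗ[ℝ] (ι → ℝ)))
  exact e.hasFDerivAt.comp_hasDerivAt s h

theorem continuous_matrix_exp_smul (X : Matrix ι ι ℝ) :
    Continuous fun s : ℝ => NormedSpace.exp (s • X) :=
  continuous_matrix fun a b => continuous_iff_continuousAt.2 fun s =>
    (hasDerivAt_matrix_exp X s a b).continuousAt

theorem exp_mul_exp_neg (X : Matrix ι ι ℝ) : NormedSpace.exp X * NormedSpace.exp (-X) = 1 := by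
  rw [Matrix.exp_neg, Matrix.mul_nonsing_inv]
  exact (Matrix.isUnit_iff_isUnit_det _).1 (Matrix.isUnit_exp X)

theorem vecMul_exp_of_eigen {X : Matrix ι ι ℝ} {x : ι → ℝ} {c : ℝ} (h : x ᵥ* X = c • x) :
    x ᵥ* NormedSpace.exp X = Real.exp c • x := by
  have h1 : ∀ k, x ᵥ* X ^ k = c ^ k • x := by
    intro k
    induction k with
    | zero => simp
    | succ k ih => rw [pow_succ, ← vecMul_vecMul, ih, smul_vecMul, h, smul_smul, pow_succ]
  let f : Matrix ι ι ℝ →+ (ι → ℝ) := ⟨⟨fun M => x ᵥ* M, by simp⟩, fun A B => by simp [vecMul_add]⟩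
  have hf : Continuous f := by
    change Continuous fun M => x ᵥ* M
    exact continuous_const.matrix_vecMul continuous_id
  have h2 := (hasSum_matrix_exp X).map f hf
  have h3 : HasSum (fun k : ℕ => ((k.factorial : ℝ)⁻¹ • c ^ k) • x) (Real.exp c • x) := by
    have := (NormedSpace.exp_series_hasSum_exp' (𝕂 := ℝ) c).smul_const x
    rwa [← Real.exp_eq_exp_ℝ] at this
  refine h2.unique ?_
  convert h3 using 2 with k
  change x ᵥ* (((k.factorial : ℝ)⁻¹) • X ^ k) = _
  rw [vecMul_smul, h1, smul_smul, smul_eq_mul]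

theorem vecMul_exp_of_nilpotent {X : Matrix ι ι ℝ} {x : ι → ℝ} (h : x ᵥ* X ᵥ* X ᵥ* X = 0) :
    x ᵥ* NormedSpace.exp X = x + x ᵥ* X + (1 / 2 : ℝ) • (x ᵥ* X ᵥ* X) := by
  let f : Matrix ι ι ℝ →+ (ι → ℝ) := ⟨⟨fun M => x ᵥ* M, by simp⟩, fun A B => by simp [vecMul_add]⟩
  have hf : Continuous f := by
    change Continuous fun M => x ᵥ* M
    exact continuous_const.matrix_vecMul continuous_id
  have h2 := (hasSum_matrix_exp X).map f hf
  refine h2.unique ?_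
  have h4 : ∀ k ∉ Finset.range 3, (f ∘ fun k : ℕ => ((k.factorial : ℝ)⁻¹) • X ^ k) k = 0 := by
    intro k hk
    obtain ⟨j, rfl⟩ : ∃ j, k = 3 + j := ⟨k - 3, by simp at hk; omega⟩
    change x ᵥ* (_ • X ^ (3 + j)) = 0
    rw [vecMul_smul, pow_add, ← vecMul_vecMul, pow_succ, pow_succ, pow_one, ← vecMul_vecMul,
      ← vecMul_vecMul, h]
    simp
  have h5 := hasSum_sum_of_ne_finset_zero (L := SummationFilter.unconditional ℕ) h4
  convert h5 using 1
  simp only [Finset.sum_range_succ, Finset.sum_range_zero, zero_add, Function.comp]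
  change _ = x ᵥ* _ + x ᵥ* _ + x ᵥ* _
  simp only [vecMul_smul, Nat.factorial, pow_zero, pow_one, pow_two, ← vecMul_vecMul]
  simp

end Exponential

/-! ### The group -/

section Group

variable {p m : ℕ}

/-- The orthogonal group of the form. -/
def orth (p m : ℕ) : Set (Mat m) :=
  {g | g * gram p m * g.transpose = gram p m}

theorem gram_mul_gram : gram p m * gram p m = 1 := by
  simp [gram, Matrix.diagonal_mul_diagonal, lam_mul_self]

theorem gram_transpose : (gram p m)ᵀ = gram p m := by simp [gram]

theorem orth_one : (1 : Mat m) ∈ orth p m := by simp [orth]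

theorem orth_mul {g h : Mat m} (hg : g ∈ orth p m)
    (hh : h ∈ orth p m) : g * h ∈ orth p m := by
  simp only [orth, Set.mem_ofPred_eq, transpose_mul] at *
  calc g * h * gram p m * (hᵀ * gᵀ) = g * (h * gram p m * hᵀ) * gᵀ := by simp only [Matrix.mul_assoc]
    _ = _ := by rw [hh, hg]

theorem orth_mul_inv {g : Mat m} (hg : g ∈ orth p m) :
    g * (gram p m * gᵀ * gram p m) = 1 := by
  rw [← Matrix.mul_assoc, ← Matrix.mul_assoc, hg, gram_mul_gram]

theorem orth_inv_eq {g : Mat m} (hg : g ∈ orth p m) :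
    g⁻¹ = gram p m * gᵀ * gram p m := Matrix.inv_eq_right_inv (orth_mul_inv hg)

theorem orth_mul_cancel {g : Mat m} (hg : g ∈ orth p m) :
    g * g⁻¹ = 1 := by rw [orth_inv_eq hg, orth_mul_inv hg]

theorem orth_inv_cancel {g : Mat m} (hg : g ∈ orth p m) :
    g⁻¹ * g = 1 := _root_.mul_eq_one_comm.1 (orth_mul_cancel hg)

theorem orth_inv {g : Mat m} (hg : g ∈ orth p m) :
    g⁻¹ ∈ orth p m := by
  have h := orth_inv_cancel hg
  have ht : gᵀ * g⁻¹ᵀ = 1 := by rw [← transpose_mul, h, transpose_one]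
  change g⁻¹ * gram p m * g⁻¹ᵀ = gram p m
  have hg' : g * gram p m * gᵀ = gram p m := hg
  calc g⁻¹ * gram p m * g⁻¹ᵀ = g⁻¹ * (g * gram p m * gᵀ) * g⁻¹ᵀ := by rw [hg']
    _ = (g⁻¹ * g) * gram p m * (gᵀ * g⁻¹ᵀ) := by simp only [Matrix.mul_assoc]
    _ = gram p m := by rw [h, ht]; simp

theorem form_vecMul_vecMul {g : Mat m} (hg : g ∈ orth p m)
    (x y : Row m) : form p (x ᵥ* g) (y ᵥ* g) = form p x y := by
  rw [form_eq_dotProduct, form_eq_dotProduct, ← mulVec_transpose g y, mulVec_mulVec,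
    ← dotProduct_mulVec, mulVec_mulVec, ← Matrix.mul_assoc, hg]

theorem form_vecMul_left {g : Mat m} (hg : g ∈ orth p m)
    (x y : Row m) : form p (x ᵥ* g) y = form p x (y ᵥ* g⁻¹) := by
  rw [← form_vecMul_vecMul hg x (y ᵥ* g⁻¹), vecMul_vecMul, orth_inv_cancel hg, vecMul_one]

theorem mem_lieAlg {X : Mat m} :
    X ∈ lieAlg p m ↔ gram p m * Xᵀ = -(X * gram p m) := by
  rw [mem_skewAdjointMatricesSubmodule, Matrix.IsSkewAdjoint, Matrix.IsAdjointPair]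
  constructor
  · intro h
    calc gram p m * Xᵀ = gram p m * (Xᵀ * gram p m) * gram p m := by
          rw [Matrix.mul_assoc, Matrix.mul_assoc, gram_mul_gram, Matrix.mul_one]
      _ = _ := by rw [h, ← Matrix.mul_assoc, gram_mul_gram, Matrix.one_mul, Matrix.neg_mul]
  · intro h
    calc Xᵀ * gram p m = gram p m * (gram p m * Xᵀ) * gram p m := by
          rw [← Matrix.mul_assoc, gram_mul_gram, Matrix.one_mul]
      _ = _ := by
        rw [h, Matrix.mul_neg, Matrix.mul_neg, Matrix.neg_mul, Matrix.mul_assoc, Matrix.mul_assoc,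
          gram_mul_gram, Matrix.mul_one]

theorem form_vecMul_skew {X : Mat m} (hX : X ∈ lieAlg p m)
    (x y : Row m) : form p (x ᵥ* X) y = -form p x (y ᵥ* X) := by
  rw [mem_lieAlg] at hX
  rw [form_eq_dotProduct, form_eq_dotProduct, ← mulVec_transpose X y, mulVec_mulVec, hX, neg_mulVec,
    dotProduct_neg, neg_neg, ← mulVec_mulVec, dotProduct_mulVec, dotProduct_mulVec,
    dotProduct_mulVec]

theorem exp_mem_orth {X : Mat m} (hX : X ∈ lieAlg p m) :
    NormedSpace.exp X ∈ orth p m := by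
  have hU : IsUnit (gram p m) := IsUnit.of_mul_eq_one _ gram_mul_gram
  have hi : (gram p m)⁻¹ = gram p m := Matrix.inv_eq_right_inv gram_mul_gram
  have h1 : Xᵀ = gram p m * (-X) * (gram p m)⁻¹ := by
    rw [hi, Matrix.mul_neg, Matrix.neg_mul, Matrix.mul_assoc]
    rw [mem_lieAlg] at hX
    rw [← Matrix.mul_neg, ← hX, ← Matrix.mul_assoc, gram_mul_gram, Matrix.one_mul]
  change NormedSpace.exp X * gram p m * (NormedSpace.exp X)ᵀ = gram p m
  rw [← Matrix.exp_transpose, h1, Matrix.exp_conj _ _ hU, hi]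
  calc NormedSpace.exp X * gram p m * (gram p m * NormedSpace.exp (-X) * gram p m)
      = NormedSpace.exp X * (gram p m * gram p m) * NormedSpace.exp (-X) * gram p m := by
        simp only [Matrix.mul_assoc]
    _ = _ := by rw [gram_mul_gram, Matrix.mul_one, exp_mul_exp_neg, Matrix.one_mul]

theorem SO₀_subset_orth : SO₀ p m ⊆ orth p m := fun _ hg =>
  (connectedComponentIn_subset _ _ hg).1

theorem one_mem_SO₀ : (1 : Mat m) ∈ SO₀ p m :=
  mem_connectedComponentIn ⟨orth_one, by simp⟩

theorem exp_mem_SO₀ {X : Mat m} (hX : X ∈ lieAlg p m) :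
    NormedSpace.exp X ∈ SO₀ p m := by
  let f : ℝ → Mat m := fun s => NormedSpace.exp (s • X)
  have hf : Continuous f := continuous_matrix_exp_smul X
  have ho : ∀ s, f s ∈ orth p m := fun s => exp_mem_orth (Submodule.smul_mem _ s hX)
  have hdet : ∀ s, (f s).det = 1 := by
    have h2 : ∀ s, (f s).det = 1 ∨ (f s).det = -1 := by
      intro s
      have := congrArg Matrix.det (ho s)
      rw [det_mul, det_mul, det_transpose] at this
      have hI : (gram p m).det ≠ 0 := by
        have := congrArg Matrix.det (gram_mul_gram (p := p) (m := m))
        rw [det_mul, det_one] at this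
        exact fun h => by simp [h] at this
      rw [← mul_self_eq_one_iff]
      apply mul_right_cancel₀ hI
      linarith
    intro s
    by_contra hs
    have hs' : (f s).det = -1 := (h2 s).resolve_left hs
    have h0 : (f 0).det = 1 := by simp [f]
    have hc : Continuous fun s => (f s).det := hf.matrix_det
    have := mem_range_of_exists_le_of_exists_ge hc (c := 0) ⟨s, by rw [hs']; norm_num⟩
      ⟨0, by rw [h0]; norm_num⟩
    obtain ⟨r, hr⟩ := this
    rcases h2 r with h | h <;> simp only at hr <;> rw [h] at hr <;> norm_num at hr
  have hpre : IsPreconnected (Set.range f) := isPreconnected_range hf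
  have := hpre.subset_connectedComponentIn (x := 1)
    (F := {g | g * gram p m * g.transpose = gram p m ∧ g.det = 1}) ⟨0, by simp [f]⟩
    (by rintro _ ⟨s, rfl⟩; exact ⟨ho s, hdet s⟩)
  exact this ⟨1, by simp [f]⟩

theorem SO₀_mul {g h : Mat m} (hg : g ∈ SO₀ p m)
    (hh : h ∈ SO₀ p m) : g * h ∈ SO₀ p m := by
  have hh' := connectedComponentIn_subset _ _ hh
  have hpre : IsPreconnected ((fun k => k * h) '' SO₀ p m) :=
    isPreconnected_connectedComponentIn.image _ (by fun_prop)
  have h1 : (fun k => k * h) '' SO₀ p m ⊆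
      {g | g * gram p m * g.transpose = gram p m ∧ g.det = 1} := by
    rintro _ ⟨k, hk, rfl⟩
    have hk' := connectedComponentIn_subset _ _ hk
    exact ⟨orth_mul hk'.1 hh'.1, by rw [det_mul, hk'.2, hh'.2, one_mul]⟩
  have := hpre.subset_connectedComponentIn (x := h) ⟨1, one_mem_SO₀, by simp⟩ h1
  have h2 := this ⟨g, hg, rfl⟩
  rwa [← connectedComponentIn_eq hh] at h2

/-- The element `x ↦ [x, a] b - [x, b] a` of the Lie algebra. -/
def wedge (p : ℕ) {m : ℕ} (a b : Row m) : Mat m :=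
  vecMulVec (gram p m *ᵥ a) b - vecMulVec (gram p m *ᵥ b) a

theorem vecMul_wedge (a b x : Row m) :
    x ᵥ* wedge p a b = form p x a • b - form p x b • a := by
  rw [wedge, vecMul_sub, vecMul_vecMulVec, vecMul_vecMulVec, form_eq_dotProduct,
    form_eq_dotProduct]

theorem wedge_mem (a b : Row m) : wedge p a b ∈ lieAlg p m := by
  rw [mem_lieAlg, wedge, transpose_sub, transpose_vecMulVec, transpose_vecMulVec, Matrix.mul_sub,
    Matrix.sub_mul, mul_vecMulVec, mul_vecMulVec, vecMulVec_mul, vecMulVec_mul, neg_sub,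
    ← mulVec_transpose, ← mulVec_transpose, gram_transpose]

theorem vecMul_exp_wedge {a v : Row m} (ha : form p a a = 0) (hv : form p a v = 0)
    (x : Row m) : x ᵥ* NormedSpace.exp (wedge p a v) =
      x + form p x a • v - (form p x v + 1 / 2 * form p v v * form p x a) • a := by
  have h1 : x ᵥ* wedge p a v = form p x a • v - form p x v • a := vecMul_wedge a v x
  have h2 : x ᵥ* wedge p a v ᵥ* wedge p a v = -(form p v v * form p x a) • a := by
    rw [h1, vecMul_wedge]
    simp only [form_sub_left, form_smul_left, ha, hv, form_comm v a]
    ext i; simp only [Pi.sub_apply, Pi.smul_apply, smul_eq_mul]; ring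
  rw [vecMul_exp_of_nilpotent, h1, ← h1, h2, h1]
  · ext i; simp; ring
  · rw [h2, smul_vecMul, vecMul_wedge, ha, hv]; simp

/-! ### The orbit -/

theorem proj_smul {c d : ℝ} (hc : c ≠ 0) (hd : d ≠ 0) (x y : Row m) :
    proj p (c • x) (d • y) = proj p x y := by
  simp only [proj, form_smul_left, form_smul_right, mulVec_smul, vecMulVec_smul, smul_vecMulVec,
    smul_smul]
  congr 1
  field_simp

theorem proj_vecMul {g : Mat m} (hg : g ∈ orth p m)
    (x y : Row m) : proj p (x ᵥ* g) (y ᵥ* g) = g⁻¹ * proj p x y * g := by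
  have h : gram p m *ᵥ (y ᵥ* g) = g⁻¹ *ᵥ (gram p m *ᵥ y) := by
    rw [orth_inv_eq hg, ← mulVec_transpose, mulVec_mulVec, mulVec_mulVec, Matrix.mul_assoc,
      Matrix.mul_assoc, gram_mul_gram, Matrix.mul_one]
  rw [proj, proj, form_vecMul_vecMul hg, h, Matrix.mul_smul, Matrix.smul_mul, mul_vecMulVec,
    vecMulVec_mul]

theorem conj_mem_Omega {g z : Mat m} (hg : g ∈ SO₀ p m)
    (hz : z ∈ Omega p m) : g⁻¹ * z * g ∈ Omega p m := by
  obtain ⟨h, hh, rfl⟩ := hz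
  exact ⟨h * g, SO₀_mul hh hg, by rw [Matrix.mul_inv_rev]; simp only [Matrix.mul_assoc]⟩

/-- The group generated by the exponentials of the Lie algebra. -/
def expGen (p m : ℕ) : Submonoid (Mat m) :=
  Submonoid.closure {g | ∃ X ∈ lieAlg p m, g = NormedSpace.exp X}

theorem exp_mem_expGen {X : Mat m} (hX : X ∈ lieAlg p m) :
    NormedSpace.exp X ∈ expGen p m := Submonoid.subset_closure ⟨X, hX, rfl⟩

theorem expGen_subset {g : Mat m} (hg : g ∈ expGen p m) :
    g ∈ SO₀ p m := by
  induction hg using Submonoid.closure_induction with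
  | mem x hx => obtain ⟨X, hX, rfl⟩ := hx; exact exp_mem_SO₀ hX
  | one => exact one_mem_SO₀
  | mul x y _ _ hx hy => exact SO₀_mul hx hy

theorem expGen_orth {g : Mat m} (hg : g ∈ expGen p m) :
    g ∈ orth p m := SO₀_subset_orth (expGen_subset hg)

theorem z₀_mem : z₀ p m ∈ Omega p m := ⟨1, one_mem_SO₀, by simp⟩

variable (hp : 2 ≤ p) (hm : p ≤ m)

include hp hm in
theorem form_sPlus_row (ξ : Fin m → ℝ) : form p (sPlus m) (row 0 ξ 0) = 0 := by
  rw [sPlus, form_row hp hm, formMid_zero_left]; ring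

include hp hm in
theorem form_sMinus_row (ξ : Fin m → ℝ) : form p (sMinus m) (row 0 ξ 0) = 0 := by
  rw [sMinus, form_row hp hm, formMid_zero_left]; ring

include hp hm in
/-- Translation of the coordinates `ξ`. -/
theorem exists_translation_uVec (ξ : Fin m → ℝ) : ∃ g ∈ expGen p m,
    sMinus m ᵥ* g = uVec p ξ ∧ sPlus m ᵥ* g = sPlus m := by
  refine ⟨_, exp_mem_expGen (wedge_mem (sPlus m) (-row 0 ξ 0)), ?_, ?_⟩
  · rw [vecMul_exp_wedge (form_sPlus_sPlus hp hm) (by rw [form_neg_right, form_sPlus_row hp hm, neg_zero]),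
      form_sMinus_sPlus hp hm, form_neg_right, form_sMinus_row hp hm, form_neg_right, form_neg_left,
      form_row hp hm, uVec_eq]
    ext i
    simp only [Pi.add_apply, Pi.sub_apply, Pi.smul_apply, Pi.neg_apply, smul_eq_mul]; ring
  · rw [vecMul_exp_wedge (form_sPlus_sPlus hp hm) (by rw [form_neg_right, form_sPlus_row hp hm, neg_zero]),
      form_sPlus_sPlus hp hm, form_neg_right, form_sPlus_row hp hm]
    ext i; simp

include hp hm in
/-- Translation of the coordinates `η`. -/
theorem exists_translation_vVec (ξ : Fin m → ℝ) : ∃ g ∈ expGen p m,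
    sPlus m ᵥ* g = vVec p ξ ∧ sMinus m ᵥ* g = sMinus m := by
  refine ⟨_, exp_mem_expGen (wedge_mem (sMinus m) (-row 0 ξ 0)), ?_, ?_⟩
  · rw [vecMul_exp_wedge (form_sMinus_sMinus hp hm) (by rw [form_neg_right, form_sMinus_row hp hm, neg_zero]),
      form_comm, form_sMinus_sPlus hp hm, form_neg_right, form_sPlus_row hp hm, form_neg_right, form_neg_left,
      form_row hp hm, vVec_eq]
    ext i
    simp only [Pi.add_apply, Pi.sub_apply, Pi.smul_apply, Pi.neg_apply, smul_eq_mul]; ring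
  · rw [vecMul_exp_wedge (form_sMinus_sMinus hp hm) (by rw [form_neg_right, form_sMinus_row hp hm, neg_zero]),
      form_sMinus_sMinus hp hm, form_neg_right, form_sMinus_row hp hm]
    ext i; simp

include hp hm in
theorem exists_smul_of_null {x y : Row m} (hx : form p x x = 0) (hy : form p y y = 0)
    (hxy : form p x y ≠ 0) : ∃ g ∈ expGen p m, ∃ c d : ℝ, c ≠ 0 ∧ d ≠ 0 ∧
      x = c • (sMinus m ᵥ* g) ∧ y = d • (sPlus m ᵥ* g) := by
  have hx0 : x ≠ 0 := by rintro rfl; simp [form_zero_left] at hxy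
  obtain ⟨η, hη⟩ := exists_form_vVec_ne_zero hp hm hx0
  obtain ⟨g₁, hg₁, h1, -⟩ := exists_translation_vVec hp hm η
  have ho₁ := orth_inv (expGen_orth hg₁)
  have ha : form p (x ᵥ* g₁⁻¹) (sPlus m) ≠ 0 := by
    rw [form_vecMul_left ho₁, Matrix.nonsing_inv_nonsing_inv _
      ((Matrix.isUnit_iff_isUnit_det _).1 (IsUnit.of_mul_eq_one _ (orth_mul_cancel (expGen_orth hg₁)))), h1]
    exact hη
  have hx1 : form p (x ᵥ* g₁⁻¹) (x ᵥ* g₁⁻¹) = 0 := by rw [form_vecMul_vecMul ho₁, hx]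
  have e1 := eq_smul_uVec hp hm hx1 ha
  set c := -(1 / 2) * form p (x ᵥ* g₁⁻¹) (sPlus m) with hc
  set ξ := (1 / 2 : ℝ) • middle ((-2 / form p (x ᵥ* g₁⁻¹) (sPlus m)) • (x ᵥ* g₁⁻¹))
  have hc0 : c ≠ 0 := by rw [hc]; simpa using ha
  obtain ⟨g₂, hg₂, h2, h2'⟩ := exists_translation_uVec hp hm ξ
  have hgg : g₂ * g₁ ∈ expGen p m := Submonoid.mul_mem _ hg₂ hg₁
  have hgo := expGen_orth hgg
  have ex : x = c • (sMinus m ᵥ* (g₂ * g₁)) := by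
    rw [← vecMul_vecMul, h2, ← smul_vecMul, ← e1, vecMul_vecMul,
      orth_inv_cancel (expGen_orth hg₁), vecMul_one]
  set y' := y ᵥ* (g₂ * g₁)⁻¹ with hy'
  have hy1 : form p y' y' = 0 := by rw [hy', form_vecMul_vecMul (orth_inv hgo), hy]
  have hb : form p y' (sMinus m) ≠ 0 := by
    intro h0
    apply hxy
    rw [ex, form_smul_left, form_vecMul_left hgo, ← hy', form_comm, h0, mul_zero]
  have e2 := eq_smul_vVec hp hm hy1 hb
  set d := -(1 / 2) * form p y' (sMinus m) with hd
  obtain ⟨g₃, hg₃, h3, h3'⟩ := exists_translation_vVec hp hm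
    ((1 / 2 : ℝ) • middle ((-2 / form p y' (sMinus m)) • y'))
  refine ⟨g₃ * (g₂ * g₁), Submonoid.mul_mem _ hg₃ hgg, c, d, hc0, by rw [hd]; simpa using hb, ?_, ?_⟩
  · rw [← vecMul_vecMul, h3', ← ex]
  · rw [← vecMul_vecMul, h3, ← smul_vecMul, ← e2, hy', vecMul_vecMul, orth_inv_cancel hgo, vecMul_one]

include hp hm in
theorem proj_mem_Omega {x y : Row m} (hx : form p x x = 0) (hy : form p y y = 0)
    (hxy : form p x y ≠ 0) : proj p x y ∈ Omega p m := by
  obtain ⟨g, hg, c, d, hc, hd, rfl, rfl⟩ := exists_smul_of_null hp hm hx hy hxy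
  exact ⟨g, expGen_subset hg, by rw [proj_smul hc hd, proj_vecMul (expGen_orth hg)]; rfl⟩

theorem eq_proj_of_conj {g z : Mat m} (hg : g ∈ SO₀ p m)
    (hz : z = g⁻¹ * z₀ p m * g) : z = proj p (sMinus m ᵥ* g) (sPlus m ᵥ* g) := by
  rw [proj_vecMul (SO₀_subset_orth hg)]; exact hz

include hp hm in
theorem exists_null_of_mem {z : Mat m} (hz : z ∈ Omega p m) :
    ∃ x y, form p x x = 0 ∧ form p y y = 0 ∧ form p x y = -2 ∧ z = proj p x y := by
  obtain ⟨g, hg, hz⟩ := hz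
  have ho := SO₀_subset_orth hg
  exact ⟨_, _, by rw [form_vecMul_vecMul ho, form_sMinus_sMinus hp hm],
    by rw [form_vecMul_vecMul ho, form_sPlus_sPlus hp hm],
    by rw [form_vecMul_vecMul ho, form_sMinus_sPlus hp hm], eq_proj_of_conj hg hz⟩

include hp hm in
theorem exists_expGen {z : Mat m} (hz : z ∈ Omega p m) :
    ∃ g ∈ expGen p m, z = g⁻¹ * z₀ p m * g := by
  obtain ⟨x, y, hx, hy, hxy, rfl⟩ := exists_null_of_mem hp hm hz
  obtain ⟨g, hg, c, d, hc, hd, rfl, rfl⟩ :=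
    exists_smul_of_null hp hm hx hy (by rw [hxy]; norm_num)
  exact ⟨g, hg, by rw [proj_smul hc hd, proj_vecMul (expGen_orth hg)]; rfl⟩

include hp hm in
theorem conj_orth_mem_Omega {g z : Mat m} (hg : g ∈ orth p m)
    (hz : z ∈ Omega p m) : g⁻¹ * z * g ∈ Omega p m := by
  obtain ⟨x, y, hx, hy, hxy, rfl⟩ := exists_null_of_mem hp hm hz
  rw [← proj_vecMul hg]
  exact proj_mem_Omega hp hm (by rw [form_vecMul_vecMul hg, hx]) (by rw [form_vecMul_vecMul hg, hy])
    (by rw [form_vecMul_vecMul hg, hxy]; norm_num)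

include hp hm in
theorem zMat_mem {ξ η : Fin m → ℝ} (h : N p ξ η ≠ 0) : zMat p ξ η ∈ Omega p m :=
  proj_mem_Omega hp hm (form_uVec_self hp hm ξ) (form_vVec_self hp hm η)
    (by rw [form_uVec_vVec hp hm]; simpa using h)

theorem zMat_zero : zMat p (0 : Fin m → ℝ) 0 = z₀ p m := by
  rw [zMat, uVec_zero, vVec_zero]; rfl

end Group

/-! ### Polynomials in the matrix entries -/

/-- Complex polynomials in the entries of an `n × n` matrix. -/
abbrev PolyMat (m : ℕ) := MvPolynomial (Fin (m + 2) × Fin (m + 2)) ℂ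

/-- The value of a polynomial at a real matrix. -/
def evalMat {m : ℕ} (M : Mat m) : PolyMat m →ₐ[ℂ] ℂ :=
  MvPolynomial.aeval fun ij => ((M ij.1 ij.2 : ℝ) : ℂ)

/-- The restriction of a polynomial to `Ω`. -/
def toPoly (p m : ℕ) : PolyMat m →ₐ[ℂ] polyOmega p m :=
  (MvPolynomial.aeval (R := ℂ)
    (fun (ij : Fin (m + 2) × Fin (m + 2)) (z : Omega p m) =>
      ((z.1 ij.1 ij.2 : ℝ) : ℂ))).rangeRestrict

section Poly

variable {p m : ℕ}

theorem toPoly_surjective : Function.Surjective (toPoly p m) :=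
  AlgHom.rangeRestrict_surjective _

theorem evalMat_X (M : Mat m) (a b : Fin (m + 2)) :
    evalMat M (MvPolynomial.X (a, b)) = ((M a b : ℝ) : ℂ) := by
  simp [evalMat]

theorem evalMat_C (M : Mat m) (c : ℂ) :
    evalMat M (MvPolynomial.C c) = c := by simp [evalMat]

theorem toPoly_apply (P : PolyMat m) (z : Omega p m) : (toPoly p m P).1 z = evalMat z.1 P := by
  have : ((Pi.evalAlgHom ℂ (fun _ : Omega p m => ℂ) z).comp (polyOmega p m).val).comp (toPoly p m)
      = evalMat z.1 := by
    apply MvPolynomial.algHom_ext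
    intro ij
    change (MvPolynomial.aeval (R := ℂ) (fun (ij : Fin (m + 2) × Fin (m + 2)) (z : Omega p m) =>
      ((z.1 ij.1 ij.2 : ℝ) : ℂ)) (MvPolynomial.X ij)) z = _
    simp [evalMat]
  exact DFunLike.congr_fun this P

theorem polyOmega_ext {F G : polyOmega p m} (h : ∀ z, F.1 z = G.1 z) : F = G :=
  Subtype.ext (funext h)

theorem toPoly_eq_zero_iff (P : PolyMat m) :
    toPoly p m P = 0 ↔ ∀ z ∈ Omega p m, evalMat z P = 0 := by
  constructor
  · intro h z hz
    rw [← toPoly_apply P ⟨z, hz⟩, h]; rfl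
  · intro h
    exact polyOmega_ext fun z => by rw [toPoly_apply, h _ z.2]; rfl

theorem ev_mem (F : Omega p m → ℂ) (z : Omega p m) : ev F z.1 = F z :=
  Subtype.val_injective.extend_apply _ _ _

theorem ev_of_mem (F : Omega p m → ℂ) {M : Mat m}
    (h : M ∈ Omega p m) : ev F M = F ⟨M, h⟩ := ev_mem F ⟨M, h⟩

theorem ev_toPoly (P : PolyMat m) {M : Mat m}
    (h : M ∈ Omega p m) : ev (toPoly p m P).1 M = evalMat M P := by
  rw [ev_of_mem _ h, toPoly_apply]

theorem evalMat_smul {d : ℕ} {P : PolyMat m} (hP : P.IsHomogeneous d) (c : ℝ)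
    (M : Mat m) : evalMat (c • M) P = (c : ℂ) ^ d * evalMat M P := by
  simp only [evalMat, MvPolynomial.aeval_def, MvPolynomial.eval₂_eq, Finset.mul_sum]
  refine Finset.sum_congr rfl fun e he => ?_
  have hd := hP.degree_eq_sum_deg_support he
  rw [hd, ← Finset.prod_pow_eq_pow_sum]
  simp only [Matrix.smul_apply, smul_eq_mul, Complex.ofReal_mul, mul_pow, Finset.prod_mul_distrib]
  ring

/-- A derivation along a curve of matrices computes the derivative of a polynomial. -/
theorem hasDerivAt_evalMat (D : Derivation ℂ (PolyMat m) (PolyMat m))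
    {Z : ℝ → Mat m} {Z' : Mat m}
    {s : ℝ} (hZ : ∀ a b, HasDerivAt (fun s => Z s a b) (Z' a b) s)
    (hD : ∀ a b, evalMat (Z s) (D (MvPolynomial.X (a, b))) = ((Z' a b : ℝ) : ℂ)) (P : PolyMat m) :
    HasDerivAt (fun s => evalMat (Z s) P) (evalMat (Z s) (D P)) s := by
  induction P using MvPolynomial.induction_on with
  | C c => simpa [evalMat_C] using hasDerivAt_const s c
  | add P Q hP hQ => simpa using hP.fun_add hQ
  | mul_X P ij hP =>
    have h1 : HasDerivAt (fun s => evalMat (Z s) (MvPolynomial.X ij)) ((Z' ij.1 ij.2 : ℝ) : ℂ) s := by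
      refine (hZ ij.1 ij.2).ofReal_comp.congr_of_eventuallyEq (Eventually.of_forall fun s => ?_)
      exact evalMat_X _ _ _
    simp only [map_mul, Derivation.leibniz, map_add, smul_eq_mul]
    refine (hP.fun_mul h1).congr_deriv ?_
    rw [← hD ij.1 ij.2]
    ring

/-! ### Curves in the orbit -/

theorem proj_apply (x y : Row m) (a b : Fin (m + 2)) :
    proj p x y a b = (form p x y)⁻¹ * (lam p a * y a * x b) := by
  simp [proj, vecMulVec, gram, mulVec_diagonal]

theorem hasDerivAt_form_left {x : ℝ → Row m} {x' : Row m} {s : ℝ}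
    (hx : ∀ b, HasDerivAt (fun s => x s b) (x' b) s) (y : Row m) :
    HasDerivAt (fun s => form p (x s) y) (form p x' y) s := by
  simp only [form]
  exact HasDerivAt.fun_sum fun i _ => ((hx i).const_mul _).mul_const _

theorem hasDerivAt_form_right {x : ℝ → Row m} {x' : Row m} {s : ℝ}
    (hx : ∀ b, HasDerivAt (fun s => x s b) (x' b) s) (y : Row m) :
    HasDerivAt (fun s => form p y (x s)) (form p y x') s := by
  simp only [form_comm y]
  exact hasDerivAt_form_left hx y

theorem hasDerivAt_vecMul_exp (X : Mat m) (x : Row m)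
    (b : Fin (m + 2)) :
    HasDerivAt (fun s : ℝ => (x ᵥ* NormedSpace.exp (s • X)) b) ((x ᵥ* X) b) 0 := by
  simp only [vecMul, dotProduct]
  refine HasDerivAt.fun_sum fun i _ => ?_
  have := (hasDerivAt_matrix_exp X 0 i b).const_mul (x i)
  simpa using this

theorem hasDerivAt_proj_left {x : ℝ → Row m} {x' : Row m} {s : ℝ}
    (hx : ∀ b, HasDerivAt (fun s => x s b) (x' b) s) {y : Row m}
    (h : form p (x s) y ≠ 0) (a b : Fin (m + 2)) :
    HasDerivAt (fun s => proj p (x s) y a b)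
      ((form p (x s) y)⁻¹ * (lam p a * y a * x' b)
        - (form p (x s) y)⁻¹ * form p x' y * proj p (x s) y a b) s := by
  simp only [proj_apply]
  have h1 := ((hasDerivAt_form_left (p := p) hx y).fun_inv h).fun_mul ((hx b).const_mul (lam p a * y a))
  refine h1.congr_deriv ?_
  field_simp
  ring

theorem hasDerivAt_proj_right {y : ℝ → Row m} {y' : Row m} {s : ℝ}
    (hy : ∀ b, HasDerivAt (fun s => y s b) (y' b) s) {x : Row m}
    (h : form p x (y s) ≠ 0) (a b : Fin (m + 2)) :
    HasDerivAt (fun s => proj p x (y s) a b)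
      ((form p x (y s))⁻¹ * (lam p a * y' a * x b)
        - (form p x (y s))⁻¹ * form p x y' * proj p x (y s) a b) s := by
  simp only [proj_apply]
  have h1 := ((hasDerivAt_form_right (p := p) hy x).fun_inv h).fun_mul
    (((hy a).const_mul (lam p a)).mul_const (x b))
  refine h1.congr_deriv ?_
  field_simp
  ring

theorem trace_proj_mul (x y : Row m) (X : Mat m) :
    (proj p x y * X).trace = (form p x y)⁻¹ * form p (x ᵥ* X) y := by
  rw [proj, Matrix.smul_mul, vecMulVec_mul, trace_smul, trace_vecMulVec, form_eq_dotProduct (x ᵥ* X),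
    dotProduct_comm, smul_eq_mul]

theorem proj_mul_apply (x y : Row m) (X : Mat m)
    (a b : Fin (m + 2)) : (proj p x y * X) a b = (form p x y)⁻¹ * (lam p a * y a * (x ᵥ* X) b) := by
  rw [proj, Matrix.smul_mul, vecMulVec_mul]
  simp [vecMulVec, gram, mulVec_diagonal]

theorem mul_proj_apply {X : Mat m} (hX : X ∈ lieAlg p m)
    (x y : Row m) (a b : Fin (m + 2)) :
    (X * proj p x y) a b = -((form p x y)⁻¹ * (lam p a * (y ᵥ* X) a * x b)) := by
  have h1 : X *ᵥ (gram p m *ᵥ y) = -(gram p m *ᵥ (y ᵥ* X)) := by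
    rw [mulVec_mulVec, ← mulVec_transpose, mulVec_mulVec, mem_lieAlg.1 hX, neg_mulVec, neg_neg]
  rw [proj, Matrix.mul_smul, mul_vecMulVec, h1]
  simp [vecMulVec, gram, mulVec_diagonal]

/-! ### Homogeneous representatives -/

theorem trace_of_mem {z : Mat m} (hp : 2 ≤ p) (hm : p ≤ m)
    (hz : z ∈ Omega p m) : z.trace = 1 := by
  obtain ⟨x, y, -, -, h, rfl⟩ := exists_null_of_mem hp hm hz
  have := trace_proj_mul (p := p) x y 1
  rw [Matrix.mul_one, vecMul_one, h] at this
  rw [this]; norm_num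

theorem exists_homogeneous (hp : 2 ≤ p) (hm : p ≤ m) (F : polyOmega p m) :
    ∃ (d : ℕ) (P : PolyMat m), P.IsHomogeneous d ∧ toPoly p m P = F := by
  obtain ⟨P, rfl⟩ := toPoly_surjective F
  set t : PolyMat m := ∑ a, MvPolynomial.X (a, a) with ht
  have ht1 : toPoly p m t = 1 := by
    refine polyOmega_ext fun z => ?_
    rw [toPoly_apply, ht, map_sum]
    simp only [evalMat_X]
    rw [← Complex.ofReal_sum]
    have := trace_of_mem hp hm z.2
    rw [Matrix.trace] at this
    simp only [diag] at this
    rw [this]; simp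
  have hth : t.IsHomogeneous 1 :=
    MvPolynomial.IsHomogeneous.sum _ _ _ fun a _ => MvPolynomial.isHomogeneous_X _ _
  refine ⟨P.totalDegree, ∑ k ∈ Finset.range (P.totalDegree + 1),
    MvPolynomial.homogeneousComponent k P * t ^ (P.totalDegree - k), ?_, ?_⟩
  · refine MvPolynomial.IsHomogeneous.sum _ _ _ fun k hk => ?_
    have h1 := (MvPolynomial.homogeneousComponent_isHomogeneous k P).mul
      (hth.pow (P.totalDegree - k))
    have : k + 1 * (P.totalDegree - k) = P.totalDegree := by
      simp at hk; omega
    rwa [this] at h1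
  · conv_rhs => rw [← MvPolynomial.sum_homogeneousComponent P]
    simp only [map_sum, map_mul, map_pow, ht1, one_pow, mul_one]

/-! ### The identity principle -/

/-- The matrix `-y* x / 2` with `x = u(ξ) g`, `y = v(η) g`. -/
def chartMat (p : ℕ) {m : ℕ} (g : Mat m) (ξ η : Fin m → ℝ) :
    Mat m :=
  -(1 / 2 : ℝ) • vecMulVec (gram p m *ᵥ (vVec p η ᵥ* g)) (uVec p ξ ᵥ* g)

theorem proj_eq_smul_chartMat (hp : 2 ≤ p) (hm : p ≤ m) {g : Mat m}
    (hg : g ∈ orth p m) (ξ η : Fin m → ℝ) :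
    g⁻¹ * zMat p ξ η * g = (N p ξ η)⁻¹ • chartMat p g ξ η := by
  rw [zMat, ← proj_vecMul hg, proj, form_vecMul_vecMul hg, form_uVec_vVec hp hm, chartMat, smul_smul]
  congr 1
  rw [mul_inv]; ring

section Analytic

variable {E : Type*} [NormedAddCommGroup E] [NormedSpace ℝ E]

theorem analyticAt_row_zero {f : E → Fin m → ℝ} {w : E} (hf : ∀ i, AnalyticAt ℝ (fun w => f w i) w)
    (a : Fin (m + 2)) : AnalyticAt ℝ (fun w => row 0 (f w) 0 a) w := by
  refine Fin.cases ?_ (fun j => ?_) a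
  · exact analyticAt_const
  · refine Fin.lastCases ?_ (fun k => ?_) j
    · simpa [row_last] using analyticAt_const
    · rw [Fin.succ_castSucc]
      simp only [row_mid]
      exact hf k

theorem analyticAt_formMid {f g : E → Fin m → ℝ} {w : E} (hf : ∀ i, AnalyticAt ℝ (fun w => f w i) w)
    (hg : ∀ i, AnalyticAt ℝ (fun w => g w i) w) : AnalyticAt ℝ (fun w => formMid p (f w) (g w)) w := by
  simp only [formMid]
  exact Finset.analyticAt_fun_sum _ fun i _ => (analyticAt_const.mul (hf i)).mul (hg i)

theorem analyticAt_uVec {f : E → Fin m → ℝ} {w : E} (hf : ∀ i, AnalyticAt ℝ (fun w => f w i) w)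
    (a : Fin (m + 2)) : AnalyticAt ℝ (fun w => uVec p (f w) a) w := by
  simp only [uVec_eq, Pi.add_apply, Pi.smul_apply, smul_eq_mul]
  exact (analyticAt_const.add (analyticAt_const.mul (analyticAt_row_zero hf a))).add
    ((analyticAt_formMid hf hf).mul analyticAt_const)

theorem analyticAt_vVec {f : E → Fin m → ℝ} {w : E} (hf : ∀ i, AnalyticAt ℝ (fun w => f w i) w)
    (a : Fin (m + 2)) : AnalyticAt ℝ (fun w => vVec p (f w) a) w := by
  simp only [vVec_eq, Pi.add_apply, Pi.smul_apply, smul_eq_mul]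
  exact (analyticAt_const.add (analyticAt_const.mul (analyticAt_row_zero hf a))).add
    ((analyticAt_formMid hf hf).mul analyticAt_const)

theorem analyticAt_vecMul {f : E → Row m} {w : E}
    (hf : ∀ i, AnalyticAt ℝ (fun w => f w i) w) (g : Mat m)
    (a : Fin (m + 2)) : AnalyticAt ℝ (fun w => (f w ᵥ* g) a) w := by
  simp only [vecMul, dotProduct]
  exact Finset.analyticAt_fun_sum _ fun i _ => (hf i).mul analyticAt_const

theorem analyticAt_form {f : E → Row m} {w : E}
    (hf : ∀ i, AnalyticAt ℝ (fun w => f w i) w) (y : Row m) :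
    AnalyticAt ℝ (fun w => form p (f w) y) w := by
  simp only [form]
  exact Finset.analyticAt_fun_sum _ fun i _ => (analyticAt_const.mul (hf i)).mul analyticAt_const

theorem analyticAt_evalMat {M : E → Mat m} {w : E}
    (hM : ∀ a b, AnalyticAt ℝ (fun w => M w a b) w) (P : PolyMat m) :
    AnalyticAt ℝ (fun w => evalMat (M w) P) w := by
  induction P using MvPolynomial.induction_on with
  | C c => simpa [evalMat_C] using analyticAt_const
  | add P Q hP hQ => simpa using hP.fun_add hQ
  | mul_X P ij hP =>
    obtain ⟨a, b⟩ := ij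
    simp only [map_mul, evalMat_X]
    exact hP.mul ((Complex.ofRealCLM.analyticAt _).comp (hM a b))

theorem analyticAt_N {f g : E → Fin m → ℝ} {w : E} (hf : ∀ i, AnalyticAt ℝ (fun w => f w i) w)
    (hg : ∀ i, AnalyticAt ℝ (fun w => g w i) w) : AnalyticAt ℝ (fun w => N p (f w) (g w)) w := by
  simp only [N]
  exact (analyticAt_const.sub (analyticAt_const.mul (analyticAt_formMid hf hg))).add
    ((analyticAt_formMid hf hf).mul (analyticAt_formMid hg hg))

theorem analyticAt_chartMat {f k : E → Fin m → ℝ} {w : E} (hf : ∀ i, AnalyticAt ℝ (fun w => f w i) w)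
    (hk : ∀ i, AnalyticAt ℝ (fun w => k w i) w) (g : Mat m)
    (a b : Fin (m + 2)) : AnalyticAt ℝ (fun w => chartMat p g (f w) (k w) a b) w := by
  simp only [chartMat, Matrix.smul_apply, vecMulVec_apply, gram, mulVec_diagonal, smul_eq_mul]
  exact analyticAt_const.mul ((analyticAt_const.mul (analyticAt_vecMul (analyticAt_vVec hk) g a)).mul
    (analyticAt_vecMul (analyticAt_uVec hf) g b))

theorem analyticAt_fst_apply (w : (Fin m → ℝ) × (Fin m → ℝ)) (i : Fin m) :
    AnalyticAt ℝ (fun w : (Fin m → ℝ) × (Fin m → ℝ) => w.1 i) w :=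
  ((ContinuousLinearMap.proj i).comp (ContinuousLinearMap.fst ℝ (Fin m → ℝ) (Fin m → ℝ))
    : ((Fin m → ℝ) × (Fin m → ℝ)) →L[ℝ] ℝ).analyticAt w

theorem analyticAt_snd_apply (w : (Fin m → ℝ) × (Fin m → ℝ)) (i : Fin m) :
    AnalyticAt ℝ (fun w : (Fin m → ℝ) × (Fin m → ℝ) => w.2 i) w :=
  ((ContinuousLinearMap.proj i).comp (ContinuousLinearMap.snd ℝ (Fin m → ℝ) (Fin m → ℝ))
    : ((Fin m → ℝ) × (Fin m → ℝ)) →L[ℝ] ℝ).analyticAt w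

end Analytic

theorem analyticOnNhd_chart (g : Mat m) (P : PolyMat m) :
    AnalyticOnNhd ℝ (fun w : (Fin m → ℝ) × (Fin m → ℝ) => evalMat (chartMat p g w.1 w.2) P)
      Set.univ := fun w _ => analyticAt_evalMat
        (analyticAt_chartMat (analyticAt_fst_apply w) (analyticAt_snd_apply w) g) P

theorem N_zero : N p (0 : Fin m → ℝ) 0 = 1 := by simp [N, formMid_zero_left]

theorem eventually_N_ne_zero :
    ∀ᶠ w : (Fin m → ℝ) × (Fin m → ℝ) in 𝓝 0, N p w.1 w.2 ≠ 0 := by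
  have h := (analyticAt_N (p := p) (analyticAt_fst_apply (m := m) 0)
    (analyticAt_snd_apply 0)).continuousAt
  exact h.eventually_ne (by simp [N_zero])

/-- An element of `S(G/H)` that vanishes near the initial point vanishes. -/
theorem eq_zero_of_eventually (hp : 2 ≤ p) (hm : p ≤ m) {F : polyOmega p m}
    (h : ∀ᶠ w : (Fin m → ℝ) × (Fin m → ℝ) in 𝓝 0, ev F.1 (zMat p w.1 w.2) = 0) : F = 0 := by
  obtain ⟨d, P, hP, rfl⟩ := exists_homogeneous hp hm F
  have key1 : ∀ w : (Fin m → ℝ) × (Fin m → ℝ), evalMat (chartMat p 1 w.1 w.2) P = 0 := by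
    have h0 : (fun w : (Fin m → ℝ) × (Fin m → ℝ) => evalMat (chartMat p 1 w.1 w.2) P) =ᶠ[𝓝 0] 0 := by
      filter_upwards [h, eventually_N_ne_zero (p := p)] with w hw hN
      rw [ev_toPoly _ (zMat_mem hp hm hN)] at hw
      have e := proj_eq_smul_chartMat hp hm (orth_one (p := p) (m := m)) w.1 w.2
      rw [inv_one, Matrix.one_mul, Matrix.mul_one] at e
      rw [e, evalMat_smul hP] at hw
      simpa [hN] using hw
    intro w
    exact (analyticOnNhd_chart 1 P).eqOn_zero_of_preconnected_of_eventuallyEq_zero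
      isPreconnected_univ (Set.mem_univ 0) h0 (Set.mem_univ w)
  rw [toPoly_eq_zero_iff]
  rintro z ⟨g, hg, rfl⟩
  have ho := SO₀_subset_orth hg
  have hne : ∀ x : Row m, x ≠ 0 → x ᵥ* g⁻¹ ≠ 0 := by
    intro x hx h0
    apply hx
    rw [← vecMul_one x, ← orth_inv_cancel ho, ← vecMul_vecMul, h0, zero_vecMul]
  have hs1 : sPlus m ≠ 0 := fun h0 => by
    have := form_sMinus_sPlus (p := p) hp hm; rw [h0, form_zero_right] at this; norm_num at this
  have hs2 : sMinus m ≠ 0 := fun h0 => by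
    have := form_sMinus_sPlus (p := p) hp hm; rw [h0, form_zero_left] at this; norm_num at this
  obtain ⟨ξ, hξ⟩ := exists_form_uVec_ne_zero hp hm (hne _ hs1)
  obtain ⟨η, hη⟩ := exists_form_vVec_ne_zero hp hm (hne _ hs2)
  rw [form_comm, ← form_vecMul_left ho] at hξ hη
  have hu : ∀ᶠ w : (Fin m → ℝ) × (Fin m → ℝ) in 𝓝 (ξ, η),
      form p (uVec p w.1 ᵥ* g) (sPlus m) ≠ 0 :=
    (analyticAt_form (p := p) (analyticAt_vecMul (analyticAt_uVec
      (analyticAt_fst_apply (ξ, η))) g) (sPlus m)).continuousAt.eventually_ne hξ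
  have hv : ∀ᶠ w : (Fin m → ℝ) × (Fin m → ℝ) in 𝓝 (ξ, η),
      form p (vVec p w.2 ᵥ* g) (sMinus m) ≠ 0 :=
    (analyticAt_form (p := p) (analyticAt_vecMul (analyticAt_vVec
      (analyticAt_snd_apply (ξ, η))) g) (sMinus m)).continuousAt.eventually_ne hη
  have h0 : (fun w : (Fin m → ℝ) × (Fin m → ℝ) => evalMat (chartMat p g w.1 w.2) P)
      =ᶠ[𝓝 (ξ, η)] 0 := by
    filter_upwards [hu, hv] with w hu hv
    have e1 := eq_smul_uVec hp hm (by rw [form_vecMul_vecMul ho, form_uVec_self hp hm]) hu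
    have e2 := eq_smul_vVec hp hm (by rw [form_vecMul_vecMul ho, form_vVec_self hp hm]) hv
    set c := -(1 / 2) * form p (uVec p w.1 ᵥ* g) (sPlus m)
    set d' := -(1 / 2) * form p (vVec p w.2 ᵥ* g) (sMinus m)
    set ξ' := (1 / 2 : ℝ) • middle ((-2 / form p (uVec p w.1 ᵥ* g) (sPlus m)) • (uVec p w.1 ᵥ* g))
    set η' := (1 / 2 : ℝ) • middle ((-2 / form p (vVec p w.2 ᵥ* g) (sMinus m)) • (vVec p w.2 ᵥ* g))
    have e3 : chartMat p g w.1 w.2 = (d' * c) • chartMat p 1 ξ' η' := by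
      rw [chartMat, e1, e2, chartMat, vecMul_one, vecMul_one]
      simp only [mulVec_smul, vecMulVec_smul, smul_vecMulVec, smul_smul]
      congr 1; ring
    rw [e3, evalMat_smul hP, key1 (ξ', η'), mul_zero]; rfl
  have h1 := (analyticOnNhd_chart g P).eqOn_zero_of_preconnected_of_eventuallyEq_zero
      isPreconnected_univ (Set.mem_univ (ξ, η)) h0 (Set.mem_univ 0)
  have h2 := proj_eq_smul_chartMat hp hm ho (0 : Fin m → ℝ) 0
  rw [N_zero, zMat_zero, inv_one, one_smul] at h2
  rw [h2]
  exact h1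

theorem HasCoord.unique (hp : 2 ≤ p) (hm : p ≤ m) {F G : polyOmega p m}
    {f : (Fin m → ℝ) → (Fin m → ℝ) → ℂ} (hF : HasCoord F.1 f) (hG : HasCoord G.1 f) : F = G := by
  rw [← sub_eq_zero]
  apply eq_zero_of_eventually hp hm
  filter_upwards [eventually_N_ne_zero (p := p)] with w hw
  have h1 := hF _ _ hw
  have h2 := hG _ _ hw
  rw [ev_of_mem _ (zMat_mem hp hm hw)] at h1 h2 ⊢
  change F.1 _ - G.1 _ = 0
  rw [h1, h2, sub_self]

end Poly

section Operators

variable {p m : ℕ}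

/-- The matrix of coordinate functions. -/
def coordMat (m : ℕ) : Matrix (Fin (m + 2)) (Fin (m + 2)) (PolyMat m) :=
  Matrix.of fun a b => MvPolynomial.X (a, b)

/-- A constant matrix. -/
def cst {m : ℕ} (X : Mat m) :
    Matrix (Fin (m + 2)) (Fin (m + 2)) (PolyMat m) :=
  X.map fun r => MvPolynomial.C (r : ℂ)

/-- The linear function `tr (z X)`. -/
def tau {m : ℕ} (X : Mat m) : PolyMat m :=
  (coordMat m * cst X).trace

/-- The derivation `z ↦ z X - tr (z X) z`, i.e. the action of `X` on the first row `x`. -/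
def Dx {m : ℕ} (X : Mat m) : Derivation ℂ (PolyMat m) (PolyMat m) :=
  MvPolynomial.mkDerivation ℂ fun ab => (coordMat m * cst X - tau X • coordMat m) ab.1 ab.2

/-- The derivation `z ↦ tr (z X) z - X z`, i.e. the action of `X` on the second row `y`. -/
def Dy {m : ℕ} (X : Mat m) : Derivation ℂ (PolyMat m) (PolyMat m) :=
  MvPolynomial.mkDerivation ℂ fun ab => (tau X • coordMat m - cst X * coordMat m) ab.1 ab.2

/-- The conjugate of `X ⊗ 1` by `Φ_σ`. -/
def Lop {m : ℕ} (σ : ℂ) (X : Mat m) : PolyMat m →ₗ[ℂ] PolyMat m :=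
  (Dx X).toLinearMap + σ • LinearMap.mulLeft ℂ (tau X)

/-- The conjugate of `1 ⊗ X` by `Φ_σ`. -/
def Rop {m : ℕ} (σ : ℂ) (X : Mat m) : PolyMat m →ₗ[ℂ] PolyMat m :=
  (Dy X).toLinearMap - σ • LinearMap.mulLeft ℂ (tau X)

theorem Lop_apply (σ : ℂ) (X : Mat m) (P : PolyMat m) :
    Lop σ X P = Dx X P + σ • (tau X * P) := rfl

theorem Rop_apply (σ : ℂ) (X : Mat m) (P : PolyMat m) :
    Rop σ X P = Dy X P - σ • (tau X * P) := rfl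

theorem Dx_X (X : Mat m) (a b : Fin (m + 2)) :
    Dx X (MvPolynomial.X (a, b)) = (coordMat m * cst X) a b - tau X * MvPolynomial.X (a, b) := by
  simp [Dx, coordMat]

theorem Dy_X (X : Mat m) (a b : Fin (m + 2)) :
    Dy X (MvPolynomial.X (a, b)) = tau X * MvPolynomial.X (a, b) - (cst X * coordMat m) a b := by
  simp [Dy, coordMat]

theorem evalMat_coord_mul (M X : Mat m) (a b : Fin (m + 2)) :
    evalMat M ((coordMat m * cst X) a b) = (((M * X) a b : ℝ) : ℂ) := by
  simp [Matrix.mul_apply, coordMat, cst, evalMat_X]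

theorem evalMat_mul_coord (M X : Mat m) (a b : Fin (m + 2)) :
    evalMat M ((cst X * coordMat m) a b) = (((X * M) a b : ℝ) : ℂ) := by
  simp [Matrix.mul_apply, coordMat, cst, evalMat_X]

theorem evalMat_tau (M X : Mat m) :
    evalMat M (tau X) = (((M * X).trace : ℝ) : ℂ) := by
  simp only [tau, Matrix.trace, diag, map_sum, evalMat_coord_mul, Complex.ofReal_sum]

theorem hasDerivAt_eval_left (X : Mat m)
    {x y : Row m} (h : form p x y ≠ 0) (Q : PolyMat m) :
    HasDerivAt (fun s : ℝ => evalMat (proj p (x ᵥ* NormedSpace.exp (s • X)) y) Q)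
      (evalMat (proj p x y) (Dx X Q)) 0 := by
  have h0 : x ᵥ* NormedSpace.exp ((0 : ℝ) • X) = x := by simp
  have h1 := hasDerivAt_proj_left (p := p) (hasDerivAt_vecMul_exp X x) (y := y) (by rwa [h0])
  have h2 := hasDerivAt_evalMat (Dx X) (Z := fun s : ℝ => proj p (x ᵥ* NormedSpace.exp (s • X)) y) h1
    (fun a b => by
      simp only [h0]
      rw [Dx_X, map_sub, map_mul, evalMat_coord_mul, evalMat_tau, evalMat_X, proj_mul_apply,
        trace_proj_mul]
      push_cast; ring) Q
  simpa only [h0] using h2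

theorem hasDerivAt_eval_right {X : Mat m} (hX : X ∈ lieAlg p m)
    {x y : Row m} (h : form p x y ≠ 0) (Q : PolyMat m) :
    HasDerivAt (fun s : ℝ => evalMat (proj p x (y ᵥ* NormedSpace.exp (s • X))) Q)
      (evalMat (proj p x y) (Dy X Q)) 0 := by
  have h0 : y ᵥ* NormedSpace.exp ((0 : ℝ) • X) = y := by simp
  have h1 := hasDerivAt_proj_right (p := p) (hasDerivAt_vecMul_exp X y) (x := x) (by rwa [h0])
  have h2 := hasDerivAt_evalMat (Dy X) (Z := fun s : ℝ => proj p x (y ᵥ* NormedSpace.exp (s • X))) h1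
    (fun a b => by
      simp only [h0]
      rw [Dy_X, map_sub, map_mul, evalMat_mul_coord, evalMat_tau, evalMat_X, mul_proj_apply hX,
        trace_proj_mul, form_vecMul_skew hX]
      push_cast; ring) Q
  simpa only [h0] using h2

theorem eventually_form_left (X : Mat m)
    {x y : Row m} (h : form p x y ≠ 0) :
    ∀ᶠ s : ℝ in 𝓝 0, form p (x ᵥ* NormedSpace.exp (s • X)) y ≠ 0 :=
  (hasDerivAt_form_left (p := p) (hasDerivAt_vecMul_exp X x) y).continuousAt.eventually_ne
    (by simpa using h)

theorem eventually_form_right (X : Mat m)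
    {x y : Row m} (h : form p x y ≠ 0) :
    ∀ᶠ s : ℝ in 𝓝 0, form p x (y ᵥ* NormedSpace.exp (s • X)) ≠ 0 :=
  (hasDerivAt_form_right (p := p) (hasDerivAt_vecMul_exp X y) x).continuousAt.eventually_ne
    (by simpa using h)

theorem form_exp_self {X : Mat m} (hX : X ∈ lieAlg p m) (s : ℝ)
    (x : Row m) : form p (x ᵥ* NormedSpace.exp (s • X)) (x ᵥ* NormedSpace.exp (s • X))
      = form p x x := form_vecMul_vecMul (exp_mem_orth (Submodule.smul_mem _ s hX)) _ _

theorem toPoly_Dx (hp : 2 ≤ p) (hm : p ≤ m) {X : Mat m}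
    (hX : X ∈ lieAlg p m) {P : PolyMat m} (hP : toPoly p m P = 0) : toPoly p m (Dx X P) = 0 := by
  rw [toPoly_eq_zero_iff] at hP ⊢
  intro z hz
  obtain ⟨x, y, hx, hy, hxy, rfl⟩ := exists_null_of_mem hp hm hz
  have hne : form p x y ≠ 0 := by rw [hxy]; norm_num
  refine (hasDerivAt_eval_left X hne P).unique ((hasDerivAt_const (0 : ℝ) (0 : ℂ)).congr_of_eventuallyEq ?_)
  filter_upwards [eventually_form_left (p := p) X hne] with s hs
  exact hP _ (proj_mem_Omega hp hm (by rw [form_exp_self hX, hx]) hy hs)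

theorem toPoly_Dy (hp : 2 ≤ p) (hm : p ≤ m) {X : Mat m}
    (hX : X ∈ lieAlg p m) {P : PolyMat m} (hP : toPoly p m P = 0) : toPoly p m (Dy X P) = 0 := by
  rw [toPoly_eq_zero_iff] at hP ⊢
  intro z hz
  obtain ⟨x, y, hx, hy, hxy, rfl⟩ := exists_null_of_mem hp hm hz
  have hne : form p x y ≠ 0 := by rw [hxy]; norm_num
  refine (hasDerivAt_eval_right hX hne P).unique ((hasDerivAt_const (0 : ℝ) (0 : ℂ)).congr_of_eventuallyEq ?_)
  filter_upwards [eventually_form_right (p := p) X hne] with s hs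
  exact hP _ (proj_mem_Omega hp hm hx (by rw [form_exp_self hX, hy]) hs)

/-! ### Powers -/

theorem powSgn_mul {a b : ℝ} (σ : ℂ) (ε : Fin 2) : powSgn (a * b) σ ε = powSgn a σ ε * powSgn b σ ε := by
  simp only [powSgn]
  rw [abs_mul, Complex.ofReal_mul, Complex.mul_cpow_ofReal_nonneg (abs_nonneg a) (abs_nonneg b)]
  have : Real.sign (a * b) = Real.sign a * Real.sign b := by
    rcases lt_trichotomy a 0 with ha | ha | ha <;> rcases lt_trichotomy b 0 with hb | hb | hb <;>
      simp [ha, hb, Real.sign_of_neg, Real.sign_of_pos, mul_pos_of_neg_of_neg, mul_neg_of_neg_of_pos,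
        mul_neg_of_pos_of_neg]
  rw [this]
  push_cast; ring

theorem powSgn_eq {t : ℝ} (ht : t ≠ 0) (σ : ℂ) (ε : Fin 2) :
    powSgn t σ ε = Complex.exp (σ * (Real.log t : ℂ)) * ((Real.sign t : ℝ) : ℂ) ^ (ε : ℕ) := by
  rw [powSgn, Complex.cpow_def_of_ne_zero (by simpa using ht), ← Complex.ofReal_log (abs_nonneg t),
    Real.log_abs, mul_comm σ]

theorem powSgn_ne_zero {t : ℝ} (ht : t ≠ 0) (σ : ℂ) (ε : Fin 2) : powSgn t σ ε ≠ 0 := by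
  rw [powSgn_eq ht]
  refine mul_ne_zero (Complex.exp_ne_zero _) (pow_ne_zero _ ?_)
  simpa using ht

theorem hasDerivAt_powSgn {f : ℝ → ℝ} {f' s : ℝ} (hf : HasDerivAt f f' s) (h : f s ≠ 0) (σ : ℂ)
    (ε : Fin 2) : HasDerivAt (fun s => powSgn (f s) σ ε) (powSgn (f s) σ ε * (σ * ((f' / f s : ℝ) : ℂ))) s := by
  have h1 : HasDerivAt (fun s => Complex.exp (σ * (Real.log (f s) : ℂ)) *
      ((Real.sign (f s) : ℝ) : ℂ) ^ (ε : ℕ)) (powSgn (f s) σ ε * (σ * ((f' / f s : ℝ) : ℂ))) s := by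
    have hl : HasDerivAt (fun s => ((Real.log (f s) : ℝ) : ℂ)) ((f' / f s : ℝ) : ℂ) s :=
      (hf.log h).ofReal_comp
    have h2 := ((hl.const_mul σ).cexp).mul_const (((Real.sign (f s) : ℝ) : ℂ) ^ (ε : ℕ))
    have h3 : ∀ᶠ r in 𝓝 s, Real.sign (f r) = Real.sign (f s) := by
      rcases lt_or_gt_of_ne h with hn | hn
      · filter_upwards [hf.continuousAt.eventually_lt_const hn] with r hr
        rw [Real.sign_of_neg hr, Real.sign_of_neg hn]
      · filter_upwards [hf.continuousAt.eventually_const_lt hn] with r hr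
        rw [Real.sign_of_pos hr, Real.sign_of_pos hn]
    refine (h2.congr_deriv ?_).congr_of_eventuallyEq ?_
    · rw [powSgn_eq h]; ring
    · filter_upwards [h3] with r hr
      rw [hr]
  refine h1.congr_of_eventuallyEq ?_
  filter_upwards [hf.continuousAt.eventually_ne h] with r hr
  exact powSgn_eq hr σ ε

/-! ### The symbols as polynomials -/

/-- The covariant symbol as a polynomial. -/
def covPoly {p m : ℕ} (σ : ℂ) (w : List (lieAlg p m)) : PolyMat m :=
  w.foldr (fun X Q => Lop σ X.1 Q) 1

/-- The result of `1 ⊗ w` on `Φ_σ`, divided by `Φ_σ`, as a polynomial. -/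
def contraPoly {p m : ℕ} (σ : ℂ) (w : List (lieAlg p m)) : PolyMat m :=
  w.foldr (fun X Q => Rop σ X.1 Q) 1

theorem envMinus_eq (hp : 2 ≤ p) (hm : p ≤ m) (σ : ℂ) (ε : Fin 2) (w : List (lieAlg p m))
    (η : Fin m → ℝ) : ∀ ξ, N p ξ η ≠ 0 → envMinus p σ ε w (fun ξ' => Phi p σ ε ξ' η) ξ =
      Phi p σ ε ξ η * evalMat (zMat p ξ η) (covPoly σ w) := by
  induction w with
  | nil => intro ξ _; simp [envMinus, covPoly]
  | cons X w ih =>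
    intro ξ hN
    set Q := covPoly σ w with hQ
    have hne : form p (uVec p ξ) (vVec p η) ≠ 0 := by rw [form_uVec_vVec hp hm]; simpa using hN
    have h2 : form p (uVec p ξ) (sPlus m) ≠ 0 := by rw [form_uVec_sPlus hp hm]; norm_num
    have hd : HasDerivAt (fun s : ℝ =>
        powSgn (-(1 / 2) * form p (uVec p ξ ᵥ* NormedSpace.exp (s • X.1)) (vVec p η)) σ ε *
          evalMat (proj p (uVec p ξ ᵥ* NormedSpace.exp (s • X.1)) (vVec p η)) Q)
        (Phi p σ ε ξ η * evalMat (zMat p ξ η) (Lop σ X.1 Q)) 0 := by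
      have e1 := (hasDerivAt_form_left (p := p) (hasDerivAt_vecMul_exp X.1 (uVec p ξ))
        (vVec p η)).const_mul (-(1 / 2 : ℝ))
      have e2 := hasDerivAt_powSgn e1 (by simpa using hne) σ ε
      have e3 := e2.fun_mul (hasDerivAt_eval_left X.1 hne Q)
      refine e3.congr_deriv ?_
      simp only [zero_smul, NormedSpace.exp_zero, vecMul_one]
      have e4 : -(1 / 2) * form p (uVec p ξ) (vVec p η) = N p ξ η := by
        rw [form_uVec_vVec hp hm]; ring
      rw [e4, Lop_apply, map_add, map_smul, map_mul, evalMat_tau, zMat, trace_proj_mul, Phi,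
        form_uVec_vVec hp hm, smul_eq_mul]
      push_cast
      field_simp
      ring
    change deriv _ 0 = _
    refine Eq.trans (Filter.EventuallyEq.deriv_eq ?_) hd.deriv
    filter_upwards [eventually_form_left (p := p) X.1 hne, eventually_form_left (p := p) X.1 h2] with s hs1 hs2
    simp only [groupMinus]
    set x := uVec p ξ ᵥ* NormedSpace.exp (s • X.1) with hx
    have e1 := eq_smul_uVec hp hm (x := x) (by rw [hx, form_exp_self X.2, form_uVec_self hp hm]) hs2
    set ξ' := (1 / 2 : ℝ) • middle ((-2 / form p x (sPlus m)) • x)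
    set c := -(1 / 2) * form p x (sPlus m) with hc
    have hc0 : c ≠ 0 := by rw [hc]; simpa using hs2
    have e2 : form p x (vVec p η) = c * (-2 * N p ξ' η) := by
      conv_lhs => rw [e1]
      rw [form_smul_left, form_uVec_vVec hp hm]
    have hN' : N p ξ' η ≠ 0 := by
      intro h0; rw [e2, h0] at hs1; simp at hs1
    have e3 : proj p x (vVec p η) = zMat p ξ' η := by
      conv_lhs => rw [e1, ← one_smul ℝ (vVec p η)]
      rw [proj_smul hc0 one_ne_zero, zMat]
    have e4 := ih ξ' hN'
    simp only [envMinus] at e4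
    rw [e4, e3, e2, Phi, show -(1 / 2) * (c * (-2 * N p ξ' η)) = N p ξ' η * c by ring,
      powSgn_mul (a := N p ξ' η) (b := c)]
    ring

theorem envPlus_eq (hp : 2 ≤ p) (hm : p ≤ m) (σ : ℂ) (ε : Fin 2) (w : List (lieAlg p m))
    (ξ : Fin m → ℝ) : ∀ η, N p ξ η ≠ 0 → envPlus p σ ε w (fun η' => Phi p σ ε ξ η') η =
      Phi p σ ε ξ η * evalMat (zMat p ξ η) (contraPoly σ w) := by
  induction w with
  | nil => intro ξ _; simp [envPlus, contraPoly]
  | cons X w ih =>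
    intro η hN
    set Q := contraPoly σ w with hQ
    have hne : form p (uVec p ξ) (vVec p η) ≠ 0 := by rw [form_uVec_vVec hp hm]; simpa using hN
    have h2 : form p (vVec p η) (sMinus m) ≠ 0 := by rw [form_vVec_sMinus hp hm]; norm_num
    have hd : HasDerivAt (fun s : ℝ =>
        powSgn (-(1 / 2) * form p (uVec p ξ) (vVec p η ᵥ* NormedSpace.exp (s • X.1))) σ ε *
          evalMat (proj p (uVec p ξ) (vVec p η ᵥ* NormedSpace.exp (s • X.1))) Q)
        (Phi p σ ε ξ η * evalMat (zMat p ξ η) (Rop σ X.1 Q)) 0 := by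
      have e1 := (hasDerivAt_form_right (p := p) (hasDerivAt_vecMul_exp X.1 (vVec p η))
        (uVec p ξ)).const_mul (-(1 / 2 : ℝ))
      have e2 := hasDerivAt_powSgn e1 (by simpa using hne) σ ε
      have e3 := e2.fun_mul (hasDerivAt_eval_right X.2 hne Q)
      refine e3.congr_deriv ?_
      simp only [zero_smul, NormedSpace.exp_zero, vecMul_one]
      have e4 : -(1 / 2) * form p (uVec p ξ) (vVec p η) = N p ξ η := by
        rw [form_uVec_vVec hp hm]; ring
      rw [e4, Rop_apply, map_sub, map_smul, map_mul, evalMat_tau, zMat, trace_proj_mul, Phi,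
        form_vecMul_skew X.2, form_uVec_vVec hp hm, smul_eq_mul]
      push_cast
      field_simp
      ring
    change deriv _ 0 = _
    refine Eq.trans (Filter.EventuallyEq.deriv_eq ?_) hd.deriv
    filter_upwards [eventually_form_right (p := p) X.1 hne, eventually_form_left (p := p) X.1 h2] with s hs1 hs2
    simp only [groupPlus]
    set y := vVec p η ᵥ* NormedSpace.exp (s • X.1) with hy
    have e1 := eq_smul_vVec hp hm (x := y) (by rw [hy, form_exp_self X.2, form_vVec_self hp hm]) hs2
    set η' := (1 / 2 : ℝ) • middle ((-2 / form p y (sMinus m)) • y)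
    set c := -(1 / 2) * form p y (sMinus m) with hc
    have hc0 : c ≠ 0 := by rw [hc]; simpa using hs2
    have e2 : form p (uVec p ξ) y = c * (-2 * N p ξ η') := by
      conv_lhs => rw [e1]
      rw [form_smul_right, form_uVec_vVec hp hm]
    have hN' : N p ξ η' ≠ 0 := by
      intro h0; rw [e2, h0] at hs1; simp at hs1
    have e3 : proj p (uVec p ξ) y = zMat p ξ η' := by
      conv_lhs => rw [e1, ← one_smul ℝ (uVec p ξ)]
      rw [proj_smul one_ne_zero hc0, zMat]
    have e4 := ih η' hN'
    simp only [envPlus] at e4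
    rw [e4, e3, e2, Phi, show -(1 / 2) * (c * (-2 * N p ξ η')) = N p ξ η' * c by ring,
      powSgn_mul (a := N p ξ η') (b := c)]
    ring

theorem hasCoord_covSymbol (hp : 2 ≤ p) (hm : p ≤ m) (σ : ℂ) (ε : Fin 2) (w : List (lieAlg p m)) :
    HasCoord (toPoly p m (covPoly σ w)).1 (covSymbol p σ ε w) := by
  intro ξ η hN
  rw [ev_toPoly _ (zMat_mem hp hm hN), covSymbol, envMinus_eq hp hm σ ε w η ξ hN, ← mul_assoc,
    inv_mul_cancel₀, one_mul]
  exact powSgn_ne_zero hN σ ε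

theorem hasCoord_contraSymbol (hp : 2 ≤ p) (hm : p ≤ m) (σ : ℂ) (ε : Fin 2)
    (w : List (lieAlg p m)) :
    HasCoord (toPoly p m (contraPoly (-(m : ℂ) - σ) w)).1 (contraSymbol p σ ε w) := by
  intro ξ η hN
  rw [ev_toPoly _ (zMat_mem hp hm hN), contraSymbol, envPlus_eq hp hm _ ε w ξ η hN, ← mul_assoc,
    inv_mul_cancel₀, one_mul]
  exact powSgn_ne_zero hN _ ε

end Operators

section Commutators

variable {p m : ℕ}

theorem cst_mul (X Y : Mat m) : cst (X * Y) = cst X * cst Y := by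
  ext1 a b
  simp [cst, Matrix.mul_apply]

theorem cst_add (X Y : Mat m) : cst (X + Y) = cst X + cst Y := by
  ext1 a b
  simp [cst]

theorem cst_sub (X Y : Mat m) : cst (X - Y) = cst X - cst Y := by
  ext1 a b
  simp [cst]

theorem cst_smul (c : ℝ) (X : Mat m) :
    cst (c • X) = (c : ℂ) • cst X := by
  ext1 a b
  simp [cst, MvPolynomial.smul_eq_C_mul]

theorem algHom_map_mul (f : PolyMat m →ₐ[ℂ] PolyMat m)
    (M M' : Matrix (Fin (m + 2)) (Fin (m + 2)) (PolyMat m)) :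
    (M * M').map f = M.map f * M'.map f := by
  ext1 a b
  simp [Matrix.mul_apply]

theorem derivation_map_mul_cst (D : Derivation ℂ (PolyMat m) (PolyMat m))
    (M : Matrix (Fin (m + 2)) (Fin (m + 2)) (PolyMat m)) (Y : Mat m) :
    (M * cst Y).map D = M.map D * cst Y := by
  ext1 a b
  simp only [Matrix.map_apply, Matrix.mul_apply, map_sum, Derivation.leibniz, cst]
  refine Finset.sum_congr rfl fun c _ => ?_
  rw [show D (MvPolynomial.C ((Y c b : ℝ) : ℂ)) = 0 from D.map_algebraMap _]
  simp [mul_comm]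

theorem derivation_map_cst_mul (D : Derivation ℂ (PolyMat m) (PolyMat m))
    (M : Matrix (Fin (m + 2)) (Fin (m + 2)) (PolyMat m)) (Y : Mat m) :
    (cst Y * M).map D = cst Y * M.map D := by
  ext1 a b
  simp only [Matrix.map_apply, Matrix.mul_apply, map_sum, Derivation.leibniz, cst]
  refine Finset.sum_congr rfl fun c _ => ?_
  rw [show D (MvPolynomial.C ((Y a c : ℝ) : ℂ)) = 0 from D.map_algebraMap _]
  simp

theorem derivation_trace (D : Derivation ℂ (PolyMat m) (PolyMat m))
    (M : Matrix (Fin (m + 2)) (Fin (m + 2)) (PolyMat m)) : D M.trace = (M.map D).trace := by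
  simp [Matrix.trace, map_sum]

theorem derivation_map_smul (D : Derivation ℂ (PolyMat m) (PolyMat m)) (f : PolyMat m)
    (M : Matrix (Fin (m + 2)) (Fin (m + 2)) (PolyMat m)) :
    (f • M).map D = f • M.map D + D f • M := by
  ext1 a b
  simp [mul_comm]

theorem derivation_map_sub (D : Derivation ℂ (PolyMat m) (PolyMat m))
    (M M' : Matrix (Fin (m + 2)) (Fin (m + 2)) (PolyMat m)) :
    (M - M').map D = M.map D - M'.map D := by
  ext1 a b
  simp

theorem derivation_ext_coord {D D' : Derivation ℂ (PolyMat m) (PolyMat m)}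
    (h : (coordMat m).map D = (coordMat m).map D') : D = D' :=
  MvPolynomial.derivation_ext fun ab => congrFun (congrFun h ab.1) ab.2

theorem coord_map_Dx (X : Mat m) :
    (coordMat m).map (Dx X) = coordMat m * cst X - tau X • coordMat m := by
  ext1 a b
  exact Dx_X X a b

theorem coord_map_Dy (X : Mat m) :
    (coordMat m).map (Dy X) = tau X • coordMat m - cst X * coordMat m := by
  ext1 a b
  exact Dy_X X a b

/-- The derivation `z ↦ z X - X z`. -/
def adD {m : ℕ} (X : Mat m) : Derivation ℂ (PolyMat m) (PolyMat m) :=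
  Dx X + Dy X

theorem coord_map_adD (X : Mat m) :
    (coordMat m).map (adD X) = coordMat m * cst X - cst X * coordMat m := by
  have : (coordMat m).map (adD X) = (coordMat m).map (Dx X) + (coordMat m).map (Dy X) := by
    ext1 a b; rfl
  rw [this, coord_map_Dx, coord_map_Dy]; abel

theorem trace_cst_mul_coord (X Y : Mat m) :
    (cst Y * coordMat m * cst X).trace = tau (X * Y) := by
  rw [Matrix.mul_assoc, Matrix.trace_mul_comm, tau, cst_mul, Matrix.mul_assoc]

theorem Dx_tau (X Y : Mat m) :
    Dx X (tau Y) = tau (X * Y) - tau X * tau Y := by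
  rw [tau, derivation_trace, derivation_map_mul_cst, coord_map_Dx, Matrix.sub_mul, trace_sub,
    Matrix.smul_mul, trace_smul, Matrix.mul_assoc, ← cst_mul]
  rfl

theorem Dy_tau (X Y : Mat m) :
    Dy X (tau Y) = tau X * tau Y - tau (Y * X) := by
  rw [tau, derivation_trace, derivation_map_mul_cst, coord_map_Dy, Matrix.sub_mul, trace_sub,
    Matrix.smul_mul, trace_smul, trace_cst_mul_coord]
  rfl

theorem tau_add (X Y : Mat m) : tau (X + Y) = tau X + tau Y := by
  simp only [tau, cst_add, Matrix.mul_add, trace_add]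

theorem tau_sub (X Y : Mat m) : tau (X - Y) = tau X - tau Y := by
  simp only [tau, cst_sub, Matrix.mul_sub, trace_sub]

theorem tau_smul (c : ℝ) (X : Mat m) :
    tau (c • X) = (c : ℂ) • tau X := by
  simp only [tau, cst_smul, Matrix.mul_smul, trace_smul]

theorem Dx_comm_Dy (X Y : Mat m) (P : PolyMat m) :
    Dx X (Dy Y P) = Dy Y (Dx X P) := by
  have h : ⁅Dx X, Dy Y⁆ = (0 : Derivation ℂ (PolyMat m) (PolyMat m)) := by
    apply derivation_ext_coord
    have e : (coordMat m).map (⁅Dx X, Dy Y⁆ : Derivation ℂ (PolyMat m) (PolyMat m)) =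
        ((coordMat m).map (Dy Y)).map (Dx X) - ((coordMat m).map (Dx X)).map (Dy Y) := by
      ext1 a b; simp [Derivation.commutator_apply]
    rw [e, coord_map_Dx, coord_map_Dy, derivation_map_sub, derivation_map_sub, derivation_map_smul,
      derivation_map_smul, derivation_map_cst_mul, derivation_map_mul_cst, coord_map_Dx,
      coord_map_Dy, Dx_tau, Dy_tau]
    simp only [Matrix.sub_mul, Matrix.mul_sub, smul_sub, sub_smul, Matrix.smul_mul, Matrix.mul_smul,
      smul_smul, Matrix.mul_assoc]
    rw [mul_comm (tau Y) (tau X)]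
    ext1 a b
    simp only [Matrix.sub_apply, Matrix.add_apply, Matrix.map_apply, Derivation.coe_zero, Pi.zero_apply]
    ring
  have := congrArg (fun D => D P) h
  simpa [Derivation.commutator_apply, sub_eq_zero] using this

theorem adD_tau (X Y : Mat m) :
    adD X (tau Y) = tau (X * Y - Y * X) := by
  rw [adD, Derivation.add_apply, Dx_tau, Dy_tau, tau_sub]; ring

theorem adD_Dx (X Y : Mat m) (P : PolyMat m) :
    adD Y (Dx X P) = Dx X (adD Y P) + Dx (Y * X - X * Y) P := by
  have h : ⁅adD Y, Dx X⁆ = (Dx (Y * X - X * Y) : Derivation ℂ (PolyMat m) (PolyMat m)) := by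
    apply derivation_ext_coord
    have e : (coordMat m).map (⁅adD Y, Dx X⁆ : Derivation ℂ (PolyMat m) (PolyMat m)) =
        ((coordMat m).map (Dx X)).map (adD Y) - ((coordMat m).map (adD Y)).map (Dx X) := by
      ext1 a b; simp [Derivation.commutator_apply]
    rw [e, coord_map_Dx, coord_map_Dx, coord_map_adD, derivation_map_sub, derivation_map_sub,
      derivation_map_smul, derivation_map_cst_mul, derivation_map_mul_cst, derivation_map_mul_cst,
      coord_map_Dx, coord_map_adD, adD_tau, cst_sub, cst_mul, cst_mul]
    simp only [Matrix.sub_mul, Matrix.mul_sub, smul_sub, Matrix.smul_mul, Matrix.mul_smul,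
      Matrix.mul_assoc]
    abel
  have := congrArg (fun D => D P) h
  simp only [Derivation.commutator_apply] at this
  rw [← this]; ring

theorem adD_Dy (X Y : Mat m) (P : PolyMat m) :
    adD Y (Dy X P) = Dy X (adD Y P) + Dy (Y * X - X * Y) P := by
  have h : ⁅adD Y, Dy X⁆ = (Dy (Y * X - X * Y) : Derivation ℂ (PolyMat m) (PolyMat m)) := by
    apply derivation_ext_coord
    have e : (coordMat m).map (⁅adD Y, Dy X⁆ : Derivation ℂ (PolyMat m) (PolyMat m)) =
        ((coordMat m).map (Dy X)).map (adD Y) - ((coordMat m).map (adD Y)).map (Dy X) := by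
      ext1 a b; simp [Derivation.commutator_apply]
    rw [e, coord_map_Dy, coord_map_Dy, coord_map_adD, derivation_map_sub, derivation_map_sub,
      derivation_map_smul, derivation_map_cst_mul, derivation_map_cst_mul, derivation_map_mul_cst,
      coord_map_Dy, coord_map_adD, adD_tau, cst_sub, cst_mul, cst_mul]
    simp only [Matrix.sub_mul, Matrix.mul_sub, smul_sub, Matrix.smul_mul, Matrix.mul_smul,
      Matrix.mul_assoc]
    abel
  have := congrArg (fun D => D P) h
  simp only [Derivation.commutator_apply] at this
  rw [← this]; ring

theorem Lop_comm_Rop (σ : ℂ) (X Y : Mat m) (P : PolyMat m) :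
    Lop σ X (Rop σ Y P) = Rop σ Y (Lop σ X P) := by
  simp only [Lop_apply, Rop_apply, map_sub, map_add, map_smul, Derivation.leibniz, Dx_tau, Dy_tau,
    Dx_comm_Dy, smul_eq_mul]
  simp only [MvPolynomial.smul_eq_C_mul]
  ring

theorem adD_Lop (σ : ℂ) (X Y : Mat m) (P : PolyMat m) :
    adD Y (Lop σ X P) = Lop σ X (adD Y P) + Lop σ (Y * X - X * Y) P := by
  simp only [Lop_apply, map_add, Derivation.map_smul, Derivation.leibniz, adD_Dx, adD_tau, smul_eq_mul]
  simp only [MvPolynomial.smul_eq_C_mul]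
  ring

theorem adD_Rop (σ : ℂ) (X Y : Mat m) (P : PolyMat m) :
    adD Y (Rop σ X P) = Rop σ X (adD Y P) + Rop σ (Y * X - X * Y) P := by
  simp only [Rop_apply, map_sub, Derivation.map_smul, Derivation.leibniz, adD_Dy, adD_tau, smul_eq_mul]
  simp only [MvPolynomial.smul_eq_C_mul]
  ring

theorem Dx_add (X Y : Mat m) : Dx (X + Y) = Dx X + Dx Y := by
  apply derivation_ext_coord
  have e : (coordMat m).map (Dx X + Dx Y) = (coordMat m).map (Dx X) + (coordMat m).map (Dx Y) := by
    ext1 a b; rfl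
  rw [e, coord_map_Dx, coord_map_Dx, coord_map_Dx, cst_add, tau_add, Matrix.mul_add, add_smul]; abel

theorem Dy_add (X Y : Mat m) : Dy (X + Y) = Dy X + Dy Y := by
  apply derivation_ext_coord
  have e : (coordMat m).map (Dy X + Dy Y) = (coordMat m).map (Dy X) + (coordMat m).map (Dy Y) := by
    ext1 a b; rfl
  rw [e, coord_map_Dy, coord_map_Dy, coord_map_Dy, cst_add, tau_add, Matrix.add_mul, add_smul]; abel

theorem Dx_smul (c : ℝ) (X : Mat m) : Dx (c • X) = (c : ℂ) • Dx X := by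
  apply derivation_ext_coord
  have e : (coordMat m).map ((c : ℂ) • Dx X) = (c : ℂ) • (coordMat m).map (Dx X) := by
    ext1 a b; rfl
  rw [e, coord_map_Dx, coord_map_Dx, cst_smul, tau_smul, Matrix.mul_smul, smul_sub, smul_assoc]

theorem Dy_smul (c : ℝ) (X : Mat m) : Dy (c • X) = (c : ℂ) • Dy X := by
  apply derivation_ext_coord
  have e : (coordMat m).map ((c : ℂ) • Dy X) = (c : ℂ) • (coordMat m).map (Dy X) := by
    ext1 a b; rfl
  rw [e, coord_map_Dy, coord_map_Dy, cst_smul, tau_smul, Matrix.smul_mul, smul_sub, smul_assoc]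

/-! ### Translations -/

/-- The translation `z ↦ g⁻¹ z g`. -/
def trans {m : ℕ} (g : Mat m) : PolyMat m →ₐ[ℂ] PolyMat m :=
  MvPolynomial.aeval fun ab => (cst g⁻¹ * coordMat m * cst g) ab.1 ab.2

theorem evalMat_trans (g M : Mat m) (P : PolyMat m) :
    evalMat M (trans g P) = evalMat (g⁻¹ * M * g) P := by
  have : (evalMat M).comp (trans g) = evalMat (g⁻¹ * M * g) := by
    apply MvPolynomial.algHom_ext
    rintro ⟨a, b⟩
    simp only [AlgHom.comp_apply, trans, MvPolynomial.aeval_X, evalMat_X]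
    simp [Matrix.mul_apply, cst, coordMat, evalMat_X]
  exact DFunLike.congr_fun this P

theorem coord_map_trans (g : Mat m) :
    (coordMat m).map (trans g) = cst g⁻¹ * coordMat m * cst g := by
  ext1 a b
  simp [trans, coordMat]

theorem cst_map_trans (g X : Mat m) :
    (cst X).map (trans g) = cst X := by
  ext1 a b
  simp [cst, trans]

theorem trans_tau (g X : Mat m) :
    trans g (tau X) = tau (g * X * g⁻¹) := by
  have h : trans g (tau X) = ((coordMat m * cst X).map (trans g)).trace := by
    simp [tau, Matrix.trace, map_sum, -Matrix.map_mul]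
  rw [h, algHom_map_mul, coord_map_trans, cst_map_trans, Matrix.mul_assoc (cst g⁻¹ * coordMat m),
    ← cst_mul, trace_cst_mul_coord]

theorem derivation_trans_ext {g : Mat m}
    {D D' : Derivation ℂ (PolyMat m) (PolyMat m)}
    (h : ((coordMat m).map D).map (trans g) = ((coordMat m).map (trans g)).map D') (P : PolyMat m) :
    trans g (D P) = D' (trans g P) := by
  induction P using MvPolynomial.induction_on with
  | C c => simp [trans]
  | add P Q hP hQ => simp [hP, hQ]
  | mul_X P ab hP =>
    have h1 := congrFun (congrFun h ab.1) ab.2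
    simp only [Matrix.map_apply, coordMat, Matrix.of_apply] at h1
    simp only [Derivation.leibniz, map_mul, map_add, smul_eq_mul, hP]
    rw [h1]

theorem trans_Dx {g : Mat m} (hg : g ∈ orth p m)
    (X : Mat m) (P : PolyMat m) :
    trans g (Dx X P) = Dx (g * X * g⁻¹) (trans g P) := by
  apply derivation_trans_ext
  have e : (coordMat m * cst X - tau X • coordMat m).map (trans g) =
      (coordMat m).map (trans g) * (cst X).map (trans g) -
        trans g (tau X) • (coordMat m).map (trans g) := by
    rw [← algHom_map_mul]; ext1 a b; simp [-Matrix.map_mul]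
  rw [coord_map_Dx, e, cst_map_trans, coord_map_trans, derivation_map_mul_cst,
    derivation_map_cst_mul, coord_map_Dx, trans_tau]
  simp only [Matrix.mul_sub, Matrix.sub_mul, Matrix.mul_assoc, ← cst_mul, Matrix.mul_smul,
    Matrix.smul_mul]
  rw [orth_inv_cancel hg, Matrix.mul_one]

theorem trans_Dy {g : Mat m} (hg : g ∈ orth p m)
    (X : Mat m) (P : PolyMat m) :
    trans g (Dy X P) = Dy (g * X * g⁻¹) (trans g P) := by
  apply derivation_trans_ext
  have e : (tau X • coordMat m - cst X * coordMat m).map (trans g) =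
      trans g (tau X) • (coordMat m).map (trans g) -
      (cst X).map (trans g) * (coordMat m).map (trans g) := by
    rw [← algHom_map_mul]; ext1 a b; simp [-Matrix.map_mul]
  rw [coord_map_Dy, e, cst_map_trans, coord_map_trans, derivation_map_mul_cst,
    derivation_map_cst_mul, coord_map_Dy, trans_tau]
  simp only [Matrix.mul_sub, Matrix.sub_mul, ← Matrix.mul_assoc, ← cst_mul, Matrix.mul_smul,
    Matrix.smul_mul]
  rw [orth_inv_cancel hg, Matrix.one_mul]

/-! ### The exchange of `x` and `y` -/

/-- The exchange of the two rows, `z ↦ I z' I`. -/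
def swap (p : ℕ) {m : ℕ} : PolyMat m →ₐ[ℂ] PolyMat m :=
  MvPolynomial.aeval fun ab => (cst (gram p m) * (coordMat m)ᵀ * cst (gram p m)) ab.1 ab.2

theorem coord_map_swap :
    (coordMat m).map (swap p) = cst (gram p m) * (coordMat m)ᵀ * cst (gram p m) := by
  ext1 a b
  simp [swap, coordMat]

theorem cst_map_swap (X : Mat m) :
    (cst X).map (swap p) = cst X := by
  ext1 a b
  simp [cst, swap]

theorem cst_transpose (X : Mat m) : (cst X)ᵀ = cst Xᵀ := rfl

theorem evalMat_swap {x y : Row m} (P : PolyMat m) :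
    evalMat (proj p x y) (swap p P) = evalMat (proj p y x) P := by
  have : (evalMat (proj p x y)).comp (swap p) = evalMat (proj p y x) := by
    apply MvPolynomial.algHom_ext
    rintro ⟨a, b⟩
    simp only [AlgHom.comp_apply, swap, MvPolynomial.aeval_X, evalMat_X]
    have : (gram p m * (proj p x y)ᵀ * gram p m) a b = proj p y x a b := by
      simp only [gram, mul_diagonal, diagonal_mul, transpose_apply, proj_apply, form_comm x y]
      have := lam_mul_self (p := p) b
      linear_combination (lam p a * (form p y x)⁻¹ * y b * x a) * this
    rw [← this]
    simp [Matrix.mul_apply, cst, coordMat, evalMat_X]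
  exact DFunLike.congr_fun this P

theorem swap_tau {X : Mat m} (hX : X ∈ lieAlg p m) :
    swap p (tau X) = -tau X := by
  have h : swap p (tau X) = ((coordMat m * cst X).map (swap p)).trace := by
    simp [tau, Matrix.trace, map_sum, -Matrix.map_mul]
  rw [mem_lieAlg] at hX
  have h2 : gram p m * X * gram p m = -Xᵀ := by
    have := congrArg (fun M => gram p m * M) hX
    simp only [← Matrix.mul_assoc, gram_mul_gram, Matrix.one_mul, Matrix.mul_neg] at this
    rw [this, neg_neg]
  rw [h, algHom_map_mul, coord_map_swap, cst_map_swap, Matrix.mul_assoc, Matrix.mul_assoc,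
    Matrix.trace_mul_comm, Matrix.mul_assoc, ← cst_mul, ← cst_mul, h2, tau, ← Matrix.trace_transpose,
    transpose_mul, transpose_transpose, Matrix.trace_mul_comm, cst_transpose]
  have : cst (-Xᵀ)ᵀ = - cst X := by ext1 a b; simp [cst]
  rw [this, Matrix.mul_neg, trace_neg]

theorem swap_Dx {X : Mat m} (hX : X ∈ lieAlg p m) (P : PolyMat m) :
    swap p (Dx X P) = Dy X (swap p P) := by
  have key : ((coordMat m).map (Dx X)).map (swap p) = ((coordMat m).map (swap p)).map (Dy X) := by
    have e : (coordMat m * cst X - tau X • coordMat m).map (swap p) =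
      (coordMat m).map (swap p) * (cst X).map (swap p) -
        swap p (tau X) • (coordMat m).map (swap p) := by
      rw [← algHom_map_mul]; ext1 a b; simp [-Matrix.map_mul]
    have e2 : ((coordMat m)ᵀ).map (Dy X) = ((coordMat m).map (Dy X))ᵀ := rfl
    rw [coord_map_Dx, e, cst_map_swap, coord_map_swap, derivation_map_mul_cst,
      derivation_map_cst_mul, e2, coord_map_Dy, swap_tau hX, transpose_sub, transpose_smul,
      transpose_mul, cst_transpose]
    rw [mem_lieAlg] at hX
    have h2 : gram p m * X = -(Xᵀ * gram p m) := by
      have := congrArg (fun M => gram p m * M * gram p m) hX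
      simp only [← Matrix.mul_assoc, gram_mul_gram, Matrix.one_mul, Matrix.mul_neg, Matrix.neg_mul] at this
      rw [this, Matrix.mul_assoc _ (gram p m), gram_mul_gram, Matrix.mul_one, neg_neg]
    have h3 : cst (gram p m * X) = -cst (Xᵀ * gram p m) := by
      rw [h2]; ext1 a b; simp [cst]
    simp only [Matrix.mul_sub, Matrix.sub_mul, Matrix.mul_assoc, ← cst_mul, Matrix.mul_smul,
      Matrix.smul_mul, h3, Matrix.mul_neg, neg_smul]
    abel
  induction P using MvPolynomial.induction_on with
  | C c => simp [swap]
  | add P Q hP hQ => simp [hP, hQ]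
  | mul_X P ab hP =>
    have h1 := congrFun (congrFun key ab.1) ab.2
    simp only [Matrix.map_apply, coordMat, Matrix.of_apply] at h1
    simp only [Derivation.leibniz, map_mul, map_add, smul_eq_mul, hP]
    rw [h1]

theorem swap_Lop {X : Mat m} (hX : X ∈ lieAlg p m) (σ : ℂ)
    (P : PolyMat m) : swap p (Lop σ X P) = Rop σ X (swap p P) := by
  rw [Lop_apply, Rop_apply, map_add, map_smul, map_mul, swap_Dx hX, swap_tau hX]
  simp [sub_eq_add_neg]

end Commutators

section OnOmega

variable {p m : ℕ}

/-- A linear right inverse of the restriction to `Ω`. -/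
def lift (p m : ℕ) : polyOmega p m →ₗ[ℂ] PolyMat m :=
  ((toPoly p m).toLinearMap.exists_rightInverse_of_surjective
    (LinearMap.range_eq_top.2 toPoly_surjective)).choose

theorem toPoly_lift (F : polyOmega p m) : toPoly p m (lift p m F) = F :=
  DFunLike.congr_fun ((toPoly p m).toLinearMap.exists_rightInverse_of_surjective
    (LinearMap.range_eq_top.2 toPoly_surjective)).choose_spec F

/-- The operator on `S(G/H)` induced by an operator on polynomials. -/
def desc (p : ℕ) {m : ℕ} (T : PolyMat m →ₗ[ℂ] PolyMat m) : polyOmega p m →ₗ[ℂ] polyOmega p m :=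
  (toPoly p m).toLinearMap ∘ₗ T ∘ₗ lift p m

theorem desc_toPoly {T : PolyMat m →ₗ[ℂ] PolyMat m}
    (hT : ∀ P, toPoly p m P = 0 → toPoly p m (T P) = 0) (P : PolyMat m) :
    desc p T (toPoly p m P) = toPoly p m (T P) := by
  have h : toPoly p m (T (lift p m (toPoly p m P) - P)) = 0 :=
    hT _ (by rw [map_sub, toPoly_lift, sub_self])
  rw [map_sub, map_sub, sub_eq_zero] at h
  exact h

theorem toPoly_Lop (hp : 2 ≤ p) (hm : p ≤ m) {X : Mat m}
    (hX : X ∈ lieAlg p m) (σ : ℂ) (P : PolyMat m) (hP : toPoly p m P = 0) :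
    toPoly p m (Lop σ X P) = 0 := by
  rw [Lop_apply, map_add, map_smul, map_mul, hP, toPoly_Dx hp hm hX hP]; simp

theorem toPoly_Rop (hp : 2 ≤ p) (hm : p ≤ m) {X : Mat m}
    (hX : X ∈ lieAlg p m) (σ : ℂ) (P : PolyMat m) (hP : toPoly p m P = 0) :
    toPoly p m (Rop σ X P) = 0 := by
  rw [Rop_apply, map_sub, map_smul, map_mul, hP, toPoly_Dy hp hm hX hP]; simp

theorem toPoly_adD (hp : 2 ≤ p) (hm : p ≤ m) {X : Mat m}
    (hX : X ∈ lieAlg p m) (P : PolyMat m) (hP : toPoly p m P = 0) :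
    toPoly p m (adD X P) = 0 := by
  rw [adD, Derivation.add_apply, map_add, toPoly_Dx hp hm hX hP, toPoly_Dy hp hm hX hP, add_zero]

theorem toPoly_trans (hp : 2 ≤ p) (hm : p ≤ m) {g : Mat m}
    (hg : g ∈ orth p m) (P : PolyMat m) (hP : toPoly p m P = 0) :
    toPoly p m (trans g P) = 0 := by
  rw [toPoly_eq_zero_iff] at hP ⊢
  intro z hz
  rw [evalMat_trans]
  exact hP _ (conj_orth_mem_Omega hp hm hg hz)

theorem toPoly_swap (hp : 2 ≤ p) (hm : p ≤ m) (P : PolyMat m) (hP : toPoly p m P = 0) :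
    toPoly p m (swap p P) = 0 := by
  rw [toPoly_eq_zero_iff] at hP ⊢
  intro z hz
  obtain ⟨x, y, hx, hy, hxy, rfl⟩ := exists_null_of_mem hp hm hz
  rw [evalMat_swap]
  exact hP _ (proj_mem_Omega hp hm hy hx (by rw [form_comm, hxy]; norm_num))

/-- The operator `Φ⁻¹ (X ⊗ 1) Φ` on `S(G/H)`. -/
def LS (p : ℕ) {m : ℕ} (σ : ℂ) (X : Mat m) :
    Module.End ℂ (polyOmega p m) := desc p (Lop σ X)

/-- The operator `Φ⁻¹ (1 ⊗ X) Φ` on `S(G/H)`. -/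
def RS (p : ℕ) {m : ℕ} (σ : ℂ) (X : Mat m) :
    Module.End ℂ (polyOmega p m) := desc p (Rop σ X)

/-- The action of `X` by vector fields on `S(G/H)`. -/
def adS (p : ℕ) {m : ℕ} (X : Mat m) :
    Module.End ℂ (polyOmega p m) := desc p (adD X).toLinearMap

/-- The action of `g` by translations on `S(G/H)`. -/
def transS (p : ℕ) {m : ℕ} (g : Mat m) :
    Module.End ℂ (polyOmega p m) := desc p (trans g).toLinearMap

/-- The exchange of `x` and `y` on `S(G/H)`. -/
def swapS (p m : ℕ) : Module.End ℂ (polyOmega p m) := desc p (swap p (m := m)).toLinearMap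

theorem LS_toPoly (hp : 2 ≤ p) (hm : p ≤ m) {X : Mat m}
    (hX : X ∈ lieAlg p m) (σ : ℂ) (P : PolyMat m) :
    LS p σ X (toPoly p m P) = toPoly p m (Lop σ X P) := desc_toPoly (toPoly_Lop hp hm hX σ) P

theorem RS_toPoly (hp : 2 ≤ p) (hm : p ≤ m) {X : Mat m}
    (hX : X ∈ lieAlg p m) (σ : ℂ) (P : PolyMat m) :
    RS p σ X (toPoly p m P) = toPoly p m (Rop σ X P) := desc_toPoly (toPoly_Rop hp hm hX σ) P

theorem adS_toPoly (hp : 2 ≤ p) (hm : p ≤ m) {X : Mat m}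
    (hX : X ∈ lieAlg p m) (P : PolyMat m) :
    adS p X (toPoly p m P) = toPoly p m (adD X P) :=
  desc_toPoly (T := (adD X).toLinearMap) (toPoly_adD hp hm hX) P

theorem transS_toPoly (hp : 2 ≤ p) (hm : p ≤ m) {g : Mat m}
    (hg : g ∈ orth p m) (P : PolyMat m) :
    transS p g (toPoly p m P) = toPoly p m (trans g P) :=
  desc_toPoly (T := (trans g).toLinearMap) (toPoly_trans hp hm hg) P

theorem swapS_toPoly (hp : 2 ≤ p) (hm : p ≤ m) (P : PolyMat m) :
    swapS p m (toPoly p m P) = toPoly p m (swap p P) :=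
  desc_toPoly (T := (swap p).toLinearMap) (toPoly_swap hp hm) P

theorem transS_apply (hp : 2 ≤ p) (hm : p ≤ m) {g : Mat m}
    (hg : g ∈ orth p m) (F : polyOmega p m) (z : Omega p m) :
    (transS p g F).1 z = F.1 ⟨g⁻¹ * z.1 * g, conj_orth_mem_Omega hp hm hg z.2⟩ := by
  obtain ⟨P, rfl⟩ := toPoly_surjective F
  rw [transS_toPoly hp hm hg, toPoly_apply, toPoly_apply, evalMat_trans]

theorem LS_comm_RS (hp : 2 ≤ p) (hm : p ≤ m) {X Y : Mat m}
    (hX : X ∈ lieAlg p m) (hY : Y ∈ lieAlg p m) (σ : ℂ) : Commute (LS p σ X) (RS p σ Y) := by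
  refine LinearMap.ext fun F => ?_
  obtain ⟨P, rfl⟩ := toPoly_surjective F
  simp only [Module.End.mul_apply, LS_toPoly hp hm hX, RS_toPoly hp hm hY, Lop_comm_Rop]

theorem swapS_LS (hp : 2 ≤ p) (hm : p ≤ m) {X : Mat m}
    (hX : X ∈ lieAlg p m) (σ : ℂ) (F : polyOmega p m) :
    swapS p m (LS p σ X F) = RS p σ X (swapS p m F) := by
  obtain ⟨P, rfl⟩ := toPoly_surjective F
  simp only [swapS_toPoly hp hm, LS_toPoly hp hm hX, RS_toPoly hp hm hX, swap_Lop hX]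

theorem swapS_swapS (hp : 2 ≤ p) (hm : p ≤ m) (F : polyOmega p m) :
    swapS p m (swapS p m F) = F := by
  obtain ⟨P, rfl⟩ := toPoly_surjective F
  refine polyOmega_ext fun z => ?_
  obtain ⟨x, y, hx, hy, hxy, h⟩ := exists_null_of_mem hp hm z.2
  rw [swapS_toPoly hp hm, swapS_toPoly hp hm, toPoly_apply, toPoly_apply, h, evalMat_swap,
    evalMat_swap]

/-- The operator of a word. -/
def LSw (p : ℕ) {m : ℕ} (σ : ℂ) (w : List (lieAlg p m)) : Module.End ℂ (polyOmega p m) :=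
  (w.map fun X => LS p σ X.1).prod

/-- The operator of a word, in the second variable. -/
def RSw (p : ℕ) {m : ℕ} (σ : ℂ) (w : List (lieAlg p m)) : Module.End ℂ (polyOmega p m) :=
  (w.map fun X => RS p σ X.1).prod

theorem toPoly_covPoly (hp : 2 ≤ p) (hm : p ≤ m) (σ : ℂ) (w : List (lieAlg p m)) :
    toPoly p m (covPoly σ w) = LSw p σ w 1 := by
  induction w with
  | nil => simp [covPoly, LSw]
  | cons X w ih =>
    have : covPoly σ (X :: w) = Lop σ X.1 (covPoly σ w) := rfl
    rw [this, ← LS_toPoly hp hm X.2, ih]; simp [LSw]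

theorem toPoly_contraPoly (hp : 2 ≤ p) (hm : p ≤ m) (σ : ℂ) (w : List (lieAlg p m)) :
    toPoly p m (contraPoly σ w) = RSw p σ w 1 := by
  induction w with
  | nil => simp [contraPoly, RSw]
  | cons X w ih =>
    have : contraPoly σ (X :: w) = Rop σ X.1 (contraPoly σ w) := rfl
    rw [this, ← RS_toPoly hp hm X.2, ih]; simp [RSw]

theorem swapS_one (hp : 2 ≤ p) (hm : p ≤ m) : swapS p m 1 = 1 := by
  rw [← map_one (toPoly p m), swapS_toPoly hp hm, map_one]

theorem swapS_LSw (hp : 2 ≤ p) (hm : p ≤ m) (σ : ℂ) (w : List (lieAlg p m)) (F : polyOmega p m) :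
    swapS p m (LSw p σ w F) = RSw p σ w (swapS p m F) := by
  induction w with
  | nil => simp [RSw, LSw]
  | cons X w ih =>
    simp only [LSw, RSw, List.map_cons, List.prod_cons, Module.End.mul_apply] at ih ⊢
    rw [swapS_LS hp hm X.2, ih]

theorem LSw_comm_RSw (hp : 2 ≤ p) (hm : p ≤ m) (σ : ℂ) (v w : List (lieAlg p m)) :
    Commute (LSw p σ v) (RSw p σ w) := by
  refine Commute.list_prod_left _ _ fun a ha => Commute.list_prod_right _ _ fun b hb => ?_
  obtain ⟨X, -, rfl⟩ := List.mem_map.1 ha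
  obtain ⟨Y, -, rfl⟩ := List.mem_map.1 hb
  exact LS_comm_RS hp hm X.2 Y.2 σ

/-! ### The functions `Z(γ, δ) = [x, γ] [y, δ] / [x, y]` -/

/-- The linear function `[x, γ] [y, δ] / [x, y]`. -/
def Zp (p : ℕ) {m : ℕ} (γ δ : Row m) : PolyMat m :=
  tau (vecMulVec (gram p m *ᵥ γ) δ)

theorem evalMat_Zp (x y γ δ : Row m) : evalMat (proj p x y) (Zp p γ δ) =
    (((form p x y)⁻¹ * (form p x γ * form p y δ) : ℝ) : ℂ) := by
  rw [Zp, evalMat_tau, trace_proj_mul, vecMul_vecMulVec, form_smul_left, form_eq_dotProduct x γ,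
    form_comm δ y]

theorem evalMat_tau_wedge (x y γ δ : Row m) :
    evalMat (proj p x y) (tau (wedge p γ δ)) =
    (((form p x y)⁻¹ * (form p x γ * form p y δ - form p x δ * form p y γ) : ℝ) : ℂ) := by
  rw [evalMat_tau, trace_proj_mul, vecMul_wedge, form_sub_left, form_smul_left, form_smul_left,
    form_comm δ y, form_comm γ y]

theorem tau_wedge (γ δ : Row m) : tau (wedge p γ δ) = Zp p γ δ - Zp p δ γ := tau_sub _ _

theorem skew_mul_gram {X : Mat m} (hX : X ∈ lieAlg p m)
    (γ : Row m) : X *ᵥ (gram p m *ᵥ γ) = -(gram p m *ᵥ (γ ᵥ* X)) := by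
  rw [mem_lieAlg] at hX
  rw [← mulVec_transpose, mulVec_mulVec, mulVec_mulVec, hX, neg_mulVec, neg_neg]

theorem Dx_Zp {X : Mat m} (hX : X ∈ lieAlg p m)
    (γ δ : Row m) : Dx X (Zp p γ δ) = -Zp p (γ ᵥ* X) δ - tau X * Zp p γ δ := by
  rw [Zp, Dx_tau, mul_vecMulVec, skew_mul_gram hX, neg_vecMulVec, ← neg_one_smul ℝ, tau_smul]
  simp [Zp]

theorem Dy_Zp (X : Mat m)
    (γ δ : Row m) : Dy X (Zp p γ δ) = tau X * Zp p γ δ - Zp p γ (δ ᵥ* X) := by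
  rw [Zp, Dy_tau, vecMulVec_mul, Zp]

theorem trans_Zp {g : Mat m} (hg : g ∈ orth p m)
    (γ δ : Row m) : trans g (Zp p γ δ) = Zp p (γ ᵥ* g⁻¹) (δ ᵥ* g⁻¹) := by
  have h : g *ᵥ (gram p m *ᵥ γ) = gram p m *ᵥ (γ ᵥ* g⁻¹) := by
    rw [← mulVec_transpose, orth_inv_eq hg]
    simp only [transpose_mul, transpose_transpose, gram_transpose, mulVec_mulVec,
      ← Matrix.mul_assoc, gram_mul_gram, Matrix.one_mul]
  rw [Zp, trans_tau, mul_vecMulVec, vecMulVec_mul, h, Zp]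

theorem trans_tau_wedge {g : Mat m} (hg : g ∈ orth p m)
    (γ δ : Row m) :
    trans g (tau (wedge p γ δ)) = tau (wedge p (γ ᵥ* g⁻¹) (δ ᵥ* g⁻¹)) := by
  rw [tau_wedge, tau_wedge, map_sub, trans_Zp hg, trans_Zp hg]

/-- The function `W₁ⁱ W₂ʲ` of the pair `α, β`. -/
def Epoly (p : ℕ) {m : ℕ} (α β : Row m) (i j : ℕ) : PolyMat m :=
  tau (wedge p α β) ^ i * Zp p α α ^ j

/-- `α, β` span a totally isotropic subspace. -/
structure IsoPair (p : ℕ) {m : ℕ} (α β : Row m) : Prop where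
  aa : form p α α = 0
  ab : form p α β = 0
  bb : form p β β = 0

theorem IsoPair.vecMul {α β : Row m} (h : IsoPair p α β)
    {g : Mat m} (hg : g ∈ orth p m) :
    IsoPair p (α ᵥ* g) (β ᵥ* g) :=
  ⟨by rw [form_vecMul_vecMul hg, h.aa], by rw [form_vecMul_vecMul hg, h.ab],
    by rw [form_vecMul_vecMul hg, h.bb]⟩

theorem trans_Epoly {g : Mat m} (hg : g ∈ orth p m)
    (α β : Row m) (i j : ℕ) :
    trans g (Epoly p α β i j) = Epoly p (α ᵥ* g⁻¹) (β ᵥ* g⁻¹) i j := by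
  rw [Epoly, map_mul, map_pow, map_pow, trans_Zp hg, trans_tau_wedge hg, Epoly]

theorem wedge_mul_wedge {α β : Row m} (h : IsoPair p α β) :
    wedge p α β * wedge p α β = 0 := by
  refine Matrix.ext_of_single_vecMul fun i => ?_
  rw [← vecMul_vecMul, vecMul_wedge, vecMul_wedge]
  simp only [form_sub_left, form_smul_left, form_comm β α, h.aa, h.ab, h.bb]
  simp

theorem Lop_wedge_Epoly {α β : Row m} (h : IsoPair p α β) (σ : ℂ) (i j : ℕ) :
    Lop σ (wedge p α β) (Epoly p α β i j) = (σ - i - j) • Epoly p α β (i + 1) j := by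
  have h1 : Dx (wedge p α β) (tau (wedge p α β)) = -tau (wedge p α β) ^ 2 := by
    rw [Dx_tau, wedge_mul_wedge h]
    simp [tau, cst, sq]
  have h2 : Dx (wedge p α β) (Zp p α α) = -(tau (wedge p α β) * Zp p α α) := by
    rw [Dx_Zp (wedge_mem α β), vecMul_wedge, h.aa, h.ab]
    simp [Zp, tau, cst]
  rw [Lop_apply, Epoly, Derivation.leibniz, Derivation.leibniz_pow, Derivation.leibniz_pow, h1, h2,
    Epoly]
  simp only [smul_eq_mul, nsmul_eq_mul, MvPolynomial.smul_eq_C_mul, map_sub, map_natCast]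
  rcases i with _ | i <;> rcases j with _ | j <;> simp <;> ring

/-- The standard basis. -/
abbrev bas {m : ℕ} (i : Fin (m + 2)) : Row m := Pi.single i 1

theorem form_bas_right (x : Row m) (i : Fin (m + 2)) :
    form p x (bas i) = lam p i * x i := form_single_right x i

theorem sum_lam_form_smul (x : Row m) :
    ∑ i, (lam p i * form p x (bas i)) • (bas i : Row m) = x := by
  ext k
  simp only [form_bas_right, ← mul_assoc, lam_mul_self, one_mul, Finset.sum_apply, Pi.smul_apply,
    smul_eq_mul, Pi.single_apply, mul_ite, mul_one, mul_zero]
  simp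

theorem sum_lam_wedge_sq {α : Row m} (h : form p α α = 0) :
    ∑ i, lam p i • (wedge p α (bas i) * wedge p α (bas i)) =
      (-(m : ℝ)) • vecMulVec (gram p m *ᵥ α) α := by
  refine Matrix.ext_of_single_vecMul fun k => ?_
  set x : Row m := Pi.single k 1
  rw [vecMul_smul, vecMul_vecMulVec, ← form_eq_dotProduct, Matrix.vecMul_sum]
  have e : ∀ i : Fin (m + 2), x ᵥ* (lam p i • (wedge p α (bas i) * wedge p α (bas i))) =
      form p x α • ((lam p i * form p α (bas i)) • (bas i : Row m)) - form p x α • α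
        + (lam p i * form p x (bas i) * form p α (bas i)) • α := by
    intro i
    have h1 : form p (bas i) (bas i) = lam p i := by rw [form_bas_right]; simp [bas]
    have h2 := lam_mul_self (p := p) i
    rw [vecMul_smul, ← vecMul_vecMul, vecMul_wedge, vecMul_wedge]
    simp only [form_sub_left, form_smul_left, h, h1, form_comm (bas i) α]
    ext l
    simp only [Pi.add_apply, Pi.sub_apply, Pi.smul_apply, smul_eq_mul]
    linear_combination (-form p x α * α l) * h2
  rw [Finset.sum_congr rfl fun i _ => e i, Finset.sum_add_distrib, Finset.sum_sub_distrib,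
    ← Finset.smul_sum, sum_lam_form_smul, ← Finset.sum_smul, ← Finset.sum_smul]
  have h3 : ∑ i, lam p i * form p x (bas i) * form p α (bas i) = form p x α := by
    simp only [form_bas_right, ← mul_assoc, lam_mul_self, one_mul]
    simp only [form]
    exact Finset.sum_congr rfl fun i _ => by ring
  rw [h3]
  ext l
  simp
  ring

theorem evalMat_sum_tau_sq {x y α : Row m} (hx : form p x x = 0) (hy : form p y y = 0)
    (hxy : form p x y ≠ 0) :
    evalMat (proj p x y) (∑ i, (lam p i : ℂ) • tau (wedge p α (bas i)) ^ 2) =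
      -2 * evalMat (proj p x y) (Zp p α α) := by
  simp only [map_sum, map_smul, map_pow, evalMat_tau_wedge, evalMat_Zp, smul_eq_mul]
  norm_cast
  have : ∀ i : Fin (m + 2), lam p i * ((form p x y)⁻¹ * (form p x α * form p y (bas i) -
      form p x (bas i) * form p y α)) ^ 2 = (form p x y)⁻¹ ^ 2 *
      (form p x α ^ 2 * (lam p i * y i * y i) - 2 * form p x α * form p y α * (lam p i * x i * y i)
        + form p y α ^ 2 * (lam p i * x i * x i)) := by
    intro i
    rw [form_bas_right, form_bas_right]
    have h2 := lam_mul_self (p := p) i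
    linear_combination (lam p i * (form p x y)⁻¹ ^ 2 * (form p x α * y i - x i * form p y α) ^ 2) * h2
  rw [Finset.sum_congr rfl fun i _ => this i, ← Finset.mul_sum, Finset.sum_add_distrib,
    Finset.sum_sub_distrib, ← Finset.mul_sum, ← Finset.mul_sum, ← Finset.mul_sum]
  change _ * (_ * form p y y - _ * form p x y + _ * form p x x) = _
  rw [hx, hy]
  push_cast
  field_simp
  ring

theorem Lop_wedge_bas {α : Row m} (h : form p α α = 0) (σ : ℂ) (j : ℕ) (i : Fin (m + 2)) :
    Lop σ (wedge p α (bas i)) (Lop σ (wedge p α (bas i)) (Zp p α α ^ j)) =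
      ((σ - j) • (tau (wedge p α (bas i) * wedge p α (bas i)) - tau (wedge p α (bas i)) ^ 2) +
        (((j : ℂ) * (form p α (bas i) : ℂ)) • 1 + (σ - j) • tau (wedge p α (bas i))) ^ 2) *
        Zp p α α ^ j := by
  have h2 : Dx (wedge p α (bas i)) (Zp p α α) =
      MvPolynomial.C (form p α (bas i) : ℂ) * Zp p α α - tau (wedge p α (bas i)) * Zp p α α := by
    rw [Dx_Zp (wedge_mem _ _), vecMul_wedge, h, zero_smul, zero_sub, Zp, Zp, mulVec_neg, mulVec_smul,
      neg_vecMulVec, smul_vecMulVec, ← neg_smul, tau_smul, MvPolynomial.smul_eq_C_mul]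
    simp
  have h1 := Dx_tau (wedge p α (bas i)) (wedge p α (bas i))
  have h3 : Lop σ (wedge p α (bas i)) (Zp p α α ^ j) =
      (((j : ℂ) * (form p α (bas i) : ℂ)) • 1 + (σ - j) • tau (wedge p α (bas i))) * Zp p α α ^ j := by
    rw [Lop_apply, Derivation.leibniz_pow, h2]
    simp only [smul_eq_mul, nsmul_eq_mul, MvPolynomial.smul_eq_C_mul, map_sub, map_natCast, map_mul]
    rcases j with _ | j <;> simp <;> ring
  rw [h3, Lop_apply, Derivation.leibniz]
  have h4 : Dx (wedge p α (bas i)) (Zp p α α ^ j) = (j : PolyMat m) * (MvPolynomial.C (form p α (bas i) : ℂ) -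
      tau (wedge p α (bas i))) * Zp p α α ^ j := by
    rw [Derivation.leibniz_pow, h2]
    simp only [smul_eq_mul, nsmul_eq_mul]
    rcases j with _ | j <;> simp <;> ring
  rw [h4]
  simp only [map_add, Derivation.map_smul, h1, Derivation.map_one_eq_zero]
  simp only [smul_eq_mul, MvPolynomial.smul_eq_C_mul, map_sub, map_natCast, map_mul]
  ring

/-- The function `W₁ⁱ W₂ʲ` of the pair `α, β` on `Ω`. -/
def EOm (p : ℕ) {m : ℕ} (α β : Row m) (i j : ℕ) : polyOmega p m :=
  toPoly p m (Epoly p α β i j)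

theorem LS_wedge_EOm (hp : 2 ≤ p) (hm : p ≤ m) {α β : Row m} (h : IsoPair p α β)
    (σ : ℂ) (i j : ℕ) :
    LS p σ (wedge p α β) (EOm p α β i j) = (σ - i - j) • EOm p α β (i + 1) j := by
  rw [EOm, LS_toPoly hp hm (wedge_mem _ _), Lop_wedge_Epoly h, map_smul, EOm]

theorem sum_LS_wedge (hp : 2 ≤ p) (hm : p ≤ m) {α β : Row m} (h : IsoPair p α β)
    (σ : ℂ) (j : ℕ) :
    ∑ i, (lam p i : ℂ) • LS p σ (wedge p α (bas i)) (LS p σ (wedge p α (bas i)) (EOm p α β 0 j)) =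
      (-2 * (σ - j) * (σ + m / 2 - 1 - j)) • EOm p α β 0 (j + 1) := by
  simp only [EOm, LS_toPoly hp hm (wedge_mem _ _), ← map_smul, ← map_sum]
  refine polyOmega_ext fun z => ?_
  obtain ⟨x, y, hx, hy, hxy, hz⟩ := exists_null_of_mem hp hm z.2
  have hne : form p x y ≠ 0 := by rw [hxy]; norm_num
  rw [toPoly_apply, toPoly_apply, hz]
  simp only [Epoly, pow_zero, one_mul, map_smul]
  rw [Finset.sum_congr rfl fun i _ => congrArg ((lam p i : ℂ) • ·) (Lop_wedge_bas h.aa σ j i)]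
  have e1 : (∑ i, (lam p i : ℂ) • tau (wedge p α (bas i) * wedge p α (bas i))) =
      (-(m : ℂ)) • Zp p α α := by
    have := congrArg tau (sum_lam_wedge_sq (p := p) h.aa)
    rw [tau_smul] at this
    have hs : ∀ s : Finset (Fin (m + 2)), tau (∑ i ∈ s, lam p i • (wedge p α (bas i) * wedge p α (bas i)))
        = ∑ i ∈ s, (lam p i : ℂ) • tau (wedge p α (bas i) * wedge p α (bas i)) := by
      intro s
      induction s using Finset.induction_on with
      | empty => simp [tau, cst]
      | insert a s ha ih => rw [Finset.sum_insert ha, Finset.sum_insert ha, tau_add, tau_smul, ih]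
    rw [hs] at this
    rw [this, Zp]; push_cast; rfl
  have e2 := evalMat_sum_tau_sq (α := α) hx hy hne
  have e3 : ∑ i, (lam p i * form p α (bas i) : ℝ) • evalMat (proj p x y) (tau (wedge p α (bas i))) = 0 := by
    simp only [evalMat_tau_wedge, form_bas_right, ← mul_assoc, lam_mul_self, one_mul,
      Complex.real_smul]
    norm_cast
    have : ∀ i : Fin (m + 2), α i * ((form p x y)⁻¹ * (form p x α * lam p i * y i -
        lam p i * x i * form p y α)) =
        (form p x y)⁻¹ * (form p x α * (lam p i * α i * y i) - form p y α * (lam p i * α i * x i)) :=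
      fun i => by ring
    rw [Finset.sum_congr rfl fun i _ => this i, ← Finset.mul_sum, Finset.sum_sub_distrib,
      ← Finset.mul_sum, ← Finset.mul_sum]
    change _ * (_ * form p α y - _ * form p α x) = (0 : ℝ)
    rw [form_comm α y, form_comm α x]; ring
  have e4 : ∑ i, lam p i * form p α (bas i) ^ 2 = 0 := by
    rw [← h.aa, form]
    refine Finset.sum_congr rfl fun i _ => ?_
    rw [form_bas_right]
    linear_combination (lam p i * α i ^ 2) * lam_mul_self (p := p) i
  have e1' := congrArg (evalMat (proj p x y)) e1
  simp only [map_sum, map_smul, map_mul, map_add, map_sub, map_pow, map_one, smul_eq_mul] at *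
  have e4' : ∑ i, (lam p i : ℂ) * (form p α (bas i) : ℂ) ^ 2 = 0 := by exact_mod_cast e4
  simp only [Complex.real_smul, Complex.ofReal_mul] at e3
  set Wv := evalMat (proj p x y) (Zp p α α)
  have e5 : ∀ i : Fin (m + 2), (lam p i : ℂ) * (((σ - j) *
      (evalMat (proj p x y) (tau (wedge p α (bas i) * wedge p α (bas i))) -
        evalMat (proj p x y) (tau (wedge p α (bas i))) ^ 2) +
      (j * (form p α (bas i) : ℂ) * 1 + (σ - j) * evalMat (proj p x y) (tau (wedge p α (bas i)))) ^ 2)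
        * Wv ^ j) =
      (σ - j) * Wv ^ j * ((lam p i : ℂ) * evalMat (proj p x y) (tau (wedge p α (bas i) * wedge p α (bas i))))
      + ((σ - j) ^ 2 - (σ - j)) * Wv ^ j *
        ((lam p i : ℂ) * evalMat (proj p x y) (tau (wedge p α (bas i))) ^ 2)
      + j ^ 2 * Wv ^ j * ((lam p i : ℂ) * (form p α (bas i) : ℂ) ^ 2)
      + 2 * j * (σ - j) * Wv ^ j * ((lam p i : ℂ) * (form p α (bas i) : ℂ) *
        evalMat (proj p x y) (tau (wedge p α (bas i)))) := fun i => by ring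
  rw [Finset.sum_congr rfl fun i _ => e5 i]
  simp only [Finset.sum_add_distrib, ← Finset.mul_sum]
  rw [e1', e2, e3, e4']
  ring

end OnOmega

section Star

variable {p m : ℕ}

/-- `σ` is generic, in terms of `m = n - 2`. -/
def Gen (m : ℕ) (σ : ℂ) : Prop := ∀ k : ℤ, σ ≠ k ∧ σ + m / 2 ≠ k

theorem Gen.sub_ne_zero {σ : ℂ} (h : Gen m σ) (k : ℤ) : σ - k ≠ 0 := _root_.sub_ne_zero.2 (h k).1

theorem Gen.add_sub_ne_zero {σ : ℂ} (h : Gen m σ) (k : ℤ) : σ + m / 2 - k ≠ 0 :=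
  _root_.sub_ne_zero.2 (h k).2

theorem Gen.dual {σ : ℂ} (h : Gen m σ) : Gen m (-(m : ℂ) - σ) := by
  intro k
  constructor
  · intro hk
    refine (h (-(m : ℤ) - k)).1 ?_
    push_cast; linear_combination -hk
  · intro hk
    refine (h (-k)).2 ?_
    push_cast; linear_combination -hk

theorem Generic.gen {n σ : ℂ} (hn : n = m + 2) (h : Generic n σ) : Gen m σ := by
  intro k
  refine ⟨(h k).1, fun hk => (h (k + 1)).2 ?_⟩
  push_cast; rw [hn]; linear_combination hk

/-- The quadratic operator that raises the power of `W₂`. -/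
def LW (p : ℕ) {m : ℕ} (σ : ℂ) (α : Row m) : Module.End ℂ (polyOmega p m) :=
  ∑ i, (lam p i : ℂ) • (LS p σ (wedge p α (bas i)) * LS p σ (wedge p α (bas i)))

/-- The factor by which a word in the raising operators differs from `W₁ⁱ W₂ʲ`. -/
def raiseCoeff (m : ℕ) (σ : ℂ) (i j : ℕ) : ℂ :=
  (∏ r ∈ Finset.range i, (σ - r - j)) *
    ∏ r ∈ Finset.range j, (-2 * (σ - r) * (σ + m / 2 - 1 - r))

theorem raiseCoeff_ne_zero {σ : ℂ} (h : Gen m σ) (i j : ℕ) : raiseCoeff m σ i j ≠ 0 := by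
  refine mul_ne_zero (Finset.prod_ne_zero_iff.2 fun r _ => ?_)
    (Finset.prod_ne_zero_iff.2 fun r _ => mul_ne_zero (mul_ne_zero (by norm_num) ?_) ?_)
  · have := h.sub_ne_zero (r + j); push_cast at this
    rwa [sub_sub]
  · simpa using h.sub_ne_zero r
  · have := h.add_sub_ne_zero (1 + r); push_cast at this
    rwa [sub_sub]

theorem EOm_zero_zero (α β : Row m) : EOm p α β 0 0 = 1 := by
  simp [EOm, Epoly]

theorem LW_pow_one (hp : 2 ≤ p) (hm : p ≤ m) {α β : Row m} (h : IsoPair p α β)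
    (σ : ℂ) (i j : ℕ) : (LS p σ (wedge p α β) ^ i * LW p σ α ^ j) 1 =
      raiseCoeff m σ i j • EOm p α β i j := by
  have h1 : ∀ j, (LW p σ α ^ j) 1 =
      (∏ r ∈ Finset.range j, (-2 * (σ - r) * (σ + m / 2 - 1 - r))) • EOm p α β 0 j := by
    intro j
    induction j with
    | zero => simp [EOm_zero_zero]
    | succ j ih =>
      rw [pow_succ', Module.End.mul_apply, ih, map_smul, Finset.prod_range_succ, mul_smul,
        ← sum_LS_wedge hp hm h]
      simp [LW, LinearMap.sum_apply]
  rw [Module.End.mul_apply, h1, map_smul, raiseCoeff, mul_comm, mul_smul]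
  congr 1
  induction i with
  | zero => simp
  | succ i ih =>
    rw [pow_succ', Module.End.mul_apply, ih, map_smul, Finset.prod_range_succ, mul_smul,
      LS_wedge_EOm hp hm h]

/-- The algebra generated by the operators `L_X`. -/
def algL (p m : ℕ) (σ : ℂ) : Subalgebra ℂ (Module.End ℂ (polyOmega p m)) :=
  Algebra.adjoin ℂ {T | ∃ X ∈ lieAlg p m, T = LS p σ X}

theorem LS_mem_algL {X : Mat m} (hX : X ∈ lieAlg p m) (σ : ℂ) :
    LS p σ X ∈ algL p m σ := Algebra.subset_adjoin ⟨X, hX, rfl⟩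

theorem LW_mem_algL (σ : ℂ) (α : Row m) : LW p σ α ∈ algL p m σ :=
  Subalgebra.sum_mem _ fun _ _ => Subalgebra.smul_mem _
    (mul_mem (LS_mem_algL (wedge_mem _ _) _) (LS_mem_algL (wedge_mem _ _) _)) _

theorem LSw_mem_algL (σ : ℂ) (w : List (lieAlg p m)) : LSw p σ w ∈ algL p m σ := by
  refine Subalgebra.list_prod_mem _ fun T hT => ?_
  obtain ⟨X, -, rfl⟩ := List.mem_map.1 hT
  exact LS_mem_algL X.2 σ

theorem algL_le_span (σ : ℂ) :
    Subalgebra.toSubmodule (algL p m σ) ≤ Submodule.span ℂ (Set.range (LSw (m := m) p σ)) := by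
  rw [algL, Algebra.adjoin_eq_span]
  refine Submodule.span_mono fun T hT => ?_
  induction hT using Submonoid.closure_induction with
  | mem T hT => obtain ⟨X, hX, rfl⟩ := hT; exact ⟨[⟨X, hX⟩], by simp [LSw]⟩
  | one => exact ⟨[], by simp [LSw]⟩
  | mul S T _ _ hS hT =>
    obtain ⟨v, rfl⟩ := hS
    obtain ⟨w, rfl⟩ := hT
    exact ⟨v ++ w, by simp [LSw]⟩

/-- The functions `W₁ⁱ W₂ʲ` of all isotropic pairs. -/
def eSet (p m : ℕ) : Set (polyOmega p m) :=
  {F | ∃ (α β : Row m) (i j : ℕ), IsoPair p α β ∧ F = EOm p α β i j}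

theorem span_LSw_one (hp : 2 ≤ p) (hm : p ≤ m) (hS : Submodule.span ℂ (eSet p m) = ⊤)
    {σ : ℂ} (hσ : Gen m σ) :
    Submodule.span ℂ (Set.range fun w => LSw p σ w (1 : polyOmega p m)) = ⊤ := by
  rw [eq_top_iff, ← hS, Submodule.span_le]
  rintro _ ⟨α, β, i, j, h, rfl⟩
  have h1 : LS p σ (wedge p α β) ^ i * LW p σ α ^ j ∈ algL p m σ :=
    mul_mem (pow_mem (LS_mem_algL (wedge_mem _ _) _) _) (pow_mem (LW_mem_algL _ _) _)
  have h2 := LW_pow_one hp hm h σ i j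
  have h3 := Submodule.mem_map_of_mem (f := LinearMap.applyₗ (1 : polyOmega p m)) (algL_le_span σ h1)
  rw [Submodule.map_span, ← Set.range_comp, LinearMap.applyₗ_apply_apply, h2] at h3
  exact (Submodule.smul_mem_iff _ (raiseCoeff_ne_zero hσ i j)).1 h3

theorem span_RSw_one (hp : 2 ≤ p) (hm : p ≤ m) (hS : Submodule.span ℂ (eSet p m) = ⊤)
    {σ : ℂ} (hσ : Gen m σ) :
    Submodule.span ℂ (Set.range fun w => RSw p σ w (1 : polyOmega p m)) = ⊤ := by
  have h : (Set.range fun w => RSw p σ w (1 : polyOmega p m)) =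
      swapS p m '' (Set.range fun w => LSw p σ w (1 : polyOmega p m)) := by
    rw [← Set.range_comp]
    congr 1; funext w
    rw [Function.comp_apply, swapS_LSw hp hm, swapS_one hp hm]
  rw [h, ← Submodule.map_span, span_LSw_one hp hm hS hσ, Submodule.map_top, LinearMap.range_eq_top]
  exact fun F => ⟨swapS p m F, swapS_swapS hp hm F⟩

theorem exists_star (hp : 2 ≤ p) (hm : p ≤ m) (hS : Submodule.span ℂ (eSet p m) = ⊤)
    {σ : ℂ} (hσ : Gen m σ) : ∃ M : polyOmega p m →ₗ[ℂ] polyOmega p m →ₗ[ℂ] polyOmega p m,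
      ∀ A ∈ algL p m σ, M (A 1) = A := by
  let f : Subalgebra.toSubmodule (algL p m σ) →ₗ[ℂ] polyOmega p m := LinearMap.applyₗ (1 : polyOmega p m) ∘ₗ
    (Subalgebra.toSubmodule (algL p m σ)).subtype
  have hf : ∀ A : Subalgebra.toSubmodule (algL p m σ), f A = A.1 1 := fun A => rfl
  have key : ∀ A ∈ algL p m σ, A (1 : polyOmega p m) = 0 → A = 0 := by
    intro A hmem hA
    refine LinearMap.ext fun F => ?_
    have hF : F ∈ Submodule.span ℂ (Set.range fun w => RSw p σ w (1 : polyOmega p m)) := by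
      rw [span_RSw_one hp hm hS hσ]; trivial
    have hcomm : ∀ w, Commute A (RSw p σ w) := by
      intro w
      have hA2 := algL_le_span σ hmem
      clear hmem hA
      induction hA2 using Submodule.span_induction with
      | mem x hx => obtain ⟨v, rfl⟩ := hx; exact LSw_comm_RSw hp hm σ v w
      | zero => exact Commute.zero_left _
      | add x y _ _ hx hy =>
        refine LinearMap.ext fun G => ?_
        have h1 := DFunLike.congr_fun hx.eq G
        have h2 := DFunLike.congr_fun hy.eq G
        simp only [Module.End.mul_apply, LinearMap.add_apply, map_add] at h1 h2 ⊢
        rw [h1, h2]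
      | smul a x _ hx => exact hx.smul_left a
    induction hF using Submodule.span_induction with
    | mem x hx =>
      obtain ⟨w, rfl⟩ := hx
      have := DFunLike.congr_fun (hcomm w).eq 1
      simp only [Module.End.mul_apply] at this
      rw [this, hA, map_zero]; rfl
    | zero => simp
    | add x y _ _ hx hy => rw [map_add, hx, hy, map_add]
    | smul a x _ hx => rw [map_smul, hx, map_smul]
  have hinj : Function.Injective f := by
    intro A A' h
    have h0 := key (A.1 + (-1 : ℂ) • A'.1) (add_mem A.2 (Submodule.smul_mem _ _ A'.2)) (by
      have h' : A.1 1 = A'.1 1 := h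
      rw [LinearMap.add_apply, LinearMap.smul_apply, h', neg_one_smul, add_neg_cancel])
    refine Subtype.ext (LinearMap.ext fun F => ?_)
    have := DFunLike.congr_fun h0 F
    rwa [LinearMap.add_apply, LinearMap.smul_apply, neg_one_smul, LinearMap.zero_apply,
      add_neg_eq_zero] at this
  have hsurj : Function.Surjective f := by
    rw [← LinearMap.range_eq_top, eq_top_iff, ← span_LSw_one hp hm hS hσ, Submodule.span_le]
    rintro _ ⟨w, rfl⟩
    exact ⟨⟨_, LSw_mem_algL σ w⟩, rfl⟩
  let e := LinearEquiv.ofBijective f ⟨hinj, hsurj⟩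
  refine ⟨(Subalgebra.toSubmodule (algL p m σ)).subtype ∘ₗ e.symm.toLinearMap, fun A hA => ?_⟩
  have : e.symm (A 1) = ⟨A, hA⟩ := by
    rw [LinearEquiv.symm_apply_eq]; rfl
  simp only [LinearMap.comp_apply, LinearEquiv.coe_coe, this]
  rfl

theorem isStar_of (hp : 2 ≤ p) (hm : p ≤ m) {σ : ℂ} (ε : Fin 2)
    {M : polyOmega p m →ₗ[ℂ] polyOmega p m →ₗ[ℂ] polyOmega p m}
    (hM : ∀ A ∈ algL p m σ, M (A 1) = A) : IsStar σ ε M := by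
  intro w₁ w₂
  refine ⟨_, _, hasCoord_covSymbol hp hm σ ε w₁, hasCoord_covSymbol hp hm σ ε w₂, ?_⟩
  rw [toPoly_covPoly hp hm, hM _ (LSw_mem_algL σ w₁), toPoly_covPoly hp hm]
  have := hasCoord_covSymbol (p := p) (m := m) hp hm σ ε (w₁ ++ w₂)
  rw [toPoly_covPoly hp hm] at this
  simpa [LSw] using this

theorem isStar_unique (hp : 2 ≤ p) (hm : p ≤ m) (hS : Submodule.span ℂ (eSet p m) = ⊤)
    {σ : ℂ} (hσ : Gen m σ) (ε : Fin 2)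
    {M M' : polyOmega p m →ₗ[ℂ] polyOmega p m →ₗ[ℂ] polyOmega p m}
    (hM : IsStar σ ε M) (hM' : IsStar σ ε M') : M' = M := by
  have hspan : Submodule.span ℂ (Set.range fun w : List (lieAlg p m) => toPoly p m (covPoly σ w)) = ⊤ := by
    simp only [toPoly_covPoly hp hm]; exact span_LSw_one hp hm hS hσ
  refine LinearMap.ext_on_range hspan fun w₁ => LinearMap.ext_on_range hspan fun w₂ => ?_
  obtain ⟨F₁, F₂, h₁, h₂, h₃⟩ := hM w₁ w₂
  obtain ⟨G₁, G₂, k₁, k₂, k₃⟩ := hM' w₁ w₂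
  have a₁ := hasCoord_covSymbol (p := p) (m := m) hp hm σ ε w₁
  have a₂ := hasCoord_covSymbol (p := p) (m := m) hp hm σ ε w₂
  rw [HasCoord.unique hp hm a₁ h₁, HasCoord.unique hp hm a₂ h₂]
  rw [HasCoord.unique hp hm h₁ k₁, HasCoord.unique hp hm h₂ k₂] at h₃ ⊢
  exact HasCoord.unique hp hm k₃ h₃

theorem isBerezin_of (hp : 2 ≤ p) (hm : p ≤ m) {σ : ℂ} (ε : Fin 2)
    {B : polyOmega p m →ₗ[ℂ] polyOmega p m} (h1 : B 1 = 1)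
    (hB : ∀ X ∈ lieAlg p m, ∀ F, B (RS p (-(m : ℂ) - σ) X F) = LS p σ X (B F)) :
    IsBerezin σ ε B := by
  intro w
  refine ⟨_, hasCoord_contraSymbol hp hm σ ε w, ?_⟩
  have h2 : B (RSw p (-(m : ℂ) - σ) w 1) = LSw p σ w 1 := by
    induction w with
    | nil => simpa [RSw, LSw] using h1
    | cons X w ih =>
      simp only [LSw, RSw, List.map_cons, List.prod_cons, Module.End.mul_apply] at ih ⊢
      rw [hB _ X.2, ih]
  rw [toPoly_contraPoly hp hm, h2, ← toPoly_covPoly hp hm]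
  exact hasCoord_covSymbol hp hm σ ε w

theorem isBerezin_unique (hp : 2 ≤ p) (hm : p ≤ m) (hS : Submodule.span ℂ (eSet p m) = ⊤)
    {σ : ℂ} (hσ : Gen m σ) (ε : Fin 2)
    {B B' : polyOmega p m →ₗ[ℂ] polyOmega p m}
    (hB : IsBerezin σ ε B) (hB' : IsBerezin σ ε B') : B' = B := by
  have hspan : Submodule.span ℂ (Set.range fun w : List (lieAlg p m) => toPoly p m (contraPoly (-(m : ℂ) - σ) w)) = ⊤ := by
    simp only [toPoly_contraPoly hp hm]; exact span_RSw_one hp hm hS hσ.dual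
  refine LinearMap.ext_on_range hspan fun w => ?_
  obtain ⟨F, h, h'⟩ := hB w
  obtain ⟨G, k, k'⟩ := hB' w
  have a := hasCoord_contraSymbol (p := p) (m := m) hp hm σ ε w
  rw [HasCoord.unique hp hm a h]
  rw [HasCoord.unique hp hm h k] at h' ⊢
  exact HasCoord.unique hp hm k' h'

end Star

section Laplace

variable {p m : ℕ}

/-- The middle basis rows. -/
def midBas {m : ℕ} (i : Fin m) : Row m := row 0 (Pi.single i 1) 0

/-- The translation in the direction `ξᵢ`. -/
def tX (p : ℕ) {m : ℕ} (i : Fin m) : Mat m :=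
  wedge p (sPlus m) (-midBas i)

/-- The translation in the direction `ηᵢ`. -/
def tY (p : ℕ) {m : ℕ} (i : Fin m) : Mat m :=
  wedge p (sMinus m) (-midBas i)

theorem tX_mem (i : Fin m) : tX p i ∈ lieAlg p m := wedge_mem _ _

theorem tY_mem (i : Fin m) : tY p i ∈ lieAlg p m := wedge_mem _ _

theorem wedge_smul_right (c : ℝ) (a b : Row m) :
    wedge p a (c • b) = c • wedge p a b := by
  rw [wedge, wedge, mulVec_smul, vecMulVec_smul, smul_vecMulVec, smul_sub]

theorem row_single_eq (i : Fin m) (s : ℝ) : row 0 (Pi.single i s) 0 = s • midBas i := by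
  rw [midBas, row_smul, mul_zero, ← Pi.single_smul, smul_eq_mul, mul_one]

theorem sMinus_exp_tX (hp : 2 ≤ p) (hm : p ≤ m) (i : Fin m) (s : ℝ) :
    sMinus m ᵥ* NormedSpace.exp (s • tX p i) = uVec p (Pi.single i s) := by
  have h0 := form_sPlus_row hp hm (Pi.single i s)
  have h1 := form_sMinus_row hp hm (Pi.single i s)
  rw [tX, ← wedge_smul_right, smul_neg, ← row_single_eq, vecMul_exp_wedge (form_sPlus_sPlus hp hm)
    (by rw [form_neg_right, h0, neg_zero]), form_sMinus_sPlus hp hm, form_neg_right, form_neg_right,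
    form_neg_left, h1, uVec_eq, form_row hp hm]
  module

theorem sPlus_exp_tY (hp : 2 ≤ p) (hm : p ≤ m) (i : Fin m) (s : ℝ) :
    sPlus m ᵥ* NormedSpace.exp (s • tY p i) = vVec p (Pi.single i s) := by
  have h0 := form_sPlus_row hp hm (Pi.single i s)
  have h1 := form_sMinus_row hp hm (Pi.single i s)
  rw [tY, ← wedge_smul_right, smul_neg, ← row_single_eq, vecMul_exp_wedge (form_sMinus_sMinus hp hm)
    (by rw [form_neg_right, h1, neg_zero]), form_comm (sPlus m) (sMinus m), form_sMinus_sPlus hp hm,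
    form_neg_right, form_neg_right,
    form_neg_left, h0, vVec_eq, form_row hp hm]
  module

theorem exp_add_smul (X : Mat m) (s t : ℝ) :
    NormedSpace.exp ((s + t) • X) = NormedSpace.exp (s • X) * NormedSpace.exp (t • X) := by
  rw [add_smul, Matrix.exp_add_of_commute]
  exact ((Commute.refl X).smul_left s).smul_right t

theorem hasDerivAt_eta (hp : 2 ≤ p) (hm : p ≤ m) (x : Row m) (i : Fin m) (t : ℝ)
    (h : form p x (vVec p (Pi.single i t)) ≠ 0) (Q : PolyMat m) :
    HasDerivAt (fun t => evalMat (proj p x (vVec p (Pi.single i t))) Q)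
      (evalMat (proj p x (vVec p (Pi.single i t))) (Dy (tY p i) Q)) t := by
  have h1 := hasDerivAt_eval_right (tY_mem i) h Q
  have h2 : HasDerivAt (fun s : ℝ => evalMat (proj p x (vVec p (Pi.single i t) ᵥ*
      NormedSpace.exp (s • tY p i))) Q) (evalMat (proj p x (vVec p (Pi.single i t)))
      (Dy (tY p i) Q)) (t - t) := by rwa [sub_self]
  have h3 := h2.comp_sub_const t t
  refine h3.congr_of_eventuallyEq (Eventually.of_forall fun s => ?_)
  simp only [← sPlus_exp_tY hp hm]
  rw [vecMul_vecMul, ← exp_add_smul, add_sub_cancel]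

theorem hasDerivAt_xi (hp : 2 ≤ p) (hm : p ≤ m) (y : Row m) (i : Fin m) (t : ℝ)
    (h : form p (uVec p (Pi.single i t)) y ≠ 0) (Q : PolyMat m) :
    HasDerivAt (fun t => evalMat (proj p (uVec p (Pi.single i t)) y) Q)
      (evalMat (proj p (uVec p (Pi.single i t)) y) (Dx (tX p i) Q)) t := by
  have h1 := hasDerivAt_eval_left (tX p i) h Q
  have h2 : HasDerivAt (fun s : ℝ => evalMat (proj p (uVec p (Pi.single i t) ᵥ*
      NormedSpace.exp (s • tX p i)) y) Q) (evalMat (proj p (uVec p (Pi.single i t)) y)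
      (Dx (tX p i) Q)) (t - t) := by rwa [sub_self]
  have h3 := h2.comp_sub_const t t
  refine h3.congr_of_eventuallyEq (Eventually.of_forall fun s => ?_)
  simp only [← sMinus_exp_tX hp hm]
  rw [vecMul_vecMul, ← exp_add_smul, add_sub_cancel]

/-- The element by which `translate` moves `z` to the initial point. -/
def base {p m : ℕ} (z : Omega p m) : Mat m := z.2.choose

theorem base_mem (z : Omega p m) : base z ∈ SO₀ p m := z.2.choose_spec.1

theorem base_orth (z : Omega p m) : base z ∈ orth p m := SO₀_subset_orth (base_mem z)

theorem base_eq (z : Omega p m) : (base z)⁻¹ * z₀ p m * base z = z.1 := z.2.choose_spec.2.symm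

theorem translate_eq (hp : 2 ≤ p) (hm : p ≤ m) (P : PolyMat m) (z : Omega p m) {ξ η : Fin m → ℝ}
    (h : N p ξ η ≠ 0) : translate (toPoly p m P).1 z ξ η =
      evalMat (proj p (uVec p ξ) (vVec p η)) (trans (base z) P) := by
  change ev _ ((base z)⁻¹ * zMat p ξ η * base z) = _
  rw [ev_toPoly P (conj_mem_Omega (base_mem z) (zMat_mem hp hm h)), evalMat_trans]
  rfl

theorem N_zero_right (ξ : Fin m → ℝ) : N p ξ 0 = 1 := by
  simp [N, formMid_zero_right]

theorem eventually_N_single (ξ : Fin m → ℝ) (i : Fin m) :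
    ∀ᶠ t : ℝ in 𝓝 0, N p ξ (Pi.single i t) ≠ 0 := by
  have hc : AnalyticAt ℝ (fun t : ℝ => N p ξ (Pi.single i t)) 0 :=
    analyticAt_N (fun _ => analyticAt_const) fun k => by
      simp only [Pi.single_apply]
      split_ifs
      · exact analyticAt_id
      · exact analyticAt_const
  refine hc.continuousAt.eventually_ne ?_
  rw [Pi.single_zero, N_zero_right]; norm_num

theorem form_ne_zero_of_N (hp : 2 ≤ p) (hm : p ≤ m) {ξ η : Fin m → ℝ} (h : N p ξ η ≠ 0) :
    form p (uVec p ξ) (vVec p η) ≠ 0 := by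
  rw [form_uVec_vVec hp hm]; simpa using h

theorem deriv_translate_eta (hp : 2 ≤ p) (hm : p ≤ m) (P : PolyMat m) (z : Omega p m)
    (ξ : Fin m → ℝ) (i : Fin m) :
    deriv (fun t : ℝ => translate (toPoly p m P).1 z ξ (Pi.single i t)) 0 =
      evalMat (proj p (uVec p ξ) (sPlus m)) (Dy (tY p i) (trans (base z) P)) := by
  have h1 := hasDerivAt_eta hp hm (uVec p ξ) i 0 (form_ne_zero_of_N hp hm (by
    rw [Pi.single_zero, N_zero_right]; norm_num)) (trans (base z) P)
  rw [Pi.single_zero, vVec_zero] at h1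
  refine Eq.trans (EventuallyEq.deriv_eq ?_) h1.deriv
  filter_upwards [eventually_N_single (p := p) ξ i] with t ht
  exact translate_eq hp hm P z ht

theorem iteratedDeriv_translate_eta (hp : 2 ≤ p) (hm : p ≤ m) (P : PolyMat m) (z : Omega p m)
    (ξ : Fin m → ℝ) (i : Fin m) :
    iteratedDeriv 2 (fun t : ℝ => translate (toPoly p m P).1 z ξ (Pi.single i t)) 0 =
      evalMat (proj p (uVec p ξ) (sPlus m)) (Dy (tY p i) (Dy (tY p i) (trans (base z) P))) := by
  have h1 := hasDerivAt_eta hp hm (uVec p ξ) i 0 (form_ne_zero_of_N hp hm (by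
    rw [Pi.single_zero, N_zero_right]; norm_num)) (Dy (tY p i) (trans (base z) P))
  rw [Pi.single_zero, vVec_zero] at h1
  rw [iteratedDeriv_succ, iteratedDeriv_one]
  refine Eq.trans (EventuallyEq.deriv_eq ?_) h1.deriv
  have hev := eventually_N_single (p := p) ξ i
  filter_upwards [hev.eventually_nhds] with t ht
  refine Eq.trans (EventuallyEq.deriv_eq ?_)
    (hasDerivAt_eta hp hm (uVec p ξ) i t (form_ne_zero_of_N hp hm ht.self_of_nhds) _).deriv
  filter_upwards [ht] with t' ht'
  exact translate_eq hp hm P z ht'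

theorem deriv_translate_xi (hp : 2 ≤ p) (hm : p ≤ m) (P : PolyMat m) (z : Omega p m) (i : Fin m) :
    deriv (fun t : ℝ => translate (toPoly p m P).1 z (Pi.single i t) 0) 0 =
      evalMat (z₀ p m) (Dx (tX p i) (trans (base z) P)) := by
  have h1 := hasDerivAt_xi hp hm (vVec p 0) i 0 (form_ne_zero_of_N hp hm (by
    rw [N_zero_right]; norm_num)) (trans (base z) P)
  rw [Pi.single_zero, uVec_zero, vVec_zero] at h1
  refine Eq.trans (EventuallyEq.deriv_eq (Eventually.of_forall fun t => ?_)) h1.deriv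
  simp only
  rw [translate_eq hp hm P z (by rw [N_zero_right]; norm_num), vVec_zero]

theorem deriv_eval_xi (hp : 2 ≤ p) (hm : p ≤ m) (Q : PolyMat m) (i : Fin m) :
    deriv (fun s : ℝ => evalMat (proj p (uVec p (Pi.single i s)) (sPlus m)) Q) 0 =
      evalMat (z₀ p m) (Dx (tX p i) Q) := by
  have h1 := hasDerivAt_xi hp hm (sPlus m) i 0 (by
    rw [form_uVec_sPlus hp hm]; norm_num) Q
  rw [Pi.single_zero, uVec_zero] at h1
  exact h1.deriv

theorem iteratedDeriv_eval_xi (hp : 2 ≤ p) (hm : p ≤ m) (Q : PolyMat m) (i : Fin m) :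
    iteratedDeriv 2 (fun s : ℝ => evalMat (proj p (uVec p (Pi.single i s)) (sPlus m)) Q) 0 =
      evalMat (z₀ p m) (Dx (tX p i) (Dx (tX p i) Q)) := by
  rw [iteratedDeriv_succ, iteratedDeriv_one, ← deriv_eval_xi hp hm]
  congr 1; funext t
  exact (hasDerivAt_xi hp hm (sPlus m) i t (by rw [form_uVec_sPlus hp hm]; norm_num) Q).deriv

/-- `Δ₂` at the initial point. -/
def lap2 (p : ℕ) {m : ℕ} (Q : PolyMat m) : ℂ :=
  ∑ i : Fin m, (lamMid p i : ℂ) * evalMat (z₀ p m) (Dx (tX p i) (Dy (tY p i) Q))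

/-- `Δ₄` at the initial point. -/
def lap4 (p : ℕ) {m : ℕ} (Q : PolyMat m) : ℂ :=
  ∑ i : Fin m, ∑ j : Fin m, (lamMid p i : ℂ) * (lamMid p j : ℂ) *
    evalMat (z₀ p m) (Dx (tX p i) (Dx (tX p i) (Dy (tY p j) (Dy (tY p j) Q))))

theorem laplace₂_toPoly (hp : 2 ≤ p) (hm : p ≤ m) (P : PolyMat m) (z : Omega p m) :
    laplace₂ (toPoly p m P).1 z = lap2 p (trans (base z) P) := by
  simp only [laplace₂, lap2, deriv_translate_eta hp hm, deriv_eval_xi hp hm]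

theorem laplace₄_toPoly (hp : 2 ≤ p) (hm : p ≤ m) (P : PolyMat m) (z : Omega p m) :
    laplace₄ (toPoly p m P).1 z = lap4 p (trans (base z) P) := by
  simp only [laplace₄, lap4, iteratedDeriv_translate_eta hp hm, iteratedDeriv_eval_xi hp hm]

theorem evalMat_trans_base (P : PolyMat m) (z : Omega p m) :
    evalMat (z₀ p m) (trans (base z) P) = (toPoly p m P).1 z := by
  rw [evalMat_trans, base_eq, toPoly_apply]

theorem lap2_add (P Q : PolyMat m) : lap2 p (P + Q) = lap2 p P + lap2 p Q := by
  simp only [lap2, map_add, mul_add, Finset.sum_add_distrib]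

theorem lap2_smul (c : ℂ) (P : PolyMat m) : lap2 p (c • P) = c * lap2 p P := by
  simp only [lap2, Derivation.map_smul, map_smul, smul_eq_mul, Finset.mul_sum]
  exact Finset.sum_congr rfl fun i _ => by ring

theorem lap4_add (P Q : PolyMat m) : lap4 p (P + Q) = lap4 p P + lap4 p Q := by
  simp only [lap4, map_add, mul_add, Finset.sum_add_distrib]

theorem lap4_smul (c : ℂ) (P : PolyMat m) : lap4 p (c • P) = c * lap4 p P := by
  simp only [lap4, Derivation.map_smul, map_smul, smul_eq_mul, Finset.mul_sum]
  exact Finset.sum_congr rfl fun i _ => Finset.sum_congr rfl fun j _ => by ring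

theorem laplace₂_add (hp : 2 ≤ p) (hm : p ≤ m) (F G : polyOmega p m) :
    laplace₂ (F + G).1 = laplace₂ F.1 + laplace₂ G.1 := by
  obtain ⟨P, rfl⟩ := toPoly_surjective F
  obtain ⟨Q, rfl⟩ := toPoly_surjective G
  funext z
  rw [← map_add, Pi.add_apply, laplace₂_toPoly hp hm, laplace₂_toPoly hp hm,
    laplace₂_toPoly hp hm, map_add, lap2_add]

theorem laplace₂_smul (hp : 2 ≤ p) (hm : p ≤ m) (c : ℂ) (F : polyOmega p m) :
    laplace₂ (c • F).1 = c • laplace₂ F.1 := by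
  obtain ⟨P, rfl⟩ := toPoly_surjective F
  funext z
  rw [← map_smul, Pi.smul_apply, laplace₂_toPoly hp hm, laplace₂_toPoly hp hm, map_smul,
    lap2_smul, smul_eq_mul]

theorem laplace₄_add (hp : 2 ≤ p) (hm : p ≤ m) (F G : polyOmega p m) :
    laplace₄ (F + G).1 = laplace₄ F.1 + laplace₄ G.1 := by
  obtain ⟨P, rfl⟩ := toPoly_surjective F
  obtain ⟨Q, rfl⟩ := toPoly_surjective G
  funext z
  rw [← map_add, Pi.add_apply, laplace₄_toPoly hp hm, laplace₄_toPoly hp hm,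
    laplace₄_toPoly hp hm, map_add, lap4_add]

theorem laplace₄_smul (hp : 2 ≤ p) (hm : p ≤ m) (c : ℂ) (F : polyOmega p m) :
    laplace₄ (c • F).1 = c • laplace₄ F.1 := by
  obtain ⟨P, rfl⟩ := toPoly_surjective F
  funext z
  rw [← map_smul, Pi.smul_apply, laplace₄_toPoly hp hm, laplace₄_toPoly hp hm, map_smul,
    lap4_smul, smul_eq_mul]

/-! ### First derivatives at the initial point -/

theorem form_midBas_right (hp : 2 ≤ p) (hm : p ≤ m) (x : Row m) (i : Fin m) :
    form p x (midBas i) = lamMid p i * middle x i := by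
  conv_lhs => rw [← row_eta x]
  rw [midBas, form_row hp hm, formMid_single_right]; ring

theorem form_midBas_self (hp : 2 ≤ p) (hm : p ≤ m) (i : Fin m) :
    form p (midBas i) (midBas i) = lamMid p i := by
  rw [form_midBas_right hp hm, midBas, middle_row]; simp

theorem form_sPlus_midBas (hp : 2 ≤ p) (hm : p ≤ m) (i : Fin m) :
    form p (sPlus m) (midBas i) = 0 := form_sPlus_row hp hm _

theorem form_sMinus_midBas (hp : 2 ≤ p) (hm : p ≤ m) (i : Fin m) :
    form p (sMinus m) (midBas i) = 0 := form_sMinus_row hp hm _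

theorem vecMul_tX (i : Fin m) (x : Row m) :
    x ᵥ* tX p i = form p x (midBas i) • sPlus m - form p x (sPlus m) • midBas i := by
  rw [tX, vecMul_wedge, form_neg_right]; module

theorem vecMul_tY (i : Fin m) (x : Row m) :
    x ᵥ* tY p i = form p x (midBas i) • sMinus m - form p x (sMinus m) • midBas i := by
  rw [tY, vecMul_wedge, form_neg_right]; module

theorem sum_midBas (hp : 2 ≤ p) (hm : p ≤ m) (x y : Row m) :
    ∑ i : Fin m, lamMid p i * (form p x (midBas i) * form p y (midBas i)) = form p x y +
      1 / 2 * (form p x (sPlus m) * form p y (sMinus m) + form p x (sMinus m) * form p y (sPlus m)) := by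
  have h : ∑ i : Fin m, lamMid p i * (form p x (midBas i) * form p y (midBas i)) =
      formMid p (middle x) (middle y) := by
    rw [formMid]
    refine Finset.sum_congr rfl fun i _ => ?_
    rw [form_midBas_right hp hm, form_midBas_right hp hm]
    linear_combination (lamMid p i * middle x i * middle y i) * lamMid_mul_self (p := p) i
  rw [h]
  conv_rhs => rw [← row_eta x, ← row_eta y]
  rw [sPlus, sMinus]
  simp only [form_row hp hm, formMid_zero_right]
  ring

end Laplace

section Eigen

variable {p m : ℕ}

/-- Second derivatives of a monomial, under an evaluation. -/
theorem eval_second_monomial {A : Type*} [CommRing A] [Algebra ℂ A] (e : A →ₐ[ℂ] ℂ)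
    (D D' : Derivation ℂ A A) (a b : A) (i j : ℕ) :
    e (D (D' (a ^ i * b ^ j))) =
      i * e a ^ (i - 1) * e b ^ j * e (D (D' a)) + j * e a ^ i * e b ^ (j - 1) * e (D (D' b)) +
      i * (i - 1 : ℕ) * e a ^ (i - 2) * e b ^ j * (e (D a) * e (D' a)) +
      i * j * e a ^ (i - 1) * e b ^ (j - 1) * (e (D a) * e (D' b) + e (D b) * e (D' a)) +
      j * (j - 1 : ℕ) * e a ^ i * e b ^ (j - 2) * (e (D b) * e (D' b)) := by
  have h : D' (a ^ i * b ^ j) = (i : A) * a ^ (i - 1) * b ^ j * D' a + j * a ^ i * b ^ (j - 1) * D' b := by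
    rw [Derivation.leibniz, Derivation.leibniz_pow, Derivation.leibniz_pow]
    simp only [smul_eq_mul, nsmul_eq_mul]; ring
  rw [h]
  simp only [map_add, Derivation.leibniz, Derivation.leibniz_pow, smul_eq_mul, nsmul_eq_mul,
    Derivation.map_natCast, map_mul, map_pow, map_natCast, Nat.sub_sub]
  simp only [map_zero]
  push_cast
  ring

theorem eval_first_monomial {A : Type*} [CommRing A] [Algebra ℂ A] (e : A →ₐ[ℂ] ℂ)
    (D : Derivation ℂ A A) (a b : A) (i j : ℕ) :
    e (D (a ^ i * b ^ j)) =
      i * e a ^ (i - 1) * e b ^ j * e (D a) + j * e a ^ i * e b ^ (j - 1) * e (D b) := by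
  rw [Derivation.leibniz, Derivation.leibniz_pow, Derivation.leibniz_pow]
  simp only [smul_eq_mul, nsmul_eq_mul, map_add, map_mul, map_pow, map_natCast]; ring

theorem cast_mul_pow_pred (i : ℕ) (x : ℂ) : (i : ℂ) * x ^ (i - 1) * x = i * x ^ i := by
  cases i <;> simp [pow_succ]; ring

theorem cast_mul_pow_pred_pred (i : ℕ) (x : ℂ) :
    (i : ℂ) * ((i - 1 : ℕ) : ℂ) * x ^ (i - 2) * x ^ 2 = i * (i - 1) * x ^ i := by
  rcases i with _ | _ | i <;> simp [pow_succ]; ring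

theorem cast_mul_pow_pred_pred' (i : ℕ) (x : ℂ) :
    (i : ℂ) * ((i - 1 : ℕ) : ℂ) * x ^ (i - 2) * x = i * (i - 1) * x ^ (i - 1) := by
  rcases i with _ | _ | i <;> simp [pow_succ]; ring

/-- A weighted sum of second derivatives of a monomial. -/
theorem sum_second_monomial {ι A : Type*} [Fintype ι] [CommRing A] [Algebra ℂ A] (e : A →ₐ[ℂ] ℂ)
    (w : ι → ℂ) (D D' : ι → Derivation ℂ A A) (a b : A) (i j : ℕ) {La Lb Saa Sab Sbb : ℂ}
    (hLa : ∑ k, w k * e (D k (D' k a)) = La) (hLb : ∑ k, w k * e (D k (D' k b)) = Lb)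
    (hSaa : ∑ k, w k * (e (D k a) * e (D' k a)) = Saa)
    (hSab : ∑ k, w k * (e (D k a) * e (D' k b) + e (D k b) * e (D' k a)) = Sab)
    (hSbb : ∑ k, w k * (e (D k b) * e (D' k b)) = Sbb) :
    ∑ k, w k * e (D k (D' k (a ^ i * b ^ j))) =
      i * e a ^ (i - 1) * e b ^ j * La + j * e a ^ i * e b ^ (j - 1) * Lb +
      i * (i - 1 : ℕ) * e a ^ (i - 2) * e b ^ j * Saa +
      i * j * e a ^ (i - 1) * e b ^ (j - 1) * Sab +
      j * (j - 1 : ℕ) * e a ^ i * e b ^ (j - 2) * Sbb := by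
  subst hLa hLb hSaa hSab hSbb
  simp only [eval_second_monomial, Finset.mul_sum, ← Finset.sum_add_distrib]
  exact Finset.sum_congr rfl fun k _ => by ring

variable (hp : 2 ≤ p) (hm : p ≤ m)

theorem sum_midBas_complex (hp : 2 ≤ p) (hm : p ≤ m) (x y : Row m) :
    ∑ i : Fin m, (lamMid p i : ℂ) * ((form p x (midBas i) : ℂ) * (form p y (midBas i) : ℂ)) =
      form p x y + 1 / 2 * (form p x (sPlus m) * form p y (sMinus m) +
        form p x (sMinus m) * form p y (sPlus m)) := by
  have h := congrArg (fun r : ℝ => (r : ℂ)) (sum_midBas hp hm x y)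
  push_cast at h
  exact h

theorem sum_lamMid_sq : ∑ i : Fin m, (lamMid p i : ℂ) * (lamMid p i : ℂ) = m := by
  have : ∀ i : Fin m, (lamMid p i : ℂ) * (lamMid p i : ℂ) = 1 := fun i => by
    exact_mod_cast lamMid_mul_self (p := p) i
  simp [this]

theorem evalMat_Zp_z₀ (hp : 2 ≤ p) (hm : p ≤ m) (γ δ : Row m) :
    evalMat (z₀ p m) (Zp p γ δ) =
    -(1 / 2) * ((form p γ (sMinus m) : ℂ) * (form p δ (sPlus m) : ℂ)) := by
  rw [z₀, evalMat_Zp, form_sMinus_sPlus hp hm, form_comm (sMinus m), form_comm (sPlus m)]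
  push_cast; ring

theorem evalMat_tau_z₀ (hp : 2 ≤ p) (hm : p ≤ m) (X : Mat m) :
    evalMat (z₀ p m) (tau X) = -(1 / 2) * (form p (sMinus m ᵥ* X) (sPlus m) : ℂ) := by
  rw [z₀, evalMat_tau, trace_proj_mul, form_sMinus_sPlus hp hm]
  push_cast; ring

theorem evalMat_tau_tX (hp : 2 ≤ p) (hm : p ≤ m) (i : Fin m) :
    evalMat (z₀ p m) (tau (tX p i)) = 0 := by
  rw [evalMat_tau_z₀ hp hm, vecMul_tX, form_sMinus_midBas hp hm, form_sMinus_sPlus hp hm,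
    form_sub_left, form_smul_left, form_smul_left, form_sPlus_sPlus hp hm, form_comm (midBas i),
    form_sPlus_midBas hp hm]
  simp

theorem evalMat_tau_tY (hp : 2 ≤ p) (hm : p ≤ m) (i : Fin m) :
    evalMat (z₀ p m) (tau (tY p i)) = 0 := by
  rw [evalMat_tau_z₀ hp hm, vecMul_tY, form_sMinus_midBas hp hm, form_sMinus_sMinus hp hm]
  simp [form_zero_left]

/-- Evaluation at `z⁰` of the first derivatives of the functions `Z`. -/
theorem Dx_Zp_z₀ (hp : 2 ≤ p) (hm : p ≤ m) (i : Fin m) (γ δ : Row m) :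
    evalMat (z₀ p m) (Dx (tX p i) (Zp p γ δ)) =
      -(form p γ (midBas i) : ℂ) * (form p δ (sPlus m) : ℂ) := by
  rw [Dx_Zp (tX_mem i), map_sub, map_neg, map_mul, evalMat_tau_tX hp hm, evalMat_Zp_z₀ hp hm, vecMul_tX,
    form_sub_left, form_smul_left, form_smul_left, form_comm (sPlus m) (sMinus m),
    form_sMinus_sPlus hp hm, form_comm (midBas i), form_sMinus_midBas hp hm]
  push_cast; ring

theorem Dy_Zp_z₀ (hp : 2 ≤ p) (hm : p ≤ m) (i : Fin m) (γ δ : Row m) :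
    evalMat (z₀ p m) (Dy (tY p i) (Zp p γ δ)) =
      -(form p γ (sMinus m) : ℂ) * (form p δ (midBas i) : ℂ) := by
  rw [Dy_Zp, map_sub, map_mul, evalMat_tau_tY hp hm, zero_mul, evalMat_Zp_z₀ hp hm, vecMul_tY,
    form_sub_left, form_smul_left, form_smul_left,
    form_sMinus_sPlus hp hm, form_comm (midBas i), form_sPlus_midBas hp hm]
  push_cast; ring

theorem tau_tX_mul_tY (hp : 2 ≤ p) (hm : p ≤ m) (i : Fin m) :
    evalMat (z₀ p m) (tau (tX p i * tY p i)) = 2 * (lamMid p i : ℂ) := by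
  rw [evalMat_tau_z₀ hp hm, ← vecMul_vecMul, vecMul_tX, vecMul_tY]
  simp only [form_sub_left, form_smul_left, form_sMinus_sPlus hp hm, form_comm (midBas i) (sPlus m),
    form_sMinus_midBas hp hm, form_sPlus_midBas hp hm, form_midBas_self hp hm]
  push_cast; ring

theorem DxDy_Zp_z₀ (hp : 2 ≤ p) (hm : p ≤ m) (i : Fin m) (γ δ : Row m) :
    evalMat (z₀ p m) (Dx (tX p i) (Dy (tY p i) (Zp p γ δ))) =
      2 * (lamMid p i : ℂ) * evalMat (z₀ p m) (Zp p γ δ) -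
        2 * ((form p γ (midBas i) : ℂ) * (form p δ (midBas i) : ℂ)) := by
  rw [Dy_Zp, map_sub, Derivation.leibniz, Dx_tau, Dx_Zp (tX_mem i) γ (δ ᵥ* tY p i)]
  simp only [map_sub, map_add, map_neg, map_mul, smul_eq_mul, evalMat_tau_tX hp hm, evalMat_tau_tY hp hm,
    tau_tX_mul_tY hp hm, evalMat_Zp_z₀ hp hm, vecMul_tX, vecMul_tY, form_sub_left, form_smul_left,
    form_comm (sPlus m) (sMinus m), form_sMinus_sPlus hp hm, form_comm (midBas i) (sMinus m),
    form_sMinus_midBas hp hm, form_comm (midBas i) (sPlus m), form_sPlus_midBas hp hm]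
  push_cast; ring

theorem lap2_Epoly (hp : 2 ≤ p) (hm : p ≤ m) {α β : Row m} (h : IsoPair p α β) (i j : ℕ) :
    lap2 p (Epoly p α β i j) =
      (2 * (i + j) * (i + j + m - 1) + 2 * j * (j + 1)) * evalMat (z₀ p m) (Epoly p α β i j) := by
  have saa := sum_midBas_complex hp hm α α
  have sab := sum_midBas_complex hp hm α β
  have sbb := sum_midBas_complex hp hm β β
  rw [h.aa] at saa; rw [h.ab] at sab; rw [h.bb] at sbb
  have hl := sum_lamMid_sq (p := p) (m := m)
  set A : ℂ := (form p α (sPlus m) : ℂ)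
  set A' : ℂ := (form p α (sMinus m) : ℂ)
  set B : ℂ := (form p β (sPlus m) : ℂ)
  set B' : ℂ := (form p β (sMinus m) : ℂ)
  set w1 : ℂ := evalMat (z₀ p m) (tau (wedge p α β)) with hw1
  set w2 : ℂ := evalMat (z₀ p m) (Zp p α α) with hw2
  have e1 : w1 = -(1 / 2) * (A' * B - B' * A) := by
    rw [hw1, tau_wedge, map_sub, evalMat_Zp_z₀ hp hm, evalMat_Zp_z₀ hp hm]; ring
  have e2 : w2 = -(1 / 2) * (A' * A) := evalMat_Zp_z₀ hp hm α α
  have key := sum_second_monomial (evalMat (z₀ p m)) (fun k : Fin m => (lamMid p k : ℂ))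
    (fun k => Dx (tX p k)) (fun k => Dy (tY p k)) (tau (wedge p α β)) (Zp p α α) i j
    (La := 2 * m * w1) (Lb := (2 * m + 4) * w2) (Saa := 2 * w1 ^ 2) (Sab := 4 * (w1 * w2))
    (Sbb := 4 * w2 ^ 2)
    (by
      have : ∀ k : Fin m, (lamMid p k : ℂ) * evalMat (z₀ p m) (Dx (tX p k) (Dy (tY p k)
          (tau (wedge p α β)))) = 2 * w1 * ((lamMid p k : ℂ) * (lamMid p k : ℂ)) := by
        intro k
        rw [tau_wedge, map_sub, map_sub, map_sub, DxDy_Zp_z₀ hp hm, DxDy_Zp_z₀ hp hm, hw1, tau_wedge,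
          map_sub]
        ring
      rw [Finset.sum_congr rfl fun k _ => this k, ← Finset.mul_sum, hl]; ring)
    (by
      have : ∀ k : Fin m, (lamMid p k : ℂ) * evalMat (z₀ p m) (Dx (tX p k) (Dy (tY p k)
          (Zp p α α))) = 2 * w2 * ((lamMid p k : ℂ) * (lamMid p k : ℂ)) -
            2 * ((lamMid p k : ℂ) * ((form p α (midBas k) : ℂ) * (form p α (midBas k) : ℂ))) := by
        intro k
        rw [DxDy_Zp_z₀ hp hm]
        ring
      rw [Finset.sum_congr rfl fun k _ => this k, Finset.sum_sub_distrib, ← Finset.mul_sum,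
        ← Finset.mul_sum, hl, saa, e2]; push_cast; ring)
    (by
      have : ∀ k : Fin m, (lamMid p k : ℂ) * (evalMat (z₀ p m) (Dx (tX p k) (tau (wedge p α β))) *
          evalMat (z₀ p m) (Dy (tY p k) (tau (wedge p α β)))) =
          -(B * B') * ((lamMid p k : ℂ) * ((form p α (midBas k) : ℂ) * (form p α (midBas k) : ℂ)))
          + (B * A' + A * B') *
            ((lamMid p k : ℂ) * ((form p α (midBas k) : ℂ) * (form p β (midBas k) : ℂ)))
          - A * A' * ((lamMid p k : ℂ) * ((form p β (midBas k) : ℂ) * (form p β (midBas k) : ℂ))) := by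
        intro k
        rw [tau_wedge, map_sub, map_sub, map_sub, map_sub, Dx_Zp_z₀ hp hm, Dx_Zp_z₀ hp hm,
          Dy_Zp_z₀ hp hm, Dy_Zp_z₀ hp hm]
        ring
      rw [Finset.sum_congr rfl fun k _ => this k, Finset.sum_sub_distrib, Finset.sum_add_distrib,
        ← Finset.mul_sum, ← Finset.mul_sum, ← Finset.mul_sum, saa, sab, sbb, e1]; push_cast; ring)
    (by
      have : ∀ k : Fin m, (lamMid p k : ℂ) * (evalMat (z₀ p m) (Dx (tX p k) (tau (wedge p α β))) *
          evalMat (z₀ p m) (Dy (tY p k) (Zp p α α)) + evalMat (z₀ p m) (Dx (tX p k) (Zp p α α)) *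
          evalMat (z₀ p m) (Dy (tY p k) (tau (wedge p α β)))) =
          (A' * B - A * B') *
            ((lamMid p k : ℂ) * ((form p α (midBas k) : ℂ) * (form p α (midBas k) : ℂ))) := by
        intro k
        rw [tau_wedge, map_sub, map_sub, map_sub, map_sub, Dx_Zp_z₀ hp hm, Dx_Zp_z₀ hp hm,
          Dx_Zp_z₀ hp hm, Dy_Zp_z₀ hp hm, Dy_Zp_z₀ hp hm, Dy_Zp_z₀ hp hm]
        ring
      rw [Finset.sum_congr rfl fun k _ => this k, ← Finset.mul_sum, saa, e1, e2]; push_cast; ring)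
    (by
      have : ∀ k : Fin m, (lamMid p k : ℂ) * (evalMat (z₀ p m) (Dx (tX p k) (Zp p α α)) *
          evalMat (z₀ p m) (Dy (tY p k) (Zp p α α))) =
          A * A' * ((lamMid p k : ℂ) * ((form p α (midBas k) : ℂ) * (form p α (midBas k) : ℂ))) := by
        intro k
        rw [Dx_Zp_z₀ hp hm, Dy_Zp_z₀ hp hm]
        ring
      rw [Finset.sum_congr rfl fun k _ => this k, ← Finset.mul_sum, saa, e2]; push_cast; ring)
  rw [lap2, Epoly, key, map_mul, map_pow, map_pow, ← hw1, ← hw2]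
  have c1 := cast_mul_pow_pred i w1
  have c2 := cast_mul_pow_pred j w2
  have c3 := cast_mul_pow_pred_pred i w1
  have c4 := cast_mul_pow_pred_pred j w2
  linear_combination (2 * m * w2 ^ j) * c1 + ((2 * m + 4) * w1 ^ i) * c2 + 2 * w2 ^ j * c3 +
    4 * w1 ^ i * c4 + 4 * j * w2 ^ (j - 1) * w2 * c1 + 4 * i * w1 ^ i * c2

end Eigen

section EigenFour

variable {p m : ℕ}

theorem evalMat_Zp_sPlus (hp : 2 ≤ p) (hm : p ≤ m) (ξ : Fin m → ℝ) (γ δ : Row m) :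
    evalMat (proj p (uVec p ξ) (sPlus m)) (Zp p γ δ) =
    -(1 / 2) * ((form p γ (uVec p ξ) : ℂ) * (form p δ (sPlus m) : ℂ)) := by
  rw [evalMat_Zp, form_uVec_sPlus hp hm, form_comm (uVec p ξ), form_comm (sPlus m)]
  push_cast; ring

theorem evalMat_tau_sPlus (hp : 2 ≤ p) (hm : p ≤ m) (ξ : Fin m → ℝ)
    (X : Mat m) :
    evalMat (proj p (uVec p ξ) (sPlus m)) (tau X) =
      -(1 / 2) * (form p (uVec p ξ ᵥ* X) (sPlus m) : ℂ) := by
  rw [evalMat_tau, trace_proj_mul, form_uVec_sPlus hp hm]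
  push_cast; ring

theorem evalMat_tau_tY_sPlus (hp : 2 ≤ p) (hm : p ≤ m) (ξ : Fin m → ℝ) (i : Fin m) :
    evalMat (proj p (uVec p ξ) (sPlus m)) (tau (tY p i)) = (form p (uVec p ξ) (midBas i) : ℂ) := by
  rw [evalMat_tau_sPlus hp hm, vecMul_tY, form_sub_left, form_smul_left, form_smul_left,
    form_sMinus_sPlus hp hm, form_comm (midBas i), form_sPlus_midBas hp hm]
  push_cast; ring

theorem evalMat_tau_tY_sq_sPlus (hp : 2 ≤ p) (hm : p ≤ m) (ξ : Fin m → ℝ) (i : Fin m) :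
    evalMat (proj p (uVec p ξ) (sPlus m)) (tau (tY p i * tY p i)) =
      -(lamMid p i : ℂ) * (form p (uVec p ξ) (sMinus m) : ℂ) := by
  rw [evalMat_tau_sPlus hp hm, ← vecMul_vecMul, vecMul_tY, vecMul_tY]
  simp only [form_sub_left, form_smul_left, form_sMinus_sPlus hp hm, form_comm (midBas i) (sPlus m),
    form_sMinus_midBas hp hm, form_sPlus_midBas hp hm, form_midBas_self hp hm,
    form_sMinus_sMinus hp hm, form_comm (midBas i) (sMinus m)]
  push_cast; ring

theorem Dy_Zp_sPlus (hp : 2 ≤ p) (hm : p ≤ m) (ξ : Fin m → ℝ) (i : Fin m)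
    (γ δ : Row m) :
    evalMat (proj p (uVec p ξ) (sPlus m)) (Dy (tY p i) (Zp p γ δ)) =
      (form p (uVec p ξ) (midBas i) : ℂ) * evalMat (proj p (uVec p ξ) (sPlus m)) (Zp p γ δ) -
        (form p γ (uVec p ξ) : ℂ) * (form p δ (midBas i) : ℂ) := by
  rw [Dy_Zp, map_sub, map_mul, evalMat_tau_tY_sPlus hp hm, evalMat_Zp_sPlus hp hm _ γ (δ ᵥ* _), vecMul_tY,
    form_sub_left, form_smul_left, form_smul_left, form_sMinus_sPlus hp hm, form_comm (midBas i),
    form_sPlus_midBas hp hm]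
  push_cast; ring

theorem DyDy_Zp_sPlus (hp : 2 ≤ p) (hm : p ≤ m) (ξ : Fin m → ℝ) (i : Fin m)
    (γ δ : Row m) :
    evalMat (proj p (uVec p ξ) (sPlus m)) (Dy (tY p i) (Dy (tY p i) (Zp p γ δ))) =
      (2 * ((form p (uVec p ξ) (midBas i) : ℂ) * (form p (uVec p ξ) (midBas i) : ℂ)) +
        (lamMid p i : ℂ) * (form p (uVec p ξ) (sMinus m) : ℂ)) *
          evalMat (proj p (uVec p ξ) (sPlus m)) (Zp p γ δ) -
        2 * (form p γ (uVec p ξ) : ℂ) * ((form p (uVec p ξ) (midBas i) : ℂ) * (form p δ (midBas i) : ℂ))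
        - (lamMid p i : ℂ) * (form p γ (uVec p ξ) : ℂ) * (form p δ (sMinus m) : ℂ) := by
  rw [Dy_Zp, map_sub, Derivation.leibniz, Dy_tau, Dy_Zp, Dy_Zp]
  simp only [map_sub, map_add, map_mul, smul_eq_mul, evalMat_tau_tY_sPlus hp hm,
    evalMat_tau_tY_sq_sPlus hp hm, evalMat_Zp_sPlus hp hm, vecMul_tY, form_sub_left, form_smul_left,
    form_sMinus_sPlus hp hm, form_comm (midBas i) (sMinus m), form_comm (midBas i) (sPlus m),
    form_sMinus_midBas hp hm, form_sPlus_midBas hp hm, form_sMinus_sMinus hp hm, form_midBas_self hp hm]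
  push_cast; ring

theorem DxDx_Zp_z₀ (hp : 2 ≤ p) (hm : p ≤ m) (i : Fin m) (γ : Row m) :
    evalMat (z₀ p m) (Dx (tX p i) (Dx (tX p i) (Zp p γ (sMinus m)))) =
      2 * (lamMid p i : ℂ) * (form p γ (sPlus m) : ℂ) := by
  have h1 : evalMat (z₀ p m) (tau (tX p i * tX p i)) = 0 := by
    rw [evalMat_tau_z₀ hp hm, ← vecMul_vecMul, vecMul_tX, vecMul_tX]
    simp only [form_sub_left, form_smul_left, form_sMinus_sPlus hp hm, form_comm (midBas i) (sPlus m),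
      form_sMinus_midBas hp hm, form_sPlus_midBas hp hm, form_midBas_self hp hm,
      form_sPlus_sPlus hp hm]
    push_cast; ring
  rw [Dx_Zp (tX_mem i), map_sub, Derivation.leibniz, Dx_tau, map_neg, Dx_Zp (tX_mem i),
    Dx_Zp (tX_mem i)]
  simp only [map_sub, map_add, map_neg, map_mul, smul_eq_mul, evalMat_tau_tX hp hm, h1,
    evalMat_Zp_z₀ hp hm, vecMul_tX, form_sub_left, form_smul_left,
    form_sMinus_sPlus hp hm, form_comm (midBas i) (sMinus m), form_comm (midBas i) (sPlus m),
    form_comm (sPlus m) (sMinus m),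
    form_sMinus_midBas hp hm, form_sPlus_midBas hp hm, form_sPlus_sPlus hp hm, form_midBas_self hp hm]
  push_cast; ring

/-- The sum of the second `η`-derivatives of `W₁ⁱ W₂ʲ` along `η = 0`. -/
theorem sum_DyDy_Epoly (hp : 2 ≤ p) (hm : p ≤ m) {α β : Row m} (h : IsoPair p α β) (i j : ℕ)
    (ξ : Fin m → ℝ) {u p' q' A A' B B' : ℂ} (hu : (form p (uVec p ξ) (sMinus m) : ℂ) = u)
    (hα : (form p α (uVec p ξ) : ℂ) = p') (hβ : (form p β (uVec p ξ) : ℂ) = q')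
    (hA : (form p α (sPlus m) : ℂ) = A) (hA' : (form p α (sMinus m) : ℂ) = A')
    (hB : (form p β (sPlus m) : ℂ) = B) (hB' : (form p β (sMinus m) : ℂ) = B') :
    ∑ k : Fin m, (lamMid p k : ℂ) * evalMat (proj p (uVec p ξ) (sPlus m))
        (Dy (tY p k) (Dy (tY p k) (Epoly p α β i j))) =
      i * (-(1 / 2) * (p' * B - q' * A)) ^ (i - 1) * (-(1 / 2) * A * p') ^ j *
        ((m - 2) * (u * (-(1 / 2) * (p' * B - q' * A)) - (p' * B' - q' * A'))) +
      j * (-(1 / 2) * (p' * B - q' * A)) ^ i * (-(1 / 2) * A * p') ^ (j - 1) *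
        ((m - 2) * (u * (-(1 / 2) * A * p') - p' * A') - 2 * (i + j) * p' ^ 2) := by
  have saa := sum_midBas_complex hp hm α α
  have sab := sum_midBas_complex hp hm α β
  have sbb := sum_midBas_complex hp hm β β
  have suu := sum_midBas_complex hp hm (uVec p ξ) (uVec p ξ)
  have sua := sum_midBas_complex hp hm (uVec p ξ) α
  have sub := sum_midBas_complex hp hm (uVec p ξ) β
  rw [h.aa] at saa; rw [h.ab] at sab; rw [h.bb] at sbb
  rw [form_comm _ α] at sua; rw [form_comm _ β] at sub
  rw [form_uVec_self hp hm] at suu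
  simp only [form_uVec_sPlus hp hm, hu, hα, hβ, hA, hA', hB, hB'] at saa sab sbb suu sua sub
  have hl := sum_lamMid_sq (p := p) (m := m)
  set e := evalMat (proj p (uVec p ξ) (sPlus m)) with he
  have e1 : e (tau (wedge p α β)) = -(1 / 2) * (p' * B - q' * A) := by
    rw [tau_wedge, map_sub, evalMat_Zp_sPlus hp hm, evalMat_Zp_sPlus hp hm, hα, hβ, hA, hB]; ring
  have e2 : e (Zp p α α) = -(1 / 2) * A * p' := by
    rw [he, evalMat_Zp_sPlus hp hm, hα, hA]; ring
  have hd1 : ∀ k : Fin m, e (Dy (tY p k) (tau (wedge p α β))) =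
      (form p (uVec p ξ) (midBas k) : ℂ) * (-(1 / 2) * (p' * B - q' * A)) -
        (p' * (form p β (midBas k) : ℂ) - q' * (form p α (midBas k) : ℂ)) := by
    intro k
    rw [← e1, tau_wedge, map_sub, map_sub, map_sub, Dy_Zp_sPlus hp hm, Dy_Zp_sPlus hp hm, hα, hβ]; ring
  have hd2 : ∀ k : Fin m, e (Dy (tY p k) (Zp p α α)) =
      (form p (uVec p ξ) (midBas k) : ℂ) * (-(1 / 2) * A * p') - p' * (form p α (midBas k) : ℂ) := by
    intro k
    rw [← e2, Dy_Zp_sPlus hp hm, hα]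
  have key := sum_second_monomial e (fun k : Fin m => (lamMid p k : ℂ))
    (fun k => Dy (tY p k)) (fun k => Dy (tY p k)) (tau (wedge p α β)) (Zp p α α) i j
    (La := (m - 2) * (u * (-(1 / 2) * (p' * B - q' * A)) - (p' * B' - q' * A')))
    (Lb := (m - 2) * (u * (-(1 / 2) * A * p') - p' * A') - 2 * p' ^ 2)
    (Saa := 0) (Sab := -2 * p' ^ 2 * (-(1 / 2) * (p' * B - q' * A)))
    (Sbb := -2 * p' ^ 2 * (-(1 / 2) * A * p'))
    (by
      have : ∀ k : Fin m, (lamMid p k : ℂ) * e (Dy (tY p k) (Dy (tY p k) (tau (wedge p α β)))) =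
          2 * (-(1 / 2) * (p' * B - q' * A)) * ((lamMid p k : ℂ) * ((form p (uVec p ξ) (midBas k) : ℂ) *
            (form p (uVec p ξ) (midBas k) : ℂ)))
          - 2 * p' * ((lamMid p k : ℂ) * ((form p (uVec p ξ) (midBas k) : ℂ) * (form p β (midBas k) : ℂ)))
          + 2 * q' * ((lamMid p k : ℂ) * ((form p (uVec p ξ) (midBas k) : ℂ) * (form p α (midBas k) : ℂ)))
          + (u * (-(1 / 2) * (p' * B - q' * A)) - p' * B' + q' * A') *
            ((lamMid p k : ℂ) * (lamMid p k : ℂ)) := by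
        intro k
        rw [← e1, tau_wedge, map_sub, map_sub, map_sub, DyDy_Zp_sPlus hp hm, DyDy_Zp_sPlus hp hm,
          hα, hβ, hu, hA', hB', map_sub]
        ring
      rw [Finset.sum_congr rfl fun k _ => this k, Finset.sum_add_distrib, Finset.sum_add_distrib,
        Finset.sum_sub_distrib, ← Finset.mul_sum, ← Finset.mul_sum, ← Finset.mul_sum,
        ← Finset.mul_sum, suu, sua, sub, hl]
      push_cast; ring)
    (by
      have : ∀ k : Fin m, (lamMid p k : ℂ) * e (Dy (tY p k) (Dy (tY p k) (Zp p α α))) =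
          2 * (-(1 / 2) * A * p') * ((lamMid p k : ℂ) * ((form p (uVec p ξ) (midBas k) : ℂ) *
            (form p (uVec p ξ) (midBas k) : ℂ)))
          - 2 * p' * ((lamMid p k : ℂ) * ((form p (uVec p ξ) (midBas k) : ℂ) * (form p α (midBas k) : ℂ)))
          + (u * (-(1 / 2) * A * p') - p' * A') * ((lamMid p k : ℂ) * (lamMid p k : ℂ)) := by
        intro k
        rw [← e2, DyDy_Zp_sPlus hp hm, hα, hu, hA']
        ring
      rw [Finset.sum_congr rfl fun k _ => this k, Finset.sum_add_distrib,
        Finset.sum_sub_distrib, ← Finset.mul_sum, ← Finset.mul_sum, ← Finset.mul_sum,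
        suu, sua, hl]
      push_cast; ring)
    (by
      have : ∀ k : Fin m, (lamMid p k : ℂ) * (e (Dy (tY p k) (tau (wedge p α β))) *
          e (Dy (tY p k) (tau (wedge p α β)))) =
          (-(1 / 2) * (p' * B - q' * A)) ^ 2 * ((lamMid p k : ℂ) * ((form p (uVec p ξ) (midBas k) : ℂ) *
            (form p (uVec p ξ) (midBas k) : ℂ)))
          + (p' * B - q' * A) * p' * ((lamMid p k : ℂ) * ((form p (uVec p ξ) (midBas k) : ℂ) * (form p β (midBas k) : ℂ)))
          - (p' * B - q' * A) * q' * ((lamMid p k : ℂ) * ((form p (uVec p ξ) (midBas k) : ℂ) * (form p α (midBas k) : ℂ)))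
          + p' ^ 2 * ((lamMid p k : ℂ) * ((form p β (midBas k) : ℂ) * (form p β (midBas k) : ℂ)))
          - 2 * p' * q' * ((lamMid p k : ℂ) * ((form p α (midBas k) : ℂ) * (form p β (midBas k) : ℂ)))
          + q' ^ 2 * ((lamMid p k : ℂ) * ((form p α (midBas k) : ℂ) * (form p α (midBas k) : ℂ))) := by
        intro k; rw [hd1]; ring
      rw [Finset.sum_congr rfl fun k _ => this k]
      simp only [Finset.sum_add_distrib, Finset.sum_sub_distrib, ← Finset.mul_sum]
      rw [suu, sua, sub, saa, sab, sbb]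
      push_cast; ring)
    (by
      have : ∀ k : Fin m, (lamMid p k : ℂ) * (e (Dy (tY p k) (tau (wedge p α β))) *
          e (Dy (tY p k) (Zp p α α)) + e (Dy (tY p k) (Zp p α α)) *
          e (Dy (tY p k) (tau (wedge p α β)))) =
          2 * (-(1 / 2) * (p' * B - q' * A)) * (-(1 / 2) * A * p') * ((lamMid p k : ℂ) *
            ((form p (uVec p ξ) (midBas k) : ℂ) * (form p (uVec p ξ) (midBas k) : ℂ)))
          + (p' * A) * p' * ((lamMid p k : ℂ) * ((form p (uVec p ξ) (midBas k) : ℂ) * (form p β (midBas k) : ℂ)))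
          + ((p' * B - q' * A) * p' - A * p' * q') *
            ((lamMid p k : ℂ) * ((form p (uVec p ξ) (midBas k) : ℂ) * (form p α (midBas k) : ℂ)))
          + 2 * p' ^ 2 * ((lamMid p k : ℂ) * ((form p α (midBas k) : ℂ) * (form p β (midBas k) : ℂ)))
          - 2 * p' * q' * ((lamMid p k : ℂ) * ((form p α (midBas k) : ℂ) * (form p α (midBas k) : ℂ))) := by
        intro k; rw [hd1, hd2]; ring
      rw [Finset.sum_congr rfl fun k _ => this k]
      simp only [Finset.sum_add_distrib, Finset.sum_sub_distrib, ← Finset.mul_sum]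
      rw [suu, sua, sub, saa, sab]
      push_cast; ring)
    (by
      have : ∀ k : Fin m, (lamMid p k : ℂ) * (e (Dy (tY p k) (Zp p α α)) *
          e (Dy (tY p k) (Zp p α α))) =
          (-(1 / 2) * A * p') ^ 2 * ((lamMid p k : ℂ) *
            ((form p (uVec p ξ) (midBas k) : ℂ) * (form p (uVec p ξ) (midBas k) : ℂ)))
          + A * p' * p' *
            ((lamMid p k : ℂ) * ((form p (uVec p ξ) (midBas k) : ℂ) * (form p α (midBas k) : ℂ)))
          + p' ^ 2 * ((lamMid p k : ℂ) * ((form p α (midBas k) : ℂ) * (form p α (midBas k) : ℂ))) := by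
        intro k; rw [hd2]; ring
      rw [Finset.sum_congr rfl fun k _ => this k]
      simp only [Finset.sum_add_distrib, ← Finset.mul_sum]
      rw [suu, sua, saa]
      push_cast; ring)
  rw [Epoly, key, e1, e2]
  set W1 := -(1 / 2) * (p' * B - q' * A)
  set W2 := -(1 / 2) * A * p'
  have c1 := cast_mul_pow_pred i W1
  have c2 := cast_mul_pow_pred_pred' j W2
  linear_combination (-2 * p' ^ 2 * j * W2 ^ (j - 1)) * c1 + (-2 * p' ^ 2 * W1 ^ i) * c2

theorem sum_second_mul_monomial {ι A : Type*} [Fintype ι] [CommRing A] [Algebra ℂ A] (e : A →ₐ[ℂ] ℂ)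
    (w : ι → ℂ) (D : ι → Derivation ℂ A A) (f a b : A) (i j : ℕ) {L Sa Sb : ℂ} (hf : e f = 0)
    (hL : ∑ k, w k * e (D k (D k f)) = L) (hSa : ∑ k, w k * (e (D k f) * e (D k a)) = Sa)
    (hSb : ∑ k, w k * (e (D k f) * e (D k b)) = Sb) :
    ∑ k, w k * e (D k (D k (f * (a ^ i * b ^ j)))) =
      L * (e a ^ i * e b ^ j) +
        2 * (i * e a ^ (i - 1) * e b ^ j * Sa + j * e a ^ i * e b ^ (j - 1) * Sb) := by
  subst hL hSa hSb
  have : ∀ k, e (D k (D k (f * (a ^ i * b ^ j)))) = e (D k (D k f)) * (e a ^ i * e b ^ j) +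
      2 * (e (D k f) * e (D k (a ^ i * b ^ j))) := by
    intro k
    rw [Derivation.leibniz, map_add, smul_eq_mul, smul_eq_mul, Derivation.leibniz,
      Derivation.leibniz (D k) (a ^ i * b ^ j)]
    simp only [map_add, map_mul, smul_eq_mul, hf, map_pow]; ring
  simp only [this, eval_first_monomial, Finset.mul_sum, Finset.sum_mul, ← Finset.sum_add_distrib]
  exact Finset.sum_congr rfl fun k _ => by ring

theorem lap4_Epoly (hp : 2 ≤ p) (hm : p ≤ m) {α β : Row m} (h : IsoPair p α β) (i j : ℕ) :
    lap4 p (Epoly p α β i j) =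
      ((2 * m - 4) * (((j : ℂ) ^ 2 - i) * (2 * m + 4 * (i + j) - 4) - 2 * m * (i + j)) +
        4 * j * (j + 1) * (i + j) * (4 * (i + j) + 2 * m)) *
        evalMat (z₀ p m) (Epoly p α β i j) := by
  set A : ℝ := form p α (sPlus m) with hA
  set A' : ℝ := form p α (sMinus m) with hA'
  set B : ℝ := form p β (sPlus m) with hB
  set B' : ℝ := form p β (sMinus m) with hB'
  set a : PolyMat m := Zp p (B • α - A • β) (sMinus m) with ha
  set b : PolyMat m := Zp p α (sMinus m) with hb
  set f1 : PolyMat m := Zp p (B' • α - A' • β) (sMinus m) with hf1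
  set f3 : PolyMat m := Zp p (sMinus m) (sMinus m) with hf3
  set κ : ℂ := -(1 / 2) with hκ
  set R : PolyMat m := (-(m - 2) * i * κ ^ (i - 1) * (κ * A) ^ j : ℂ) • (f1 * (a ^ (i - 1) * b ^ j)) +
    ((m - 2) * (i + j) * κ ^ i * (κ * A) ^ j : ℂ) • (f3 * (a ^ i * b ^ j)) +
    (-(m - 2) * j * A' * κ ^ i * (κ * A) ^ (j - 1) : ℂ) • (a ^ i * b ^ j) +
    (-2 * j * (i + j) * κ ^ i * (κ * A) ^ (j - 1) : ℂ) • (a ^ i * b ^ (j + 1)) with hR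
  have hev : ∀ (ξ : Fin m → ℝ) (γ : Row m),
      evalMat (proj p (uVec p ξ) (sPlus m)) (Zp p γ (sMinus m)) = (form p γ (uVec p ξ) : ℂ) := by
    intro ξ γ
    rw [evalMat_Zp_sPlus hp hm, form_sMinus_sPlus hp hm]; push_cast; ring
  have hinner : ∀ ξ : Fin m → ℝ, evalMat (proj p (uVec p ξ) (sPlus m))
      (∑ k : Fin m, (lamMid p k : ℂ) • Dy (tY p k) (Dy (tY p k) (Epoly p α β i j))) =
      evalMat (proj p (uVec p ξ) (sPlus m)) R := by
    intro ξ
    have h1 := sum_DyDy_Epoly hp hm h i j ξ rfl rfl rfl rfl rfl rfl rfl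
    simp only [map_sum, map_smul, smul_eq_mul]
    rw [h1, hR]
    simp only [map_add, map_smul, map_mul, map_pow, smul_eq_mul, ha, hb, hf1, hf3, hev, form_sub_left,
      form_smul_left, ← hA, ← hA', ← hB, ← hB', form_comm (sMinus m) (uVec p ξ)]
    push_cast
    generalize (form p α (uVec p ξ) : ℂ) = P
    generalize (form p β (uVec p ξ) : ℂ) = Q
    generalize (form p (uVec p ξ) (sMinus m) : ℂ) = U
    have t1 : ∀ k : ℕ, (-(1 / 2) * (P * (B : ℂ) - Q * A)) ^ k = κ ^ k * ((B : ℂ) * P - A * Q) ^ k := by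
      intro k; rw [← mul_pow, hκ]; congr 1; ring
    have t2 : ∀ k : ℕ, (-(1 / 2) * (A : ℂ) * P) ^ k = (κ * (A : ℂ)) ^ k * P ^ k := by
      intro k; rw [← mul_pow]
    rw [t1, t2, t1, t2]
    generalize hX : (B : ℂ) * P - A * Q = X
    have hX' : -(1 / 2) * (P * (B : ℂ) - Q * A) = κ * X := by rw [← hX, hκ]; ring
    rw [hX']
    rcases i with _ | i <;> rcases j with _ | j <;>
      simp only [Nat.add_sub_cancel, Nat.cast_zero, Nat.cast_add, Nat.cast_one, pow_zero] <;>
      (rw [hκ]; ring)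
  have hlap : lap4 p (Epoly p α β i j) =
      ∑ k : Fin m, (lamMid p k : ℂ) * evalMat (z₀ p m) (Dx (tX p k) (Dx (tX p k) R)) := by
    rw [lap4]
    refine Finset.sum_congr rfl fun k _ => ?_
    have h2 := iteratedDeriv_eval_xi hp hm R k
    simp only [← hinner] at h2
    rw [iteratedDeriv_eval_xi hp hm] at h2
    rw [← h2]
    simp only [map_sum, Derivation.map_smul, map_smul, smul_eq_mul, Finset.mul_sum]
    exact Finset.sum_congr rfl fun l _ => by ring
  have hz : ∀ γ : Row m, evalMat (z₀ p m) (Zp p γ (sMinus m)) = (form p γ (sMinus m) : ℂ) := by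
    intro γ
    rw [evalMat_Zp_z₀ hp hm, form_sMinus_sPlus hp hm]; push_cast; ring
  have hd : ∀ (k : Fin m) (γ : Row m), evalMat (z₀ p m) (Dx (tX p k) (Zp p γ (sMinus m))) =
      2 * (form p γ (midBas k) : ℂ) := by
    intro k γ
    rw [Dx_Zp_z₀ hp hm, form_sMinus_sPlus hp hm]; push_cast; ring
  have hL : ∀ γ : Row m, ∑ k : Fin m, (lamMid p k : ℂ) *
      evalMat (z₀ p m) (Dx (tX p k) (Dx (tX p k) (Zp p γ (sMinus m)))) =
      2 * m * (form p γ (sPlus m) : ℂ) := by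
    intro γ
    have : ∀ k : Fin m, (lamMid p k : ℂ) *
      evalMat (z₀ p m) (Dx (tX p k) (Dx (tX p k) (Zp p γ (sMinus m)))) =
        2 * (form p γ (sPlus m) : ℂ) * ((lamMid p k : ℂ) * (lamMid p k : ℂ)) := by
      intro k; rw [DxDx_Zp_z₀ hp hm]; ring
    rw [Finset.sum_congr rfl fun k _ => this k, ← Finset.mul_sum, sum_lamMid_sq]; ring
  have hS : ∀ γ δ : Row m, ∑ k : Fin m, (lamMid p k : ℂ) *
      (evalMat (z₀ p m) (Dx (tX p k) (Zp p γ (sMinus m))) *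
        evalMat (z₀ p m) (Dx (tX p k) (Zp p δ (sMinus m)))) =
      4 * (form p γ δ : ℂ) + 2 * ((form p γ (sPlus m) : ℂ) * (form p δ (sMinus m) : ℂ) +
        (form p γ (sMinus m) : ℂ) * (form p δ (sPlus m) : ℂ)) := by
    intro γ δ
    have : ∀ k : Fin m, (lamMid p k : ℂ) *
      (evalMat (z₀ p m) (Dx (tX p k) (Zp p γ (sMinus m))) *
        evalMat (z₀ p m) (Dx (tX p k) (Zp p δ (sMinus m)))) =
        4 * ((lamMid p k : ℂ) * ((form p γ (midBas k) : ℂ) * (form p δ (midBas k) : ℂ))) := by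
      intro k; rw [hd, hd]; ring
    rw [Finset.sum_congr rfl fun k _ => this k, ← Finset.mul_sum, sum_midBas_complex hp hm]; ring
  have hba : form p β α = 0 := by rw [form_comm, h.ab]
  have Lb := hL α
  have La := hL (B • α - A • β)
  have L1 := hL (B' • α - A' • β)
  have L3 := hL (sMinus m)
  have Saa := hS (B • α - A • β) (B • α - A • β)
  have Sab := hS (B • α - A • β) α
  have Sbb := hS α α
  have S1a := hS (B' • α - A' • β) (B • α - A • β)
  have S1b := hS (B' • α - A' • β) α
  have S3a := hS (sMinus m) (B • α - A • β)
  have S3b := hS (sMinus m) α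
  have v1 := hz (B' • α - A' • β)
  have va := hz (B • α - A • β)
  have vb := hz α
  have v3 := hz (sMinus m)
  simp only [form_sub_left, form_sub_right, form_smul_left, form_smul_right, h.aa, h.ab, h.bb, hba,
    form_comm (sMinus m) α, form_comm (sMinus m) β, form_sMinus_sPlus hp hm, form_sMinus_sMinus hp hm,
    ← hA, ← hA', ← hB, ← hB', ← ha, ← hb, ← hf1, ← hf3] at Lb La L1 L3 Saa Sab Sbb S1a S1b S3a S3b v1 va vb v3
  set e := evalMat (z₀ p m) with he
  have v1' : e f1 = 0 := by rw [v1]; push_cast; ring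
  have v3' : e f3 = 0 := by rw [v3]; push_cast; ring
  set w : ℂ := A' * B - B' * A with hw
  have va' : e a = w := by rw [va, hw]; push_cast; ring
  have T2 : ∀ i j : ℕ, ∑ k : Fin m, (lamMid p k : ℂ) * e (Dx (tX p k) (Dx (tX p k) (a ^ i * b ^ j))) = _ :=
    fun i j => sum_second_monomial e (fun k : Fin m => (lamMid p k : ℂ))
      (fun k => Dx (tX p k)) (fun k => Dx (tX p k)) a b i j
      (La := 0) (Lb := 2 * m * A) (Saa := 0) (Sab := 4 * A * w) (Sbb := 4 * A * A')
      (by rw [La]; push_cast; ring) (by rw [Lb]) (by rw [Saa]; push_cast; ring)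
      (by
        simp only [mul_comm (e ((Dx (tX p _)) b)), ← two_mul]
        simp only [mul_left_comm _ (2 : ℂ)]
        rw [← Finset.mul_sum, Sab, hw]; push_cast; ring)
      (by rw [Sbb]; push_cast; ring)
  have T1 : ∀ i j : ℕ, ∑ k : Fin m, (lamMid p k : ℂ) * e (Dx (tX p k) (Dx (tX p k) (f1 * (a ^ i * b ^ j)))) = _ :=
    fun i j => sum_second_mul_monomial e (fun k : Fin m => (lamMid p k : ℂ))
      (fun k => Dx (tX p k)) f1 a b i j (L := -(2 * m * w)) (Sa := -2 * w ^ 2) (Sb := -2 * w * A') v1'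
      (by rw [L1, hw]; push_cast; ring) (by rw [S1a, hw]; push_cast; ring)
      (by rw [S1b, hw]; push_cast; ring)
  have T3 : ∀ i j : ℕ, ∑ k : Fin m, (lamMid p k : ℂ) * e (Dx (tX p k) (Dx (tX p k) (f3 * (a ^ i * b ^ j)))) = _ :=
    fun i j => sum_second_mul_monomial e (fun k : Fin m => (lamMid p k : ℂ))
      (fun k => Dx (tX p k)) f3 a b i j (L := -(4 * m)) (Sa := 0) (Sb := 0) v3'
      (by rw [L3]; push_cast; ring) (by rw [S3a]; push_cast; ring)
      (by rw [S3b]; push_cast; ring)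
  have hsum : ∑ k : Fin m, (lamMid p k : ℂ) * e (Dx (tX p k) (Dx (tX p k) R)) =
      (-(m - 2) * i * κ ^ (i - 1) * (κ * A) ^ j : ℂ) * ∑ k : Fin m, (lamMid p k : ℂ) *
        e (Dx (tX p k) (Dx (tX p k) (f1 * (a ^ (i - 1) * b ^ j)))) +
      ((m - 2) * (i + j) * κ ^ i * (κ * A) ^ j : ℂ) * ∑ k : Fin m, (lamMid p k : ℂ) *
        e (Dx (tX p k) (Dx (tX p k) (f3 * (a ^ i * b ^ j)))) +
      (-(m - 2) * j * A' * κ ^ i * (κ * A) ^ (j - 1) : ℂ) * ∑ k : Fin m, (lamMid p k : ℂ) *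
        e (Dx (tX p k) (Dx (tX p k) (a ^ i * b ^ j))) +
      (-2 * j * (i + j) * κ ^ i * (κ * A) ^ (j - 1) : ℂ) * ∑ k : Fin m, (lamMid p k : ℂ) *
        e (Dx (tX p k) (Dx (tX p k) (a ^ i * b ^ (j + 1)))) := by
    rw [hR]
    simp only [map_add, Derivation.map_smul, map_smul, smul_eq_mul, Finset.mul_sum,
      ← Finset.sum_add_distrib]
    exact Finset.sum_congr rfl fun k _ => by ring
  have hE : e (Epoly p α β i j) = κ ^ i * w ^ i * ((κ * A) ^ j * (A' : ℂ) ^ j) := by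
    rw [Epoly, map_mul, map_pow, map_pow, tau_wedge, map_sub, he, evalMat_Zp_z₀ hp hm,
      evalMat_Zp_z₀ hp hm, evalMat_Zp_z₀ hp hm, ← mul_pow, ← mul_pow, hw, hκ]
    congr 2 <;> ring
  rw [hlap, hsum, T1, T2, T2, T3, hE, va', vb]
  clear hsum T1 T2 T3 hlap hE hinner Lb La L1 L3 Saa Sab Sbb S1a S1b S3a S3b v1 va v3 v1' v3' va' hR R
  generalize (A' : ℂ) = x
  generalize (A : ℂ) = y
  clear_value w
  rcases i with _ | _ | i <;> rcases j with _ | _ | j <;>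
    simp only [Nat.add_sub_cancel, Nat.cast_zero, Nat.cast_add, Nat.cast_one, pow_zero,
      zero_add, Nat.zero_sub, Nat.sub_self, Nat.reduceSub,
      show ∀ k : ℕ, k + 1 + 1 - 2 = k from fun k => rfl] <;>
    ring1

end EigenFour

section FirstOrder

variable {p m : ℕ}

theorem jointEigen_EOm (hp : 2 ≤ p) (hm : p ≤ m) {n : ℂ} (hn : n = m + 2) {α β : Row m}
    (h : IsoPair p α β) (i j : ℕ) : JointEigen n (i + 2 * j) i (EOm p α β i j).1 := by
  have e : ∀ z : Omega p m, evalMat (z₀ p m) (Epoly p (α ᵥ* (base z)⁻¹) (β ᵥ* (base z)⁻¹) i j) =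
      (EOm p α β i j).1 z := by
    intro z
    rw [← trans_Epoly (base_orth z), evalMat_trans_base, EOm]
  constructor
  · funext z
    have h1 := lap2_Epoly hp hm (h.vecMul (orth_inv (base_orth z))) i j
    rw [e] at h1
    rw [EOm, laplace₂_toPoly hp hm, trans_Epoly (base_orth z), h1, Pi.smul_apply, smul_eq_mul, EOm, d₁, d₂, hn]
    ring
  · funext z
    have h1 := lap4_Epoly hp hm (h.vecMul (orth_inv (base_orth z))) i j
    rw [e] at h1
    rw [EOm, laplace₄_toPoly hp hm, trans_Epoly (base_orth z), h1, Pi.smul_apply, smul_eq_mul, EOm, d₁, d₂, hn]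
    ring

theorem derivation_sum_apply {ι : Type*} (s : Finset ι)
    (D : ι → Derivation ℂ (PolyMat m) (PolyMat m)) (Q : PolyMat m) :
    (∑ i ∈ s, D i) Q = ∑ i ∈ s, D i Q := by
  classical
  induction s using Finset.induction_on with
  | empty => simp
  | insert a s ha ih => rw [Finset.sum_insert ha, Finset.sum_insert ha, Derivation.add_apply, ih]

theorem evalMat_derivation_congr (M : Mat m)
    {D D' : Derivation ℂ (PolyMat m) (PolyMat m)}
    (h : ∀ a b, evalMat M (D (MvPolynomial.X (a, b))) = evalMat M (D' (MvPolynomial.X (a, b))))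
    (Q : PolyMat m) : evalMat M (D Q) = evalMat M (D' Q) := by
  induction Q using MvPolynomial.induction_on with
  | C c =>
    rw [show D (MvPolynomial.C c) = 0 from D.map_algebraMap c,
      show D' (MvPolynomial.C c) = 0 from D'.map_algebraMap c]
  | add P Q hP hQ => simp only [map_add, hP, hQ]
  | mul_X P ab hP =>
    simp only [Derivation.leibniz, map_add, smul_eq_mul, map_mul, hP, h ab.1 ab.2]

theorem evalMat_Dx_X_z₀ (hp : 2 ≤ p) (hm : p ≤ m) (X : Mat m)
    (a b : Fin (m + 2)) : evalMat (z₀ p m) (Dx X (MvPolynomial.X (a, b))) =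
      ((-(1 / 2) * lam p a * sPlus m a *
        (sMinus m ᵥ* X + (1 / 2 * form p (sMinus m ᵥ* X) (sPlus m)) • sMinus m) b : ℝ) : ℂ) := by
  rw [Dx_X, map_sub, map_mul, evalMat_coord_mul, evalMat_tau_z₀ hp hm, evalMat_X, z₀, proj_mul_apply,
    proj_apply, form_sMinus_sPlus hp hm]
  simp only [Pi.add_apply, Pi.smul_apply, smul_eq_mul]
  push_cast; ring

theorem evalMat_Dy_X_z₀ (hp : 2 ≤ p) (hm : p ≤ m) {X : Mat m}
    (hX : X ∈ lieAlg p m) (a b : Fin (m + 2)) : evalMat (z₀ p m) (Dy X (MvPolynomial.X (a, b))) =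
      ((-(1 / 2) * lam p a * sMinus m b *
        (sPlus m ᵥ* X + (1 / 2 * form p (sPlus m ᵥ* X) (sMinus m)) • sPlus m) a : ℝ) : ℂ) := by
  rw [Dy_X, map_sub, map_mul, evalMat_mul_coord, evalMat_tau_z₀ hp hm, evalMat_X, z₀, mul_proj_apply hX,
    proj_apply, form_sMinus_sPlus hp hm, form_vecMul_skew hX (sMinus m), form_comm (sMinus m)]
  simp only [Pi.add_apply, Pi.smul_apply, smul_eq_mul]
  push_cast; ring

theorem sum_smul_midBas (v : Fin m → ℝ) : ∑ i, v i • midBas i = row 0 v 0 := by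
  apply row_ext
  · simp [midBas, row_zero]
  · rw [middle_row]
    funext k
    simp only [middle, Finset.sum_apply, Pi.smul_apply, midBas, row_mid, smul_eq_mul]
    simp [Pi.single_apply]
  · simp [midBas, row_last]

theorem sMinus_vecMul_skew (hp : 2 ≤ p) (hm : p ≤ m) {X : Mat m}
    (hX : X ∈ lieAlg p m) : sMinus m ᵥ* X + (1 / 2 * form p (sMinus m ᵥ* X) (sPlus m)) • sMinus m =
      row 0 (middle (sMinus m ᵥ* X)) 0 := by
  have h0 : form p (sMinus m ᵥ* X) (sMinus m) = 0 := by
    have := form_vecMul_skew hX (sMinus m) (sMinus m)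
    rw [form_comm (sMinus m)] at this; linarith
  set x := sMinus m ᵥ* X
  have h1 := form_sPlus hp hm x
  have h2 := form_sMinus hp hm x
  apply row_ext
  · simp only [Pi.add_apply, Pi.smul_apply, smul_eq_mul, row_zero, sMinus]; linarith
  · rw [middle_row]; funext k
    simp only [middle, Pi.add_apply, Pi.smul_apply, smul_eq_mul, sMinus, row_mid]; simp
  · simp only [Pi.add_apply, Pi.smul_apply, smul_eq_mul, row_last, sMinus]; linarith

theorem sPlus_vecMul_skew (hp : 2 ≤ p) (hm : p ≤ m) {X : Mat m}
    (hX : X ∈ lieAlg p m) : sPlus m ᵥ* X + (1 / 2 * form p (sPlus m ᵥ* X) (sMinus m)) • sPlus m =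
      row 0 (middle (sPlus m ᵥ* X)) 0 := by
  have h0 : form p (sPlus m ᵥ* X) (sPlus m) = 0 := by
    have := form_vecMul_skew hX (sPlus m) (sPlus m)
    rw [form_comm (sPlus m)] at this; linarith
  set x := sPlus m ᵥ* X
  have h1 := form_sPlus hp hm x
  have h2 := form_sMinus hp hm x
  apply row_ext
  · simp only [Pi.add_apply, Pi.smul_apply, smul_eq_mul, row_zero, sPlus]; linarith
  · rw [middle_row]; funext k
    simp only [middle, Pi.add_apply, Pi.smul_apply, smul_eq_mul, sPlus, row_mid]; simp
  · simp only [Pi.add_apply, Pi.smul_apply, smul_eq_mul, row_last, sPlus]; linarith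

theorem sMinus_vecMul_tX (hp : 2 ≤ p) (hm : p ≤ m) (i : Fin m) :
    sMinus m ᵥ* tX p i = (2 : ℝ) • midBas i := by
  rw [vecMul_tX, form_sMinus_midBas hp hm, form_sMinus_sPlus hp hm]; module

theorem sPlus_vecMul_tY (hp : 2 ≤ p) (hm : p ≤ m) (i : Fin m) :
    sPlus m ᵥ* tY p i = (2 : ℝ) • midBas i := by
  rw [vecMul_tY, form_sPlus_midBas hp hm, form_comm (sPlus m), form_sMinus_sPlus hp hm]; module

theorem evalMat_Dx_z₀ (hp : 2 ≤ p) (hm : p ≤ m) {X : Mat m}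
    (hX : X ∈ lieAlg p m) (Q : PolyMat m) : evalMat (z₀ p m) (Dx X Q) =
      ∑ i : Fin m, (1 / 2 * middle (sMinus m ᵥ* X) i : ℂ) * evalMat (z₀ p m) (Dx (tX p i) Q) := by
  have h := evalMat_derivation_congr (z₀ p m) (D := Dx X)
    (D' := ∑ i : Fin m, (1 / 2 * middle (sMinus m ᵥ* X) i : ℂ) • Dx (tX p i)) (fun a b => by
      rw [derivation_sum_apply, map_sum]
      simp only [Derivation.smul_apply, map_smul, evalMat_Dx_X_z₀ hp hm, smul_eq_mul,
        sMinus_vecMul_skew hp hm hX, sMinus_vecMul_skew hp hm (tX_mem _)]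
      rw [← sum_smul_midBas]
      have e : ∀ i : Fin m, row 0 (middle (sMinus m ᵥ* tX p i)) 0 = (2 : ℝ) • midBas i := by
        intro i
        rw [sMinus_vecMul_tX hp hm, midBas, row_smul, middle_row]; simp
      simp only [e]
      simp only [Finset.sum_apply, Pi.smul_apply, smul_eq_mul]
      push_cast
      rw [Finset.mul_sum]
      exact Finset.sum_congr rfl fun i _ => by ring) Q
  rw [h, derivation_sum_apply, map_sum]
  simp only [Derivation.smul_apply, map_smul, smul_eq_mul]

theorem evalMat_Dy_z₀ (hp : 2 ≤ p) (hm : p ≤ m) {X : Mat m}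
    (hX : X ∈ lieAlg p m) (Q : PolyMat m) : evalMat (z₀ p m) (Dy X Q) =
      ∑ i : Fin m, (1 / 2 * middle (sPlus m ᵥ* X) i : ℂ) * evalMat (z₀ p m) (Dy (tY p i) Q) := by
  have h := evalMat_derivation_congr (z₀ p m) (D := Dy X)
    (D' := ∑ i : Fin m, (1 / 2 * middle (sPlus m ᵥ* X) i : ℂ) • Dy (tY p i)) (fun a b => by
      rw [derivation_sum_apply, map_sum]
      simp only [Derivation.smul_apply, map_smul, evalMat_Dy_X_z₀ hp hm hX,
        evalMat_Dy_X_z₀ hp hm (tY_mem _), smul_eq_mul,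
        sPlus_vecMul_skew hp hm hX, sPlus_vecMul_skew hp hm (tY_mem _)]
      rw [← sum_smul_midBas]
      have e : ∀ i : Fin m, row 0 (middle (sPlus m ᵥ* tY p i)) 0 = (2 : ℝ) • midBas i := by
        intro i
        rw [sPlus_vecMul_tY hp hm, midBas, row_smul, middle_row]; simp
      simp only [e]
      simp only [Finset.sum_apply, Pi.smul_apply, smul_eq_mul]
      push_cast
      rw [Finset.mul_sum]
      exact Finset.sum_congr rfl fun i _ => by ring) Q
  rw [h, derivation_sum_apply, map_sum]
  simp only [Derivation.smul_apply, map_smul, smul_eq_mul]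

theorem Dy_tY_tau_z₀ (hp : 2 ≤ p) (hm : p ≤ m) {X : Mat m}
    (i : Fin m) : evalMat (z₀ p m) (Dy (tY p i) (tau X)) =
      -(lamMid p i : ℂ) * middle (sMinus m ᵥ* X) i := by
  rw [Dy_tau, map_sub, map_mul, evalMat_tau_tY hp hm, evalMat_tau_z₀ hp hm (X * _), ← vecMul_vecMul,
    form_vecMul_skew (tY_mem i), sPlus_vecMul_tY hp hm, form_smul_right, form_midBas_right hp hm]
  push_cast; ring

theorem Dx_tX_tau_z₀ (hp : 2 ≤ p) (hm : p ≤ m) {X : Mat m}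
    (hX : X ∈ lieAlg p m) (i : Fin m) : evalMat (z₀ p m) (Dx (tX p i) (tau X)) =
      (lamMid p i : ℂ) * middle (sPlus m ᵥ* X) i := by
  rw [Dx_tau, map_sub, map_mul, evalMat_tau_tX hp hm, evalMat_tau_z₀ hp hm (_ * X), ← vecMul_vecMul,
    form_vecMul_skew hX, sMinus_vecMul_tX hp hm, form_smul_left, form_comm (midBas i),
    form_midBas_right hp hm]
  push_cast; ring

theorem DxDy_tau_z₀ (hp : 2 ≤ p) (hm : p ≤ m) {X : Mat m}
    (hX : X ∈ lieAlg p m) (i : Fin m) :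
    evalMat (z₀ p m) (Dx (tX p i) (Dy (tY p i) (tau X))) =
      2 * (lamMid p i : ℂ) * evalMat (z₀ p m) (tau X) := by
  rw [Dy_tau, map_sub, Derivation.leibniz, Dx_tau _ (tY p i), Dx_tau _ (X * _)]
  simp only [map_sub, map_add, map_mul, smul_eq_mul, evalMat_tau_tY hp hm, evalMat_tau_tX hp hm,
    tau_tX_mul_tY hp hm]
  have : evalMat (z₀ p m) (tau (tX p i * (X * tY p i))) = 0 := by
    have h0 := form_vecMul_skew hX (midBas i) (midBas i)
    rw [form_comm (midBas i)] at h0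
    have h1 : form p (midBas i ᵥ* X) (midBas i) = 0 := by linarith
    rw [evalMat_tau_z₀ hp hm, ← vecMul_vecMul, ← vecMul_vecMul, form_vecMul_skew (tY_mem i),
      sPlus_vecMul_tY hp hm, sMinus_vecMul_tX hp hm, smul_vecMul, form_smul_left, form_smul_right, h1]
    simp
  rw [this]; ring

theorem lap2_tau_mul (hp : 2 ≤ p) (hm : p ≤ m) {X : Mat m}
    (hX : X ∈ lieAlg p m) (Q : PolyMat m) : lap2 p (tau X * Q) =
      2 * m * evalMat (z₀ p m) (tau X * Q) - 2 * evalMat (z₀ p m) (Dx X Q) +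
        2 * evalMat (z₀ p m) (Dy X Q) + evalMat (z₀ p m) (tau X) * lap2 p Q := by
  have hl : ∀ i : Fin m, (lamMid p i : ℂ) * (lamMid p i : ℂ) = 1 := fun i => by
    exact_mod_cast lamMid_mul_self (p := p) i
  have h : ∀ i : Fin m, (lamMid p i : ℂ) * evalMat (z₀ p m) (Dx (tX p i) (Dy (tY p i) (tau X * Q))) =
      2 * evalMat (z₀ p m) (tau X * Q) * ((lamMid p i : ℂ) * (lamMid p i : ℂ)) -
      2 * ((1 / 2 * middle (sMinus m ᵥ* X) i : ℂ) * evalMat (z₀ p m) (Dx (tX p i) Q)) +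
      2 * ((1 / 2 * middle (sPlus m ᵥ* X) i : ℂ) * evalMat (z₀ p m) (Dy (tY p i) Q)) +
      evalMat (z₀ p m) (tau X) * ((lamMid p i : ℂ) * evalMat (z₀ p m) (Dx (tX p i) (Dy (tY p i) Q))) := by
    intro i
    rw [Derivation.leibniz, map_add, smul_eq_mul, smul_eq_mul, Derivation.leibniz, Derivation.leibniz]
    simp only [map_add, map_mul, smul_eq_mul, DxDy_tau_z₀ hp hm hX, Dx_tX_tau_z₀ hp hm hX,
      Dy_tY_tau_z₀ hp hm]
    linear_combination ((middle (sPlus m ᵥ* X) i : ℂ) * evalMat (z₀ p m) (Dy (tY p i) Q) -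
      (middle (sMinus m ᵥ* X) i : ℂ) * evalMat (z₀ p m) (Dx (tX p i) Q)) * hl i
  rw [lap2, Finset.sum_congr rfl fun i _ => h i]
  simp only [Finset.sum_add_distrib, Finset.sum_sub_distrib, ← Finset.mul_sum]
  rw [sum_lamMid_sq, ← evalMat_Dx_z₀ hp hm hX, ← evalMat_Dy_z₀ hp hm hX, lap2]
  ring

theorem conj_mem_lieAlg {g X : Mat m} (hg : g ∈ orth p m)
    (hX : X ∈ lieAlg p m) : g * X * g⁻¹ ∈ lieAlg p m := by
  rw [mem_lieAlg] at hX ⊢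
  have h1 : gram p m * g⁻¹ᵀ = g * gram p m := by
    rw [orth_inv_eq hg]
    simp only [transpose_mul, transpose_transpose, gram_transpose, ← Matrix.mul_assoc, gram_mul_gram,
      Matrix.one_mul]
  have h2 : gram p m * gᵀ = g⁻¹ * gram p m := by
    rw [orth_inv_eq hg, Matrix.mul_assoc _ (gram p m), gram_mul_gram, Matrix.mul_one]
  rw [transpose_mul, transpose_mul, ← Matrix.mul_assoc, h1, Matrix.mul_assoc, ← Matrix.mul_assoc _ Xᵀ,
    hX, Matrix.neg_mul, Matrix.mul_assoc X, h2, Matrix.mul_neg]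
  simp only [Matrix.mul_assoc]

/-- The linear function `tr (z X)` on `Ω`. -/
def tauS (p : ℕ) {m : ℕ} (X : Mat m) : polyOmega p m :=
  toPoly p m (tau X)

theorem laplace₂_tau_mul (hp : 2 ≤ p) (hm : p ≤ m) {X : Mat m}
    (hX : X ∈ lieAlg p m) (Q : PolyMat m) (z : Omega p m) :
    laplace₂ (tauS p X * toPoly p m Q).1 z = 2 * m * (tauS p X * toPoly p m Q).1 z -
      2 * (toPoly p m (Dx X Q)).1 z + 2 * (toPoly p m (Dy X Q)).1 z +
        (tauS p X).1 z * laplace₂ (toPoly p m Q).1 z := by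
  have hX' := conj_mem_lieAlg (base_orth z) hX
  have h := lap2_tau_mul hp hm hX' (trans (base z) Q)
  rw [← trans_Dx (base_orth z), ← trans_Dy (base_orth z), ← trans_tau, ← map_mul,
    evalMat_trans_base, evalMat_trans_base, evalMat_trans_base, evalMat_trans_base] at h
  rw [tauS, ← map_mul, laplace₂_toPoly hp hm, laplace₂_toPoly hp hm, h]

theorem LS_apply_eq (hp : 2 ≤ p) (hm : p ≤ m) {X : Mat m}
    (hX : X ∈ lieAlg p m) (σ : ℂ) (F : polyOmega p m) (z : Omega p m) :
    (LS p σ X F).1 z = 1 / 2 * (adS p X F).1 z + (σ + m / 2) * (tauS p X * F).1 z -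
      1 / 4 * (laplace₂ (tauS p X * F).1 z - (tauS p X).1 z * laplace₂ F.1 z) := by
  obtain ⟨Q, rfl⟩ := toPoly_surjective F
  rw [laplace₂_tau_mul hp hm hX, LS_toPoly hp hm hX, adS_toPoly hp hm hX, tauS, ← map_mul, adD]
  simp only [toPoly_apply]
  simp only [Lop_apply, map_add, map_smul, smul_eq_mul, Derivation.add_apply]
  ring

theorem RS_apply_eq (hp : 2 ≤ p) (hm : p ≤ m) {X : Mat m}
    (hX : X ∈ lieAlg p m) (σ : ℂ) (F : polyOmega p m) (z : Omega p m) :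
    (RS p (-(m : ℂ) - σ) X F).1 z = 1 / 2 * (adS p X F).1 z + (σ + m / 2) * (tauS p X * F).1 z +
      1 / 4 * (laplace₂ (tauS p X * F).1 z - (tauS p X).1 z * laplace₂ F.1 z) := by
  obtain ⟨Q, rfl⟩ := toPoly_surjective F
  rw [laplace₂_tau_mul hp hm hX, RS_toPoly hp hm hX, adS_toPoly hp hm hX, tauS, ← map_mul, adD]
  simp only [toPoly_apply]
  simp only [Rop_apply, map_add, map_sub, map_smul, smul_eq_mul, Derivation.add_apply]
  ring

/-- The bidifferential operator in the first term of the expansion of the product. -/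
def gam {p m : ℕ} (F₁ F₂ : Omega p m → ℂ) (z : Omega p m) : ℂ :=
  -(1 / 2) * ∑ i : Fin m, (lamMid p i : ℂ) *
    (deriv (fun t : ℝ => translate F₁ z 0 (Pi.single i t)) 0 *
        deriv (fun s : ℝ => translate F₂ z (Pi.single i s) 0) 0)

theorem poisson_eq_gam (F₁ F₂ : Omega p m → ℂ) (z : Omega p m) :
    poisson F₁ F₂ z = gam F₂ F₁ z - gam F₁ F₂ z := by
  simp only [poisson, gam, mul_sub, Finset.sum_sub_distrib]
  have : ∀ i : Fin m, (lamMid p i : ℂ) * (deriv (fun s : ℝ => translate F₁ z (Pi.single i s) 0) 0 *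
      deriv (fun t : ℝ => translate F₂ z 0 (Pi.single i t)) 0) = (lamMid p i : ℂ) *
      (deriv (fun t : ℝ => translate F₂ z 0 (Pi.single i t)) 0 *
        deriv (fun s : ℝ => translate F₁ z (Pi.single i s) 0) 0) := fun i => by ring
  rw [Finset.sum_congr rfl fun i _ => this i]; ring

theorem gam_toPoly (hp : 2 ≤ p) (hm : p ≤ m) (P Q : PolyMat m) (z : Omega p m) :
    gam (toPoly p m P).1 (toPoly p m Q).1 z = -(1 / 2) * ∑ i : Fin m, (lamMid p i : ℂ) *
      (evalMat (z₀ p m) (Dy (tY p i) (trans (base z) P)) *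
        evalMat (z₀ p m) (Dx (tX p i) (trans (base z) Q))) := by
  have : proj p (uVec p 0) (sPlus m) = z₀ p m := by rw [uVec_zero, z₀]
  simp only [gam, deriv_translate_eta hp hm, deriv_translate_xi hp hm, this]

theorem gam_tau (hp : 2 ≤ p) (hm : p ≤ m) {X : Mat m}
    (hX : X ∈ lieAlg p m) (Q : PolyMat m) (z : Omega p m) :
    gam (tauS p X).1 (toPoly p m Q).1 z = (toPoly p m (Dx X Q)).1 z := by
  have hX' := conj_mem_lieAlg (base_orth z) hX
  rw [tauS, gam_toPoly hp hm, ← evalMat_trans_base, trans_Dx (base_orth z), trans_tau,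
    evalMat_Dx_z₀ hp hm hX', Finset.mul_sum]
  refine Finset.sum_congr rfl fun i _ => ?_
  have hl : (lamMid p i : ℂ) * (lamMid p i : ℂ) = 1 := by exact_mod_cast lamMid_mul_self (p := p) i
  rw [Dy_tY_tau_z₀ hp hm]
  linear_combination (1 / 2 * (middle (sMinus m ᵥ* (base z * X * (base z)⁻¹)) i : ℂ) *
    evalMat (z₀ p m) (Dx (tX p i) (trans (base z) Q))) * hl

theorem gam_mul_left (hp : 2 ≤ p) (hm : p ≤ m) (F G H : polyOmega p m) (z : Omega p m) :
    gam (F * G).1 H.1 z = F.1 z * gam G.1 H.1 z + G.1 z * gam F.1 H.1 z := by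
  obtain ⟨P, rfl⟩ := toPoly_surjective F
  obtain ⟨Q, rfl⟩ := toPoly_surjective G
  obtain ⟨R, rfl⟩ := toPoly_surjective H
  rw [← map_mul, gam_toPoly hp hm, gam_toPoly hp hm, gam_toPoly hp hm, ← evalMat_trans_base P,
    ← evalMat_trans_base Q]
  simp only [Finset.mul_sum, ← Finset.sum_add_distrib, map_mul, Derivation.leibniz, map_add,
    smul_eq_mul]
  exact Finset.sum_congr rfl fun i _ => by ring

theorem gam_mul_right (hp : 2 ≤ p) (hm : p ≤ m) (F G H : polyOmega p m) (z : Omega p m) :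
    gam F.1 (G * H).1 z = G.1 z * gam F.1 H.1 z + H.1 z * gam F.1 G.1 z := by
  obtain ⟨P, rfl⟩ := toPoly_surjective F
  obtain ⟨Q, rfl⟩ := toPoly_surjective G
  obtain ⟨R, rfl⟩ := toPoly_surjective H
  rw [← map_mul, gam_toPoly hp hm, gam_toPoly hp hm, gam_toPoly hp hm, ← evalMat_trans_base R,
    ← evalMat_trans_base Q]
  simp only [Finset.mul_sum, ← Finset.sum_add_distrib, map_mul, Derivation.leibniz, map_add,
    smul_eq_mul]
  exact Finset.sum_congr rfl fun i _ => by ring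

theorem gam_add_left (hp : 2 ≤ p) (hm : p ≤ m) (F G H : polyOmega p m) (z : Omega p m) :
    gam (F + G).1 H.1 z = gam F.1 H.1 z + gam G.1 H.1 z := by
  obtain ⟨P, rfl⟩ := toPoly_surjective F
  obtain ⟨Q, rfl⟩ := toPoly_surjective G
  obtain ⟨R, rfl⟩ := toPoly_surjective H
  rw [← map_add, gam_toPoly hp hm, gam_toPoly hp hm, gam_toPoly hp hm]
  simp only [Finset.mul_sum, ← Finset.sum_add_distrib, map_add]
  exact Finset.sum_congr rfl fun i _ => by ring

theorem gam_smul_left (hp : 2 ≤ p) (hm : p ≤ m) (c : ℂ) (F H : polyOmega p m) (z : Omega p m) :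
    gam (c • F).1 H.1 z = c * gam F.1 H.1 z := by
  obtain ⟨P, rfl⟩ := toPoly_surjective F
  obtain ⟨R, rfl⟩ := toPoly_surjective H
  rw [← map_smul, gam_toPoly hp hm, gam_toPoly hp hm]
  simp only [Finset.mul_sum, map_smul, Derivation.map_smul, smul_eq_mul]
  exact Finset.sum_congr rfl fun i _ => by ring

end FirstOrder

section Roots

variable {p m : ℕ}

/-! ### Brackets of the Lie algebra acting on `S(G/H)` -/

theorem adD_adD (X Y : Mat m) (P : PolyMat m) :
    adD Y (adD X P) = adD X (adD Y P) + adD (Y * X - X * Y) P := by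
  have h : ∀ Z, adD Z P = Dx Z P + Dy Z P := fun Z => rfl
  have h' : ∀ Q, adD X Q = Dx X Q + Dy X Q := fun Z => rfl
  rw [h X, map_add, adD_Dx, adD_Dy, h', h (Y * X - X * Y)]; ring

theorem bracket_mem {X Y : Mat m} (hX : X ∈ lieAlg p m)
    (hY : Y ∈ lieAlg p m) : X * Y - Y * X ∈ lieAlg p m := by
  rw [mem_lieAlg] at *
  have h : ∀ {X Y : Mat m}, gram p m * Xᵀ = -(X * gram p m) →
      gram p m * Yᵀ = -(Y * gram p m) → gram p m * (Xᵀ * Yᵀ) = X * Y * gram p m := by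
    intro X Y hX hY
    rw [← Matrix.mul_assoc, hX, Matrix.neg_mul, Matrix.mul_assoc, hY, Matrix.mul_neg, neg_neg,
      Matrix.mul_assoc]
  rw [transpose_sub, transpose_mul, transpose_mul, Matrix.mul_sub, h hX hY, h hY hX, Matrix.sub_mul,
    neg_sub]

theorem adS_adS (hp : 2 ≤ p) (hm : p ≤ m) {X Y : Mat m}
    (hX : X ∈ lieAlg p m) (hY : Y ∈ lieAlg p m) (F : polyOmega p m) :
    adS p Y (adS p X F) = adS p X (adS p Y F) + adS p (Y * X - X * Y) F := by
  obtain ⟨P, rfl⟩ := toPoly_surjective F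
  simp only [adS_toPoly hp hm hX, adS_toPoly hp hm hY, adS_toPoly hp hm (bracket_mem hY hX), adD_adD X Y,
    map_add]

theorem adD_add (X Y : Mat m) (P : PolyMat m) :
    adD (X + Y) P = adD X P + adD Y P := by
  simp only [adD, Derivation.add_apply, Dx_add, Dy_add]; ring

theorem adD_smul (c : ℝ) (X : Mat m) (P : PolyMat m) :
    adD (c • X) P = (c : ℂ) • adD X P := by
  simp only [adD, Derivation.add_apply, Dx_smul, Dy_smul, Derivation.smul_apply, smul_add]

theorem adS_add (hp : 2 ≤ p) (hm : p ≤ m) {X Y : Mat m}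
    (hX : X ∈ lieAlg p m) (hY : Y ∈ lieAlg p m) (F : polyOmega p m) :
    adS p (X + Y) F = adS p X F + adS p Y F := by
  obtain ⟨P, rfl⟩ := toPoly_surjective F
  simp only [adS_toPoly hp hm hX, adS_toPoly hp hm hY, adS_toPoly hp hm (Submodule.add_mem _ hX hY),
    adD_add, map_add]

theorem adS_smul (hp : 2 ≤ p) (hm : p ≤ m) (c : ℝ) {X : Mat m}
    (hX : X ∈ lieAlg p m) (F : polyOmega p m) : adS p (c • X) F = (c : ℂ) • adS p X F := by
  obtain ⟨P, rfl⟩ := toPoly_surjective F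
  simp only [adS_toPoly hp hm hX, adS_toPoly hp hm (Submodule.smul_mem _ c hX), adD_smul, map_smul]

theorem adS_mul (hp : 2 ≤ p) (hm : p ≤ m) {X : Mat m}
    (hX : X ∈ lieAlg p m) (F G : polyOmega p m) :
    adS p X (F * G) = F * adS p X G + G * adS p X F := by
  obtain ⟨P, rfl⟩ := toPoly_surjective F
  obtain ⟨Q, rfl⟩ := toPoly_surjective G
  rw [← map_mul, adS_toPoly hp hm hX, adS_toPoly hp hm hX, adS_toPoly hp hm hX, Derivation.leibniz]
  simp only [map_add, map_mul, smul_eq_mul]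

theorem wedge_mul_sub {X : Mat m} (hX : X ∈ lieAlg p m)
    (a b : Row m) :
    wedge p a b * X - X * wedge p a b = wedge p (a ᵥ* X) b + wedge p a (b ᵥ* X) := by
  refine Matrix.ext_of_single_vecMul fun i => ?_
  simp only [vecMul_sub, vecMul_add, ← vecMul_vecMul, vecMul_wedge, sub_vecMul, smul_vecMul,
    form_vecMul_skew hX]
  module

theorem wedge_smul_left (c : ℝ) (a b : Row m) :
    wedge p (c • a) b = c • wedge p a b := by
  rw [wedge, wedge, mulVec_smul, smul_vecMulVec, vecMulVec_smul, smul_sub]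

theorem wedge_add_left (a b c : Row m) :
    wedge p (a + b) c = wedge p a c + wedge p b c := by
  refine Matrix.ext_of_single_vecMul fun i => ?_
  simp only [vecMul_wedge, vecMul_add, form_add_right]
  module

theorem wedge_add_right (a b c : Row m) :
    wedge p a (b + c) = wedge p a b + wedge p a c := by
  refine Matrix.ext_of_single_vecMul fun i => ?_
  simp only [vecMul_wedge, vecMul_add, form_add_right]
  module

theorem wedge_sub_left (a b c : Row m) :
    wedge p (a - b) c = wedge p a c - wedge p b c := by
  refine Matrix.ext_of_single_vecMul fun i => ?_
  simp only [vecMul_wedge, vecMul_sub, form_sub_right]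
  module

theorem wedge_sub_right (a b c : Row m) :
    wedge p a (b - c) = wedge p a b - wedge p a c := by
  refine Matrix.ext_of_single_vecMul fun i => ?_
  simp only [vecMul_wedge, vecMul_sub, form_sub_right]
  module

theorem wedge_swap (a b : Row m) : wedge p b a = -wedge p a b := by
  rw [wedge, wedge, neg_sub]

theorem wedge_self (a : Row m) : wedge p a a = 0 := by
  rw [wedge, sub_self]

/-- Wedges of basis rows span the Lie algebra. -/
theorem lieAlg_le {D : Submodule ℝ (Mat m)}
    (h : ∀ i j, i < j → wedge p (bas i) (bas j) ∈ D) : lieAlg p m ≤ D := by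
  intro X hX
  have h' : ∀ i j, wedge p (bas i) (bas j) ∈ D := by
    intro i j
    rcases lt_trichotomy i j with hij | rfl | hij
    · exact h i j hij
    · rw [wedge_self]; exact D.zero_mem
    · rw [wedge_swap]; exact D.neg_mem (h j i hij)
  have h1 : ∀ i v, wedge p (bas i) v ∈ D := by
    intro i v
    have h2 : ∀ s : Finset (Fin (m + 2)),
        wedge p (bas i) (∑ j ∈ s, (lam p j * form p v (bas j)) • bas j) ∈ D := by
      intro s
      induction s using Finset.induction_on with
      | empty =>
        rw [Finset.sum_empty, show wedge p (bas i) 0 = 0 by simp [wedge]]; exact D.zero_mem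
      | insert a s ha ih =>
        rw [Finset.sum_insert ha, wedge_add_right, wedge_smul_right]
        exact D.add_mem (D.smul_mem _ (h' i a)) ih
    rw [← sum_lam_form_smul (p := p) v]
    exact h2 _
  have h2 : X = (1 / 2 : ℝ) • ∑ i, lam p i • wedge p (bas i) (bas i ᵥ* X) := by
    refine Matrix.ext_of_single_vecMul fun k => ?_
    set x : Row m := Pi.single k 1
    have e1 : ∀ i : Fin (m + 2), x ᵥ* (lam p i • wedge p (bas i) (bas i ᵥ* X)) =
        ((lam p i * form p x (bas i)) • (bas i : Row m)) ᵥ* X +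
          (lam p i * form p (x ᵥ* X) (bas i)) • bas i := by
      intro i
      rw [vecMul_smul, vecMul_wedge, smul_vecMul, form_vecMul_skew hX]
      module
    rw [vecMul_smul, vecMul_sum, Finset.sum_congr rfl fun i _ => e1 i, Finset.sum_add_distrib,
      ← sum_vecMul, sum_lam_form_smul, sum_lam_form_smul]
    module
  rw [h2]
  exact D.smul_mem _ (D.sum_mem fun i _ => D.smul_mem _ (h1 _ _))

end Roots

section Restricted

variable {p m : ℕ}

/-! ### The restricted root spaces -/

/-- The last but one index. -/
abbrev pen (m : ℕ) : Fin (m + 2) := (Fin.last m).castSucc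

/-- The row of weight `-t₁`. -/
def rowA (m : ℕ) : Row m := bas (pen m) - bas 0

/-- The row of weight `t₁`. -/
def rowA' (m : ℕ) : Row m := bas (pen m) + bas 0

/-- The row of weight `-t₂`. -/
def rowB (m : ℕ) : Row m := bas (Fin.last (m + 1)) - bas 1

/-- The row of weight `t₂`. -/
def rowB' (m : ℕ) : Row m := bas (Fin.last (m + 1)) + bas 1

/-- The element `A_t`, `t = (1, 0)`. -/
def carA (p m : ℕ) : Mat m := wedge p (bas (pen m)) (bas 0)

/-- The element `A_t`, `t = (0, 1)`. -/
def carB (p m : ℕ) : Mat m :=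
  wedge p (bas (Fin.last (m + 1))) (bas 1)

theorem carA_mem : carA p m ∈ lieAlg p m := wedge_mem _ _

theorem carB_mem : carB p m ∈ lieAlg p m := wedge_mem _ _

theorem lam_second (hp : 2 ≤ p) : lam p (1 : Fin (m + 2)) = -1 := by
  simp [lam]; omega

theorem lam_pen (hm : p ≤ m) : lam p (pen m) = 1 := by
  simp [lam, pen]; omega

/-- A row of weight `r₁ t₁ + r₂ t₂`. -/
structure IsWt (p : ℕ) {m : ℕ} (u : Row m) (r₁ r₂ : ℝ) : Prop where
  left : u ᵥ* carA p m = r₁ • u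
  right : u ᵥ* carB p m = r₂ • u

theorem form_bas_bas (i j : Fin (m + 2)) :
    form p (bas i) (bas j) = if i = j then lam p j else 0 := by
  rw [form_bas_right]
  simp [Pi.single_apply, eq_comm]

theorem distinct_indices (hp : 2 ≤ p) (hm : p ≤ m) :
    (0 : Fin (m + 2)) ≠ 1 ∧ (0 : Fin (m + 2)) ≠ pen m ∧ (0 : Fin (m + 2)) ≠ Fin.last (m + 1) ∧
      (1 : Fin (m + 2)) ≠ pen m ∧ (1 : Fin (m + 2)) ≠ Fin.last (m + 1) ∧ pen m ≠ Fin.last (m + 1) := by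
  simp only [ne_eq, Fin.ext_iff, pen, Fin.val_zero, Fin.val_one, Fin.val_castSucc, Fin.val_last]
  omega

theorem isWt_rowA (hp : 2 ≤ p) (hm : p ≤ m) : IsWt p (rowA m) (-1) 0 := by
  obtain ⟨h1, h2, h3, h4, h5, h6⟩ := distinct_indices hp hm
  constructor <;>
  · simp only [rowA, carA, carB, vecMul_wedge, form_sub_left, form_bas_bas, h1, h2, h3, h6,
      h2.symm, h4.symm, lam_first (m := m) hp, lam_second hp, lam_pen hm,
      lam_last hm, if_true, if_false]
    module

theorem isWt_rowA' (hp : 2 ≤ p) (hm : p ≤ m) : IsWt p (rowA' m) 1 0 := by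
  obtain ⟨h1, h2, h3, h4, h5, h6⟩ := distinct_indices hp hm
  constructor <;>
  · simp only [rowA', carA, carB, vecMul_wedge, form_add_left, form_bas_bas, h1, h2, h3, h6,
      h2.symm, h4.symm, lam_first (m := m) hp, lam_second hp, lam_pen hm,
      lam_last hm, if_true, if_false]
    module

theorem isWt_rowB (hp : 2 ≤ p) (hm : p ≤ m) : IsWt p (rowB m) 0 (-1) := by
  obtain ⟨h1, h2, h3, h4, h5, h6⟩ := distinct_indices hp hm
  constructor <;>
  · simp only [rowB, carA, carB, vecMul_wedge, form_sub_left, form_bas_bas, h4, h5,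
      h1.symm, h3.symm, h5.symm, h6.symm, lam_first (m := m) hp, lam_second hp, lam_pen hm,
      lam_last hm, if_true, if_false]
    module

theorem isWt_rowB' (hp : 2 ≤ p) (hm : p ≤ m) : IsWt p (rowB' m) 0 1 := by
  obtain ⟨h1, h2, h3, h4, h5, h6⟩ := distinct_indices hp hm
  constructor <;>
  · simp only [rowB', carA, carB, vecMul_wedge, form_add_left, form_bas_bas, h4, h5,
      h1.symm, h3.symm, h5.symm, h6.symm, lam_first (m := m) hp, lam_second hp, lam_pen hm,
      lam_last hm, if_true, if_false]
    module

/-- The index of a row of weight zero. -/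
def IsInner {m : ℕ} (k : Fin (m + 2)) : Prop := k ≠ 0 ∧ k ≠ 1 ∧ k ≠ pen m ∧ k ≠ Fin.last (m + 1)

theorem isWt_bas {k : Fin (m + 2)} (hk : IsInner k) : IsWt p (bas k) 0 0 := by
  obtain ⟨h1, h2, h3, h4⟩ := hk
  constructor <;>
  · simp only [carA, carB, vecMul_wedge, form_bas_bas, h1, h2, h3, h4, if_false]
    module

theorem form_rowA_rowA' (hp : 2 ≤ p) (hm : p ≤ m) : form p (rowA m) (rowA' m) = 2 := by
  obtain ⟨h1, h2, h3, h4, h5, h6⟩ := distinct_indices hp hm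
  simp only [rowA, rowA', form_add_right, form_sub_left, form_bas_bas, h2, h2.symm, lam_first (m := m) hp,
    lam_pen hm, if_true, if_false]
  norm_num

theorem form_rowB_rowB' (hp : 2 ≤ p) (hm : p ≤ m) : form p (rowB m) (rowB' m) = 2 := by
  obtain ⟨h1, h2, h3, h4, h5, h6⟩ := distinct_indices hp hm
  simp only [rowB, rowB', form_add_right, form_sub_left, form_bas_bas, h5, h5.symm, lam_second hp,
    lam_last hm, if_true, if_false]
  norm_num

/-- Rows whose weights do not cancel are orthogonal. -/
theorem IsWt.form_eq_zero {u v : Row m} {r₁ r₂ s₁ s₂ : ℝ} (hu : IsWt p u r₁ r₂)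
    (hv : IsWt p v s₁ s₂) (h : r₁ + s₁ ≠ 0 ∨ r₂ + s₂ ≠ 0) : form p u v = 0 := by
  have h1 := form_vecMul_skew (carA_mem (p := p)) u v
  have h2 := form_vecMul_skew (carB_mem (p := p)) u v
  rw [hu.left, hv.left, form_smul_left, form_smul_right] at h1
  rw [hu.right, hv.right, form_smul_left, form_smul_right] at h2
  rcases h with h | h
  · exact (mul_eq_zero.1 (show (r₁ + s₁) * form p u v = 0 by linarith)).resolve_left h
  · exact (mul_eq_zero.1 (show (r₂ + s₂) * form p u v = 0 by linarith)).resolve_left h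

/-- A root vector of the root `r₁ t₁ + r₂ t₂`. -/
structure IsRoot (p : ℕ) {m : ℕ} (Y : Mat m) (r₁ r₂ : ℝ) : Prop where
  mem : Y ∈ lieAlg p m
  left : carA p m * Y - Y * carA p m = r₁ • Y
  right : carB p m * Y - Y * carB p m = r₂ • Y

theorem IsWt.wedge {u v : Row m} {r₁ r₂ s₁ s₂ : ℝ} (hu : IsWt p u r₁ r₂)
    (hv : IsWt p v s₁ s₂) : IsRoot p (wedge p u v) (-(r₁ + s₁)) (-(r₂ + s₂)) := by
  refine ⟨wedge_mem _ _, ?_, ?_⟩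
  · rw [← neg_sub, wedge_mul_sub carA_mem, hu.left, hv.left, wedge_smul_left, wedge_smul_right]
    module
  · rw [← neg_sub, wedge_mul_sub carB_mem, hu.right, hv.right, wedge_smul_left, wedge_smul_right]
    module

/-- Root vectors that span `𝔫`. -/
def posRoots (p m : ℕ) : Set (Mat m) :=
  {Y | Y = wedge p (rowA m) (rowB m) ∨ Y = wedge p (rowA m) (rowB' m) ∨
    ∃ k, IsInner k ∧ (Y = wedge p (rowA m) (bas k) ∨ Y = wedge p (rowB m) (bas k))}

theorem exists_isRoot (hp : 2 ≤ p) (hm : p ≤ m) {Y : Mat m}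
    (hY : Y ∈ posRoots p m) :
    ∃ r₁ r₂ : ℝ, IsRoot p Y r₁ r₂ ∧ (0 < r₁ ∨ (r₁ = 0 ∧ 0 < r₂)) ∧ 0 < 2 * r₁ + r₂ := by
  rcases hY with rfl | rfl | ⟨k, hk, rfl | rfl⟩
  · exact ⟨_, _, (isWt_rowA hp hm).wedge (isWt_rowB hp hm), by norm_num, by norm_num⟩
  · exact ⟨_, _, (isWt_rowA hp hm).wedge (isWt_rowB' hp hm), by norm_num, by norm_num⟩
  · exact ⟨_, _, (isWt_rowA hp hm).wedge (isWt_bas hk), by norm_num, by norm_num⟩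
  · exact ⟨_, _, (isWt_rowB hp hm).wedge (isWt_bas hk), by norm_num, by norm_num⟩

theorem cartan_eq (hp : 2 ≤ p) (hm : p ≤ m) (t₁ t₂ : ℝ) :
    cartan m t₁ t₂ = t₁ • carA p m + t₂ • carB p m := by
  obtain ⟨h1, h2, h3, h4, h5, h6⟩ := distinct_indices hp hm
  refine Matrix.ext_of_single_vecMul fun i => ?_
  change bas i ᵥ* _ = bas i ᵥ* _
  rw [vecMul_add, vecMul_smul, vecMul_smul, carA, carB, vecMul_wedge, vecMul_wedge]
  ext j
  simp only [bas, single_one_vecMul, Matrix.row, cartan, Pi.add_apply, Pi.smul_apply, Pi.sub_apply,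
    smul_eq_mul, form_single_right, Pi.single_apply, lam_first (m := m) hp, lam_second hp, lam_pen hm,
    lam_last hm]
  have e0 : ∀ i : Fin (m + 2), i = 0 ↔ (i : ℕ) = 0 := fun i => by rw [Fin.ext_iff]; rfl
  have e1 : ∀ i : Fin (m + 2), i = 1 ↔ (i : ℕ) = 1 := fun i => by rw [Fin.ext_iff]; rfl
  have em : ∀ i : Fin (m + 2), i = pen m ↔ (i : ℕ) = m := fun i => by rw [Fin.ext_iff]; rfl
  have el : ∀ i : Fin (m + 2), i = Fin.last (m + 1) ↔ (i : ℕ) = m + 1 := fun i => by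
    rw [Fin.ext_iff]; rfl
  simp only [eq_comm (b := i), e0, e1, em, el]
  have hm2 : 2 ≤ m := hp.trans hm
  split_ifs <;> first | (exfalso; omega) | ring1

theorem posRoots_subset_nilp (hp : 2 ≤ p) (hm : p ≤ m) : posRoots p m ⊆ nilp p m := by
  intro Y hY
  obtain ⟨r₁, r₂, h, hr, -⟩ := exists_isRoot hp hm hY
  refine Submodule.subset_span ⟨h.mem, r₁, r₂, hr, fun t₁ t₂ => ?_⟩
  rw [cartan_eq hp hm, Matrix.add_mul, Matrix.mul_add, Matrix.smul_mul, Matrix.smul_mul,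
    Matrix.mul_smul, Matrix.mul_smul, add_sub_add_comm, ← smul_sub, ← smul_sub, h.left, h.right]
  module

/-- The Lie algebra of the stabilizer of the initial point. -/
def stab (p m : ℕ) : Submodule ℝ (Mat m) where
  carrier := {X | X ∈ lieAlg p m ∧ middle (sMinus m ᵥ* X) = 0 ∧ middle (sPlus m ᵥ* X) = 0}
  zero_mem' := ⟨Submodule.zero_mem _, by simp; rfl, by simp; rfl⟩
  add_mem' := by
    rintro X Y ⟨h1, h2, h3⟩ ⟨k1, k2, k3⟩
    refine ⟨Submodule.add_mem _ h1 k1, ?_, ?_⟩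
    · rw [vecMul_add, show middle (sMinus m ᵥ* X + sMinus m ᵥ* Y) = middle (sMinus m ᵥ* X) +
        middle (sMinus m ᵥ* Y) from rfl, h2, k2, add_zero]
    · rw [vecMul_add, show middle (sPlus m ᵥ* X + sPlus m ᵥ* Y) = middle (sPlus m ᵥ* X) +
        middle (sPlus m ᵥ* Y) from rfl, h3, k3, add_zero]
  smul_mem' := by
    rintro c X ⟨h1, h2, h3⟩
    refine ⟨Submodule.smul_mem _ c h1, ?_, ?_⟩
    · rw [vecMul_smul, show middle (c • (sMinus m ᵥ* X)) = c • middle (sMinus m ᵥ* X) from rfl, h2,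
        smul_zero]
    · rw [vecMul_smul, show middle (c • (sPlus m ᵥ* X)) = c • middle (sPlus m ᵥ* X) from rfl, h3,
        smul_zero]

theorem exists_mid {i : Fin (m + 2)} (h0 : i ≠ 0) (hl : i ≠ Fin.last (m + 1)) :
    ∃ k : Fin m, i = k.succ.castSucc := by
  obtain ⟨j, rfl⟩ := Fin.exists_castSucc_eq.2 hl
  obtain ⟨k, rfl⟩ := Fin.exists_succ_eq.2 (show j ≠ 0 by rintro rfl; exact h0 rfl)
  exact ⟨k, rfl⟩

theorem wedge_mid_mem_stab {i j : Fin (m + 2)} (hi : i ≠ 0) (hi' : i ≠ Fin.last (m + 1)) (hj : j ≠ 0)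
    (hj' : j ≠ Fin.last (m + 1)) : wedge p (bas i) (bas j) ∈ stab p m := by
  obtain ⟨k, rfl⟩ := exists_mid hi hi'
  obtain ⟨l, rfl⟩ := exists_mid hj hj'
  refine ⟨wedge_mem _ _, ?_, ?_⟩ <;>
  · rw [vecMul_wedge, form_bas_right, form_bas_right]
    simp only [sMinus, sPlus, row_mid]
    simp; rfl

theorem wedge_ends_mem_stab : wedge p (bas 0) (bas (Fin.last (m + 1))) ∈ stab p m := by
  refine ⟨wedge_mem _ _, ?_, ?_⟩ <;>
  · rw [vecMul_wedge]
    funext k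
    have h1 : k.succ.castSucc ≠ (0 : Fin (m + 2)) := by simp [Fin.ext_iff]
    have h2 : k.succ.castSucc ≠ Fin.last (m + 1) := by
      simp [Fin.ext_iff]; omega
    simp only [middle, Pi.sub_apply, Pi.smul_apply, bas, Pi.single_apply, h1, h2, if_false]
    simp

theorem iwasawa (hp : 2 ≤ p) (hm : p ≤ m) : lieAlg p m ≤
    stab p m ⊔ Submodule.span ℝ {carA p m, carB p m} ⊔ Submodule.span ℝ (posRoots p m) := by
  obtain ⟨h1, h2, h3, h4, h5, h6⟩ := distinct_indices hp hm
  set D := stab p m ⊔ Submodule.span ℝ {carA p m, carB p m} ⊔ Submodule.span ℝ (posRoots p m)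
  have dS : ∀ {X}, X ∈ stab p m → X ∈ D := fun h =>
    Submodule.mem_sup_left (Submodule.mem_sup_left h)
  have dA : carA p m ∈ D := Submodule.mem_sup_left (Submodule.mem_sup_right
    (Submodule.subset_span (by simp)))
  have dB : carB p m ∈ D := Submodule.mem_sup_left (Submodule.mem_sup_right
    (Submodule.subset_span (by simp)))
  have dN : ∀ {X}, X ∈ posRoots p m → X ∈ D := fun h =>
    Submodule.mem_sup_right (Submodule.subset_span h)
  have n1 := dN (X := wedge p (rowA m) (rowB m)) (Or.inl rfl)
  have n2 := dN (X := wedge p (rowA m) (rowB' m)) (Or.inr (Or.inl rfl))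
  have s0 := dS (wedge_ends_mem_stab (p := p) (m := m))
  have hmid := fun {i j : Fin (m + 2)} (hi : i ≠ 0) (hi' : i ≠ Fin.last (m + 1)) (hj : j ≠ 0)
    (hj' : j ≠ Fin.last (m + 1)) => dS (wedge_mid_mem_stab (p := p) hi hi' hj hj')
  apply lieAlg_le
  intro i j hij
  have hj0 : j ≠ 0 := fun h => by rw [h] at hij; exact absurd hij (Fin.not_lt_zero i)
  have hil : i ≠ Fin.last (m + 1) := fun h => by
    rw [h] at hij; exact absurd (Fin.le_last j) (not_le.2 hij)
  by_cases hi : i = 0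
  · subst hi
    by_cases hjl : j = Fin.last (m + 1)
    · rw [hjl]; exact s0
    by_cases hj1 : j = 1
    · subst hj1
      have e : wedge p (bas 0) (bas 1) = (1 / 2 : ℝ) • wedge p (rowA m) (rowB m) -
          (1 / 2 : ℝ) • wedge p (rowA m) (rowB' m) + wedge p (bas (pen m)) (bas 1) := by
        simp only [rowA, rowB, rowB', wedge_sub_left, wedge_sub_right, wedge_add_right]; module
      rw [e]
      exact D.add_mem (D.sub_mem (D.smul_mem _ n1) (D.smul_mem _ n2)) (hmid h2.symm h6 hj0 hjl)
    by_cases hjm : j = pen m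
    · rw [hjm, wedge_swap]; exact D.neg_mem dA
    · have e : wedge p (bas 0) (bas j) = wedge p (bas (pen m)) (bas j) - wedge p (rowA m) (bas j) := by
        rw [rowA, wedge_sub_left]; module
      rw [e]
      exact D.sub_mem (hmid h2.symm h6 hj0 hjl)
        (dN (Or.inr (Or.inr ⟨j, ⟨hj0, hj1, hjm, hjl⟩, Or.inl rfl⟩)))
  by_cases hjl : j = Fin.last (m + 1)
  · subst hjl
    by_cases hi1 : i = 1
    · rw [hi1, wedge_swap]; exact D.neg_mem dB
    by_cases him : i = pen m
    · subst him
      have e : wedge p (bas (pen m)) (bas (Fin.last (m + 1))) =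
          (1 / 2 : ℝ) • wedge p (rowA m) (rowB m) + (1 / 2 : ℝ) • wedge p (rowA m) (rowB' m) +
            wedge p (bas 0) (bas (Fin.last (m + 1))) := by
        simp only [rowA, rowB, rowB', wedge_sub_left, wedge_sub_right, wedge_add_right]; module
      rw [e]
      exact D.add_mem (D.add_mem (D.smul_mem _ n1) (D.smul_mem _ n2)) s0
    · have e : wedge p (bas i) (bas (Fin.last (m + 1))) =
          -(wedge p (rowB m) (bas i) + wedge p (bas 1) (bas i)) := by
        rw [rowB, wedge_sub_left, wedge_swap]; module
      rw [e]
      exact D.neg_mem (D.add_mem (dN (Or.inr (Or.inr ⟨i, ⟨hi, hi1, him, hil⟩, Or.inr rfl⟩)))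
        (hmid h1.symm h5 hi hil))
  · exact hmid hi hil hj0 hjl

end Restricted

section Uniqueness

variable {p m : ℕ}

/-! ### The filtration by degree -/

/-- The restrictions of the homogeneous polynomials of degree `k`. -/
def wS (p m k : ℕ) : Submodule ℂ (polyOmega p m) :=
  (MvPolynomial.homogeneousSubmodule (Fin (m + 2) × Fin (m + 2)) ℂ k).map (toPoly p m).toLinearMap

instance free_submodule (V : Submodule ℂ (polyOmega p m)) : Module.Free ℂ V :=
  Module.Free.of_divisionRing ℂ V

instance finiteDimensional_wS (k : ℕ) : FiniteDimensional ℂ (wS p m k) := by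
  have : Module.Finite ℂ (MvPolynomial.homogeneousSubmodule (Fin (m + 2) × Fin (m + 2)) ℂ k) :=
    Module.Finite.iff_fg.2 (MvPolynomial.homogeneousSubmodule_fg _ ℂ k)
  exact Module.Finite.map _ _

theorem exists_mem_wS (hp : 2 ≤ p) (hm : p ≤ m) (F : polyOmega p m) : ∃ k, F ∈ wS p m k := by
  obtain ⟨k, P, hP, rfl⟩ := exists_homogeneous hp hm F
  exact ⟨k, P, hP, rfl⟩

theorem adD_X (X : Mat m) (a b : Fin (m + 2)) :
    adD X (MvPolynomial.X (a, b)) = (coordMat m * cst X) a b - (cst X * coordMat m) a b :=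
  congrFun (congrFun (coord_map_adD X) a) b

theorem isHomogeneous_adD (X : Mat m) {k : ℕ} {P : PolyMat m}
    (hP : P.IsHomogeneous k) : (adD X P).IsHomogeneous k := by
  have h1 : ∀ a b, (adD X (MvPolynomial.X (a, b) : PolyMat m)).IsHomogeneous 1 := by
    intro a b
    rw [adD_X, Matrix.mul_apply, Matrix.mul_apply]
    refine MvPolynomial.IsHomogeneous.sub (MvPolynomial.IsHomogeneous.sum _ _ _ fun c _ => ?_)
      (MvPolynomial.IsHomogeneous.sum _ _ _ fun c _ => ?_)
    · exact (MvPolynomial.isHomogeneous_X ℂ (a, c)).mul (MvPolynomial.isHomogeneous_C _ _)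
    · exact ((MvPolynomial.isHomogeneous_C _ _).mul (MvPolynomial.isHomogeneous_X ℂ (c, b)))
  have h2 : ∀ d : Fin (m + 2) × Fin (m + 2) →₀ ℕ, ∀ c : ℂ,
      (adD X (MvPolynomial.monomial d c)).IsHomogeneous d.degree := by
    intro d c
    induction d using Finsupp.induction with
    | zero =>
      rw [show (MvPolynomial.monomial 0 c : PolyMat m) = MvPolynomial.C c from rfl,
        show adD X (MvPolynomial.C c) = 0 from (adD X).map_algebraMap c]
      exact MvPolynomial.isHomogeneous_zero _ _ _
    | single_add a n f _ hn ih =>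
      obtain ⟨l, rfl⟩ := Nat.exists_eq_succ_of_ne_zero hn
      have ih0 : (MvPolynomial.monomial f c : PolyMat m).IsHomogeneous f.degree :=
        MvPolynomial.isHomogeneous_monomial _ rfl
      rw [MvPolynomial.monomial_single_add, Derivation.leibniz, Derivation.leibniz_pow, map_add,
        Finsupp.degree_single, smul_eq_mul, smul_eq_mul]
      refine MvPolynomial.IsHomogeneous.add ?_ ?_
      · have h3 := ((MvPolynomial.isHomogeneous_X ℂ a).pow (l + 1)).mul ih
        rwa [one_mul] at h3
      · have h3 := ((MvPolynomial.isHomogeneous_X ℂ a).pow l).mul (h1 a.1 a.2)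
        have h4 := ih0.mul (h3.C_mul ((l : ℂ) + 1))
        rw [one_mul] at h4
        refine (congrArg₂ MvPolynomial.IsHomogeneous ?_ ?_).mp h4
        · simp [nsmul_eq_mul]
        · omega
  rw [P.as_sum, map_sum]
  refine MvPolynomial.IsHomogeneous.sum _ _ _ fun d hd => ?_
  have h3 : d.degree = k := by
    by_contra h
    exact (MvPolynomial.mem_support_iff.1 hd) (hP.coeff_eq_zero h)
  rw [← h3]
  exact h2 d _

theorem adS_mem_wS (hp : 2 ≤ p) (hm : p ≤ m) {X : Mat m}
    (hX : X ∈ lieAlg p m) {k : ℕ} {F : polyOmega p m} (hF : F ∈ wS p m k) : adS p X F ∈ wS p m k := by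
  obtain ⟨P, hP, rfl⟩ := hF
  exact ⟨adD X P, isHomogeneous_adD X hP, (adS_toPoly hp hm hX P).symm⟩

/-! ### Curves -/

theorem hasDerivAt_conj_exp (X z : Mat m) (s : ℝ) (P : PolyMat m) :
    HasDerivAt (fun s : ℝ => evalMat ((NormedSpace.exp (s • X))⁻¹ * z * NormedSpace.exp (s • X)) P)
      (evalMat ((NormedSpace.exp (s • X))⁻¹ * z * NormedSpace.exp (s • X)) (adD X P)) s := by
  have hi : ∀ s : ℝ, (NormedSpace.exp (s • X))⁻¹ = NormedSpace.exp (s • -X) := fun s => by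
    rw [smul_neg, Matrix.exp_neg]
  have hc : NormedSpace.exp (s • -X) * X = X * NormedSpace.exp (s • -X) := by
    let _ : NormedRing (Mat m) := Matrix.linftyOpNormedRing
    let _ : NormedAlgebra ℝ (Mat m) := Matrix.linftyOpNormedAlgebra
    exact (((Commute.refl X).neg_right.smul_right s).exp_right).symm
  have h1 : ∀ a b, HasDerivAt (fun s : ℝ => ((NormedSpace.exp (s • X))⁻¹ * z * NormedSpace.exp (s • X)) a b)
      (((NormedSpace.exp (s • X))⁻¹ * z * NormedSpace.exp (s • X) * X -
        X * ((NormedSpace.exp (s • X))⁻¹ * z * NormedSpace.exp (s • X))) a b) s := by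
    intro a b
    simp only [hi]
    have h2 : HasDerivAt (fun s : ℝ => ∑ c, (∑ d, NormedSpace.exp (s • -X) a d * z d c) *
        NormedSpace.exp (s • X) c b) (∑ c, ((∑ d, (NormedSpace.exp (s • -X) * -X) a d * z d c) *
          NormedSpace.exp (s • X) c b + (∑ d, NormedSpace.exp (s • -X) a d * z d c) *
          (NormedSpace.exp (s • X) * X) c b)) s :=
      HasDerivAt.fun_sum fun c _ => (HasDerivAt.fun_sum fun d _ =>
        (hasDerivAt_matrix_exp (-X) s a d).mul_const (z d c)).fun_mul (hasDerivAt_matrix_exp X s c b)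
    refine h2.congr_deriv ?_
    rw [Finset.sum_add_distrib]
    simp only [← Matrix.mul_apply]
    rw [Matrix.mul_neg, hc, ← Matrix.mul_assoc, Matrix.sub_apply]
    simp only [Matrix.neg_mul, Matrix.neg_apply, Matrix.mul_assoc]
    ring
  refine hasDerivAt_evalMat (adD X) h1 (fun a b => ?_) P
  rw [adD_X, map_sub, evalMat_coord_mul, evalMat_mul_coord, Matrix.sub_apply]
  push_cast; ring

/-- A finite-dimensional invariant space of functions that vanish at a point consists of functions
that vanish everywhere. -/
theorem vanish_exp (hp : 2 ≤ p) (hm : p ≤ m) {X : Mat m}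
    (hX : X ∈ lieAlg p m) {V : Submodule ℂ (polyOmega p m)} [FiniteDimensional ℂ V]
    (hV : ∀ F ∈ V, adS p X F ∈ V) {z : Mat m} (hz : z ∈ Omega p m)
    (h0 : ∀ F ∈ V, ev F.1 z = 0) (F : polyOmega p m) (hF : F ∈ V) :
    ev F.1 ((NormedSpace.exp X)⁻¹ * z * NormedSpace.exp X) = 0 := by
  let b := Module.finBasis ℂ V
  let c : ℝ → Mat m := fun s =>
    (NormedSpace.exp (s • X))⁻¹ * z * NormedSpace.exp (s • X)
  have hc : ∀ s, c s ∈ Omega p m := fun s =>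
    conj_mem_Omega (exp_mem_SO₀ (Submodule.smul_mem _ s hX)) hz
  have hd : ∀ (G : polyOmega p m) (s : ℝ), HasDerivAt (fun s => ev G.1 (c s)) (ev (adS p X G).1 (c s)) s := by
    intro G s
    obtain ⟨P, rfl⟩ := toPoly_surjective G
    rw [adS_toPoly hp hm hX, ev_toPoly _ (hc s)]
    exact (hasDerivAt_conj_exp X z s P).congr_of_eventuallyEq
      (Eventually.of_forall fun t => ev_toPoly _ (hc t))
  let A : Matrix (Fin (Module.finrank ℂ V)) (Fin (Module.finrank ℂ V)) ℂ :=
    fun i j => b.repr ⟨adS p X (b i), hV _ (b i).2⟩ j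
  let L : (Fin (Module.finrank ℂ V) → ℂ) →L[ℂ] (Fin (Module.finrank ℂ V) → ℂ) :=
    LinearMap.toContinuousLinearMap A.mulVecLin
  let f : ℝ → Fin (Module.finrank ℂ V) → ℂ := fun s i => ev (b i).1.1 (c s)
  have hev : ∀ (s : ℝ) (G : V), ev G.1.1 (c s) = ∑ j, b.repr G j * f s j := by
    intro s G
    conv_lhs => rw [← b.sum_repr G]
    simp only [f, ev_of_mem _ (hc s), Submodule.coe_sum, Submodule.coe_smul]
    simp
  have hf : ∀ s, HasDerivAt f (L (f s)) s := by
    intro s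
    rw [hasDerivAt_pi]
    intro i
    refine (hd (b i).1 s).congr_deriv ?_
    exact hev s ⟨adS p X (b i), hV _ (b i).2⟩
  have h1 : f = fun _ => 0 := by
    refine ODE_solution_unique_univ (v := fun _ x => L x) (s := fun _ => Set.univ) (t₀ := 0)
      (K := ‖L‖₊) (fun t => L.lipschitz.lipschitzOnWith) (fun t => ⟨hf t, trivial⟩)
      (fun t => ⟨by simpa using hasDerivAt_const t (0 : Fin (Module.finrank ℂ V) → ℂ), trivial⟩) ?_
    funext i
    have : c 0 = z := by simp [c]
    simp only [f, this]
    exact h0 _ (b i).2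
  have h2 := hev 1 ⟨F, hF⟩
  simp only [c, one_smul, h1] at h2
  simpa using h2

theorem eq_zero_of_vanish (hp : 2 ≤ p) (hm : p ≤ m) {V : Submodule ℂ (polyOmega p m)}
    [FiniteDimensional ℂ V] (hV : ∀ X ∈ lieAlg p m, ∀ F ∈ V, adS p X F ∈ V)
    (h0 : ∀ F ∈ V, ev F.1 (z₀ p m) = 0) {F : polyOmega p m} (hF : F ∈ V) : F = 0 := by
  have key : ∀ g ∈ expGen p m, ∀ z ∈ Omega p m, (∀ F ∈ V, ev F.1 z = 0) →
      ∀ F ∈ V, ev F.1 (g⁻¹ * z * g) = 0 := by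
    intro g hg
    induction hg using Submonoid.closure_induction with
    | mem x hx =>
      obtain ⟨X, hX, rfl⟩ := hx
      intro z hz h F hF
      exact vanish_exp hp hm hX (hV X hX) hz h F hF
    | one => intro z hz h F hF; simpa using h F hF
    | mul x y hx hy ihx ihy =>
      intro z hz h F hF
      have := ihy _ (conj_mem_Omega (expGen_subset hx) hz) (ihx z hz h) F hF
      rw [Matrix.mul_inv_rev]
      simpa only [Matrix.mul_assoc] using this
  refine polyOmega_ext fun z => ?_
  obtain ⟨g, hg, hz⟩ := exists_expGen hp hm z.2
  rw [← ev_mem F.1 z, hz]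
  exact key g hg _ z₀_mem h0 F hF

/-- Evaluation at the initial point. -/
def ev₀ (p m : ℕ) : polyOmega p m →ₗ[ℂ] ℂ where
  toFun F := F.1 ⟨z₀ p m, z₀_mem⟩
  map_add' _ _ := rfl
  map_smul' _ _ := rfl

theorem ev_z₀ (F : polyOmega p m) : ev F.1 (z₀ p m) = ev₀ p m F := ev_of_mem _ z₀_mem

theorem ev₀_stab (hp : 2 ≤ p) (hm : p ≤ m) {X : Mat m}
    (hX : X ∈ stab p m) (F : polyOmega p m) : ev₀ p m (adS p X F) = 0 := by
  obtain ⟨h1, h2, h3⟩ := hX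
  obtain ⟨P, rfl⟩ := toPoly_surjective F
  rw [← ev_z₀, adS_toPoly hp hm h1, ev_toPoly _ z₀_mem, adD, Derivation.add_apply, map_add,
    evalMat_Dx_z₀ hp hm h1, evalMat_Dy_z₀ hp hm h1, h2, h3]
  simp

/-- The operator of a word. -/
def adW (p : ℕ) {m : ℕ} (w : List (lieAlg p m)) : Module.End ℂ (polyOmega p m) :=
  (w.map fun X => adS p X.1).prod

theorem adW_nil (F : polyOmega p m) : adW p [] F = F := rfl

theorem adW_cons (X : lieAlg p m) (w : List (lieAlg p m)) (F : polyOmega p m) :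
    adW p (X :: w) F = adS p X.1 (adW p w F) := by
  simp [adW]

theorem adW_append (v w : List (lieAlg p m)) (F : polyOmega p m) :
    adW p (v ++ w) F = adW p v (adW p w F) := by
  simp [adW]

theorem adW_adS (hp : 2 ≤ p) (hm : p ≤ m) (K : polyOmega p m) (H : lieAlg p m) (w : List (lieAlg p m)) :
    ∃ q ∈ Submodule.span ℂ {F | ∃ v : List (lieAlg p m), v.length ≤ w.length ∧ F = adW p v K},
      adW p w (adS p H.1 K) = adS p H.1 (adW p w K) + q := by
  induction w with
  | nil => exact ⟨0, Submodule.zero_mem _, by rw [adW_nil, adW_nil, add_zero]⟩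
  | cons X w ih =>
    obtain ⟨q, hq, h⟩ := ih
    refine ⟨adS p (X.1 * H.1 - H.1 * X.1) (adW p w K) + adS p X.1 q, Submodule.add_mem _ ?_ ?_, ?_⟩
    · exact Submodule.subset_span ⟨⟨_, bracket_mem X.2 H.2⟩ :: w, by simp, by rw [adW_cons]⟩
    · have h1 := Submodule.mem_map_of_mem (f := adS p X.1) hq
      rw [Submodule.map_span] at h1
      refine Submodule.span_mono ?_ h1
      rintro _ ⟨_, ⟨v, hv, rfl⟩, rfl⟩
      exact ⟨X :: v, by simpa using hv, by rw [adW_cons]⟩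
    · rw [adW_cons, adW_cons, h, map_add, adS_adS hp hm H.2 X.2, add_assoc]

/-- `F` is annihilated by the positive root vectors. -/
def Killed (F : polyOmega p m) : Prop := ∀ Y ∈ posRoots p m, adS p Y F = 0

theorem posRoots_subset : posRoots p m ⊆ lieAlg p m := by
  rintro _ (rfl | rfl | ⟨k, -, rfl | rfl⟩) <;> exact wedge_mem _ _

theorem Killed.span (hp : 2 ≤ p) (hm : p ≤ m) {F : polyOmega p m} (hF : Killed F)
    {Y : Mat m} (hY : Y ∈ Submodule.span ℝ (posRoots p m)) :
    Y ∈ lieAlg p m ∧ adS p Y F = 0 := by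
  have h0 : ∀ Y ∈ Submodule.span ℝ (posRoots p m), Y ∈ lieAlg p m := fun Y hY =>
    Submodule.span_le.2 posRoots_subset hY
  refine ⟨h0 Y hY, ?_⟩
  induction hY using Submodule.span_induction with
  | mem x hx => exact hF x hx
  | zero =>
    have := adS_smul hp hm 0 (Submodule.zero_mem (lieAlg p m)) F
    simpa using this
  | add x y hx hy h1 h2 => rw [adS_add hp hm (h0 x hx) (h0 y hy), h1, h2, add_zero]
  | smul c x hx h1 => rw [adS_smul hp hm c (h0 x hx), h1, smul_zero]

theorem eq_zero_of_killed (hp : 2 ≤ p) (hm : p ≤ m) {S : Set (polyOmega p m)}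
    (hS : ∀ K ∈ S, Killed K ∧ adS p (carA p m) K ∈ S ∧ adS p (carB p m) K ∈ S ∧ ev₀ p m K = 0)
    {K : polyOmega p m} (hK : K ∈ S) : K = 0 := by
  have key : ∀ r : ℕ, ∀ K ∈ S, ∀ w : List (lieAlg p m), w.length ≤ r → ev₀ p m (adW p w K) = 0 := by
    intro r
    induction r with
    | zero =>
      intro K hK w hw
      rw [List.length_eq_zero_iff.1 (Nat.le_zero.1 hw), adW_nil]
      exact (hS K hK).2.2.2
    | succ r ih =>
      intro K hK w hw
      rcases List.eq_nil_or_concat' w with rfl | ⟨w', X, rfl⟩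
      · rw [adW_nil]; exact (hS K hK).2.2.2
      have hw' : w'.length ≤ r := by simpa using hw
      obtain ⟨hK1, hKA, hKB, -⟩ := hS K hK
      have hX := iwasawa hp hm X.2
      obtain ⟨u, hu, y, hy, huy⟩ := Submodule.mem_sup.1 hX
      obtain ⟨h, hh, a, ha, hha⟩ := Submodule.mem_sup.1 hu
      obtain ⟨c₁, c₂, hc⟩ := Submodule.mem_span_pair.1 ha
      obtain ⟨hyl, hy0⟩ := hK1.span hp hm hy
      have e : adS p X.1 K = adS p h K + ((c₁ : ℂ) • adS p (carA p m) K + (c₂ : ℂ) • adS p (carB p m) K) := by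
        have m1 := Submodule.smul_mem _ c₁ (carA_mem (p := p) (m := m))
        have m2 := Submodule.smul_mem _ c₂ (carB_mem (p := p) (m := m))
        have m3 := Submodule.add_mem _ m1 m2
        rw [← huy, ← hha, ← hc, adS_add hp hm (Submodule.add_mem _ hh.1 m3) hyl, hy0, add_zero,
          adS_add hp hm hh.1 m3, adS_add hp hm m1 m2, adS_smul hp hm c₁ carA_mem,
          adS_smul hp hm c₂ carB_mem]
      obtain ⟨q, hq, hqe⟩ := adW_adS hp hm K ⟨h, hh.1⟩ w'
      have hq0 : ev₀ p m q = 0 := by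
        have : Submodule.span ℂ {F | ∃ v : List (lieAlg p m), v.length ≤ w'.length ∧ F = adW p v K} ≤
            LinearMap.ker (ev₀ p m) := by
          rw [Submodule.span_le]
          rintro _ ⟨v, hv, rfl⟩
          exact ih K hK v (hv.trans hw')
        exact this hq
      rw [adW_append, adW_cons, adW_nil, e]
      simp only [map_add, map_smul, hqe, ev₀_stab hp hm hh, hq0, ih _ hKA w' hw', ih _ hKB w' hw',
        smul_zero, add_zero]
  obtain ⟨k, hk⟩ := exists_mem_wS hp hm K
  set V : Submodule ℂ (polyOmega p m) := Submodule.span ℂ {F | ∃ w : List (lieAlg p m), F = adW p w K}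
  have hVk : V ≤ wS p m k := by
    rw [Submodule.span_le]
    rintro _ ⟨w, rfl⟩
    induction w with
    | nil => exact hk
    | cons X w ih => rw [adW_cons]; exact adS_mem_wS hp hm X.2 ih
  have : FiniteDimensional ℂ V := Submodule.finiteDimensional_of_le hVk
  refine eq_zero_of_vanish hp hm (V := V) ?_ ?_ (Submodule.subset_span ⟨[], rfl⟩)
  · intro X hX F hF
    have h1 := Submodule.mem_map_of_mem (f := adS p X) hF
    rw [Submodule.map_span] at h1
    refine Submodule.span_mono ?_ h1
    rintro _ ⟨_, ⟨v, rfl⟩, rfl⟩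
    exact ⟨⟨X, hX⟩ :: v, by rw [adW_cons]⟩
  · intro F hF
    have : V ≤ LinearMap.ker (ev₀ p m) := by
      rw [Submodule.span_le]
      rintro _ ⟨v, rfl⟩
      exact key v.length K hK v le_rfl
    rw [ev_z₀]
    exact this hF

end Uniqueness

theorem exists_nat_of_sl2 {V : Type*} [AddCommGroup V] [Module ℂ V] [FiniteDimensional ℂ V]
    {h e f : Module.End ℂ V} (h1 : ∀ x, e (f x) = f (e x) + h x)
    (h2 : ∀ x, h (e x) = e (h x) + (2 : ℂ) • e x) (h3 : ∀ x, h (f x) = f (h x) + (-2 : ℂ) • f x)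
    {v : V} {μ : ℂ} (hv : v ≠ 0) (hh : h v = μ • v) (he : e v = 0) : ∃ n : ℕ, μ = n := by
  let _ : LieRing (Module.End ℂ V) := LieRing.ofAssociativeRing
  let _ : LieAlgebra ℂ (Module.End ℂ V) := LieAlgebra.ofAssociativeAlgebra
  by_cases h0 : h = 0
  · refine ⟨0, ?_⟩
    rw [h0, LinearMap.zero_apply] at hh
    simpa [hv] using hh.symm
  · have t : IsSl2Triple h e f := by
      refine ⟨h0, ?_, ?_, ?_⟩ <;> refine LinearMap.ext fun x => ?_ <;>
        simp only [LieRing.of_associative_ring_bracket, LinearMap.sub_apply, Module.End.mul_apply,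
          LinearMap.neg_apply, LinearMap.smul_apply]
      · rw [h1, add_sub_cancel_left]
      · rw [h2, add_sub_cancel_left, ofNat_smul_eq_nsmul]
      · rw [h3, add_sub_cancel_left, neg_smul, ofNat_smul_eq_nsmul]
    have P : t.HasPrimitiveVectorWith v μ := ⟨hv, hh, he⟩
    exact P.exists_nat

theorem eq_exp_of_hasDerivAt {f : ℝ → ℂ} {μ : ℂ} (hf : ∀ s, HasDerivAt f (μ * f s) s) (s : ℝ) :
    f s = f 0 * Complex.exp (μ * s) := by
  have h1 : ∀ s : ℝ, HasDerivAt (fun s : ℝ => f s * Complex.exp (-(μ * s))) 0 s := by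
    intro s
    have h2 : HasDerivAt (fun s : ℝ => Complex.exp (-(μ * s))) (Complex.exp (-(μ * s)) * -(μ * 1)) s :=
      (((Complex.ofRealCLM.hasDerivAt (x := s)).const_mul μ).neg).cexp
    refine ((hf s).fun_mul h2).congr_deriv ?_
    ring
  have h3 := is_const_of_deriv_eq_zero (fun s => (h1 s).differentiableAt) (fun s => (h1 s).deriv) s 0
  simp only [Complex.ofReal_zero, mul_zero, neg_zero, Complex.exp_zero, mul_one] at h3
  rw [← h3, mul_assoc, ← Complex.exp_add]; simp

section Weights

variable {p m : ℕ}

theorem IsRoot.adS_left (hp : 2 ≤ p) (hm : p ≤ m) {Y : Mat m}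
    {r₁ r₂ : ℝ} (h : IsRoot p Y r₁ r₂) (F : polyOmega p m) :
    adS p (carA p m) (adS p Y F) = adS p Y (adS p (carA p m) F) + (r₁ : ℂ) • adS p Y F := by
  rw [adS_adS hp hm h.mem carA_mem, h.left, adS_smul hp hm _ h.mem]

theorem IsRoot.adS_right (hp : 2 ≤ p) (hm : p ≤ m) {Y : Mat m}
    {r₁ r₂ : ℝ} (h : IsRoot p Y r₁ r₂) (F : polyOmega p m) :
    adS p (carB p m) (adS p Y F) = adS p Y (adS p (carB p m) F) + (r₂ : ℂ) • adS p Y F := by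
  rw [adS_adS hp hm h.mem carB_mem, h.right, adS_smul hp hm _ h.mem]

/-- The value of a coroot on the weight of a function annihilated by a root vector. -/
theorem exists_nat_of_root (hp : 2 ≤ p) (hm : p ≤ m) {X Y : Mat m}
    {r₁ r₂ c₁ c₂ : ℝ} (hX : IsRoot p X r₁ r₂) (hY : IsRoot p Y (-r₁) (-r₂))
    (hXY : X * Y - Y * X = c₁ • carA p m + c₂ • carB p m) (hc : c₁ * r₁ + c₂ * r₂ = 2)
    {F : polyOmega p m} (hF : F ≠ 0) {a b : ℂ} (ha : adS p (carA p m) F = a • F)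
    (hb : adS p (carB p m) F = b • F) (h0 : adS p X F = 0) : ∃ n : ℕ, c₁ * a + c₂ * b = n := by
  obtain ⟨k, hk⟩ := exists_mem_wS hp hm F
  set H := X * Y - Y * X
  have hH : H ∈ lieAlg p m := bracket_mem hX.mem hY.mem
  have e1 : H * X - X * H = (2 : ℝ) • X := by
    rw [hXY, Matrix.add_mul, Matrix.mul_add, Matrix.smul_mul, Matrix.smul_mul, Matrix.mul_smul,
      Matrix.mul_smul, add_sub_add_comm, ← smul_sub, ← smul_sub, hX.left, hX.right, ← hc]
    module
  have e2 : H * Y - Y * H = (-2 : ℝ) • Y := by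
    rw [hXY, Matrix.add_mul, Matrix.mul_add, Matrix.smul_mul, Matrix.smul_mul, Matrix.mul_smul,
      Matrix.mul_smul, add_sub_add_comm, ← smul_sub, ← smul_sub, hY.left, hY.right, ← hc]
    module
  let r : ∀ Z ∈ lieAlg p m, Module.End ℂ (wS p m k) := fun Z hZ =>
    (adS p Z).restrict fun G hG => adS_mem_wS hp hm hZ hG
  have hr : ∀ (Z) (hZ : Z ∈ lieAlg p m) (G : wS p m k), (r Z hZ G).1 = adS p Z G.1 := fun _ _ _ => rfl
  refine exists_nat_of_sl2 (V := wS p m k) (h := r H hH) (e := r X hX.mem) (f := r Y hY.mem)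
    (v := ⟨F, hk⟩) (fun G => Subtype.ext ?_) (fun G => Subtype.ext ?_) (fun G => Subtype.ext ?_)
    (fun h => hF (congrArg Subtype.val h)) (Subtype.ext ?_) (Subtype.ext h0)
  · exact adS_adS hp hm hY.mem hX.mem G.1
  · have := adS_adS hp hm hX.mem hH G.1
    rw [e1, adS_smul hp hm _ hX.mem, Complex.ofReal_ofNat] at this
    exact this
  · have := adS_adS hp hm hY.mem hH G.1
    rw [e2, adS_smul hp hm _ hY.mem, Complex.ofReal_neg, Complex.ofReal_ofNat] at this
    exact this
  · have m1 := Submodule.smul_mem _ c₁ (carA_mem (p := p) (m := m))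
    have m2 := Submodule.smul_mem _ c₂ (carB_mem (p := p) (m := m))
    change adS p H F = (c₁ * a + c₂ * b : ℂ) • F
    rw [hXY, adS_add hp hm m1 m2, adS_smul hp hm _ carA_mem, adS_smul hp hm _ carB_mem, ha, hb,
      smul_smul, smul_smul, add_smul]

theorem wedge_bracket {u v u' v' : Row m} (h1 : form p u v' = 0) (h2 : form p v u' = 0) :
    wedge p u v * wedge p u' v' - wedge p u' v' * wedge p u v =
      -(form p v v' • wedge p u u') - form p u u' • wedge p v v' := by
  rw [wedge_mul_sub (wedge_mem _ _), vecMul_wedge, vecMul_wedge, h1, h2, zero_smul, zero_smul,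
    sub_zero, zero_sub, wedge_smul_left, ← neg_smul, wedge_smul_right, wedge_swap v v']
  module

theorem wedge_rowA : wedge p (rowA m) (rowA' m) = (2 : ℝ) • carA p m := by
  simp only [rowA, rowA', wedge_sub_left, wedge_add_right, wedge_self, carA]
  rw [wedge_swap (bas (pen m)) (bas 0)]
  module

theorem wedge_rowB : wedge p (rowB m) (rowB' m) = (2 : ℝ) • carB p m := by
  simp only [rowB, rowB', wedge_sub_left, wedge_add_right, wedge_self, carB]
  rw [wedge_swap (bas (Fin.last (m + 1))) (bas 1)]
  module

theorem weight_nat (hp : 2 ≤ p) (hm : p ≤ m) {F : polyOmega p m} (hF : F ≠ 0) (hK : Killed F) {a b : ℂ}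
    (ha : adS p (carA p m) F = a • F) (hb : adS p (carB p m) F = b • F) :
    (∃ n : ℕ, a + b = n) ∧ (∃ n : ℕ, a - b = n) ∧ (2 < m → ∃ n : ℕ, 2 * b = n) := by
  have wA := isWt_rowA hp hm
  have wA' := isWt_rowA' hp hm
  have wB := isWt_rowB hp hm
  have wB' := isWt_rowB' hp hm
  have fA := form_rowA_rowA' hp hm
  have fB := form_rowB_rowB' hp hm
  refine ⟨?_, ?_, fun hm2 => ?_⟩
  · have h1 : wedge p (rowA m) (rowB m) * wedge p ((-(1 / 4) : ℝ) • rowA' m) (rowB' m) -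
        wedge p ((-(1 / 4) : ℝ) • rowA' m) (rowB' m) * wedge p (rowA m) (rowB m) =
        (1 : ℝ) • carA p m + (1 : ℝ) • carB p m := by
      rw [wedge_bracket (wA.form_eq_zero wB' (by norm_num)) (by
        rw [form_smul_right, wB.form_eq_zero wA' (by norm_num), mul_zero]), wedge_smul_right,
        form_smul_right, fA, fB, wedge_rowA, wedge_rowB]
      module
    have hY : IsRoot p (wedge p ((-(1 / 4) : ℝ) • rowA' m) (rowB' m)) (-1) (-1) := by
      have := IsWt.wedge (u := (-(1 / 4) : ℝ) • rowA' m) (r₁ := 1) (r₂ := 0)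
        ⟨by rw [smul_vecMul, wA'.left]; module, by rw [smul_vecMul, wA'.right]; module⟩ wB'
      norm_num at this ⊢; exact this
    have hX : IsRoot p (wedge p (rowA m) (rowB m)) 1 1 := by
      have := wA.wedge wB
      norm_num at this ⊢; exact this
    obtain ⟨n, hn⟩ := exists_nat_of_root hp hm hX hY h1 (by norm_num) hF ha hb (hK _ (Or.inl rfl))
    exact ⟨n, by rw [← hn]; push_cast; ring⟩
  · have h1 : wedge p (rowA m) (rowB' m) * wedge p ((-(1 / 4) : ℝ) • rowA' m) (rowB m) -
        wedge p ((-(1 / 4) : ℝ) • rowA' m) (rowB m) * wedge p (rowA m) (rowB' m) =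
        (1 : ℝ) • carA p m + (-1 : ℝ) • carB p m := by
      rw [wedge_bracket (wA.form_eq_zero wB (by norm_num)) (by
        rw [form_smul_right, wB'.form_eq_zero wA' (by norm_num), mul_zero]), wedge_smul_right,
        form_smul_right, fA, form_comm (rowB' m), fB, wedge_rowA, wedge_swap (rowB m),
        wedge_rowB]
      module
    have hY : IsRoot p (wedge p ((-(1 / 4) : ℝ) • rowA' m) (rowB m)) (-1) (- -1) := by
      have := IsWt.wedge (u := (-(1 / 4) : ℝ) • rowA' m) (r₁ := 1) (r₂ := 0)
        ⟨by rw [smul_vecMul, wA'.left]; module, by rw [smul_vecMul, wA'.right]; module⟩ wB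
      norm_num at this ⊢; exact this
    have hX : IsRoot p (wedge p (rowA m) (rowB' m)) 1 (-1) := by
      have := wA.wedge wB'
      norm_num at this ⊢; exact this
    obtain ⟨n, hn⟩ := exists_nat_of_root hp hm hX hY h1 (by norm_num) hF ha hb
      (hK _ (Or.inr (Or.inl rfl)))
    exact ⟨n, by rw [← hn]; push_cast; ring⟩
  · obtain ⟨k, hk⟩ : ∃ k : Fin (m + 2), IsInner k := by
      refine ⟨⟨2, by omega⟩, ?_⟩
      simp only [IsInner, ne_eq, Fin.ext_iff, pen, Fin.val_zero, Fin.val_one, Fin.val_castSucc,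
        Fin.val_last]
      omega
    have wk := isWt_bas (p := p) hk
    have fk : form p (bas k) (bas k) = lam p k := by rw [form_bas_bas, if_pos rfl]
    have hl := lam_mul_self (p := p) k
    have h1 : wedge p (rowB m) (bas k) * wedge p ((-lam p k) • rowB' m) (bas k) -
        wedge p ((-lam p k) • rowB' m) (bas k) * wedge p (rowB m) (bas k) =
        (0 : ℝ) • carA p m + (2 : ℝ) • carB p m := by
      rw [wedge_bracket (wB.form_eq_zero wk (by norm_num)) (by
        rw [form_smul_right, wk.form_eq_zero wB' (by norm_num), mul_zero]), wedge_smul_right,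
        fk, wedge_rowB, wedge_self, smul_smul, smul_smul]
      rw [show lam p k * -lam p k * 2 = -2 by linear_combination -2 * hl]
      module
    have hY : IsRoot p (wedge p ((-lam p k) • rowB' m) (bas k)) (-0) (-1) := by
      have := IsWt.wedge (u := (-lam p k) • rowB' m) (r₁ := 0) (r₂ := 1)
        ⟨by rw [smul_vecMul, wB'.left]; module, by rw [smul_vecMul, wB'.right]; module⟩ wk
      norm_num at this ⊢; exact this
    have hX : IsRoot p (wedge p (rowB m) (bas k)) 0 1 := by
      have := wB.wedge wk
      norm_num at this ⊢; exact this
    obtain ⟨n, hn⟩ := exists_nat_of_root hp hm hX hY h1 (by norm_num) hF ha hb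
      (hK _ (Or.inr (Or.inr ⟨k, hk, Or.inr rfl⟩)))
    exact ⟨n, by rw [← hn]; push_cast; ring⟩

end Weights

section Classification

variable {p m : ℕ}

theorem ev_conj_exp (hp : 2 ≤ p) (hm : p ≤ m) {X : Mat m}
    (hX : X ∈ lieAlg p m) {F : polyOmega p m} {μ : ℂ} (hF : adS p X F = μ • F) (s : ℝ) :
    ev F.1 ((NormedSpace.exp (s • X))⁻¹ * z₀ p m * NormedSpace.exp (s • X)) =
      ev₀ p m F * Complex.exp (μ * s) := by
  obtain ⟨P, rfl⟩ := toPoly_surjective F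
  have hc : ∀ s : ℝ, (NormedSpace.exp (s • X))⁻¹ * z₀ p m * NormedSpace.exp (s • X) ∈ Omega p m :=
    fun s => conj_mem_Omega (exp_mem_SO₀ (Submodule.smul_mem _ s hX)) z₀_mem
  have h1 : ∀ s : ℝ, HasDerivAt (fun s : ℝ => ev (toPoly p m P).1
      ((NormedSpace.exp (s • X))⁻¹ * z₀ p m * NormedSpace.exp (s • X)))
      (μ * ev (toPoly p m P).1 ((NormedSpace.exp (s • X))⁻¹ * z₀ p m * NormedSpace.exp (s • X))) s := by
    intro s
    refine ((hasDerivAt_conj_exp X (z₀ p m) s P).congr_of_eventuallyEq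
      (Eventually.of_forall fun t => ev_toPoly _ (hc t))).congr_deriv ?_
    rw [← ev_toPoly _ (hc s), ← adS_toPoly hp hm hX, hF, ev_of_mem _ (hc s), ev_of_mem _ (hc s)]
    rfl
  have h2 := eq_exp_of_hasDerivAt h1 s
  simp only [zero_smul, NormedSpace.exp_zero, inv_one, Matrix.one_mul, Matrix.mul_one] at h2
  rw [h2, ev_z₀]

theorem sMinus_eq : sMinus m =
    (1 / 2 : ℝ) • (rowA' m - rowA m - (rowB m + rowB' m)) := by
  have : sMinus m = bas 0 - bas (Fin.last (m + 1)) := by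
    apply row_ext
    · simp [sMinus, row_zero, bas, Fin.ext_iff]
    · funext k
      have h1 : k.succ.castSucc ≠ (0 : Fin (m + 2)) := by simp [Fin.ext_iff]
      have h2 : k.succ.castSucc ≠ Fin.last (m + 1) := by simp [Fin.ext_iff]; omega
      simp only [middle, sMinus, row_mid, bas, Pi.sub_apply, Pi.single_apply, h1, h2, if_false]
      simp
    · simp [sMinus, row_last, bas, Fin.ext_iff]
  rw [this, rowA, rowA', rowB, rowB']; module

theorem sPlus_eq : sPlus m =
    (1 / 2 : ℝ) • (rowA' m - rowA m + (rowB m + rowB' m)) := by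
  have : sPlus m = bas 0 + bas (Fin.last (m + 1)) := by
    apply row_ext
    · simp [sPlus, row_zero, bas, Fin.ext_iff]
    · funext k
      have h1 : k.succ.castSucc ≠ (0 : Fin (m + 2)) := by simp [Fin.ext_iff]
      have h2 : k.succ.castSucc ≠ Fin.last (m + 1) := by simp [Fin.ext_iff]; omega
      simp only [middle, sPlus, row_mid, bas, Pi.add_apply, Pi.single_apply, h1, h2, if_false]
      simp
    · simp [sPlus, row_last, bas, Fin.ext_iff]
  rw [this, rowA, rowA', rowB, rowB']; module

/-- The weights of functions on `Ω` satisfy a parity condition. -/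
theorem even_of_weight (hp : 2 ≤ p) (hm : p ≤ m) {X : Mat m}
    (hX : X ∈ lieAlg p m) {β β' : Row m} (hβ : β + β' = rowB m + rowB' m)
    (h1 : rowA m ᵥ* X = (-1 : ℝ) • rowA m) (h2 : rowA' m ᵥ* X = (1 : ℝ) • rowA' m)
    (h3 : β ᵥ* X = (-1 : ℝ) • β) (h4 : β' ᵥ* X = (1 : ℝ) • β')
    {F : polyOmega p m} {N : ℕ} (hF : adS p X F = (N : ℂ) • F) (h0 : ev₀ p m F ≠ 0) : Even N := by
  obtain ⟨d, P, hP, rfl⟩ := exists_homogeneous hp hm F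
  let x : ℝ → Row m := fun q => q • (rowA' m - β') - (rowA m + β)
  let y : ℝ → Row m := fun q => q • (rowA' m + β') - (rowA m - β)
  let W : ℝ → Mat m := fun s =>
    vecMulVec (gram p m *ᵥ y (s ^ 2)) (x (s ^ 2))
  obtain ⟨f, hf⟩ : ∃ f : Polynomial ℂ, ∀ s : ℝ, evalMat (W s) P = f.eval (s : ℂ) := by
    clear hP hF h0
    induction P using MvPolynomial.induction_on with
    | C c => exact ⟨Polynomial.C c, fun s => by rw [evalMat_C, Polynomial.eval_C]⟩
    | add P Q hP hQ =>
      obtain ⟨f, hf⟩ := hP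
      obtain ⟨g, hg⟩ := hQ
      exact ⟨f + g, fun s => by rw [map_add, Polynomial.eval_add, hf, hg]⟩
    | mul_X P ab hP =>
      obtain ⟨f, hf⟩ := hP
      obtain ⟨i, j⟩ := ab
      refine ⟨f * (Polynomial.C (lam p i : ℂ) * (Polynomial.X ^ 2 * Polynomial.C ((rowA' m i + β' i : ℝ) : ℂ) -
        Polynomial.C ((rowA m i - β i : ℝ) : ℂ)) * (Polynomial.X ^ 2 * Polynomial.C ((rowA' m j - β' j : ℝ) : ℂ) -
        Polynomial.C ((rowA m j + β j : ℝ) : ℂ))), fun s => ?_⟩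
      have : W s i j = lam p i * (s ^ 2 * (rowA' m i + β' i) - (rowA m i - β i)) *
          (s ^ 2 * (rowA' m j - β' j) - (rowA m j + β j)) := by
        simp only [W, vecMulVec_apply, gram, mulVec_diagonal, x, y, Pi.sub_apply, Pi.add_apply,
          Pi.smul_apply, smul_eq_mul]
      rw [map_mul, hf, evalMat_X, this]
      simp only [Polynomial.eval_mul, Polynomial.eval_sub, Polynomial.eval_pow, Polynomial.eval_X,
        Polynomial.eval_C]
      push_cast; ring
  have e1 : ∀ t : ℝ, sMinus m ᵥ* NormedSpace.exp (t • X) = (1 / 2 * Real.exp (-t)) • x (Real.exp t ^ 2) := by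
    intro t
    have k1 := vecMul_exp_of_eigen (X := t • X) (x := rowA m) (c := -t) (by rw [vecMul_smul, h1]; module)
    have k2 := vecMul_exp_of_eigen (X := t • X) (x := rowA' m) (c := t) (by rw [vecMul_smul, h2]; module)
    have k3 := vecMul_exp_of_eigen (X := t • X) (x := β) (c := -t) (by rw [vecMul_smul, h3]; module)
    have k4 := vecMul_exp_of_eigen (X := t • X) (x := β') (c := t) (by rw [vecMul_smul, h4]; module)
    have k5 : Real.exp (-t) * Real.exp t ^ 2 = Real.exp t := by
      rw [sq, ← mul_assoc, ← Real.exp_add, neg_add_cancel, Real.exp_zero, one_mul]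
    rw [sMinus_eq, ← hβ, smul_vecMul, sub_vecMul, sub_vecMul, add_vecMul, k1, k2, k3, k4]
    simp only [x, smul_sub, smul_add, smul_smul]
    rw [mul_assoc, k5]
    module
  have e2 : ∀ t : ℝ, sPlus m ᵥ* NormedSpace.exp (t • X) = (1 / 2 * Real.exp (-t)) • y (Real.exp t ^ 2) := by
    intro t
    have k1 := vecMul_exp_of_eigen (X := t • X) (x := rowA m) (c := -t) (by rw [vecMul_smul, h1]; module)
    have k2 := vecMul_exp_of_eigen (X := t • X) (x := rowA' m) (c := t) (by rw [vecMul_smul, h2]; module)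
    have k3 := vecMul_exp_of_eigen (X := t • X) (x := β) (c := -t) (by rw [vecMul_smul, h3]; module)
    have k4 := vecMul_exp_of_eigen (X := t • X) (x := β') (c := t) (by rw [vecMul_smul, h4]; module)
    have k5 : Real.exp (-t) * Real.exp t ^ 2 = Real.exp t := by
      rw [sq, ← mul_assoc, ← Real.exp_add, neg_add_cancel, Real.exp_zero, one_mul]
    rw [sPlus_eq, ← hβ, smul_vecMul, add_vecMul, sub_vecMul, add_vecMul, k1, k2, k3, k4]
    simp only [y, smul_sub, smul_add, smul_smul]
    rw [mul_assoc, k5]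
    module
  have e3 : ∀ t : ℝ, W (Real.exp t) = (-8 * Real.exp t ^ 2) •
      ((NormedSpace.exp (t • X))⁻¹ * z₀ p m * NormedSpace.exp (t • X)) := by
    intro t
    have ho := exp_mem_orth (Submodule.smul_mem _ t hX)
    have k1 : form p (sMinus m ᵥ* NormedSpace.exp (t • X)) (sPlus m ᵥ* NormedSpace.exp (t • X)) = -2 := by
      rw [form_vecMul_vecMul ho, form_sMinus_sPlus hp hm]
    have k2 : (1 / 2 * Real.exp (-t)) ≠ 0 := by positivity
    have k3 : form p (x (Real.exp t ^ 2)) (y (Real.exp t ^ 2)) = -8 * Real.exp t ^ 2 := by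
      rw [e1, e2, form_smul_left, form_smul_right] at k1
      have k5 : Real.exp (-t) * Real.exp t = 1 := by
        rw [← Real.exp_add, neg_add_cancel, Real.exp_zero]
      linear_combination 4 * Real.exp t ^ 2 * k1 - form p (x (Real.exp t ^ 2)) (y (Real.exp t ^ 2)) *
        (Real.exp (-t) * Real.exp t + 1) * k5
    rw [z₀, ← proj_vecMul ho, e1, e2, proj_smul k2 k2, proj, k3, smul_smul, mul_inv_cancel₀ (by positivity),
      one_smul]
  have e4 : f = Polynomial.C ((-8 : ℂ) ^ d * ev₀ p m (toPoly p m P)) * Polynomial.X ^ (2 * d + N) := by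
    refine Polynomial.eq_of_infinite_eval_eq _ _ (Set.Infinite.mono (s := (fun t : ℝ => (Real.exp t : ℂ)) '' Set.univ) ?_
      (Set.infinite_univ.image ?_))
    · rintro _ ⟨t, -, rfl⟩
      rw [Set.mem_ofPred_eq, ← hf, e3, evalMat_smul hP, ← ev_toPoly (p := p) P
        (conj_mem_Omega (exp_mem_SO₀ (Submodule.smul_mem _ t hX)) z₀_mem), ev_conj_exp hp hm hX hF t]
      simp only [Polynomial.eval_mul, Polynomial.eval_C, Polynomial.eval_pow, Polynomial.eval_X]
      push_cast
      rw [Complex.exp_nat_mul]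
      ring
    · intro s _ t _ h
      exact Real.exp_injective (Complex.ofReal_injective h)
  have e5 : f.eval ((-1 : ℝ) : ℂ) = f.eval ((1 : ℝ) : ℂ) := by
    rw [← hf, ← hf]
    simp only [W]; norm_num
  rw [e4] at e5
  simp only [Polynomial.eval_mul, Polynomial.eval_C, Polynomial.eval_pow, Polynomial.eval_X] at e5
  have e6 : (-8 : ℂ) ^ d * ev₀ p m (toPoly p m P) ≠ 0 := mul_ne_zero (pow_ne_zero _ (by norm_num)) h0
  have e7 := mul_left_cancel₀ e6 e5
  by_contra hN
  rw [Nat.not_even_iff_odd] at hN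
  rw [pow_add, pow_mul] at e7
  push_cast at e7
  rw [hN.neg_one_pow] at e7
  norm_num at e7

/-! ### The functions `W₁ⁱ W₂ʲ` as weight vectors -/

theorem adS_EOm (hp : 2 ≤ p) (hm : p ≤ m) {X : Mat m}
    (hX : X ∈ lieAlg p m) {α β : Row m} {r s c : ℝ} (hα : α ᵥ* X = r • α)
    (hβ : β ᵥ* X = s • β + c • α) (i j : ℕ) :
    adS p X (EOm p α β i j) = (-((i : ℂ) * (r + s) + 2 * j * r)) • EOm p α β i j := by
  have h1 : adD X (tau (wedge p α β)) = (-(r + s : ℝ) : ℂ) • tau (wedge p α β) := by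
    rw [adD_tau, ← neg_sub, wedge_mul_sub hX, hα, hβ, wedge_add_right, wedge_smul_left,
      wedge_smul_right, wedge_smul_right, wedge_self, smul_zero, add_zero, ← add_smul, ← neg_smul,
      tau_smul]
    push_cast; rfl
  have h2 : adD X (Zp p α α) = (-(2 * r : ℝ) : ℂ) • Zp p α α := by
    have e : Zp p (r • α) α = (r : ℂ) • Zp p α α := by
      rw [Zp, mulVec_smul, smul_vecMulVec, tau_smul, Zp]
    have e' : Zp p α (r • α) = (r : ℂ) • Zp p α α := by
      rw [Zp, vecMulVec_smul, tau_smul, Zp]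
    rw [adD, Derivation.add_apply, Dx_Zp hX, Dy_Zp, hα, e, e']
    simp only [MvPolynomial.smul_eq_C_mul]
    push_cast
    simp only [map_neg, map_mul, map_ofNat]
    ring
  rw [EOm, adS_toPoly hp hm hX, Epoly, Derivation.leibniz, Derivation.leibniz_pow,
    Derivation.leibniz_pow, h1, h2, ← map_smul]
  congr 1
  have e1 : ∀ (i : ℕ) (T : PolyMat m), i • T ^ (i - 1) • ((-(r + s : ℝ) : ℂ) • T) =
      ((i : ℂ) * (-(r + s : ℝ) : ℂ)) • T ^ i := by
    intro i T
    rcases i with _ | i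
    · simp
    · simp only [MvPolynomial.smul_eq_C_mul, nsmul_eq_mul, smul_eq_mul, Nat.add_sub_cancel, map_mul]
      push_cast
      simp only [map_add, map_natCast, map_one, map_neg]
      ring
  have e2 : ∀ (i : ℕ) (T : PolyMat m), i • T ^ (i - 1) • ((-(2 * r : ℝ) : ℂ) • T) =
      ((i : ℂ) * (-(2 * r : ℝ) : ℂ)) • T ^ i := by
    intro i T
    rcases i with _ | i
    · simp
    · simp only [MvPolynomial.smul_eq_C_mul, nsmul_eq_mul, smul_eq_mul, Nat.add_sub_cancel, map_mul]
      push_cast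
      simp only [map_add, map_natCast, map_one, map_neg, map_mul, map_ofNat]
      ring
  rw [e1, e2]
  simp only [MvPolynomial.smul_eq_C_mul, smul_eq_mul]
  push_cast
  simp only [map_add, map_natCast, map_neg, map_mul, map_ofNat]
  ring

theorem isoPair_rowB (hp : 2 ≤ p) (hm : p ≤ m) : IsoPair p (rowA m) (rowB m) :=
  ⟨(isWt_rowA hp hm).form_eq_zero (isWt_rowA hp hm) (by norm_num),
    (isWt_rowA hp hm).form_eq_zero (isWt_rowB hp hm) (by norm_num),
    (isWt_rowB hp hm).form_eq_zero (isWt_rowB hp hm) (by norm_num)⟩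

theorem isoPair_rowB' (hp : 2 ≤ p) (hm : p ≤ m) : IsoPair p (rowA m) (rowB' m) :=
  ⟨(isWt_rowA hp hm).form_eq_zero (isWt_rowA hp hm) (by norm_num),
    (isWt_rowA hp hm).form_eq_zero (isWt_rowB' hp hm) (by norm_num),
    (isWt_rowB' hp hm).form_eq_zero (isWt_rowB' hp hm) (by norm_num)⟩

theorem IsWt.adS_EOm_left (hp : 2 ≤ p) (hm : p ≤ m) {β : Row m} {s : ℝ} (h : IsWt p β 0 s)
    (i j : ℕ) : adS p (carA p m) (EOm p (rowA m) β i j) = (i + 2 * j : ℂ) • EOm p (rowA m) β i j := by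
  rw [adS_EOm hp hm carA_mem (isWt_rowA hp hm).left (s := 0) (c := 0) (by rw [h.left]; module)]
  congr 1
  push_cast; ring

theorem IsWt.adS_EOm_right (hp : 2 ≤ p) (hm : p ≤ m) {β : Row m} {s : ℝ} (h : IsWt p β 0 s)
    (i j : ℕ) : adS p (carB p m) (EOm p (rowA m) β i j) = (-(i * s) : ℂ) • EOm p (rowA m) β i j := by
  rw [adS_EOm hp hm carB_mem (isWt_rowA hp hm).right (s := s) (c := 0) (by rw [h.right]; module)]
  congr 1
  push_cast; ring

theorem killed_EOm (hp : 2 ≤ p) (hm : p ≤ m) (i j : ℕ) : Killed (EOm p (rowA m) (rowB m) i j) := by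
  have wA := isWt_rowA hp hm
  have wB := isWt_rowB hp hm
  have wB' := isWt_rowB' hp hm
  have fAA := wA.form_eq_zero wA (by norm_num)
  have fAB := wA.form_eq_zero wB (by norm_num)
  have fBB := wB.form_eq_zero wB (by norm_num)
  have fAB' := wA.form_eq_zero wB' (by norm_num)
  have key : ∀ Y ∈ lieAlg p m, rowA m ᵥ* Y = 0 → (∃ c : ℝ, rowB m ᵥ* Y = c • rowA m) →
      adS p Y (EOm p (rowA m) (rowB m) i j) = 0 := by
    rintro Y hY h1 ⟨c, h2⟩
    rw [adS_EOm hp hm hY (r := 0) (s := 0) (c := c) (by rw [h1]; module) (by rw [h2]; module)]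
    simp
  rintro _ (rfl | rfl | ⟨k, hk, rfl | rfl⟩)
  · exact key _ (wedge_mem _ _) (by rw [vecMul_wedge, fAA, fAB]; module)
      ⟨0, by rw [vecMul_wedge, form_comm, fAB, fBB]; module⟩
  · exact key _ (wedge_mem _ _) (by rw [vecMul_wedge, fAA, fAB']; module)
      ⟨-form p (rowB m) (rowB' m), by rw [vecMul_wedge, form_comm, fAB]; module⟩
  · exact key _ (wedge_mem _ _) (by
      rw [vecMul_wedge, fAA, wA.form_eq_zero (isWt_bas hk) (by norm_num)]; module)
      ⟨0, by rw [vecMul_wedge, form_comm, fAB, wB.form_eq_zero (isWt_bas hk) (by norm_num)]; module⟩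
  · exact key _ (wedge_mem _ _) (by
      rw [vecMul_wedge, fAB, wA.form_eq_zero (isWt_bas hk) (by norm_num)]; module)
      ⟨0, by rw [vecMul_wedge, fBB, wB.form_eq_zero (isWt_bas hk) (by norm_num)]; module⟩

theorem killed_EOm' (hp : 2 ≤ p) (hm : p ≤ m) (hm2 : m = 2) (i j : ℕ) :
    Killed (EOm p (rowA m) (rowB' m) i j) := by
  have wA := isWt_rowA hp hm
  have wB := isWt_rowB hp hm
  have wB' := isWt_rowB' hp hm
  have fAA := wA.form_eq_zero wA (by norm_num)
  have fAB := wA.form_eq_zero wB (by norm_num)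
  have fBB := wB'.form_eq_zero wB' (by norm_num)
  have fAB' := wA.form_eq_zero wB' (by norm_num)
  have key : ∀ Y ∈ lieAlg p m, rowA m ᵥ* Y = 0 → (∃ c : ℝ, rowB' m ᵥ* Y = c • rowA m) →
      adS p Y (EOm p (rowA m) (rowB' m) i j) = 0 := by
    rintro Y hY h1 ⟨c, h2⟩
    rw [adS_EOm hp hm hY (r := 0) (s := 0) (c := c) (by rw [h1]; module) (by rw [h2]; module)]
    simp
  have hinner : ∀ k : Fin (m + 2), ¬ IsInner k := by
    intro k
    simp only [IsInner, ne_eq, Fin.ext_iff, pen, Fin.val_zero, Fin.val_one, Fin.val_castSucc,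
      Fin.val_last]
    omega
  rintro _ (rfl | rfl | ⟨k, hk, -⟩)
  · exact key _ (wedge_mem _ _) (by rw [vecMul_wedge, fAA, fAB]; module)
      ⟨-form p (rowB' m) (rowB m), by rw [vecMul_wedge, form_comm, fAB']; module⟩
  · exact key _ (wedge_mem _ _) (by rw [vecMul_wedge, fAA, fAB']; module)
      ⟨0, by rw [vecMul_wedge, form_comm, fAB', fBB]; module⟩
  · exact absurd hk (hinner k)

theorem ev₀_EOm (hp : 2 ≤ p) (hm : p ≤ m) {β : Row m} (hβ : β = rowB m ∨ β = rowB' m)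
    (i j : ℕ) : ev₀ p m (EOm p (rowA m) β i j) ≠ 0 := by
  have hm0 : 2 ≤ m := hp.trans hm
  have h1 : form p (sMinus m) (rowA m) = 1 ∧ form p (sPlus m) (rowA m) = 1 := by
    have wA := isWt_rowA hp hm
    have a1 := wA.form_eq_zero wA (by norm_num)
    have a2 := (isWt_rowB hp hm).form_eq_zero wA (by norm_num)
    have a3 := (isWt_rowB' hp hm).form_eq_zero wA (by norm_num)
    have a4 := form_rowA_rowA' hp hm
    rw [form_comm] at a4
    rw [sMinus_eq, sPlus_eq]
    simp only [form_smul_left, form_add_left, form_sub_left, a1, a2, a3, a4]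
    norm_num
  have h2 : form p (sMinus m) β = -1 ∧ form p (sPlus m) β = 1 := by
    have wA := isWt_rowA hp hm
    have wA' := isWt_rowA' hp hm
    have wB := isWt_rowB hp hm
    have wB' := isWt_rowB' hp hm
    have a4 := form_rowB_rowB' hp hm
    rw [sMinus_eq, sPlus_eq]
    rcases hβ with rfl | rfl
    · simp only [form_smul_left, form_add_left, form_sub_left, wA.form_eq_zero wB (by norm_num),
        wA'.form_eq_zero wB (by norm_num), wB.form_eq_zero wB (by norm_num), form_comm (rowB' m), a4]
      norm_num
    · simp only [form_smul_left, form_add_left, form_sub_left, wA.form_eq_zero wB' (by norm_num),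
        wA'.form_eq_zero wB' (by norm_num), wB'.form_eq_zero wB' (by norm_num), a4]
      norm_num
  rw [← ev_z₀, EOm, ev_toPoly _ z₀_mem, Epoly, map_mul, map_pow, map_pow, z₀, evalMat_tau_wedge,
    evalMat_Zp, form_sMinus_sPlus hp hm, h1.1, h1.2, h2.1, h2.2]
  norm_num

/-- The functions of a given weight annihilated by the positive root vectors. -/
theorem classification (hp : 2 ≤ p) (hm : p ≤ m) {F : polyOmega p m} (hF : F ≠ 0) (hK : Killed F)
    {a b : ℂ} (ha : adS p (carA p m) F = a • F) (hb : adS p (carB p m) F = b • F) :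
    ∃ (i j : ℕ) (c : ℂ), (F = c • EOm p (rowA m) (rowB m) i j ∧ a = i + 2 * j ∧ b = i) ∨
      (m = 2 ∧ F = c • EOm p (rowA m) (rowB' m) i j ∧ a = i + 2 * j ∧ b = -i) := by
  have wA := isWt_rowA hp hm
  have wA' := isWt_rowA' hp hm
  have wB := isWt_rowB hp hm
  have wB' := isWt_rowB' hp hm
  have uniq : ∀ {K : polyOmega p m}, Killed K → adS p (carA p m) K = a • K →
      adS p (carB p m) K = b • K → ev₀ p m K = 0 → K = 0 := by
    intro K h1 h2 h3 h4
    refine eq_zero_of_killed hp hm (S := {K | Killed K ∧ adS p (carA p m) K = a • K ∧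
      adS p (carB p m) K = b • K ∧ ev₀ p m K = 0}) ?_ ⟨h1, h2, h3, h4⟩
    have hsm : ∀ (c : ℂ) (K : polyOmega p m), (Killed K ∧ adS p (carA p m) K = a • K ∧
        adS p (carB p m) K = b • K ∧ ev₀ p m K = 0) → (Killed (c • K) ∧ adS p (carA p m) (c • K) = a • (c • K) ∧
        adS p (carB p m) (c • K) = b • (c • K) ∧ ev₀ p m (c • K) = 0) := by
      rintro c K ⟨h1, h2, h3, h4⟩
      exact ⟨fun Y hY => by rw [map_smul, h1 Y hY, smul_zero], by rw [map_smul, h2, smul_comm],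
        by rw [map_smul, h3, smul_comm], by rw [map_smul, h4, smul_zero]⟩
    rintro K hK
    refine ⟨hK.1, ?_, ?_, hK.2.2.2⟩
    · rw [hK.2.1]; exact hsm a K hK
    · rw [hK.2.2.1]; exact hsm b K hK
  have h0 : ev₀ p m F ≠ 0 := fun h => hF (uniq hK ha hb h)
  obtain ⟨⟨n₁, hn₁⟩, ⟨n₂, hn₂⟩, hn₃⟩ := weight_nat hp hm hF hK ha hb
  have mB := Submodule.neg_mem _ (carB_mem (p := p) (m := m))
  have p1 : Even n₁ := by
    refine even_of_weight hp hm (Submodule.add_mem _ carA_mem carB_mem) (β := rowB m) (β' := rowB' m)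
      rfl ?_ ?_ ?_ ?_ (F := F) ?_ h0
    · rw [vecMul_add, wA.left, wA.right]; module
    · rw [vecMul_add, wA'.left, wA'.right]; module
    · rw [vecMul_add, wB.left, wB.right]; module
    · rw [vecMul_add, wB'.left, wB'.right]; module
    · rw [adS_add hp hm carA_mem carB_mem, ha, hb, ← hn₁, add_smul]
  have p2 : Even n₂ := by
    refine even_of_weight hp hm (X := carA p m + (-1 : ℝ) • carB p m)
      (Submodule.add_mem _ carA_mem (Submodule.smul_mem _ _ carB_mem)) (β := rowB' m) (β' := rowB m)
      (add_comm _ _) ?_ ?_ ?_ ?_ (F := F) ?_ h0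
    · rw [vecMul_add, vecMul_smul, wA.left, wA.right]; module
    · rw [vecMul_add, vecMul_smul, wA'.left, wA'.right]; module
    · rw [vecMul_add, vecMul_smul, wB'.left, wB'.right]; module
    · rw [vecMul_add, vecMul_smul, wB.left, wB.right]; module
    · rw [adS_add hp hm carA_mem (Submodule.smul_mem _ _ carB_mem), adS_smul hp hm _ carB_mem, ha, hb,
        ← hn₂, smul_smul, ← add_smul]
      congr 1; push_cast; ring
  obtain ⟨l₁, rfl⟩ := p1
  obtain ⟨l₂, rfl⟩ := p2
  have fin : ∀ {G : polyOmega p m}, Killed G → adS p (carA p m) G = a • G →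
      adS p (carB p m) G = b • G → ev₀ p m G ≠ 0 → F = (ev₀ p m F / ev₀ p m G) • G := by
    intro G g1 g2 g3 g4
    have := uniq (K := F + (-(ev₀ p m F / ev₀ p m G)) • G)
      (fun Y hY => by rw [map_add, map_smul, hK Y hY, g1 Y hY, smul_zero, add_zero])
      (by rw [map_add, map_smul, ha, g2, smul_add, smul_comm])
      (by rw [map_add, map_smul, hb, g3, smul_add, smul_comm])
      (by rw [map_add, map_smul, smul_eq_mul]; field_simp; ring)
    rw [neg_smul] at this
    exact add_neg_eq_zero.1 this
  by_cases hl : l₂ ≤ l₁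
  · obtain ⟨i, rfl⟩ := Nat.exists_eq_add_of_le hl
    have ea : a = i + 2 * l₂ := by push_cast at hn₁ hn₂; linear_combination (1 / 2) * hn₁ + (1 / 2) * hn₂
    have eb : b = i := by push_cast at hn₁ hn₂; linear_combination (1 / 2) * hn₁ - (1 / 2) * hn₂
    refine ⟨i, l₂, _, Or.inl ⟨fin (killed_EOm hp hm i l₂) ?_ ?_ (ev₀_EOm hp hm (Or.inl rfl) i l₂), ea, eb⟩⟩
    · rw [wB.adS_EOm_left hp hm, ea]
    · rw [wB.adS_EOm_right hp hm, eb]; congr 1; push_cast; ring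
  · have hm2 : m = 2 := by
      by_contra hne
      have : 2 ≤ m := hp.trans hm
      obtain ⟨n₃, hn₃⟩ := hn₃ (by omega)
      have h5 : (l₁ + l₁ : ℂ) = ((n₃ + (l₂ + l₂) : ℕ) : ℂ) := by
        push_cast at hn₁ hn₂ hn₃ ⊢; linear_combination hn₃ - hn₁ + hn₂
      have h6 : l₁ + l₁ = n₃ + (l₂ + l₂) := by exact_mod_cast h5
      omega
    obtain ⟨i, rfl⟩ := Nat.exists_eq_add_of_le (le_of_lt (not_le.1 hl))
    have ea : a = i + 2 * l₁ := by push_cast at hn₁ hn₂; linear_combination (1 / 2) * hn₁ + (1 / 2) * hn₂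
    have eb : b = -i := by push_cast at hn₁ hn₂; linear_combination (1 / 2) * hn₁ - (1 / 2) * hn₂
    refine ⟨i, l₁, _, Or.inr ⟨hm2, fin (killed_EOm' hp hm hm2 i l₁) ?_ ?_ (ev₀_EOm hp hm (Or.inr rfl) i l₁), ea, eb⟩⟩
    · rw [wB'.adS_EOm_left hp hm, ea]
    · rw [wB'.adS_EOm_right hp hm, eb]; congr 1; push_cast; ring

end Classification

/-! ### The Fischer inner product -/

section Fischer

variable {ι : Type*} [Fintype ι]

/-- The squared norm of a monomial. -/
def fischerWeight (d : ι →₀ ℕ) : ℂ := ∏ i, ((d i).factorial : ℂ)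

/-- The inner product `(P(∂)‾ Q)(0)` of polynomials. -/
def fischer (P Q : MvPolynomial ι ℂ) : ℂ :=
  ∑ d ∈ P.support, fischerWeight d * (starRingEnd ℂ (P.coeff d) * Q.coeff d)

theorem fischer_eq {P : MvPolynomial ι ℂ} {s : Finset (ι →₀ ℕ)} (h : P.support ⊆ s)
    (Q : MvPolynomial ι ℂ) :
    fischer P Q = ∑ d ∈ s, fischerWeight d * (starRingEnd ℂ (P.coeff d) * Q.coeff d) := by
  refine Finset.sum_subset h fun d _ hd => ?_
  rw [MvPolynomial.notMem_support_iff.1 hd]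
  simp

/-- The Fischer inner product. -/
@[reducible] def fischerCore (ι : Type*) [Fintype ι] : InnerProductSpace.Core ℂ (MvPolynomial ι ℂ) where
  inner := fischer
  conj_inner_symm P Q := by
    classical
    rw [fischer_eq (P := Q) (s := P.support ∪ Q.support) Finset.subset_union_right,
      fischer_eq (P := P) (s := P.support ∪ Q.support) Finset.subset_union_left, map_sum]
    refine Finset.sum_congr rfl fun d _ => ?_
    simp only [map_mul, fischerWeight, map_prod, map_natCast, Complex.conj_conj]
    ring
  re_inner_nonneg P := by
    simp only [fischer, fischerWeight, Complex.conj_mul', map_sum]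
    refine Finset.sum_nonneg fun d _ => ?_
    have : (∏ i, ((d i).factorial : ℂ)) * (‖P.coeff d‖ : ℂ) ^ 2 =
        (((∏ i, ((d i).factorial : ℝ)) * ‖P.coeff d‖ ^ 2 : ℝ) : ℂ) := by push_cast; rfl
    rw [this]
    simp only [RCLike.re_to_complex, Complex.ofReal_re]
    positivity
  add_left P Q R := by
    classical
    rw [fischer_eq (MvPolynomial.support_add (p := P) (q := Q)),
      fischer_eq (P := P) (s := P.support ∪ Q.support) Finset.subset_union_left,
      fischer_eq (P := Q) (s := P.support ∪ Q.support) Finset.subset_union_right, ← Finset.sum_add_distrib]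
    refine Finset.sum_congr rfl fun d _ => ?_
    rw [MvPolynomial.coeff_add, map_add]
    ring
  smul_left P Q c := by
    rw [fischer_eq (P := c • P) MvPolynomial.support_smul, fischer, Finset.mul_sum]
    refine Finset.sum_congr rfl fun d _ => ?_
    rw [MvPolynomial.coeff_smul, smul_eq_mul, map_mul]
    ring
  definite P h := by
    have h1 : ∑ d ∈ P.support, (∏ i, ((d i).factorial : ℝ)) * ‖P.coeff d‖ ^ 2 = 0 := by
      have : ((∑ d ∈ P.support, (∏ i, ((d i).factorial : ℝ)) * ‖P.coeff d‖ ^ 2 : ℝ) : ℂ) = fischer P P := by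
        simp only [fischer, fischerWeight, Complex.conj_mul']
        push_cast; rfl
      rw [h] at this
      exact_mod_cast this
    rw [Finset.sum_eq_zero_iff_of_nonneg fun d _ => by positivity] at h1
    rw [← MvPolynomial.support_eq_empty, Finset.eq_empty_iff_forall_notMem]
    intro d hd
    have h2 : (∏ i, ((d i).factorial : ℝ)) ≠ 0 :=
      Finset.prod_ne_zero_iff.2 fun i _ => by exact_mod_cast (d i).factorial_ne_zero
    have h3 := (mul_eq_zero.1 (h1 d hd)).resolve_left h2
    exact MvPolynomial.mem_support_iff.1 hd (by simpa using h3)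

theorem fischer_mul_X [DecidableEq ι] (P Q : MvPolynomial ι ℂ) (a : ι) :
    fischer (P * MvPolynomial.X a) Q = fischer P (MvPolynomial.pderiv a Q) := by
  rw [fischer, MvPolynomial.support_mul_X, Finset.sum_map, fischer]
  refine Finset.sum_congr rfl fun d _ => ?_
  rw [addRightEmbedding_apply, MvPolynomial.coeff_mul_X, MvPolynomial.coeff_pderiv]
  have : fischerWeight (d + Finsupp.single a 1) = fischerWeight d * (d a + 1) := by
    rw [fischerWeight, fischerWeight, ← Finset.mul_prod_erase _ _ (Finset.mem_univ a),
      ← Finset.mul_prod_erase _ (fun i => ((d i).factorial : ℂ)) (Finset.mem_univ a)]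
    rw [Finset.prod_congr rfl (g := fun i => ((d i).factorial : ℂ)) fun i hi => by
      rw [Finsupp.add_apply, Finsupp.single_eq_of_ne (Finset.ne_of_mem_erase hi), add_zero]]
    rw [Finsupp.add_apply, Finsupp.single_eq_same, Nat.factorial_succ]
    push_cast; ring
  rw [this]
  ring

theorem fischer_conj (P Q : MvPolynomial ι ℂ) : starRingEnd ℂ (fischer Q P) = fischer P Q :=
  (fischerCore ι).conj_inner_symm P Q

theorem fischer_X_mul_pderiv [DecidableEq ι] (P Q : MvPolynomial ι ℂ) (a b : ι) :
    fischer (MvPolynomial.X a * MvPolynomial.pderiv b P) Q =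
      fischer P (MvPolynomial.X b * MvPolynomial.pderiv a Q) := by
  rw [mul_comm, fischer_mul_X, ← fischer_conj, ← fischer_mul_X, fischer_conj, mul_comm]

end Fischer

section Fischer

variable {p m : ℕ}

theorem adD_apply (X : Mat m) (P : PolyMat m) :
    adD X P = ∑ a, ∑ b, ∑ c, ((X b c : ℂ) • (MvPolynomial.X (a, b) * MvPolynomial.pderiv (a, c) P) -
      (X b c : ℂ) • (MvPolynomial.X (c, a) * MvPolynomial.pderiv (b, a) P)) := by
  have h : adD X = ∑ a, ∑ b, ∑ c, ((X b c : ℂ) • ((MvPolynomial.X (a, b) : PolyMat m) • MvPolynomial.pderiv (a, c)) -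
      (X b c : ℂ) • ((MvPolynomial.X (c, a) : PolyMat m) • MvPolynomial.pderiv (b, a))) := by
    refine MvPolynomial.derivation_ext fun ⟨i, j⟩ => ?_
    rw [adD_X, Matrix.mul_apply, Matrix.mul_apply]
    simp only [derivation_sum_apply, Derivation.sub_apply, Derivation.smul_apply, MvPolynomial.pderiv_X,
      Pi.single_apply, Prod.mk.injEq, Finset.sum_sub_distrib]
    congr 1
    · rw [Finset.sum_eq_single i (fun a _ ha => Finset.sum_eq_zero fun b _ => Finset.sum_eq_zero fun c _ => by
        simp [Ne.symm ha]) (by simp)]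
      refine Finset.sum_congr rfl fun b _ => ?_
      rw [Finset.sum_eq_single j (fun c _ hc => by simp [Ne.symm hc]) (by simp)]
      simp [coordMat, cst, MvPolynomial.smul_eq_C_mul, mul_comm]
    · rw [Finset.sum_eq_single j (fun a _ ha => Finset.sum_eq_zero fun b _ => Finset.sum_eq_zero fun c _ => by
        simp [Ne.symm ha]) (by simp),
        Finset.sum_eq_single i (fun b _ hb => Finset.sum_eq_zero fun c _ => by
        simp [Ne.symm hb]) (by simp)]
      refine Finset.sum_congr rfl fun b _ => ?_
      simp [coordMat, cst, MvPolynomial.smul_eq_C_mul, mul_comm]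
  conv_lhs => rw [h]
  simp only [derivation_sum_apply, Derivation.sub_apply, Derivation.smul_apply, smul_eq_mul]

theorem fischer_adD (X : Mat m) (P Q : PolyMat m) :
    fischer (adD X P) Q = fischer P (adD X.transpose Q) := by
  let _ : NormedAddCommGroup (PolyMat m) := (fischerCore _).toNormedAddCommGroup
  let _ : InnerProductSpace ℂ (PolyMat m) := InnerProductSpace.ofCore (fischerCore _).toCore
  change inner ℂ (adD X P) Q = inner ℂ P (adD X.transpose Q)
  have key : ∀ a b, inner ℂ (MvPolynomial.X a * MvPolynomial.pderiv b P) Q =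
      inner ℂ P (MvPolynomial.X b * MvPolynomial.pderiv a Q) := fun a b => fischer_X_mul_pderiv P Q a b
  simp only [adD_apply, sum_inner, inner_sum, inner_sub_left, inner_sub_right, inner_smul_left,
    inner_smul_right, Complex.conj_ofReal, key, Matrix.transpose_apply]
  exact Finset.sum_congr rfl fun a _ => Finset.sum_comm

/-- Complements of invariant subspaces. -/
theorem exists_complement (hp : 2 ≤ p) (hm : p ≤ m) {𝒳 : Set (Mat m)}
    (h𝒳 : ∀ X ∈ 𝒳, X ∈ lieAlg p m ∧ X.transpose ∈ 𝒳) {T K : Submodule ℂ (polyOmega p m)}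
    (hT : ∀ X ∈ 𝒳, ∀ F ∈ T, adS p X F ∈ T) (hK : ∀ X ∈ 𝒳, ∀ F ∈ K, adS p X F ∈ K)
    (hTK : T ≤ K) (hne : ¬ K ≤ T) :
    ∃ (k : ℕ) (V : Submodule ℂ (polyOmega p m)), V ≠ ⊥ ∧ V ≤ wS p m k ∧ V ≤ K ∧ V ⊓ T = ⊥ ∧
      ∀ X ∈ 𝒳, ∀ F ∈ V, adS p X F ∈ V := by
  let _ : NormedAddCommGroup (PolyMat m) := (fischerCore _).toNormedAddCommGroup
  let _ : InnerProductSpace ℂ (PolyMat m) := InnerProductSpace.ofCore (fischerCore _).toCore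
  obtain ⟨F, hFK, hFT⟩ := Set.not_subset.1 hne
  obtain ⟨k, P, hP, rfl⟩ := exists_homogeneous hp hm F
  let H := MvPolynomial.homogeneousSubmodule (Fin (m + 2) × Fin (m + 2)) ℂ k
  have hH : FiniteDimensional ℂ H := Module.Finite.iff_fg.2 (MvPolynomial.homogeneousSubmodule_fg _ ℂ k)
  let π : PolyMat m →ₗ[ℂ] polyOmega p m := (toPoly p m).toLinearMap
  let T' := H ⊓ T.comap π
  let K' := H ⊓ K.comap π
  have : FiniteDimensional ℂ T' := Submodule.finiteDimensional_of_le inf_le_left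
  have h1 : T' ≤ K' := inf_le_inf_left _ (Submodule.comap_mono hTK)
  have h2 := Submodule.sup_orthogonal_inf_of_hasOrthogonalProjection h1
  have h3 : P ∈ T' ⊔ T'ᗮ ⊓ K' := by rw [h2]; exact ⟨hP, hFK⟩
  obtain ⟨R, hR, Q, hQ, rfl⟩ := Submodule.mem_sup.1 h3
  refine ⟨k, (T'ᗮ ⊓ K').map π, ?_, ?_, ?_, ?_, ?_⟩
  · intro h0
    have : π Q = 0 := (Submodule.mem_bot ℂ).1 (h0 ▸ Submodule.mem_map_of_mem hQ)
    refine hFT ?_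
    rw [SetLike.mem_coe, map_add, show toPoly p m Q = 0 from this, add_zero]
    exact hR.2
  · exact Submodule.map_mono (inf_le_right.trans inf_le_left)
  · exact Submodule.map_le_iff_le_comap.2 (inf_le_right.trans inf_le_right)
  · rw [eq_bot_iff]
    rintro _ ⟨⟨Q, hQ, rfl⟩, hQT⟩
    have h4 : Q ∈ T' := ⟨hQ.2.1, hQT⟩
    have h5 : inner ℂ Q Q = 0 := hQ.1 Q h4
    rw [inner_self_eq_zero.1 h5, map_zero]
    exact Submodule.zero_mem _
  · rintro X hX _ ⟨Q, hQ, rfl⟩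
    refine ⟨adD X Q, ⟨fun R hR => ?_, isHomogeneous_adD X hQ.2.1, ?_⟩, (adS_toPoly hp hm (h𝒳 X hX).1 Q).symm⟩
    · have h4 : inner ℂ (adD X.transpose R) Q = inner ℂ R (adD X Q) := by
        have := fischer_adD X.transpose R Q
        rwa [Matrix.transpose_transpose] at this
      rw [← h4]
      refine hQ.1 _ ⟨isHomogeneous_adD _ hR.1, ?_⟩
      have h5 := hT _ (h𝒳 X hX).2 _ hR.2
      rwa [show π R = toPoly p m R from rfl, adS_toPoly hp hm (h𝒳 _ (h𝒳 X hX).2).1] at h5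
    · have h5 := hK _ hX _ hQ.2.2
      rwa [show π Q = toPoly p m Q from rfl, adS_toPoly hp hm (h𝒳 X hX).1] at h5

end Fischer

/-! ### Highest weight vectors -/

theorem exists_highest {E : Type*} [AddCommGroup E] [Module ℂ E] {A₁ A₂ : Module.End ℂ E}
    (hA : ∀ v, A₁ (A₂ v) = A₂ (A₁ v)) {𝒴 : Set (Module.End ℂ E)}
    (h𝒴 : ∀ Y ∈ 𝒴, ∃ r₁ r₂ : ℝ, 0 < 2 * r₁ + r₂ ∧ (∀ v, A₁ (Y v) = Y (A₁ v) + (r₁ : ℂ) • Y v) ∧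
      ∀ v, A₂ (Y v) = Y (A₂ v) + (r₂ : ℂ) • Y v)
    {V : Submodule ℂ E} [FiniteDimensional ℂ V] (hV : V ≠ ⊥) (hV₁ : ∀ v ∈ V, A₁ v ∈ V)
    (hV₂ : ∀ v ∈ V, A₂ v ∈ V) (hVY : ∀ Y ∈ 𝒴, ∀ v ∈ V, Y v ∈ V) :
    ∃ v ∈ V, v ≠ 0 ∧ (∃ a b : ℂ, A₁ v = a • v ∧ A₂ v = b • v) ∧ ∀ Y ∈ 𝒴, Y v = 0 := by
  let C : Module.End ℂ E := (2 : ℂ) • A₁ + A₂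
  have hC : ∀ v ∈ V, C v ∈ V := fun v hv =>
    V.add_mem (V.smul_mem _ (hV₁ v hv)) (hV₂ v hv)
  let C' : Module.End ℂ V := C.restrict hC
  have : Nontrivial V := Submodule.nontrivial_iff_ne_bot.2 hV
  obtain ⟨μ, hμ, hmax⟩ := Set.exists_max_image {μ | C'.HasEigenvalue μ} Complex.re
    C'.finite_hasEigenvalue (Module.End.exists_eigenvalue C')
  have hW1 : ∀ v : V, v ∈ C'.eigenspace μ → A₁.restrict hV₁ v ∈ C'.eigenspace μ := by
    intro v hv
    rw [Module.End.mem_eigenspace_iff] at hv ⊢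
    have h1 : C (v : E) = μ • (v : E) := congrArg Subtype.val hv
    refine Subtype.ext ?_
    change C (A₁ v) = μ • A₁ v
    rw [← map_smul, ← h1]
    simp only [C, LinearMap.add_apply, LinearMap.smul_apply, map_add, map_smul, hA]
  have : Nontrivial (C'.eigenspace μ) := Submodule.nontrivial_iff_ne_bot.2 hμ
  obtain ⟨a, ha⟩ := Module.End.exists_eigenvalue ((A₁.restrict hV₁).restrict hW1)
  obtain ⟨w, hw, hw0⟩ := ha.exists_hasEigenvector
  rw [Module.End.mem_eigenspace_iff] at hw
  have h1 : A₁ w.1.1 = a • w.1.1 := congrArg (fun x => x.1.1) hw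
  have h2 : C w.1.1 = μ • w.1.1 := congrArg Subtype.val (Module.End.mem_eigenspace_iff.1 w.2)
  have h3 : A₂ w.1.1 = (μ - 2 * a) • w.1.1 := by
    have h4 : (2 : ℂ) • A₁ w.1.1 + A₂ w.1.1 = μ • w.1.1 := h2
    rw [h1] at h4
    rw [sub_smul, ← h4]
    module
  refine ⟨w.1.1, w.1.2, fun h => hw0 (Subtype.ext (Subtype.ext h)), ⟨a, _, h1, h3⟩, fun Y hY => ?_⟩
  by_contra hY0
  obtain ⟨r₁, r₂, hr, e1, e2⟩ := h𝒴 Y hY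
  have h4 : C (Y w.1.1) = (μ + (2 * r₁ + r₂ : ℝ)) • Y w.1.1 := by
    simp only [C, LinearMap.add_apply, LinearMap.smul_apply, e1, e2, h1, h3, map_smul]
    push_cast
    module
  have h5 : C'.HasEigenvalue (μ + (2 * r₁ + r₂ : ℝ)) :=
    Module.End.hasEigenvalue_of_hasEigenvector (x := ⟨Y w.1.1, hVY Y hY _ w.1.2⟩)
      ⟨Module.End.mem_eigenspace_iff.2 (Subtype.ext h4), fun h => hY0 (congrArg Subtype.val h)⟩
  have h6 := hmax _ h5
  rw [Complex.add_re, Complex.ofReal_re] at h6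
  linarith

section Span

variable {p m : ℕ}

theorem carA_carB_comm (hp : 2 ≤ p) (hm : p ≤ m) : carA p m * carB p m = carB p m * carA p m := by
  have h3 : bas (Fin.last (m + 1)) ᵥ* carA p m = 0 := by
    rw [show bas (Fin.last (m + 1)) = (1 / 2 : ℝ) • (rowB m + rowB' m) by rw [rowB, rowB']; module,
      smul_vecMul, add_vecMul, (isWt_rowB hp hm).left, (isWt_rowB' hp hm).left]
    module
  have h4 : bas (1 : Fin (m + 2)) ᵥ* carA p m = 0 := by
    rw [show bas (1 : Fin (m + 2)) = (1 / 2 : ℝ) • (rowB' m - rowB m) by rw [rowB, rowB']; module,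
      smul_vecMul, sub_vecMul, (isWt_rowB hp hm).left, (isWt_rowB' hp hm).left]
    module
  rw [eq_comm, ← sub_eq_zero, carB, wedge_mul_sub carA_mem, h3, h4, ← zero_smul ℝ (0 : Row m),
    wedge_smul_left, wedge_smul_right, zero_smul, zero_smul, add_zero]

theorem adS_carA_carB (hp : 2 ≤ p) (hm : p ≤ m) (F : polyOmega p m) :
    adS p (carA p m) (adS p (carB p m) F) = adS p (carB p m) (adS p (carA p m) F) := by
  rw [adS_adS hp hm carB_mem carA_mem, carA_carB_comm hp hm, sub_self]
  have := adS_smul hp hm 0 (Submodule.zero_mem (lieAlg p m)) F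
  rw [zero_smul, Complex.ofReal_zero, zero_smul] at this
  rw [this, add_zero]

/-- The highest weight functions. -/
def hwSet (p m : ℕ) : Set (polyOmega p m) :=
  {F | ∃ i j : ℕ, F = EOm p (rowA m) (rowB m) i j ∨ (m = 2 ∧ F = EOm p (rowA m) (rowB' m) i j)}

theorem hwSet_subset (hp : 2 ≤ p) (hm : p ≤ m) : hwSet p m ⊆ eSet p m := by
  rintro _ ⟨i, j, rfl | ⟨-, rfl⟩⟩
  · exact ⟨_, _, i, j, isoPair_rowB hp hm, rfl⟩
  · exact ⟨_, _, i, j, isoPair_rowB' hp hm, rfl⟩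

theorem mem_of_classification (hp : 2 ≤ p) (hm : p ≤ m) {F : polyOmega p m} (hF : F ≠ 0) (hK : Killed F)
    {a b : ℂ} (ha : adS p (carA p m) F = a • F) (hb : adS p (carB p m) F = b • F) :
    F ∈ Submodule.span ℂ (hwSet p m) := by
  obtain ⟨i, j, c, ⟨h, -⟩ | ⟨h2, h, -⟩⟩ := classification hp hm hF hK ha hb <;> rw [h]
  · exact Submodule.smul_mem _ _ (Submodule.subset_span ⟨i, j, Or.inl rfl⟩)
  · exact Submodule.smul_mem _ _ (Submodule.subset_span ⟨i, j, Or.inr ⟨h2, rfl⟩⟩)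

theorem exists_highest_mem (hp : 2 ≤ p) (hm : p ≤ m) {V : Submodule ℂ (polyOmega p m)}
    [FiniteDimensional ℂ V] (hV : V ≠ ⊥) (hA : ∀ F ∈ V, adS p (carA p m) F ∈ V)
    (hB : ∀ F ∈ V, adS p (carB p m) F ∈ V)
    (hY : ∀ Y ∈ posRoots p m, ∀ F ∈ V, adS p Y F ∈ V) :
    ∃ F ∈ V, F ≠ 0 ∧ (∃ a b : ℂ, adS p (carA p m) F = a • F ∧ adS p (carB p m) F = b • F) ∧ Killed F := by
  obtain ⟨F, hF, h0, hab, hK⟩ := exists_highest (A₁ := adS p (carA p m)) (A₂ := adS p (carB p m))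
    (adS_carA_carB hp hm) (𝒴 := adS p '' posRoots p m) (by
      rintro _ ⟨Y, hY, rfl⟩
      obtain ⟨r₁, r₂, h, -, hr⟩ := exists_isRoot hp hm hY
      exact ⟨r₁, r₂, hr, h.adS_left hp hm, h.adS_right hp hm⟩) hV hA hB (by
      rintro _ ⟨Y, hY', rfl⟩
      exact hY Y hY')
  exact ⟨F, hF, h0, hab, fun Y hY => hK _ ⟨Y, hY, rfl⟩⟩

theorem transpose_mem_lieAlg {X : Mat m} (hX : X ∈ lieAlg p m) :
    X.transpose ∈ lieAlg p m := by
  rw [mem_lieAlg] at hX ⊢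
  have h := congrArg (fun M => gram p m * M * gram p m) hX
  beta_reduce at h
  rw [← Matrix.mul_assoc, gram_mul_gram, Matrix.one_mul, Matrix.mul_neg, Matrix.neg_mul,
    ← Matrix.mul_assoc (gram p m) X, Matrix.mul_assoc (gram p m * X), gram_mul_gram, Matrix.mul_one] at h
  rw [h, neg_neg, Matrix.transpose_transpose]

theorem eq_top_of_hwSet (hp : 2 ≤ p) (hm : p ≤ m) {T : Submodule ℂ (polyOmega p m)}
    (hT : ∀ X ∈ lieAlg p m, ∀ F ∈ T, adS p X F ∈ T) (h : hwSet p m ⊆ T) : T = ⊤ := by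
  by_contra hne
  obtain ⟨k, V, h0, hVk, -, hVT, hV⟩ := exists_complement hp hm (𝒳 := lieAlg p m)
    (fun X hX => ⟨hX, transpose_mem_lieAlg hX⟩) hT (fun _ _ _ _ => Submodule.mem_top) le_top
    (fun h => hne (top_le_iff.1 h))
  have := Submodule.finiteDimensional_of_le hVk
  obtain ⟨F, hF, hF0, ⟨a, b, ha, hb⟩, hK⟩ := exists_highest_mem hp hm h0 (hV _ carA_mem)
    (hV _ carB_mem) (fun Y hY => hV _ (posRoots_subset hY))
  have h1 : F ∈ V ⊓ T := ⟨hF, Submodule.span_le.2 h (mem_of_classification hp hm hF0 hK ha hb)⟩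
  rw [hVT] at h1
  exact hF0 ((Submodule.mem_bot ℂ).1 h1)

theorem transpose_car (hp : 2 ≤ p) (hm : p ≤ m) :
    (carA p m).transpose = carA p m ∧ (carB p m).transpose = carB p m := by
  have h : ∀ t₁ t₂ : ℝ, (cartan m t₁ t₂).transpose = cartan m t₁ t₂ := by
    intro t₁ t₂
    ext i j
    simp only [Matrix.transpose_apply, cartan]
    congr 1
    · exact propext (by tauto)
    · congr 1; exact propext (by tauto)
  have h1 := h 1 0
  have h2 := h 0 1
  simp only [cartan_eq hp hm, one_smul, zero_smul, add_zero, zero_add] at h1 h2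
  exact ⟨h1, h2⟩

/-- The functions annihilated by the positive root vectors. -/
theorem Killed.mem_span (hp : 2 ≤ p) (hm : p ≤ m) {F : polyOmega p m} (hF : Killed F) :
    F ∈ Submodule.span ℂ (hwSet p m) := by
  let K : Submodule ℂ (polyOmega p m) :=
    { carrier := {F | Killed F}
      zero_mem' := fun Y _ => map_zero _
      add_mem' := fun h1 h2 Y hY => by rw [map_add, h1 Y hY, h2 Y hY, add_zero]
      smul_mem' := fun c F h Y hY => by rw [map_smul, h Y hY, smul_zero] }
  have hKs : ∀ X ∈ ({carA p m, carB p m} : Set _), ∀ F ∈ K, adS p X F ∈ K := by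
    intro X hX F hF Y hY
    obtain ⟨r₁, r₂, h, -, -⟩ := exists_isRoot hp hm hY
    have hF0 : adS p Y F = 0 := hF Y hY
    rcases hX with rfl | rfl
    · have := h.adS_left hp hm F
      rwa [hF0, map_zero, smul_zero, add_zero, eq_comm] at this
    · have := h.adS_right hp hm F
      rwa [hF0, map_zero, smul_zero, add_zero, eq_comm] at this
  have hTs : ∀ X ∈ ({carA p m, carB p m} : Set _), ∀ F ∈ Submodule.span ℂ (hwSet p m),
      adS p X F ∈ Submodule.span ℂ (hwSet p m) := by
    intro X hX F hF
    refine (Submodule.span_le (p := (Submodule.span ℂ (hwSet p m)).comap (adS p X))).2 ?_ hF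
    intro F hF
    have hF' := Submodule.subset_span (R := ℂ) hF
    rcases hF with ⟨i, j, rfl | ⟨h2, rfl⟩⟩ <;> rcases hX with rfl | rfl <;>
      simp only [SetLike.mem_coe, Submodule.mem_comap, (isWt_rowB hp hm).adS_EOm_left hp hm,
        (isWt_rowB hp hm).adS_EOm_right hp hm, (isWt_rowB' hp hm).adS_EOm_left hp hm,
        (isWt_rowB' hp hm).adS_EOm_right hp hm] <;> exact Submodule.smul_mem _ _ hF'
  have hle : Submodule.span ℂ (hwSet p m) ≤ K := by
    rw [Submodule.span_le]
    rintro _ ⟨i, j, rfl | ⟨h2, rfl⟩⟩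
    · exact killed_EOm hp hm i j
    · exact killed_EOm' hp hm h2 i j
  by_contra hne
  obtain ⟨k, V, h0, hVk, hVK, hVT, hV⟩ := exists_complement hp hm (𝒳 := {carA p m, carB p m}) (by
    rintro X (rfl | rfl)
    · rw [(transpose_car hp hm).1]; exact ⟨carA_mem, Or.inl rfl⟩
    · rw [(transpose_car hp hm).2]; exact ⟨carB_mem, Or.inr rfl⟩) hTs hKs hle (fun h => hne (h hF))
  have := Submodule.finiteDimensional_of_le hVk
  obtain ⟨F, hF, hF0, ⟨a, b, ha, hb⟩, hK⟩ := exists_highest_mem hp hm h0 (hV _ (Or.inl rfl))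
    (hV _ (Or.inr rfl)) (fun Y hY F hF => by
      rw [show adS p Y F = 0 from hVK hF Y hY]; exact Submodule.zero_mem _)
  have h1 : F ∈ V ⊓ Submodule.span ℂ (hwSet p m) := ⟨hF, mem_of_classification hp hm hF0 hK ha hb⟩
  rw [hVT] at h1
  exact hF0 ((Submodule.mem_bot ℂ).1 h1)

/-! ### Infinitesimal and global invariance -/

theorem hasDerivAt_transS (hp : 2 ≤ p) (hm : p ≤ m) {X : Mat m}
    (hX : X ∈ lieAlg p m) (F : polyOmega p m) (z : Omega p m) :
    HasDerivAt (fun s : ℝ => (transS p (NormedSpace.exp (s • X)) F).1 z) ((adS p X F).1 z) 0 := by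
  obtain ⟨P, rfl⟩ := toPoly_surjective F
  rw [adS_toPoly hp hm hX, toPoly_apply]
  have h := hasDerivAt_conj_exp X z.1 0 P
  simp only [zero_smul, NormedSpace.exp_zero, inv_one, one_mul, mul_one] at h
  refine h.congr_of_eventuallyEq (Eventually.of_forall fun s => ?_)
  beta_reduce
  rw [transS_toPoly hp hm (exp_mem_orth (Submodule.smul_mem _ s hX)), toPoly_apply, evalMat_trans]

theorem adS_mem_of_transS (hp : 2 ≤ p) (hm : p ≤ m) {X : Mat m}
    (hX : X ∈ lieAlg p m) {V : Submodule ℂ (polyOmega p m)} [FiniteDimensional ℂ V] {F : polyOmega p m}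
    (hF : F ∈ V) (h : ∀ s : ℝ, transS p (NormedSpace.exp (s • X)) F ∈ V) : adS p X F ∈ V := by
  let W : Submodule ℂ (Omega p m → ℂ) := V.map (polyOmega p m).val.toLinearMap
  have : FiniteDimensional ℂ W := Module.Finite.map _ _
  have hW : IsClosed (W : Set (Omega p m → ℂ)) := Submodule.closed_of_finiteDimensional W
  have h1 : (adS p X F).1 ∈ W := by
    have h2 : ∀ z, (transS p (NormedSpace.exp ((0 : ℝ) • X)) F).1 z = F.1 z := by
      intro z
      rw [transS_apply hp hm (exp_mem_orth (Submodule.smul_mem _ 0 hX))]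
      simp
    refine hW.mem_of_tendsto (b := 𝓝[≠] (0 : ℝ)) (f := fun s : ℝ => (s⁻¹ : ℂ) •
      ((transS p (NormedSpace.exp (s • X)) F).1 - F.1)) ?_ (Eventually.of_forall fun s => ?_)
    · rw [tendsto_pi_nhds]
      intro z
      have h3 := (hasDerivAt_transS hp hm hX F z).tendsto_slope_zero
      simp only [zero_add, h2] at h3
      refine h3.congr fun s => ?_
      rw [Pi.smul_apply, Pi.sub_apply, Complex.real_smul, smul_eq_mul, Complex.ofReal_inv]
    · exact W.smul_mem _ (W.sub_mem ⟨_, h s, rfl⟩ ⟨_, hF, rfl⟩)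
  obtain ⟨G, hG, hGF⟩ := h1
  rwa [← show G = adS p X F from Subtype.ext hGF]

theorem isHomogeneous_tau (X : Mat m) : (tau X : PolyMat m).IsHomogeneous 1 := by
  rw [tau, Matrix.trace]
  refine MvPolynomial.IsHomogeneous.sum _ _ _ fun a _ => ?_
  rw [Matrix.diag_apply, Matrix.mul_apply]
  exact MvPolynomial.IsHomogeneous.sum _ _ _ fun c _ =>
    (MvPolynomial.isHomogeneous_X ℂ (a, c)).mul (MvPolynomial.isHomogeneous_C _ _)

theorem EOm_mem_wS (α β : Row m) (i j : ℕ) : EOm p α β i j ∈ wS p m (i + j) := by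
  refine ⟨Epoly p α β i j, ?_, rfl⟩
  have := ((isHomogeneous_tau (wedge p α β)).pow i).mul
    ((isHomogeneous_tau (vecMulVec (gram p m *ᵥ α) α)).pow j)
  rwa [one_mul, one_mul] at this

theorem transS_EOm (hp : 2 ≤ p) (hm : p ≤ m) {g : Mat m}
    (hg : g ∈ orth p m) (α β : Row m) (i j : ℕ) :
    transS p g (EOm p α β i j) = EOm p (α ᵥ* g⁻¹) (β ᵥ* g⁻¹) i j := by
  rw [EOm, transS_toPoly hp hm hg, trans_Epoly hg, EOm]

theorem span_eSet (hp : 2 ≤ p) (hm : p ≤ m) : Submodule.span ℂ (eSet p m) = ⊤ := by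
  refine eq_top_of_hwSet hp hm (fun X hX F hF => ?_) ((hwSet_subset hp hm).trans Submodule.subset_span)
  refine (Submodule.span_le (p := (Submodule.span ℂ (eSet p m)).comap (adS p X))).2 ?_ hF
  rintro _ ⟨α, β, i, j, h, rfl⟩
  let V := wS p m (i + j) ⊓ Submodule.span ℂ (eSet p m)
  have : FiniteDimensional ℂ V := Submodule.finiteDimensional_of_le inf_le_left
  refine (adS_mem_of_transS hp hm hX (V := V)
    ⟨EOm_mem_wS α β i j, Submodule.subset_span ⟨α, β, i, j, h, rfl⟩⟩ fun s => ?_).2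
  have ho := exp_mem_orth (Submodule.smul_mem _ s hX)
  rw [transS_EOm hp hm ho]
  exact ⟨EOm_mem_wS _ _ _ _, Submodule.subset_span ⟨_, _, i, j, h.vecMul (orth_inv ho), rfl⟩⟩

theorem NInvariant.killed (hp : 2 ≤ p) (hm : p ≤ m) {F : polyOmega p m} (hF : NInvariant F.1) : Killed F := by
  intro Y hY
  have hYl := posRoots_subset hY
  refine polyOmega_ext fun z => ?_
  have h := hasDerivAt_transS hp hm hYl F z
  have e : (fun s : ℝ => (transS p (NormedSpace.exp (s • Y)) F).1 z) = fun _ => F.1 z := by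
    funext s
    rw [transS_apply hp hm (exp_mem_orth (Submodule.smul_mem _ s hYl)), ← hF (s • Y)
      (Submodule.smul_mem _ s (posRoots_subset_nilp hp hm hY)) z, ← ev_mem F.1, Matrix.exp_neg]
  rw [e] at h
  exact h.unique (hasDerivAt_const _ _)

end Span

/-! ### Radial parts -/

section Radial

/-- The span of the exponentials. -/
def expSpan : Submodule ℂ (ℝ → ℝ → ℂ) :=
  Submodule.span ℂ (Set.range fun ab : ℂ × ℂ => fun t₁ t₂ : ℝ => Complex.exp (ab.1 * t₁ + ab.2 * t₂))

theorem hasDerivAt_expFun (a b : ℂ) (t₁ t₂ : ℝ) :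
    HasDerivAt (fun s : ℝ => Complex.exp (a * s + b * t₂)) (a * Complex.exp (a * t₁ + b * t₂)) t₁ ∧
    HasDerivAt (fun s : ℝ => Complex.exp (a * t₁ + b * s)) (b * Complex.exp (a * t₁ + b * t₂)) t₂ := by
  constructor
  · refine HasDerivAt.congr_deriv ((((hasDerivAt_id (t₁ : ℂ)).const_mul a).add_const
      (b * t₂)).cexp.comp_ofReal) ?_
    simp [mul_comm]
  · refine HasDerivAt.congr_deriv ((((hasDerivAt_id (t₂ : ℂ)).const_mul b).const_add
      (a * t₁)).cexp.comp_ofReal) ?_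
    simp [mul_comm]

theorem expSpan_differentiableAt {f : ℝ → ℝ → ℂ} (hf : f ∈ expSpan) (t₁ t₂ : ℝ) :
    DifferentiableAt ℝ (fun s => f s t₂) t₁ ∧ DifferentiableAt ℝ (fun s => f t₁ s) t₂ := by
  induction hf using Submodule.span_induction with
  | mem f h =>
    obtain ⟨⟨a, b⟩, rfl⟩ := h
    exact ⟨(hasDerivAt_expFun a b t₁ t₂).1.differentiableAt, (hasDerivAt_expFun a b t₁ t₂).2.differentiableAt⟩
  | zero => exact ⟨differentiableAt_const _, differentiableAt_const _⟩
  | add f g _ _ h1 h2 => exact ⟨h1.1.add h2.1, h1.2.add h2.2⟩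
  | smul c f _ h => exact ⟨h.1.const_smul c, h.2.const_smul c⟩

theorem firstOrder_add {f g : ℝ → ℝ → ℂ} (hf : f ∈ expSpan) (hg : g ∈ expSpan) (κ c : ℂ) :
    firstOrder κ c (f + g) = firstOrder κ c f + firstOrder κ c g := by
  funext t₁ t₂
  simp only [firstOrder, Pi.add_apply]
  rw [deriv_fun_add (expSpan_differentiableAt hf t₁ t₂).1 (expSpan_differentiableAt hg t₁ t₂).1,
    deriv_fun_add (expSpan_differentiableAt hf t₁ t₂).2 (expSpan_differentiableAt hg t₁ t₂).2]
  ring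

theorem firstOrder_smul (f : ℝ → ℝ → ℂ) (r κ c : ℂ) :
    firstOrder κ c (r • f) = r • firstOrder κ c f := by
  funext t₁ t₂
  simp only [firstOrder, Pi.smul_apply, smul_eq_mul, deriv_const_mul_field]
  ring

theorem firstOrder_exp (a b κ c : ℂ) :
    firstOrder κ c (fun t₁ t₂ : ℝ => Complex.exp (a * t₁ + b * t₂)) =
      (a + κ * b + c) • fun t₁ t₂ : ℝ => Complex.exp (a * t₁ + b * t₂) := by
  funext t₁ t₂
  simp only [firstOrder, Pi.smul_apply, smul_eq_mul]
  rw [(hasDerivAt_expFun a b t₁ t₂).1.deriv, (hasDerivAt_expFun a b t₁ t₂).2.deriv]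
  ring

theorem firstOrder_mem {f : ℝ → ℝ → ℂ} (hf : f ∈ expSpan) (κ c : ℂ) : firstOrder κ c f ∈ expSpan := by
  induction hf using Submodule.span_induction with
  | mem f h =>
    obtain ⟨⟨a, b⟩, rfl⟩ := h
    rw [firstOrder_exp]
    exact Submodule.smul_mem _ _ (Submodule.subset_span ⟨(a, b), rfl⟩)
  | zero =>
    have := firstOrder_smul 0 0 κ c
    rw [zero_smul, zero_smul] at this
    rw [this]; exact Submodule.zero_mem _
  | add f g h1 h2 h3 h4 => rw [firstOrder_add h1 h2]; exact Submodule.add_mem _ h3 h4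
  | smul r f _ h => rw [firstOrder_smul]; exact Submodule.smul_mem _ _ h

theorem opD₁_eq (n : ℂ) (f : ℝ → ℝ → ℂ) :
    opD₁ n f = firstOrder 1 (n - 3) (firstOrder 1 (n - 3) f) - (2 * n - 7) • f := rfl

theorem opD₂_eq (n : ℂ) (f : ℝ → ℝ → ℂ) :
    opD₂ n f = firstOrder (-1) 1 (firstOrder (-1) 1 f) - (2 * n - 7) • f := rfl

theorem opD_mem {f : ℝ → ℝ → ℂ} (hf : f ∈ expSpan) (n : ℂ) :
    opD₁ n f ∈ expSpan ∧ opD₂ n f ∈ expSpan :=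
  ⟨Submodule.sub_mem _ (firstOrder_mem (firstOrder_mem hf _ _) _ _) (Submodule.smul_mem _ _ hf),
    Submodule.sub_mem _ (firstOrder_mem (firstOrder_mem hf _ _) _ _) (Submodule.smul_mem _ _ hf)⟩

theorem opD_add {f g : ℝ → ℝ → ℂ} (hf : f ∈ expSpan) (hg : g ∈ expSpan) (n : ℂ) :
    opD₁ n (f + g) = opD₁ n f + opD₁ n g ∧ opD₂ n (f + g) = opD₂ n f + opD₂ n g := by
  constructor
  · rw [opD₁_eq, firstOrder_add hf hg, firstOrder_add (firstOrder_mem hf _ _) (firstOrder_mem hg _ _),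
      opD₁_eq, opD₁_eq]
    module
  · rw [opD₂_eq, firstOrder_add hf hg, firstOrder_add (firstOrder_mem hf _ _) (firstOrder_mem hg _ _),
      opD₂_eq, opD₂_eq]
    module

theorem opD_smul (f : ℝ → ℝ → ℂ) (r n : ℂ) :
    opD₁ n (r • f) = r • opD₁ n f ∧ opD₂ n (r • f) = r • opD₂ n f := by
  constructor
  · rw [opD₁_eq, firstOrder_smul, firstOrder_smul, opD₁_eq]; module
  · rw [opD₂_eq, firstOrder_smul, firstOrder_smul, opD₂_eq]; module

theorem opD_exp (n a b : ℂ) :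
    opD₁ n (fun t₁ t₂ : ℝ => Complex.exp (a * t₁ + b * t₂)) =
      d₁ n a b • (fun t₁ t₂ : ℝ => Complex.exp (a * t₁ + b * t₂)) ∧
    opD₂ n (fun t₁ t₂ : ℝ => Complex.exp (a * t₁ + b * t₂)) =
      d₂ n a b • (fun t₁ t₂ : ℝ => Complex.exp (a * t₁ + b * t₂)) := by
  constructor
  · rw [opD₁_eq, firstOrder_exp, firstOrder_smul, firstOrder_exp, smul_smul, ← sub_smul, d₁]
    congr 1; ring
  · rw [opD₂_eq, firstOrder_exp, firstOrder_smul, firstOrder_exp, smul_smul, ← sub_smul, d₂]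
    congr 1; ring

variable {p m : ℕ}

theorem cartan_mem (hp : 2 ≤ p) (hm : p ≤ m) (t₁ t₂ : ℝ) : cartan m t₁ t₂ ∈ lieAlg p m := by
  rw [cartan_eq hp hm]
  exact Submodule.add_mem _ (Submodule.smul_mem _ _ carA_mem) (Submodule.smul_mem _ _ carB_mem)

theorem exp_cartan_mem (hp : 2 ≤ p) (hm : p ≤ m) (t₁ t₂ : ℝ) :
    NormedSpace.exp (-cartan m t₁ t₂) * z₀ p m * NormedSpace.exp (cartan m t₁ t₂) ∈ Omega p m := by
  rw [Matrix.exp_neg]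
  exact conj_mem_Omega (exp_mem_SO₀ (cartan_mem hp hm t₁ t₂)) z₀_mem

theorem radialFun_add (hp : 2 ≤ p) (hm : p ≤ m) (F G : polyOmega p m) :
    radialFun (F + G).1 = radialFun F.1 + radialFun G.1 := by
  funext t₁ t₂
  simp only [radialFun, Pi.add_apply, ev_of_mem _ (exp_cartan_mem hp hm t₁ t₂)]
  rfl

theorem radialFun_smul (hp : 2 ≤ p) (hm : p ≤ m) (c : ℂ) (F : polyOmega p m) :
    radialFun (c • F).1 = c • radialFun F.1 := by
  funext t₁ t₂
  simp only [radialFun, Pi.smul_apply, ev_of_mem _ (exp_cartan_mem hp hm t₁ t₂)]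
  rfl

theorem radialFun_weight (hp : 2 ≤ p) (hm : p ≤ m) {F : polyOmega p m} {a b : ℂ}
    (ha : adS p (carA p m) F = a • F) (hb : adS p (carB p m) F = b • F) :
    radialFun F.1 = ev₀ p m F • fun t₁ t₂ : ℝ => Complex.exp (a * t₁ + b * t₂) := by
  funext t₁ t₂
  have h : adS p (cartan m t₁ t₂) F = (a * t₁ + b * t₂) • F := by
    rw [cartan_eq hp hm, adS_add hp hm (Submodule.smul_mem _ _ carA_mem) (Submodule.smul_mem _ _ carB_mem),
      adS_smul hp hm _ carA_mem, adS_smul hp hm _ carB_mem, ha, hb]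
    module
  have h1 := ev_conj_exp hp hm (cartan_mem hp hm t₁ t₂) h 1
  rw [one_smul] at h1
  rw [radialFun, Matrix.exp_neg, h1]
  simp

/-- The facts on the restriction to the Cartan subspace that are linear in the function. -/
structure RadialFacts (n : ℂ) (F : polyOmega p m) : Prop where
  mem : radialFun F.1 ∈ expSpan
  left : radialFun (adS p (carA p m) F).1 = firstOrder 0 0 (radialFun F.1)
  right : radialFun (adS p (carB p m) F).1 = firstOrder 1 0 (radialFun F.1) - firstOrder 0 0 (radialFun F.1)
  two : ∃ G ∈ Submodule.span ℂ (hwSet p m), G.1 = laplace₂ F.1 ∧ radialFun G.1 =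
    (1 / 2 : ℂ) • (opD₁ n (radialFun F.1) + opD₂ n (radialFun F.1) - ((n - 4) * (n - 6)) • radialFun F.1)
  four : ∃ G ∈ Submodule.span ℂ (hwSet p m), G.1 = laplace₄ F.1 ∧ radialFun G.1 =
    opD₁ n (opD₂ n (radialFun F.1)) + (2 * (n - 4) ^ 3) • radialFun F.1

theorem radialFacts_of_weight (hp : 2 ≤ p) (hm : p ≤ m) {n : ℂ} {F : polyOmega p m} {a b a' b' : ℂ}
    (hF : F ∈ hwSet p m) (ha : adS p (carA p m) F = a • F) (hb : adS p (carB p m) F = b • F)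
    (hj : JointEigen n a' b' F.1) (h₂ : d₁ n a b + d₂ n a b = d₁ n a' b' + d₂ n a' b')
    (h₄ : d₁ n a b * d₂ n a b = d₁ n a' b' * d₂ n a' b') : RadialFacts n F := by
  have hf := radialFun_weight hp hm ha hb
  have hs := Submodule.subset_span (R := ℂ) hF
  obtain ⟨o1, o2⟩ := opD_exp n a b
  refine ⟨?_, ?_, ?_, ⟨_, Submodule.smul_mem _ _ hs, hj.1.symm, ?_⟩, ⟨_, Submodule.smul_mem _ _ hs, hj.2.symm, ?_⟩⟩
  · rw [hf]; exact Submodule.smul_mem _ _ (Submodule.subset_span ⟨(a, b), rfl⟩)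
  · rw [ha, radialFun_smul hp hm, hf, firstOrder_smul, firstOrder_exp]; module
  · rw [hb, radialFun_smul hp hm, hf, firstOrder_smul, firstOrder_exp, firstOrder_smul, firstOrder_exp]; module
  · rw [radialFun_smul hp hm, ← h₂, hf, (opD_smul _ _ _).1, (opD_smul _ _ _).2, o1, o2]; module
  · rw [radialFun_smul hp hm, ← h₄, hf, (opD_smul _ _ _).2, (opD_smul _ _ _).1, o2, (opD_smul _ _ _).1, o1]
    module

theorem radialFacts (hp : 2 ≤ p) (hm : p ≤ m) {n : ℂ} (hn : n = m + 2) {F : polyOmega p m}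
    (hF : F ∈ Submodule.span ℂ (hwSet p m)) : RadialFacts n F := by
  induction hF using Submodule.span_induction with
  | mem F h =>
    have h' := h
    rcases h with ⟨i, j, rfl | ⟨hm2, rfl⟩⟩
    · exact radialFacts_of_weight hp hm h' ((isWt_rowB hp hm).adS_EOm_left hp hm i j)
        ((isWt_rowB hp hm).adS_EOm_right hp hm i j) (jointEigen_EOm hp hm hn (isoPair_rowB hp hm) i j)
        (by simp [d₁, d₂]) (by simp [d₁, d₂])
    · have hn4 : n = 4 := by rw [hn, hm2]; norm_num
      refine radialFacts_of_weight hp hm h' ((isWt_rowB' hp hm).adS_EOm_left hp hm i j)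
        ((isWt_rowB' hp hm).adS_EOm_right hp hm i j) (jointEigen_EOm hp hm hn (isoPair_rowB' hp hm) i j)
        ?_ ?_ <;> rw [hn4, d₁, d₂, d₁, d₂] <;> push_cast <;> ring
  | zero =>
    have h := radialFun_smul hp hm 0 (0 : polyOmega p m)
    have hw := (opD_smul (0 : ℝ → ℝ → ℂ) 0 n)
    have hl2 := laplace₂_smul hp hm 0 (0 : polyOmega p m)
    have hl4 := laplace₄_smul hp hm 0 (0 : polyOmega p m)
    have hf := fun κ c => firstOrder_smul 0 0 κ c
    simp only [zero_smul] at h hw hl2 hl4 hf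
    refine ⟨?_, ?_, ?_, ⟨0, Submodule.zero_mem _, hl2.symm, ?_⟩, ⟨0, Submodule.zero_mem _, hl4.symm, ?_⟩⟩
    · rw [h]; exact Submodule.zero_mem _
    · rw [map_zero, h, hf]
    · rw [map_zero, h, hf, hf, sub_zero]
    · rw [h, hw.1, hw.2]; module
    · rw [h, hw.2, hw.1]; module
  | add F G _ _ hF hG =>
    obtain ⟨f1, f2, f3, ⟨F2, f4, f5, f6⟩, ⟨F4, f7, f8, f9⟩⟩ := hF
    obtain ⟨g1, g2, g3, ⟨G2, g4, g5, g6⟩, ⟨G4, g7, g8, g9⟩⟩ := hG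
    refine ⟨?_, ?_, ?_, ⟨F2 + G2, Submodule.add_mem _ f4 g4, ?_, ?_⟩, ⟨F4 + G4, Submodule.add_mem _ f7 g7, ?_, ?_⟩⟩
    · rw [radialFun_add hp hm]; exact Submodule.add_mem _ f1 g1
    · rw [map_add, radialFun_add hp hm, radialFun_add hp hm, f2, g2, firstOrder_add f1 g1]
    · rw [map_add, radialFun_add hp hm, radialFun_add hp hm, f3, g3, firstOrder_add f1 g1, firstOrder_add f1 g1]
      module
    · rw [laplace₂_add hp hm, ← f5, ← g5]; rfl
    · rw [radialFun_add hp hm, radialFun_add hp hm, f6, g6, (opD_add f1 g1 n).1, (opD_add f1 g1 n).2]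
      module
    · rw [laplace₄_add hp hm, ← f8, ← g8]; rfl
    · rw [radialFun_add hp hm, radialFun_add hp hm, f9, g9, (opD_add f1 g1 n).2,
        (opD_add (opD_mem f1 n).2 (opD_mem g1 n).2 n).1]
      module
  | smul c F _ hF =>
    obtain ⟨f1, f2, f3, ⟨F2, f4, f5, f6⟩, ⟨F4, f7, f8, f9⟩⟩ := hF
    refine ⟨?_, ?_, ?_, ⟨c • F2, Submodule.smul_mem _ _ f4, ?_, ?_⟩, ⟨c • F4, Submodule.smul_mem _ _ f7, ?_, ?_⟩⟩
    · rw [radialFun_smul hp hm]; exact Submodule.smul_mem _ _ f1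
    · rw [map_smul, radialFun_smul hp hm, radialFun_smul hp hm, f2, firstOrder_smul]
    · rw [map_smul, radialFun_smul hp hm, radialFun_smul hp hm, f3, firstOrder_smul, firstOrder_smul, smul_sub]
    · rw [laplace₂_smul hp hm, ← f5]; rfl
    · rw [radialFun_smul hp hm, radialFun_smul hp hm, f6, (opD_smul _ _ _).1, (opD_smul _ _ _).2]
      module
    · rw [laplace₄_smul hp hm, ← f8]; rfl
    · rw [radialFun_smul hp hm, radialFun_smul hp hm, f9, (opD_smul _ _ _).2, (opD_smul _ _ _).1]
      module

theorem radialFun_apply (F : Omega p m → ℂ) {t₁ t₂ : ℝ} {z : Omega p m}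
    (hz : z.1 = NormedSpace.exp (-cartan m t₁ t₂) * z₀ p m * NormedSpace.exp (cartan m t₁ t₂)) :
    F z = radialFun F t₁ t₂ := by
  rw [radialFun, ← hz, ev_mem]

theorem radial_parts (hp : 2 ≤ p) (hm : p ≤ m) {n : ℂ} (hn : n = m + 2) {F : polyOmega p m}
    (hF : NInvariant F.1) {t₁ t₂ : ℝ} {z : Omega p m}
    (hz : z.1 = NormedSpace.exp (-cartan m t₁ t₂) * z₀ p m * NormedSpace.exp (cartan m t₁ t₂)) :
    laplace₂ F.1 z = 1 / 2 * (opD₁ n (radialFun F.1) t₁ t₂ + opD₂ n (radialFun F.1) t₁ t₂ -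
        (n - 4) * (n - 6) * radialFun F.1 t₁ t₂) ∧
    laplace₄ F.1 z = opD₁ n (opD₂ n (radialFun F.1)) t₁ t₂ + 2 * (n - 4) ^ 3 * radialFun F.1 t₁ t₂ := by
  obtain ⟨-, -, -, ⟨G, -, g1, g2⟩, ⟨G', -, g3, g4⟩⟩ := radialFacts hp hm hn ((hF.killed hp hm).mem_span hp hm)
  rw [← g1, ← g3, radialFun_apply G.1 hz, radialFun_apply G'.1 hz, g2, g4]
  exact ⟨rfl, rfl⟩

theorem killed_of_mem_span (hp : 2 ≤ p) (hm : p ≤ m) {K : polyOmega p m}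
    (hK : K ∈ Submodule.span ℂ (hwSet p m)) : Killed K := by
  induction hK using Submodule.span_induction with
  | mem F h =>
    obtain ⟨i, j, rfl | ⟨h2, rfl⟩⟩ := h
    · exact killed_EOm hp hm i j
    · exact killed_EOm' hp hm h2 i j
  | zero => exact fun Y _ => map_zero _
  | add F G _ _ h1 h2 => exact fun Y hY => by rw [map_add, h1 Y hY, h2 Y hY, add_zero]
  | smul c F _ h => exact fun Y hY => by rw [map_smul, h Y hY, smul_zero]

theorem eq_zero_of_radialFun (hp : 2 ≤ p) (hm : p ≤ m) {K : polyOmega p m}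
    (hK : K ∈ Submodule.span ℂ (hwSet p m)) (h0 : radialFun K.1 = 0) : K = 0 := by
  have hk := @killed_of_mem_span p m hp hm
  refine eq_zero_of_killed hp hm (S := {K | Killed K ∧ radialFun K.1 = 0}) ?_ ⟨hk hK, h0⟩
  rintro K ⟨hK, h0⟩
  have hf := radialFacts hp hm rfl (hK.mem_span hp hm)
  have hk' : ∀ X, (X = carA p m ∨ X = carB p m) → Killed (adS p X K) := by
    intro X hX Y hY
    obtain ⟨r₁, r₂, h, -, -⟩ := exists_isRoot hp hm hY
    rcases hX with rfl | rfl
    · have := h.adS_left hp hm K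
      rwa [hK Y hY, map_zero, smul_zero, add_zero, eq_comm] at this
    · have := h.adS_right hp hm K
      rwa [hK Y hY, map_zero, smul_zero, add_zero, eq_comm] at this
  have hf0 := fun κ c => firstOrder_smul 0 0 κ c
  simp only [zero_smul] at hf0
  refine ⟨hK, ⟨hk' _ (Or.inl rfl), ?_⟩, ⟨hk' _ (Or.inr rfl), ?_⟩, ?_⟩
  · rw [hf.left, h0, hf0]
  · rw [hf.right, h0, hf0, hf0, sub_zero]
  · have h1 : radialFun K.1 0 0 = ev₀ p m K := by
      have hc : cartan m 0 0 = 0 := by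
        have := cartan_eq hp hm 0 0
        rwa [zero_smul, zero_smul, add_zero] at this
      rw [radialFun, hc, neg_zero, NormedSpace.exp_zero, Matrix.one_mul, Matrix.mul_one, ev_z₀]
    rw [← h1, h0]; rfl

theorem jointEigen_of_radial (hp : 2 ≤ p) (hm : p ≤ m) {n : ℂ} (hn : n = m + 2) {F : polyOmega p m} {a b : ℂ}
    (hF : NInvariant F.1)
    (h₁ : ∀ t₁ t₂, opD₁ n (radialFun F.1) t₁ t₂ = d₁ n a b * radialFun F.1 t₁ t₂)
    (h₂ : ∀ t₁ t₂, opD₂ n (radialFun F.1) t₁ t₂ = d₂ n a b * radialFun F.1 t₁ t₂) :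
    JointEigen n a b F.1 := by
  have hs := (hF.killed hp hm).mem_span hp hm
  obtain ⟨-, -, -, ⟨G, g0, g1, g2⟩, ⟨G', g0', g3, g4⟩⟩ := radialFacts hp hm hn hs
  have e1 : opD₁ n (radialFun F.1) = d₁ n a b • radialFun F.1 := funext fun t₁ => funext fun t₂ => h₁ t₁ t₂
  have e2 : opD₂ n (radialFun F.1) = d₂ n a b • radialFun F.1 := funext fun t₁ => funext fun t₂ => h₂ t₁ t₂
  rw [e2, e1] at g2
  rw [e2, (opD_smul _ _ _).1, e1] at g4
  have key : ∀ {G : polyOmega p m} {c : ℂ}, G ∈ Submodule.span ℂ (hwSet p m) →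
      radialFun G.1 = c • radialFun F.1 → G = c • F := by
    intro G c hG h
    have := eq_zero_of_radialFun hp hm (Submodule.add_mem _ hG (Submodule.smul_mem _ (-c) hs)) (by
      rw [radialFun_add hp hm, radialFun_smul hp hm, h]; module)
    rw [neg_smul] at this
    exact add_neg_eq_zero.1 this
  rw [JointEigen, ← g1, ← g3]
  exact ⟨congrArg Subtype.val (key g0 (by rw [g2]; module)), congrArg Subtype.val (key g0' (by rw [g4]; module))⟩

end Radial

/-! ### Functions of commuting diagonalizable operators -/

section Diagonal

variable {E : Type*} [AddCommGroup E] [Module ℂ E] {A₁ A₂ : Module.End ℂ E}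

theorem exists_diag {s : Set E} (hs : ∀ v ∈ s, ∃ q : ℂ × ℂ, A₁ v = q.1 • v ∧ A₂ v = q.2 • v)
    (hspan : Submodule.span ℂ s = ⊤) (h : ℂ → ℂ → ℂ) :
    ∃ T : Module.End ℂ E, ∀ a b v, A₁ v = a • v → A₂ v = b • v → T v = h a b • v := by
  let b := Module.Basis.ofSpan hspan.ge
  have hb : ∀ i, ∃ q : ℂ × ℂ, A₁ (b i) = q.1 • b i ∧ A₂ (b i) = q.2 • b i := fun i =>
    hs _ (Module.Basis.ofSpan_subset hspan.ge ⟨i, rfl⟩)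
  choose q hq₁ hq₂ using hb
  let T : Module.End ℂ E := b.constr ℂ fun i => h (q i).1 (q i).2 • b i
  have hT : ∀ i, T (b i) = h (q i).1 (q i).2 • b i := fun i => b.constr_basis ℂ _ i
  have key : ∀ (A : Module.End ℂ E) (i : _) (c : _ → ℂ), (∀ j, A (b j) = c j • b j) → ∀ v,
      b.repr (A v) i = c i * b.repr v i := by
    intro A i c hc v
    have : (b.coord i) ∘ₗ A = c i • b.coord i := by
      refine b.ext fun j => ?_
      rcases eq_or_ne j i with rfl | hij
      · simp [hc]
      · simp [hc, hij.symm]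
    exact LinearMap.congr_fun this v
  refine ⟨T, fun a c v h₁ h₂ => b.ext_elem fun i => ?_⟩
  have e1 := key A₁ i _ hq₁ v
  have e2 := key A₂ i _ hq₂ v
  rw [h₁, map_smul, Finsupp.smul_apply, smul_eq_mul] at e1
  rw [h₂, map_smul, Finsupp.smul_apply, smul_eq_mul] at e2
  rw [key T i _ hT v, map_smul, Finsupp.smul_apply, smul_eq_mul]
  by_cases h0 : b.repr v i = 0
  · rw [h0, mul_zero, mul_zero]
  · rw [mul_right_cancel₀ h0 e1, mul_right_cancel₀ h0 e2]

theorem eigenvalues_mem {s : Set E} {Q : Set (ℂ × ℂ)}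
    (hs : ∀ v ∈ s, ∃ q ∈ Q, A₁ v = q.1 • v ∧ A₂ v = q.2 • v) {v : E} (hv : v ∈ Submodule.span ℂ s)
    (h0 : v ≠ 0) {a b : ℂ} (h₁ : A₁ v = a • v) (h₂ : A₂ v = b • v) : (a, b) ∈ Q := by
  by_contra hQ
  let W := Submodule.span ℂ s
  have hW : ∀ A : Module.End ℂ E, (∀ v ∈ s, ∃ c : ℂ, A v = c • v) → ∀ v ∈ W, A v ∈ W := by
    intro A hA v hv
    refine (Submodule.span_le (p := W.comap A)).2 (fun v hv => ?_) hv
    obtain ⟨c, hc⟩ := hA v hv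
    rw [SetLike.mem_coe, Submodule.mem_comap, hc]
    exact W.smul_mem _ (Submodule.subset_span hv)
  have hW₁ := hW A₁ fun v hv => (hs v hv).imp' Prod.fst fun q h => h.2.1
  have hW₂ := hW A₂ fun v hv => (hs v hv).imp' Prod.snd fun q h => h.2.2
  let s' : Set W := Subtype.val ⁻¹' s
  have hspan : Submodule.span ℂ s' = ⊤ := Submodule.span_span_coe_preimage
  classical
  obtain ⟨T, hT⟩ := exists_diag (A₁ := A₁.restrict hW₁) (A₂ := A₂.restrict hW₂) (s := s')
    (fun v hv => by
      obtain ⟨q, -, h⟩ := hs _ hv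
      exact ⟨q, Subtype.ext h.1, Subtype.ext h.2⟩) hspan (fun c d => if (c, d) = (a, b) then 1 else 0)
  have hT0 : T = 0 := by
    refine LinearMap.ext_on hspan fun w hw => ?_
    obtain ⟨q, hq, h⟩ := hs _ hw
    rw [hT q.1 q.2 w (Subtype.ext h.1) (Subtype.ext h.2),
      if_neg (show ¬ (q.1, q.2) = (a, b) from fun e => hQ (by rw [← e]; exact hq)), zero_smul]; rfl
  have h3 := hT a b ⟨v, hv⟩ (Subtype.ext h₁) (Subtype.ext h₂)
  rw [hT0, if_pos rfl, one_smul] at h3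
  exact h0 (congrArg Subtype.val h3).symm

end Diagonal

section Laplace

variable {p m : ℕ}

theorem exists_laplace (hp : 2 ≤ p) (hm : p ≤ m) (F : polyOmega p m) :
    (∃ G : polyOmega p m, G.1 = laplace₂ F.1) ∧ ∃ G : polyOmega p m, G.1 = laplace₄ F.1 := by
  have hF : F ∈ Submodule.span ℂ (eSet p m) := by rw [span_eSet hp hm]; trivial
  induction hF using Submodule.span_induction with
  | mem F h =>
    obtain ⟨α, β, i, j, h, rfl⟩ := h
    have hj := jointEigen_EOm hp hm rfl h i j
    exact ⟨⟨(_ : ℂ) • EOm p α β i j, hj.1.symm⟩, ⟨(_ : ℂ) • EOm p α β i j, hj.2.symm⟩⟩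
  | zero =>
    have h2 := laplace₂_smul hp hm 0 (0 : polyOmega p m)
    have h4 := laplace₄_smul hp hm 0 (0 : polyOmega p m)
    simp only [zero_smul] at h2 h4
    exact ⟨⟨0, h2.symm⟩, ⟨0, h4.symm⟩⟩
  | add F G _ _ hF hG =>
    obtain ⟨⟨F2, f2⟩, ⟨F4, f4⟩⟩ := hF
    obtain ⟨⟨G2, g2⟩, ⟨G4, g4⟩⟩ := hG
    exact ⟨⟨F2 + G2, by rw [laplace₂_add hp hm, ← f2, ← g2]; rfl⟩,
      ⟨F4 + G4, by rw [laplace₄_add hp hm, ← f4, ← g4]; rfl⟩⟩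
  | smul c F _ hF =>
    obtain ⟨⟨F2, f2⟩, ⟨F4, f4⟩⟩ := hF
    exact ⟨⟨c • F2, by rw [laplace₂_smul hp hm, ← f2]; rfl⟩, ⟨c • F4, by rw [laplace₄_smul hp hm, ← f4]; rfl⟩⟩

/-- `Δ₂` on `S(G/H)`. -/
def lapS₂ (hp : 2 ≤ p) (hm : p ≤ m) : Module.End ℂ (polyOmega p m) where
  toFun F := (exists_laplace hp hm F).1.choose
  map_add' F G := Subtype.ext (by
    rw [(exists_laplace hp hm _).1.choose_spec, laplace₂_add hp hm]
    exact (congrArg₂ _ (exists_laplace hp hm F).1.choose_spec (exists_laplace hp hm G).1.choose_spec).symm)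
  map_smul' c F := Subtype.ext (by
    rw [(exists_laplace hp hm _).1.choose_spec, laplace₂_smul hp hm]
    exact (congrArg _ (exists_laplace hp hm F).1.choose_spec).symm)

/-- `Δ₄` on `S(G/H)`. -/
def lapS₄ (hp : 2 ≤ p) (hm : p ≤ m) : Module.End ℂ (polyOmega p m) where
  toFun F := (exists_laplace hp hm F).2.choose
  map_add' F G := Subtype.ext (by
    rw [(exists_laplace hp hm _).2.choose_spec, laplace₄_add hp hm]
    exact (congrArg₂ _ (exists_laplace hp hm F).2.choose_spec (exists_laplace hp hm G).2.choose_spec).symm)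
  map_smul' c F := Subtype.ext (by
    rw [(exists_laplace hp hm _).2.choose_spec, laplace₄_smul hp hm]
    exact (congrArg _ (exists_laplace hp hm F).2.choose_spec).symm)

theorem lapS₂_val (hp : 2 ≤ p) (hm : p ≤ m) (F : polyOmega p m) : (lapS₂ hp hm F).1 = laplace₂ F.1 :=
  (exists_laplace hp hm F).1.choose_spec

theorem lapS₄_val (hp : 2 ≤ p) (hm : p ≤ m) (F : polyOmega p m) : (lapS₄ hp hm F).1 = laplace₄ F.1 :=
  (exists_laplace hp hm F).2.choose_spec

/-- The eigenvalue of `Δ₂` in terms of `a, b`. -/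
def eig₂ (n a b : ℂ) : ℂ := 1 / 2 * (d₁ n a b + d₂ n a b - (n - 4) * (n - 6))

/-- The eigenvalue of `Δ₄` in terms of `a, b`. -/
def eig₄ (n a b : ℂ) : ℂ := d₁ n a b * d₂ n a b + 2 * (n - 4) ^ 3

theorem jointEigen_iff (hp : 2 ≤ p) (hm : p ≤ m) {n a b : ℂ} {F : polyOmega p m} :
    JointEigen n a b F.1 ↔ lapS₂ hp hm F = eig₂ n a b • F ∧ lapS₄ hp hm F = eig₄ n a b • F := by
  rw [JointEigen, ← lapS₂_val hp hm, ← lapS₄_val hp hm, Subtype.ext_iff, Subtype.ext_iff]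
  rfl

theorem exists_diagS (hp : 2 ≤ p) (hm : p ≤ m) (h : ℂ → ℂ → ℂ) :
    ∃ T : Module.End ℂ (polyOmega p m), ∀ a b F, lapS₂ hp hm F = a • F → lapS₄ hp hm F = b • F →
      T F = h a b • F := by
  refine exists_diag ?_ (span_eSet hp hm) h
  rintro _ ⟨α, β, i, j, h, rfl⟩
  exact ⟨(_, _), (jointEigen_iff hp hm).1 (jointEigen_EOm hp hm rfl h i j)⟩

/-- The operator that multiplies the joint eigenfunctions by a function of the eigenvalues. -/
def diagS (hp : 2 ≤ p) (hm : p ≤ m) (h : ℂ → ℂ → ℂ) : Module.End ℂ (polyOmega p m) :=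
  (exists_diagS hp hm h).choose

theorem diagS_apply (hp : 2 ≤ p) (hm : p ≤ m) (h : ℂ → ℂ → ℂ) {a b : ℂ} {F : polyOmega p m}
    (h₂ : lapS₂ hp hm F = a • F) (h₄ : lapS₄ hp hm F = b • F) : diagS hp hm h F = h a b • F :=
  (exists_diagS hp hm h).choose_spec a b F h₂ h₄

theorem ext_eigen (hp : 2 ≤ p) (hm : p ≤ m) {T T' : Module.End ℂ (polyOmega p m)}
    (h : ∀ α β i j, IsoPair p α β → ∀ F : polyOmega p m, F = EOm p α β i j →
      lapS₂ hp hm F = eig₂ (m + 2) (i + 2 * j) i • F → lapS₄ hp hm F = eig₄ (m + 2) (i + 2 * j) i • F →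
      T F = T' F) : T = T' := by
  refine LinearMap.ext_on (span_eSet hp hm) ?_
  rintro _ ⟨α, β, i, j, h', rfl⟩
  have := (jointEigen_iff hp hm).1 (jointEigen_EOm hp hm rfl h' i j)
  exact h α β i j h' _ rfl this.1 this.2

theorem diagS_adS (hp : 2 ≤ p) (hm : p ≤ m) (h : ℂ → ℂ → ℂ) {X : Mat m}
    (hX : X ∈ lieAlg p m) (F : polyOmega p m) : diagS hp hm h (adS p X F) = adS p X (diagS hp hm h F) := by
  have key : diagS hp hm h * adS p X = adS p X * diagS hp hm h := by
    refine ext_eigen hp hm fun α β i j hαβ F hF h₂ h₄ => ?_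
    let V : Submodule ℂ (polyOmega p m) := wS p m (i + j) ⊓
      (LinearMap.eqLocus (lapS₂ hp hm) (eig₂ (m + 2) (i + 2 * j) i • LinearMap.id) ⊓
        LinearMap.eqLocus (lapS₄ hp hm) (eig₄ (m + 2) (i + 2 * j) i • LinearMap.id))
    have : FiniteDimensional ℂ V := Submodule.finiteDimensional_of_le inf_le_left
    have hV : adS p X F ∈ V := by
      refine adS_mem_of_transS hp hm hX ⟨hF ▸ EOm_mem_wS α β i j, h₂, h₄⟩ fun s => ?_
      have ho := exp_mem_orth (Submodule.smul_mem _ s hX)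
      rw [hF, transS_EOm hp hm ho]
      exact ⟨EOm_mem_wS _ _ _ _,
        (jointEigen_iff hp hm).1 (jointEigen_EOm hp hm rfl (hαβ.vecMul (orth_inv ho)) i j)⟩
    rw [Module.End.mul_apply, Module.End.mul_apply, diagS_apply hp hm h h₂ h₄,
      diagS_apply hp hm h hV.2.1 hV.2.2, map_smul]
  exact LinearMap.congr_fun key F

theorem diagS_mul (hp : 2 ≤ p) (hm : p ≤ m) (g h : ℂ → ℂ → ℂ) (F : polyOmega p m) :
    diagS hp hm g (diagS hp hm h F) = diagS hp hm (fun a b => g a b * h a b) F := by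
  have key : diagS hp hm g * diagS hp hm h = diagS hp hm (fun a b => g a b * h a b) := by
    refine ext_eigen hp hm fun α β i j hαβ F hF h₂ h₄ => ?_
    rw [Module.End.mul_apply, diagS_apply hp hm h h₂ h₄, map_smul, diagS_apply hp hm g h₂ h₄,
      diagS_apply hp hm _ h₂ h₄, smul_smul, mul_comm]
  exact LinearMap.congr_fun key F

theorem eq_zero_of_diagS (hp : 2 ≤ p) (hm : p ≤ m) {h : ℂ → ℂ → ℂ} {F G : polyOmega p m} {a b : ℂ}
    (hG : G = diagS hp hm h F) (h₂ : lapS₂ hp hm G = a • G) (h₄ : lapS₄ hp hm G = b • G)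
    (h0 : h a b = 0) : G = 0 := by
  classical
  have h1 := diagS_apply hp hm (fun c d => if (c, d) = (a, b) then 1 else 0) h₂ h₄
  have h2 : diagS hp hm (fun c d => (if (c, d) = (a, b) then 1 else 0) * h c d) = 0 := by
    refine ext_eigen hp hm fun α β i j hαβ F hF k₂ k₄ => ?_
    rw [diagS_apply hp hm _ k₂ k₄, LinearMap.zero_apply]
    split_ifs with h
    · rw [Prod.mk.injEq] at h
      rw [h.1, h.2, h0, mul_zero, zero_smul]
    · rw [zero_mul, zero_smul]
  rw [if_pos rfl, one_smul] at h1
  rw [← h1]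
  conv_lhs => rw [hG]
  rw [diagS_mul, h2, LinearMap.zero_apply]

theorem LS_eq (hp : 2 ≤ p) (hm : p ≤ m) {X : Mat m} (hX : X ∈ lieAlg p m)
    (σ : ℂ) (F : polyOmega p m) : LS p σ X F = (1 / 2 : ℂ) • adS p X F + (σ + m / 2) • (tauS p X * F) -
      (1 / 4 : ℂ) • (lapS₂ hp hm (tauS p X * F) - tauS p X * lapS₂ hp hm F) := by
  refine polyOmega_ext fun z => (LS_apply_eq hp hm hX σ F z).trans ?_
  rw [← lapS₂_val hp hm, ← lapS₂_val hp hm]; rfl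

theorem RS_eq (hp : 2 ≤ p) (hm : p ≤ m) {X : Mat m} (hX : X ∈ lieAlg p m)
    (σ : ℂ) (F : polyOmega p m) : RS p (-(m : ℂ) - σ) X F = (1 / 2 : ℂ) • adS p X F +
      (σ + m / 2) • (tauS p X * F) +
      (1 / 4 : ℂ) • (lapS₂ hp hm (tauS p X * F) - tauS p X * lapS₂ hp hm F) := by
  refine polyOmega_ext fun z => (RS_apply_eq hp hm hX σ F z).trans ?_
  rw [← lapS₂_val hp hm, ← lapS₂_val hp hm]; rfl

theorem adS_LS (hp : 2 ≤ p) (hm : p ≤ m) {X Y : Mat m} (hX : X ∈ lieAlg p m)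
    (hY : Y ∈ lieAlg p m) (σ : ℂ) (F : polyOmega p m) :
    adS p Y (LS p σ X F) = LS p σ X (adS p Y F) + LS p σ (Y * X - X * Y) F ∧
    adS p Y (RS p σ X F) = RS p σ X (adS p Y F) + RS p σ (Y * X - X * Y) F := by
  obtain ⟨P, rfl⟩ := toPoly_surjective F
  simp only [LS_toPoly hp hm hX, LS_toPoly hp hm (bracket_mem hY hX), RS_toPoly hp hm hX,
    RS_toPoly hp hm (bracket_mem hY hX), adS_toPoly hp hm hY, adD_Lop, adD_Rop, map_add, and_self]

/-- The deviation from the intertwining property, as a function of the operators. -/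
theorem diagS_RS (hp : 2 ≤ p) (hm : p ≤ m) {X : Mat m} (hX : X ∈ lieAlg p m)
    (σ : ℂ) (h : ℂ → ℂ → ℂ) {F : polyOmega p m} {a b : ℂ} (h₂ : lapS₂ hp hm F = a • F)
    (h₄ : lapS₄ hp hm F = b • F) : diagS hp hm h (RS p (-(m : ℂ) - σ) X F) =
      LS p σ X (diagS hp hm h F) + diagS hp hm (fun a' b' => h a' b' * (σ + m / 2 + (a' - a) / 4) -
        h a b * (σ + m / 2 - (a' - a) / 4)) (tauS p X * F) := by
  have key : diagS hp hm (fun a' b' => h a' b' * (σ + m / 2 + (a' - a) / 4) -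
        h a b * (σ + m / 2 - (a' - a) / 4)) = (σ + m / 2 - a / 4) • diagS hp hm h +
        (1 / 4 : ℂ) • (diagS hp hm h * lapS₂ hp hm) + (-(h a b * (σ + m / 2 + a / 4))) • LinearMap.id +
        (h a b / 4) • lapS₂ hp hm := by
    refine ext_eigen hp hm fun α β i j hαβ G hG k₂ k₄ => ?_
    simp only [LinearMap.add_apply, LinearMap.smul_apply, Module.End.mul_apply, LinearMap.id_apply,
      diagS_apply hp hm _ k₂ k₄, k₂, map_smul, smul_smul, ← add_smul]
    congr 1
    ring
  rw [key, RS_eq hp hm hX, diagS_apply hp hm h h₂ h₄, map_smul, LS_eq hp hm hX, h₂]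
  simp only [LinearMap.add_apply, LinearMap.smul_apply, Module.End.mul_apply, LinearMap.id_apply, map_add,
    map_sub, map_smul, diagS_adS hp hm h hX, diagS_apply hp hm h h₂ h₄, mul_smul_comm]
  module

end Laplace

/-! ### The ratio of Gamma functions -/

section Gamma

theorem gamma_shift {u v : ℂ} (hu : ∀ r : ℕ, u + r ≠ 0) (hv : ∀ r : ℕ, v - 1 - r ≠ 0) (k : ℕ) :
    Complex.Gamma (u + k) * Complex.Gamma (v - k) = Complex.Gamma u * Complex.Gamma v *
      ∏ r ∈ Finset.range k, (u + r) / (v - 1 - r) := by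
  induction k with
  | zero => simp
  | succ k ih =>
    have e1 := Complex.Gamma_add_one (u + k) (hu k)
    have e2 := Complex.Gamma_add_one (v - 1 - k) (hv k)
    rw [Finset.prod_range_succ, ← mul_assoc, ← ih, show v - (k : ℂ) = v - 1 - k + 1 by ring, e2]
    push_cast
    rw [← add_assoc, e1, show v - ((k : ℂ) + 1) = v - 1 - k by ring]
    field_simp [hv k]

/-- The ratio of Gamma functions at integral points. -/
def berezinCoeff (m : ℕ) (σ : ℂ) (k l : ℕ) : ℂ :=
  (∏ r ∈ Finset.range k, (σ - r) / (σ + m + r)) *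
    ∏ r ∈ Finset.range l, (σ + m / 2 - 1 - r) / (σ + m / 2 + 1 + r)

theorem gammaRatio_eq {m : ℕ} {n σ : ℂ} (hn : n = m + 2) (hσ : Gen m σ) {k l : ℕ} {a b : ℂ}
    (h₁ : a + b = 2 * k) (h₂ : a - b = 2 * l) : gammaRatio n σ a b = berezinCoeff m σ k l := by
  have g1 : ∀ r : ℤ, -σ + r ≠ 0 := fun r h => (hσ r).1 (by linear_combination -h)
  have g2 : ∀ r : ℤ, -σ - m / 2 + r ≠ 0 := fun r h => (hσ r).2 (by linear_combination -h)
  have k1 : ∀ r : ℕ, -σ + r ≠ 0 := fun r => by exact_mod_cast g1 r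
  have k2 : ∀ r : ℕ, 3 - n - σ - 1 - r ≠ 0 := fun r h => g1 (-m - r) (by
    push_cast; linear_combination h + hn)
  have k3 : ∀ r : ℕ, 2 - n / 2 - σ + r ≠ 0 := fun r h => g2 (1 + r) (by
    push_cast; linear_combination h + hn / 2)
  have k4 : ∀ r : ℕ, 1 - n / 2 - σ - 1 - r ≠ 0 := fun r h => g2 (-1 - r) (by
    push_cast; linear_combination h + hn / 2)
  have e1 := gamma_shift k1 k2 k
  have e2 := gamma_shift k3 k4 l
  have n1 : Complex.Gamma (-σ) ≠ 0 := Complex.Gamma_ne_zero fun r h => k1 r (by rw [h]; ring)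
  have n2 : Complex.Gamma (3 - n - σ) ≠ 0 := Complex.Gamma_ne_zero fun r h =>
    g1 (1 - m + r) (by push_cast; linear_combination h + hn)
  have n3 : Complex.Gamma (2 - n / 2 - σ) ≠ 0 := Complex.Gamma_ne_zero fun r h => k3 r (by rw [h]; ring)
  have n4 : Complex.Gamma (1 - n / 2 - σ) ≠ 0 := Complex.Gamma_ne_zero fun r h =>
    g2 r (by push_cast; linear_combination h + hn / 2)
  have q1 : ∏ r ∈ Finset.range k, (-σ + r) / (3 - n - σ - 1 - r) =
      ∏ r ∈ Finset.range k, (σ - r) / (σ + m + r) := Finset.prod_congr rfl fun r _ => by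
    rw [← neg_div_neg_eq, hn]; congr 1 <;> ring
  have q2 : ∏ r ∈ Finset.range l, (2 - n / 2 - σ + r) / (1 - n / 2 - σ - 1 - r) =
      ∏ r ∈ Finset.range l, (σ + m / 2 - 1 - r) / (σ + m / 2 + 1 + r) := Finset.prod_congr rfl fun r _ => by
    rw [← neg_div_neg_eq, hn]; congr 1 <;> ring
  rw [gammaRatio, h₁, h₂, mul_div_cancel_left₀ _ two_ne_zero, mul_div_cancel_left₀ _ two_ne_zero, e1,
    mul_assoc (_ * _), e2, q1, q2, berezinCoeff,
    div_eq_iff (mul_ne_zero (mul_ne_zero (mul_ne_zero n1 n2) n3) n4)]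
  ring

theorem gammaRatio_congr {n σ a b a' b' : ℂ} (h₂ : eig₂ n a b = eig₂ n a' b')
    (h₄ : eig₄ n a b = eig₄ n a' b') : gammaRatio n σ a b = gammaRatio n σ a' b' := by
  have hform : ∀ a b, gammaRatio n σ a b =
      (Complex.Gamma (-σ - (n - 3) / 2 + (a + b + n - 3) / 2) * Complex.Gamma (-σ - (n - 3) / 2 - (a + b + n - 3) / 2) *
        (Complex.Gamma (-σ - (n - 3) / 2 + (a - b + 1) / 2) * Complex.Gamma (-σ - (n - 3) / 2 - (a - b + 1) / 2))) /
      (Complex.Gamma (-σ) * Complex.Gamma (3 - n - σ) * Complex.Gamma (2 - n / 2 - σ) *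
        Complex.Gamma (1 - n / 2 - σ)) := by
    intro a b
    rw [gammaRatio, mul_assoc (_ * _)]
    congr 1
    congr 1 <;> congr 1 <;> congr 1 <;> ring
  rw [eig₂, eig₂, d₁, d₂, d₁, d₂] at h₂
  rw [eig₄, eig₄, d₁, d₂, d₁, d₂] at h₄
  set x := a + b + n - 3 with hx
  set y := a - b + 1 with hy
  set x' := a' + b' + n - 3 with hx'
  set y' := a' - b' + 1 with hy'
  have hs : x ^ 2 + y ^ 2 = x' ^ 2 + y' ^ 2 := by rw [hx, hy, hx', hy']; linear_combination 2 * h₂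
  have hq : x ^ 2 * y ^ 2 = x' ^ 2 * y' ^ 2 := by
    have e : (x ^ 2 - (2 * n - 7)) * (y ^ 2 - (2 * n - 7)) = (x' ^ 2 - (2 * n - 7)) * (y' ^ 2 - (2 * n - 7)) := by
      rw [hx, hy, hx', hy']; linear_combination h₄
    linear_combination e + (2 * n - 7) * hs
  have hpair : (x ^ 2 = x' ^ 2 ∧ y ^ 2 = y' ^ 2) ∨ (x ^ 2 = y' ^ 2 ∧ y ^ 2 = x' ^ 2) := by
    have : (x ^ 2 - x' ^ 2) * (x ^ 2 - y' ^ 2) = 0 := by linear_combination x ^ 2 * hs - hq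
    rcases mul_eq_zero.1 this with h | h
    · exact Or.inl ⟨by linear_combination h, by linear_combination hs - h⟩
    · exact Or.inr ⟨by linear_combination h, by linear_combination hs - h⟩
  have hsym : ∀ {c u v : ℂ}, u ^ 2 = v ^ 2 → Complex.Gamma (c + u / 2) * Complex.Gamma (c - u / 2) =
      Complex.Gamma (c + v / 2) * Complex.Gamma (c - v / 2) := by
    intro c u v h
    rcases sq_eq_sq_iff_eq_or_eq_neg.1 h with rfl | rfl
    · rfl
    · rw [mul_comm, neg_div, sub_neg_eq_add, ← sub_eq_add_neg]
  rw [hform, hform, ← hx, ← hy, ← hx', ← hy']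
  rcases hpair with ⟨h, h'⟩ | ⟨h, h'⟩
  · rw [hsym h, hsym h']
  · rw [hsym h, hsym h', mul_comm (_ * _)]

open Classical in
/-- The ratio of Gamma functions as a function of the eigenvalues. -/
def berezinFun (n σ x y : ℂ) : ℂ :=
  if h : ∃ q : ℂ × ℂ, eig₂ n q.1 q.2 = x ∧ eig₄ n q.1 q.2 = y then gammaRatio n σ h.choose.1 h.choose.2
  else 0

theorem berezinFun_eig (n σ a b : ℂ) : berezinFun n σ (eig₂ n a b) (eig₄ n a b) = gammaRatio n σ a b := by
  have h : ∃ q : ℂ × ℂ, eig₂ n q.1 q.2 = eig₂ n a b ∧ eig₄ n q.1 q.2 = eig₄ n a b := ⟨(a, b), rfl, rfl⟩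
  rw [berezinFun, dif_pos h]
  exact gammaRatio_congr h.choose_spec.1 h.choose_spec.2

theorem eig₂_eq {m : ℕ} {a b : ℂ} {k l : ℕ} (h₁ : a + b = 2 * k) (h₂ : a - b = 2 * l) :
    eig₂ (m + 2) a b = 2 * k * (k + m - 1) + 2 * l * (l + 1) := by
  rw [eig₂, d₁, d₂, h₁, h₂]; ring

theorem berezinCoeff_neighbour {m : ℕ} {σ : ℂ} (hσ : Gen m σ) {k l k' l' : ℕ}
    (h : (k' = k ∧ l' = l) ∨ (k' = k + 1 ∧ l' = l) ∨ (k = k' + 1 ∧ l' = l) ∨ (k' = k ∧ l' = l + 1) ∨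
      (k' = k ∧ l = l' + 1)) :
    berezinCoeff m σ k' l' * (σ + m / 2 + ((2 * k' * (k' + m - 1) + 2 * l' * (l' + 1)) -
        (2 * k * (k + m - 1) + 2 * l * (l + 1))) / 4) -
      berezinCoeff m σ k l * (σ + m / 2 - ((2 * k' * (k' + m - 1) + 2 * l' * (l' + 1)) -
        (2 * k * (k + m - 1) + 2 * l * (l + 1))) / 4) = 0 := by
  have g1 : ∀ k : ℕ, σ + m + k ≠ 0 := fun k h => (hσ (-m - k)).1 (by push_cast; linear_combination h)
  have g2 : ∀ l : ℕ, σ + m / 2 + 1 + l ≠ 0 := fun l h => (hσ (-1 - l)).2 (by push_cast; linear_combination h)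
  have e1 : ∀ k l, berezinCoeff m σ (k + 1) l * (σ + m + k) = berezinCoeff m σ k l * (σ - k) := by
    intro k l
    rw [berezinCoeff, berezinCoeff, Finset.prod_range_succ]
    field_simp [g1 k]
  have e2 : ∀ k l, berezinCoeff m σ k (l + 1) * (σ + m / 2 + 1 + l) =
      berezinCoeff m σ k l * (σ + m / 2 - 1 - l) := by
    intro k l
    rw [berezinCoeff, berezinCoeff, Finset.prod_range_succ, ← mul_assoc, mul_assoc, div_mul_cancel₀ _ (g2 l)]
  rcases h with ⟨rfl, rfl⟩ | ⟨rfl, rfl⟩ | ⟨rfl, rfl⟩ | ⟨rfl, rfl⟩ | ⟨rfl, rfl⟩ <;> push_cast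
  · ring
  · linear_combination e1 k l'
  · linear_combination -e1 k' l'
  · linear_combination e2 k' l
  · linear_combination -e2 k' l'

end Gamma

section Intertwining

variable {p m : ℕ}

theorem tauS_add (X Y : Mat m) : tauS p (X + Y) = tauS p X + tauS p Y := by
  rw [tauS, tau_add, map_add]; rfl

theorem tauS_smul (c : ℝ) (X : Mat m) :
    tauS p (c • X) = (c : ℂ) • tauS p X := by
  rw [tauS, tau_smul, map_smul]; rfl

theorem adS_tauS_mul (hp : 2 ≤ p) (hm : p ≤ m) {X Y : Mat m}
    (hX : X ∈ lieAlg p m) {F : polyOmega p m} {c : ℂ} (hF : adS p X F = c • F) :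
    adS p X (tauS p Y * F) = c • (tauS p Y * F) + tauS p (X * Y - Y * X) * F := by
  rw [adS_mul hp hm hX, hF, tauS, adS_toPoly hp hm hX, adD_tau, mul_smul_comm, mul_comm F]; rfl

/-- The functions of weights close to `(a, b)`. -/
def nearWeights (p m : ℕ) (a b : ℂ) : Set (polyOmega p m) :=
  {G | ∃ q ∈ {q : ℂ × ℂ | ∃ e₁ e₂ : ℤ, |e₁| ≤ 1 ∧ |e₂| ≤ 1 ∧ q = (a + e₁, b + e₂)},
    adS p (carA p m) G = q.1 • G ∧ adS p (carB p m) G = q.2 • G}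

theorem tauS_mul_mem (hp : 2 ≤ p) (hm : p ≤ m) {F : polyOmega p m} {a b : ℂ}
    (ha : adS p (carA p m) F = a • F) (hb : adS p (carB p m) F = b • F)
    {X : Mat m} (hX : X ∈ lieAlg p m) :
    tauS p X * F ∈ Submodule.span ℂ (nearWeights p m a b) := by
  let D : Submodule ℝ (Mat m) :=
    { carrier := {X | tauS p X * F ∈ Submodule.span ℂ (nearWeights p m a b)}
      zero_mem' := by
        have := tauS_smul (p := p) 0 (0 : Mat m)
        rw [zero_smul, Complex.ofReal_zero, zero_smul] at this
        rw [Set.mem_ofPred_eq, this, zero_mul]; exact Submodule.zero_mem _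
      add_mem' := fun h1 h2 => by
        rw [Set.mem_ofPred_eq, tauS_add, add_mul]; exact Submodule.add_mem _ h1 h2
      smul_mem' := fun c X h => by
        rw [Set.mem_ofPred_eq, tauS_smul, smul_mul_assoc]; exact Submodule.smul_mem _ _ h }
  have key : ∀ {u v : Row m} {r₁ r₂ s₁ s₂ : ℝ}, IsWt p u r₁ r₂ → IsWt p v s₁ s₂ →
      (r₁ + s₁ = -1 ∨ r₁ + s₁ = 0 ∨ r₁ + s₁ = 1) → (r₂ + s₂ = -1 ∨ r₂ + s₂ = 0 ∨ r₂ + s₂ = 1) →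
      wedge p u v ∈ D := by
    intro u v r₁ r₂ s₁ s₂ hu hv h₁ h₂
    have hint : ∀ {x : ℝ}, (x = -1 ∨ x = 0 ∨ x = 1) → ∃ e : ℤ, |e| ≤ 1 ∧ -x = e := by
      rintro x (rfl | rfl | rfl)
      · exact ⟨1, by norm_num, by norm_num⟩
      · exact ⟨0, by norm_num, by norm_num⟩
      · exact ⟨-1, by norm_num, by norm_num⟩
    obtain ⟨e₁, he₁, e1⟩ := hint h₁
    obtain ⟨e₂, he₂, e2⟩ := hint h₂
    have hr := hu.wedge hv
    rw [e1, e2] at hr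
    refine Submodule.subset_span ⟨(a + e₁, b + e₂), ⟨e₁, e₂, he₁, he₂, rfl⟩, ?_, ?_⟩
    · rw [adS_tauS_mul hp hm carA_mem ha, hr.left, tauS_smul, smul_mul_assoc, ← add_smul]; norm_num
    · rw [adS_tauS_mul hp hm carB_mem hb, hr.right, tauS_smul, smul_mul_assoc, ← add_smul]; norm_num
  have wA := isWt_rowA hp hm
  have wA' := isWt_rowA' hp hm
  have wB := isWt_rowB hp hm
  have wB' := isWt_rowB' hp hm
  let R : Set (Row m) := {u | u = rowA m ∨ u = rowA' m ∨ u = rowB m ∨ u = rowB' m ∨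
    ∃ k, IsInner k ∧ u = bas k}
  have hR : ∀ u ∈ R, ∀ v ∈ R, wedge p u v ∈ D := by
    rintro u (rfl | rfl | rfl | rfl | ⟨k, hk, rfl⟩) v (rfl | rfl | rfl | rfl | ⟨l, hl, rfl⟩) <;>
    first
      | (rw [wedge_self]; exact D.zero_mem)
      | exact key (by first | assumption | exact isWt_bas ‹_›) (by first | assumption | exact isWt_bas ‹_›)
          (by norm_num) (by norm_num)
  have hbas : ∀ i, bas i ∈ Submodule.span ℝ R := by
    intro i
    have mem : ∀ u ∈ R, u ∈ Submodule.span ℝ R := fun u hu => Submodule.subset_span hu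
    have m1 := mem (rowA m) (by simp [R])
    have m2 := mem (rowA' m) (by simp [R])
    have m3 := mem (rowB m) (by simp [R])
    have m4 := mem (rowB' m) (by simp [R])
    have lc : ∀ {u v w : Row m} (c d : ℝ), u ∈ Submodule.span ℝ R → v ∈ Submodule.span ℝ R →
        w = c • u + d • v → w ∈ Submodule.span ℝ R := by
      rintro u v w c d hu hv rfl
      exact Submodule.add_mem _ (Submodule.smul_mem _ _ hu) (Submodule.smul_mem _ _ hv)
    by_cases h0 : i = 0
    · exact lc (1 / 2) (-1 / 2) m2 m1 (by rw [h0, rowA, rowA']; module)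
    by_cases h1 : i = 1
    · exact lc (1 / 2) (-1 / 2) m4 m3 (by rw [h1, rowB, rowB']; module)
    by_cases h2 : i = pen m
    · exact lc (1 / 2) (1 / 2) m2 m1 (by rw [h2, rowA, rowA']; module)
    by_cases h3 : i = Fin.last (m + 1)
    · exact lc (1 / 2) (1 / 2) m4 m3 (by rw [h3, rowB, rowB']; module)
    · exact mem _ (Or.inr (Or.inr (Or.inr (Or.inr ⟨i, ⟨h0, h1, h2, h3⟩, rfl⟩))))
  have hspan : ∀ (f : (Row m) → Mat m),
      (∀ u v, f (u + v) = f u + f v) → (∀ (c : ℝ) u, f (c • u) = c • f u) → (∀ u ∈ R, f u ∈ D) →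
      ∀ i, f (bas i) ∈ D := by
    intro f hadd hsmul hf i
    have h := hbas i
    generalize bas i = w at h
    induction h using Submodule.span_induction with
    | mem u hu => exact hf u hu
    | zero => have := hsmul 0 0; rw [zero_smul, zero_smul] at this; rw [this]; exact D.zero_mem
    | add u v _ _ h1 h2 => rw [hadd]; exact D.add_mem h1 h2
    | smul c u _ h => rw [hsmul]; exact D.smul_mem _ h
  refine lieAlg_le (D := D) (fun i j _ => ?_) hX
  exact hspan (fun u => wedge p u (bas j)) (fun u v => wedge_add_left _ _ _) (fun c u => wedge_smul_left _ _ _)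
    (fun u hu => hspan (fun v => wedge p u v) (fun v w => wedge_add_right _ _ _)
      (fun c v => wedge_smul_right _ _ _) (fun v hv => hR u hu v hv) j) i

theorem eigen_of_killed (hp : 2 ≤ p) (hm : p ≤ m) {F : polyOmega p m} (hF : F ≠ 0) (hK : Killed F)
    {a b : ℂ} (ha : adS p (carA p m) F = a • F) (hb : adS p (carB p m) F = b • F) :
    (∃ k l : ℕ, a + b = 2 * k ∧ a - b = 2 * l) ∧ lapS₂ hp hm F = eig₂ (m + 2) a b • F ∧
      lapS₄ hp hm F = eig₄ (m + 2) a b • F := by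
  obtain ⟨i, j, c, ⟨h, rfl, rfl⟩ | ⟨h2, h, rfl, rfl⟩⟩ := classification hp hm hF hK ha hb
  · refine ⟨⟨i + j, j, by push_cast; ring, by ring⟩, ?_⟩
    obtain ⟨e2, e4⟩ := (jointEigen_iff hp hm).1 (jointEigen_EOm hp hm rfl (isoPair_rowB hp hm) i j)
    rw [h, map_smul, map_smul, e2, e4, smul_comm, smul_comm c]
    exact ⟨rfl, rfl⟩
  · refine ⟨⟨j, i + j, by ring, by push_cast; ring⟩, ?_⟩
    obtain ⟨e2, e4⟩ := (jointEigen_iff hp hm).1 (jointEigen_EOm hp hm rfl (isoPair_rowB' hp hm) i j)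
    have hm2 : (m : ℂ) = 2 := by rw [h2]; norm_num
    have q2 : eig₂ (m + 2) (i + 2 * j) (-i) = eig₂ (m + 2) (i + 2 * j) i := by
      rw [hm2, eig₂, eig₂, d₁, d₂, d₁, d₂]; ring
    have q4 : eig₄ (m + 2) (i + 2 * j) (-i) = eig₄ (m + 2) (i + 2 * j) i := by
      rw [hm2, eig₄, eig₄, d₁, d₂, d₁, d₂]; ring
    rw [q2, q4, h, map_smul, map_smul, e2, e4, smul_comm, smul_comm c]
    exact ⟨rfl, rfl⟩

theorem diagS_tauS_mul (hp : 2 ≤ p) (hm : p ≤ m) {σ : ℂ} (hσ : Gen m σ) {F : polyOmega p m} (hF : F ≠ 0)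
    (hK : Killed F) {a b : ℂ} (ha : adS p (carA p m) F = a • F) (hb : adS p (carB p m) F = b • F)
    {ψ : ℂ → ℂ → ℂ} (hψ : ψ = fun x y => berezinFun (m + 2) σ x y * (σ + m / 2 + (x - eig₂ (m + 2) a b) / 4) -
      berezinFun (m + 2) σ (eig₂ (m + 2) a b) (eig₄ (m + 2) a b) *
        (σ + m / 2 - (x - eig₂ (m + 2) a b) / 4))
    {X : Mat m} (hX : X ∈ lieAlg p m) :
    diagS hp hm ψ (tauS p X * F) = 0 := by
  obtain ⟨⟨k, l, hk, hl⟩, -⟩ := eigen_of_killed hp hm hF hK ha hb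
  let W : Submodule ℂ (polyOmega p m) := Submodule.span ℂ {G | ∃ X ∈ lieAlg p m, G = tauS p X * F}
  let V := W.map (diagS hp hm ψ)
  have hWfin : FiniteDimensional ℂ W := by
    obtain ⟨d, P, hP, hPF⟩ := exists_mem_wS hp hm F
    refine Submodule.finiteDimensional_of_le (S₂ := wS p m (1 + d)) (Submodule.span_le.2 ?_)
    rintro _ ⟨X, -, rfl⟩
    exact ⟨tau X * P, (isHomogeneous_tau X).mul hP, by rw [← hPF]; exact map_mul (toPoly p m) _ _⟩
  have : FiniteDimensional ℂ V := Module.Finite.map _ _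
  have hstab : ∀ Y ∈ lieAlg p m, (∃ c : ℂ, adS p Y F = c • F) → ∀ G ∈ V, adS p Y G ∈ V := by
    rintro Y hY ⟨c, hc⟩ _ ⟨G, hG, rfl⟩
    rw [← diagS_adS hp hm ψ hY]
    refine Submodule.mem_map_of_mem ((Submodule.span_le (p := W.comap (adS p Y))).2 ?_ hG)
    rintro _ ⟨X, hX, rfl⟩
    rw [SetLike.mem_coe, Submodule.mem_comap, adS_tauS_mul hp hm hY hc]
    exact W.add_mem (W.smul_mem _ (Submodule.subset_span ⟨X, hX, rfl⟩))
      (Submodule.subset_span ⟨_, bracket_mem hY hX, rfl⟩)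
  have hV : V = ⊥ := by
    by_contra hne
    obtain ⟨f, hf, f0, ⟨a', b', ha', hb'⟩, hfK⟩ := exists_highest_mem hp hm hne
      (hstab _ carA_mem ⟨a, ha⟩) (hstab _ carB_mem ⟨b, hb⟩)
      (fun Y hY => hstab Y (posRoots_subset hY) ⟨0, by rw [hK Y hY, zero_smul]⟩)
    obtain ⟨⟨k', l', hk', hl'⟩, e2, e4⟩ := eigen_of_killed hp hm f0 hfK ha' hb'
    have hVN : V ≤ Submodule.span ℂ (nearWeights p m a b) := by
      have h1 : W ≤ Submodule.span ℂ (nearWeights p m a b) := by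
        rw [Submodule.span_le]
        rintro _ ⟨X, hX, rfl⟩
        exact tauS_mul_mem hp hm ha hb hX
      refine (Submodule.map_mono h1).trans ?_
      rw [Submodule.map_span]
      refine Submodule.span_mono ?_
      rintro _ ⟨G, ⟨q, hq, h1, h2⟩, rfl⟩
      exact ⟨q, hq, by rw [← diagS_adS hp hm ψ carA_mem, h1, map_smul],
        by rw [← diagS_adS hp hm ψ carB_mem, h2, map_smul]⟩
    obtain ⟨e₁, e₂, he₁, he₂, hq⟩ := eigenvalues_mem (fun G hG => hG) (hVN hf) f0 ha' hb'
    rw [Prod.mk.injEq] at hq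
    have n1 : 2 * (k' : ℤ) = 2 * k + e₁ + e₂ := by
      have : (2 * k' : ℂ) = 2 * k + e₁ + e₂ := by linear_combination -hk' + hq.1 + hq.2 + hk
      exact_mod_cast this
    have n2 : 2 * (l' : ℤ) = 2 * l + e₁ - e₂ := by
      have : (2 * l' : ℂ) = 2 * l + e₁ - e₂ := by linear_combination -hl' + hq.1 - hq.2 + hl
      exact_mod_cast this
    rw [abs_le] at he₁ he₂
    obtain ⟨w, -, hw⟩ := hf
    refine f0 (eq_zero_of_diagS hp hm hw.symm e2 e4 ?_)
    rw [hψ]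
    beta_reduce
    rw [berezinFun_eig, berezinFun_eig, gammaRatio_eq rfl hσ hk' hl', gammaRatio_eq rfl hσ hk hl,
      eig₂_eq hk' hl', eig₂_eq hk hl]
    exact berezinCoeff_neighbour hσ (by omega)
  have h1 : diagS hp hm ψ (tauS p X * F) ∈ V := Submodule.mem_map_of_mem (Submodule.subset_span ⟨X, hX, rfl⟩)
  rw [hV] at h1
  exact (Submodule.mem_bot ℂ).1 h1

/-- The Berezin transform. -/
def berezin (hp : 2 ≤ p) (hm : p ≤ m) (σ : ℂ) : Module.End ℂ (polyOmega p m) :=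
  diagS hp hm (berezinFun (m + 2) σ)

theorem berezin_jointEigen (hp : 2 ≤ p) (hm : p ≤ m) {n σ a b : ℂ} (hn : n = m + 2) {F : polyOmega p m}
    (hF : JointEigen n a b F.1) : berezin hp hm σ F = gammaRatio n σ a b • F := by
  rw [jointEigen_iff hp hm] at hF
  rw [berezin, ← hn, diagS_apply hp hm _ hF.1 hF.2, berezinFun_eig]

theorem berezin_RS (hp : 2 ≤ p) (hm : p ≤ m) {σ : ℂ} (hσ : Gen m σ)
    {X : Mat m} (hX : X ∈ lieAlg p m) (F : polyOmega p m) :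
    berezin hp hm σ (RS p (-(m : ℂ) - σ) X F) = LS p σ X (berezin hp hm σ F) := by
  let T : Submodule ℂ (polyOmega p m) :=
    { carrier := {F | ∀ X ∈ lieAlg p m, berezin hp hm σ (RS p (-(m : ℂ) - σ) X F) = LS p σ X (berezin hp hm σ F)}
      zero_mem' := fun X _ => by simp only [map_zero]
      add_mem' := fun h1 h2 X hX => by simp only [map_add, h1 X hX, h2 X hX]
      smul_mem' := fun c F h X hX => by simp only [map_smul, h X hX] }
  have hT : T = ⊤ := by
    refine eq_top_of_hwSet hp hm (fun Y hY F hF X hX => ?_) ?_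
    · have h1 := congrArg (adS p Y) (hF X hX)
      have hB : ∀ G, adS p Y (berezin hp hm σ G) = berezin hp hm σ (adS p Y G) := fun G =>
        (diagS_adS hp hm _ hY G).symm
      rw [(adS_LS hp hm hX hY σ _).1, hB, (adS_LS hp hm hX hY _ _).2, map_add, hF _ (bracket_mem hY hX), hB] at h1
      exact add_right_cancel h1
    · have fin : ∀ {F : polyOmega p m} {a b : ℂ}, Killed F → adS p (carA p m) F = a • F →
          adS p (carB p m) F = b • F → F ∈ T := by
        intro F a b hK ha hb X hX
        by_cases hF : F = 0
        · rw [hF]; simp only [map_zero]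
        obtain ⟨-, e2, e4⟩ := eigen_of_killed hp hm hF hK ha hb
        rw [berezin, diagS_RS hp hm hX σ _ e2 e4, diagS_tauS_mul hp hm hσ hF hK ha hb rfl hX, add_zero]
      rintro _ ⟨i, j, rfl | ⟨h2, rfl⟩⟩
      · exact fin (killed_EOm hp hm i j) ((isWt_rowB hp hm).adS_EOm_left hp hm i j)
          ((isWt_rowB hp hm).adS_EOm_right hp hm i j)
      · exact fin (killed_EOm' hp hm h2 i j) ((isWt_rowB' hp hm).adS_EOm_left hp hm i j)
          ((isWt_rowB' hp hm).adS_EOm_right hp hm i j)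
  have hF : F ∈ T := hT ▸ Submodule.mem_top
  exact hF X hX

theorem berezin_EOm (hp : 2 ≤ p) (hm : p ≤ m) {σ : ℂ} (hσ : Gen m σ) {α β : Row m}
    (h : IsoPair p α β) (i j : ℕ) :
    berezin hp hm σ (EOm p α β i j) = berezinCoeff m σ (i + j) j • EOm p α β i j := by
  rw [berezin_jointEigen hp hm rfl (jointEigen_EOm hp hm rfl h i j),
    gammaRatio_eq rfl hσ (k := i + j) (l := j) (by push_cast; ring) (by ring)]

theorem berezin_one (hp : 2 ≤ p) (hm : p ≤ m) {σ : ℂ} (hσ : Gen m σ) :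
    berezin hp hm σ (1 : polyOmega p m) = 1 := by
  have := berezin_EOm hp hm hσ (isoPair_rowB hp hm) 0 0
  rwa [EOm_zero_zero, berezinCoeff, Finset.prod_range_zero, Finset.prod_range_zero, one_mul, one_smul] at this

end Intertwining

/-! ### Asymptotic expansions -/

section Asy

variable {l : Filter ℝ}

/-- `f(σ) = c₀ + c₁ σ⁻¹ + O(σ⁻²)`. -/
def Asy (l : Filter ℝ) (f : ℝ → ℂ) (c₀ c₁ : ℂ) : Prop :=
  (fun σ : ℝ => f σ - (c₀ + c₁ * (σ : ℂ)⁻¹)) =O[l] fun σ : ℝ => (σ ^ 2)⁻¹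

theorem tendsto_inv_ofReal (hl : l ≤ atBot) : Tendsto (fun σ : ℝ => (σ : ℂ)⁻¹) l (𝓝 0) := by
  have h := (Complex.continuous_ofReal.tendsto 0).comp ((tendsto_inv_atBot_zero (𝕜 := ℝ)).mono_left hl)
  rw [Complex.ofReal_zero] at h
  exact h.congr fun σ => by simp

theorem isBigO_inv_sq (c : ℂ) : (fun σ : ℝ => c * ((σ : ℂ)⁻¹ * (σ : ℂ)⁻¹)) =O[l] fun σ : ℝ => (σ ^ 2)⁻¹ := by
  refine IsBigO.of_bound ‖c‖ (Eventually.of_forall fun σ => le_of_eq ?_)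
  simp [sq]

theorem Asy.congr {f g : ℝ → ℂ} {c₀ c₁ : ℂ} (h : Asy l f c₀ c₁) (hfg : f =ᶠ[l] g) : Asy l g c₀ c₁ :=
  IsBigO.congr' h (hfg.mono fun σ hσ => by beta_reduce; rw [hσ]) EventuallyEq.rfl

theorem Asy.of_eq {f g : ℝ → ℂ} {c₀ c₁ d₀ d₁ : ℂ} (h : Asy l f c₀ c₁) (hfg : ∀ σ, g σ = f σ) (h₀ : d₀ = c₀)
    (h₁ : d₁ = c₁) : Asy l g d₀ d₁ := by
  rw [h₀, h₁, funext hfg]; exact h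

theorem Asy.const (c : ℂ) : Asy l (fun _ => c) c 0 := by
  refine (isBigO_zero _ _).congr_left fun σ => ?_
  simp

theorem Asy.add {f g : ℝ → ℂ} {c₀ c₁ d₀ d₁ : ℂ} (hf : Asy l f c₀ c₁) (hg : Asy l g d₀ d₁) :
    Asy l (fun σ => f σ + g σ) (c₀ + d₀) (c₁ + d₁) :=
  (IsBigO.add hf hg).congr_left fun σ => by ring

theorem Asy.tendsto (hl : l ≤ atBot) {f : ℝ → ℂ} {c₀ c₁ : ℂ} (h : Asy l f c₀ c₁) :
    Tendsto f l (𝓝 c₀) ∧ Tendsto (fun σ : ℝ => (σ : ℂ) * (f σ - c₀)) l (𝓝 c₁) := by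
  unfold Asy at h
  have h0 := tendsto_inv_ofReal hl
  have hne : ∀ᶠ σ : ℝ in l, (σ : ℂ) ≠ 0 := ((eventually_lt_atBot 0).filter_mono hl).mono fun σ hσ =>
    Complex.ofReal_ne_zero.2 hσ.ne
  have h1 : Tendsto (fun σ : ℝ => (σ : ℂ) * (f σ - (c₀ + c₁ * (σ : ℂ)⁻¹))) l (𝓝 0) := by
    have h2 : (fun σ : ℝ => (σ : ℂ) * (f σ - (c₀ + c₁ * (σ : ℂ)⁻¹))) =O[l] fun σ : ℝ => (σ : ℂ)⁻¹ := by
      refine (((isBigO_refl (fun σ : ℝ => (σ : ℂ)) l).norm_right).mul h).trans (IsBigO.of_bound 1 ?_)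
      filter_upwards [hne] with σ hσ
      have hσ' := norm_ne_zero_iff.2 hσ
      rw [Complex.norm_real, Real.norm_eq_abs] at hσ'
      simp only [norm_mul, norm_inv, Complex.norm_real, Real.norm_eq_abs, abs_abs, one_mul, sq]
      exact le_of_eq (by field_simp)
    exact h2.trans_tendsto h0
  have h3 : Tendsto (fun σ : ℝ => (σ : ℂ) * (f σ - c₀)) l (𝓝 c₁) := by
    have := h1.add_const c₁
    rw [zero_add] at this
    refine this.congr' (hne.mono fun σ hσ => ?_)
    field_simp
    ring
  refine ⟨?_, h3⟩
  have := (h0.mul h3).add_const c₀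
  rw [zero_mul, zero_add] at this
  refine this.congr' (hne.mono fun σ hσ => ?_)
  rw [← mul_assoc, inv_mul_cancel₀ hσ, one_mul, sub_add_cancel]

theorem Asy.unique [l.NeBot] (hl : l ≤ atBot) {f : ℝ → ℂ} {c₀ c₁ d₀ d₁ : ℂ} (h : Asy l f c₀ c₁)
    (h' : Asy l f d₀ d₁) : c₀ = d₀ ∧ c₁ = d₁ := by
  have h0 := tendsto_nhds_unique (h.tendsto hl).1 (h'.tendsto hl).1
  subst h0
  exact ⟨rfl, tendsto_nhds_unique (h.tendsto hl).2 (h'.tendsto hl).2⟩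

theorem Asy.mul (hl : l ≤ atBot) {f g : ℝ → ℂ} {c₀ c₁ d₀ d₁ : ℂ} (hf : Asy l f c₀ c₁) (hg : Asy l g d₀ d₁) :
    Asy l (fun σ => f σ * g σ) (c₀ * d₀) (c₀ * d₁ + c₁ * d₀) := by
  have h1 : Tendsto (fun σ : ℝ => c₀ + c₁ * (σ : ℂ)⁻¹) l (𝓝 (c₀ + c₁ * 0)) :=
    ((tendsto_inv_ofReal hl).const_mul c₁).const_add c₀
  have h2 := IsBigO.mul hf ((hg.tendsto hl).1.isBigO_one ℝ)
  have h3 := (h1.isBigO_one ℝ).mul hg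
  simp only [mul_one, one_mul] at h2 h3
  exact ((h2.add h3).add (isBigO_inv_sq (c₁ * d₁))).congr_left fun σ => by ring

theorem Asy.div (hl : l ≤ atBot) (p q : ℂ) : Asy l (fun σ : ℝ => (σ + p) / (σ + q)) 1 (p - q) := by
  have h1 : Tendsto (fun σ : ℝ => 1 + q * (σ : ℂ)⁻¹) l (𝓝 1) := by
    have := ((tendsto_inv_ofReal hl).const_mul q).const_add 1
    rwa [mul_zero, add_zero] at this
  have h2 := (h1.inv₀ one_ne_zero).isBigO_one ℝ
  have h3 := (isBigO_inv_sq (l := l) (-(p - q) * q)).mul h2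
  simp only [mul_one] at h3
  refine IsBigO.congr' h3 ?_ EventuallyEq.rfl
  filter_upwards [(eventually_lt_atBot 0).filter_mono hl, h1.eventually_ne one_ne_zero] with σ hσ hq
  have hσ' : (σ : ℂ) ≠ 0 := Complex.ofReal_ne_zero.2 hσ.ne
  have hq' : (σ : ℂ) + q ≠ 0 := by
    intro h
    apply hq
    field_simp
    rw [h, mul_zero]
  have e : (1 + q * (σ : ℂ)⁻¹)⁻¹ = σ / (σ + q) := by
    rw [eq_div_iff hq', inv_mul_eq_iff_eq_mul₀ hq]
    field_simp
  rw [e]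
  field_simp
  ring

theorem asy_berezinCoeff (hl : l ≤ atBot) (m k j : ℕ) :
    Asy l (fun σ : ℝ => berezinCoeff m σ k j) 1 (-(k * (k + m - 1) + j * (j + 1))) := by
  have h1 : Asy l (fun σ : ℝ => ∏ r ∈ Finset.range k, ((σ : ℂ) - r) / (σ + m + r)) 1 (-(k * (k + m - 1))) := by
    induction k with
    | zero => simpa using Asy.const (l := l) 1
    | succ k ih =>
      have := ih.mul hl (Asy.div hl (-k) (m + k))
      simp only [Finset.prod_range_succ]
      convert this using 4 <;> push_cast <;> ring
  have h2 : Asy l (fun σ : ℝ => ∏ r ∈ Finset.range j, ((σ : ℂ) + m / 2 - 1 - r) / (σ + m / 2 + 1 + r)) 1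
      (-(j * (j + 1))) := by
    induction j with
    | zero => simpa using Asy.const (l := l) 1
    | succ k ih =>
      have := ih.mul hl (Asy.div hl (m / 2 - 1 - k) (m / 2 + 1 + k))
      simp only [Finset.prod_range_succ]
      convert this using 4 <;> push_cast <;> ring
  exact (h1.mul hl h2).of_eq (fun σ => rfl) (by ring) (by ring)

theorem toMinusInfty_neBot {m : ℕ} {n : ℂ} (hn : n = m + 2) : (toMinusInfty n).NeBot := by
  rw [toMinusInfty, ← frequently_mem_iff_neBot, frequently_atBot]
  intro a
  refine ⟨-(⌈|a|⌉₊ : ℝ) - 1 / 4, ?_, fun k => ⟨fun h => ?_, fun h => ?_⟩⟩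
  · have := Nat.le_ceil |a|
    have := neg_abs_le a
    linarith
  · have : (-(4 * ⌈|a|⌉₊ : ℕ) - 1 : ℂ) = 4 * k := by push_cast at h ⊢; linear_combination 4 * h
    have : (-((4 * ⌈|a|⌉₊ : ℕ) : ℤ) - 1 : ℤ) = 4 * k := by exact_mod_cast this
    omega
  · have : (-(4 * ⌈|a|⌉₊ : ℕ) - 1 + 2 * (m + 2) : ℂ) = 4 * k := by
      push_cast at h ⊢; linear_combination 4 * h - 2 * hn
    have : (-((4 * ⌈|a|⌉₊ : ℕ) : ℤ) - 1 + 2 * ((m : ℤ) + 2) : ℤ) = 4 * k := by exact_mod_cast this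
    omega

theorem eventually_gen {m : ℕ} {n : ℂ} (hn : n = m + 2) : ∀ᶠ σ : ℝ in toMinusInfty n, Gen m (σ : ℂ) :=
  ((eventually_principal.2 fun _ h => h : ∀ᶠ σ : ℝ in 𝓟 {σ : ℝ | Generic n σ}, Generic n σ).filter_mono
    inf_le_right).mono fun _ h => h.gen hn

end Asy

section BerezinAsymptotics

variable {p m : ℕ}

theorem berezin_asymptotics (hp : 2 ≤ p) (hm : p ≤ m) {n : ℂ} (hn : n = m + 2) (F : polyOmega p m)
    (z : Omega p m) :
    Asy (toMinusInfty n) (fun σ : ℝ => (berezin hp hm σ F).1 z) (F.1 z) (-(1 / 2) * laplace₂ F.1 z) := by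
  have hF : F ∈ Submodule.span ℂ (eSet p m) := by rw [span_eSet hp hm]; trivial
  have hl : toMinusInfty n ≤ atBot := inf_le_left
  rw [← lapS₂_val hp hm]
  induction hF using Submodule.span_induction with
  | mem F h =>
    obtain ⟨α, β, i, j, h, rfl⟩ := h
    have h1 := (asy_berezinCoeff hl m (i + j) j).mul hl (Asy.const ((EOm p α β i j).1 z))
    rw [((jointEigen_iff hp hm).1 (jointEigen_EOm hp hm rfl h i j)).1, eig₂_eq (k := i + j) (l := j)
      (by push_cast; ring) (by ring)]
    refine (h1.congr (g := fun σ : ℝ => (berezin hp hm σ (EOm p α β i j)).1 z) ?_).of_eq (fun σ => rfl)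
      (one_mul _).symm ?_
    · filter_upwards [eventually_gen hn] with σ hσ
      rw [berezin_EOm hp hm hσ h]; rfl
    · change _ * (_ * (EOm p α β i j).1 z) = _
      ring
  | zero =>
    refine (Asy.const 0).of_eq (fun σ => by rw [map_zero]; rfl) rfl ?_
    rw [map_zero]; exact mul_zero _
  | add F G _ _ hF hG =>
    refine (hF.add hG).of_eq (fun σ => by rw [map_add]; rfl) rfl ?_
    rw [map_add, ← mul_add]; rfl
  | smul c F _ hF =>
    refine ((Asy.const c).mul hl hF).of_eq (fun σ => by rw [map_smul]; rfl) rfl ?_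
    rw [map_smul, zero_mul, add_zero, mul_left_comm]; rfl

end BerezinAsymptotics

/-! ### The correspondence principle -/

section Star

variable {p m : ℕ}

/-- The polynomials in `σ⁻¹` with coefficients in `S(G/H)`. -/
def invPoly (p m : ℕ) : Submodule ℂ (ℝ → polyOmega p m) :=
  Submodule.span ℂ {Q | ∃ (k : ℕ) (G : polyOmega p m), Q = fun σ : ℝ => ((σ : ℂ)⁻¹) ^ k • G}

theorem const_mem_invPoly (G : polyOmega p m) : (fun _ => G) ∈ invPoly p m :=
  Submodule.subset_span ⟨0, G, funext fun σ => by rw [pow_zero, one_smul]⟩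

theorem shift_mem_invPoly {R : ℝ → polyOmega p m} (hR : R ∈ invPoly p m) (k : ℕ) :
    (fun σ : ℝ => ((σ : ℂ)⁻¹) ^ k • R σ) ∈ invPoly p m := by
  induction hR using Submodule.span_induction with
  | mem Q h =>
    obtain ⟨r, G, rfl⟩ := h
    exact Submodule.subset_span ⟨k + r, G, funext fun σ => by rw [smul_smul, pow_add]⟩
  | zero => simp only [Pi.zero_apply, smul_zero]; exact Submodule.zero_mem _
  | add Q R _ _ h1 h2 => simp only [Pi.add_apply, smul_add]; exact Submodule.add_mem _ h1 h2
  | smul c Q _ h => simp only [Pi.smul_apply, smul_comm _ c]; exact Submodule.smul_mem _ c h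

theorem isBigO_invPoly {l : Filter ℝ} (hl : l ≤ atBot) {R : ℝ → polyOmega p m} (hR : R ∈ invPoly p m)
    (z : Omega p m) : (fun σ => (R σ).1 z) =O[l] fun _ => (1 : ℝ) := by
  induction hR using Submodule.span_induction with
  | mem Q h =>
    obtain ⟨k, G, rfl⟩ := h
    exact (((tendsto_inv_ofReal hl).pow k).mul_const (G.1 z)).isBigO_one ℝ
  | zero => exact isBigO_zero _ _
  | add Q R _ _ h1 h2 => exact h1.add h2
  | smul c Q _ h => exact h.const_mul_left c

/-- The family `A` of operators is `F ↦ f F + σ⁻¹ ({f, F}' + g F) + O(σ⁻²)`, where `{ , }'` is half of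
the Poisson bracket. -/
def IsSymbol (A : ℝ → Module.End ℂ (polyOmega p m)) (f : polyOmega p m) : Prop :=
  ∃ g : Omega p m → ℂ, ∀ F : polyOmega p m, ∃ (G : polyOmega p m), ∃ R ∈ invPoly p m,
    (∀ σ : ℝ, σ ≠ 0 → A σ F = f * F + (σ : ℂ)⁻¹ • G + ((σ : ℂ)⁻¹) ^ 2 • R σ) ∧
      ∀ z, G.1 z = gam f.1 F.1 z + g z * F.1 z

theorem IsSymbol.apply_mem {A : ℝ → Module.End ℂ (polyOmega p m)} {f : polyOmega p m} (hA : IsSymbol A f)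
    {R : ℝ → polyOmega p m} (hR : R ∈ invPoly p m) :
    ∃ R' ∈ invPoly p m, ∀ σ : ℝ, σ ≠ 0 → A σ (R σ) = R' σ := by
  obtain ⟨g, hg⟩ := hA
  induction hR using Submodule.span_induction with
  | mem Q h =>
    obtain ⟨k, F, rfl⟩ := h
    obtain ⟨G, R, hR, h, -⟩ := hg F
    refine ⟨_, shift_mem_invPoly (Submodule.add_mem _ (Submodule.add_mem _ (const_mem_invPoly (f * F))
      (shift_mem_invPoly (const_mem_invPoly G) 1)) (shift_mem_invPoly hR 2)) k, fun σ hσ => ?_⟩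
    rw [map_smul, h σ hσ]
    simp only [Pi.add_apply, pow_one]
  | zero => exact ⟨0, Submodule.zero_mem _, fun σ _ => map_zero _⟩
  | add Q R _ _ h1 h2 =>
    obtain ⟨Q', hQ', hQ⟩ := h1
    obtain ⟨R', hR', hR⟩ := h2
    exact ⟨Q' + R', Submodule.add_mem _ hQ' hR', fun σ hσ => by
      rw [Pi.add_apply, map_add, hQ σ hσ, hR σ hσ]; rfl⟩
  | smul c Q _ h =>
    obtain ⟨Q', hQ', hQ⟩ := h
    exact ⟨c • Q', Submodule.smul_mem _ _ hQ', fun σ hσ => by rw [Pi.smul_apply, map_smul, hQ σ hσ]; rfl⟩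

theorem IsSymbol.mul (hp : 2 ≤ p) (hm : p ≤ m) {A B : ℝ → Module.End ℂ (polyOmega p m)}
    {f f' : polyOmega p m} (hA : IsSymbol A f) (hB : IsSymbol B f') :
    IsSymbol (fun σ => A σ * B σ) (f * f') := by
  have hA' := hA
  obtain ⟨g, hg⟩ := hA'
  obtain ⟨g', hg'⟩ := hB
  refine ⟨fun z => gam f.1 f'.1 z + g z * f'.1 z + f.1 z * g' z, fun F => ?_⟩
  obtain ⟨G, R, hR, e, eG⟩ := hg' F
  obtain ⟨G₁, R₁, hR₁, e₁, eG₁⟩ := hg (f' * F)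
  obtain ⟨G₂, R₂, hR₂, e₂, -⟩ := hg G
  obtain ⟨R₃, hR₃, e₃⟩ := hA.apply_mem hR
  refine ⟨G₁ + f * G, _, Submodule.add_mem _ (Submodule.add_mem _ (Submodule.add_mem _ hR₁
    (const_mem_invPoly G₂)) (shift_mem_invPoly hR₂ 1)) hR₃, fun σ hσ => ?_, fun z => ?_⟩
  · rw [Module.End.mul_apply, e σ hσ, map_add, map_add, map_smul, map_smul, e₁ σ hσ, e₂ σ hσ, e₃ σ hσ]
    simp only [Pi.add_apply, pow_one, mul_assoc]
    module
  · change G₁.1 z + f.1 z * G.1 z = _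
    rw [eG₁, eG, gam_mul_right hp hm, gam_mul_left hp hm]
    change _ + g z * (f'.1 z * F.1 z) + _ = _
    ring

theorem IsSymbol.add (hp : 2 ≤ p) (hm : p ≤ m) {A B : ℝ → Module.End ℂ (polyOmega p m)}
    {f f' : polyOmega p m} (hA : IsSymbol A f) (hB : IsSymbol B f') (c : ℂ) :
    IsSymbol (fun σ => A σ + c • B σ) (f + c • f') := by
  obtain ⟨g, hg⟩ := hA
  obtain ⟨g', hg'⟩ := hB
  refine ⟨fun z => g z + c * g' z, fun F => ?_⟩
  obtain ⟨G, R, hR, e, eG⟩ := hg F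
  obtain ⟨G', R', hR', e', eG'⟩ := hg' F
  refine ⟨G + c • G', _, Submodule.add_mem _ hR (Submodule.smul_mem _ c hR'), fun σ hσ => ?_, fun z => ?_⟩
  · rw [LinearMap.add_apply, LinearMap.smul_apply, e σ hσ, e' σ hσ, add_mul, smul_mul_assoc]
    simp only [Pi.add_apply, Pi.smul_apply]
    module
  · change G.1 z + c * G'.1 z = _
    rw [eG, eG', gam_add_left hp hm, gam_smul_left hp hm]
    ring

theorem IsSymbol.one (hp : 2 ≤ p) (hm : p ≤ m) (c : ℂ) :
    IsSymbol (fun _ => c • (1 : Module.End ℂ (polyOmega p m))) (c • 1) := by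
  have h1 : ∀ F : polyOmega p m, ∀ z, gam (c • 1 : polyOmega p m).1 F.1 z = 0 := by
    intro F z
    have := gam_mul_left hp hm 1 1 F z
    rw [mul_one] at this
    change _ = 1 * _ + 1 * _ at this
    rw [gam_smul_left hp hm, show gam (1 : polyOmega p m).1 F.1 z = 0 by linear_combination -this, mul_zero]
  refine ⟨0, fun F => ⟨0, 0, Submodule.zero_mem _, fun σ _ => ?_, fun z => ?_⟩⟩
  · rw [LinearMap.smul_apply, Module.End.one_apply, smul_mul_assoc, one_mul, Pi.zero_apply, smul_zero,
      smul_zero, add_zero, add_zero]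
  · rw [h1, Pi.zero_apply, zero_mul, add_zero]; rfl

theorem IsSymbol.pow (hp : 2 ≤ p) (hm : p ≤ m) {A : ℝ → Module.End ℂ (polyOmega p m)}
    {f : polyOmega p m} (hA : IsSymbol A f) (i : ℕ) : IsSymbol (fun σ => A σ ^ i) (f ^ i) := by
  induction i with
  | zero => simpa only [pow_zero, one_smul] using IsSymbol.one (p := p) hp hm 1
  | succ i ih => simp only [pow_succ]; exact ih.mul hp hm hA

theorem IsSymbol.sum (hp : 2 ≤ p) (hm : p ≤ m) {ι : Type*} (s : Finset ι) (c : ι → ℂ)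
    {A : ι → ℝ → Module.End ℂ (polyOmega p m)} {f : ι → polyOmega p m} (hA : ∀ i, IsSymbol (A i) (f i)) :
    IsSymbol (fun σ => ∑ i ∈ s, c i • A i σ) (∑ i ∈ s, c i • f i) := by
  classical
  induction s using Finset.induction_on with
  | empty => simpa only [Finset.sum_empty, zero_smul] using IsSymbol.one (p := p) hp hm 0
  | insert a s ha ih =>
    simp only [Finset.sum_insert ha, add_comm (c a • _)]
    exact ih.add hp hm (hA a) (c a)

theorem isSymbol_LS (hp : 2 ≤ p) (hm : p ≤ m) {X : Mat m}
    (hX : X ∈ lieAlg p m) : IsSymbol (fun σ => (σ : ℂ)⁻¹ • LS p (σ : ℂ) X) (tauS p X) := by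
  refine ⟨0, fun F => ⟨LS p 0 X F, 0, Submodule.zero_mem _, fun σ hσ => ?_, fun z => ?_⟩⟩
  · have hσ' : (σ : ℂ) ≠ 0 := Complex.ofReal_ne_zero.2 hσ
    have h : LS p (σ : ℂ) X F = LS p 0 X F + (σ : ℂ) • (tauS p X * F) := by
      obtain ⟨P, rfl⟩ := toPoly_surjective F
      rw [LS_toPoly hp hm hX, LS_toPoly hp hm hX, tauS, ← map_mul, ← map_smul, ← map_add, Lop_apply,
        Lop_apply, zero_smul, add_zero]
    rw [LinearMap.smul_apply, h, smul_add, smul_smul, inv_mul_cancel₀ hσ', one_smul, Pi.zero_apply,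
      smul_zero, add_zero, add_comm (tauS p X * F)]
  · obtain ⟨P, rfl⟩ := toPoly_surjective F
    rw [gam_tau hp hm hX, LS_toPoly hp hm hX, Lop_apply, zero_smul, add_zero, Pi.zero_apply, zero_mul,
      add_zero]

/-- The inverse of the factor `raiseCoeff`, without its leading power of `σ`. -/
def raiseInv (m i j : ℕ) (σ : ℂ) : ℂ :=
  (∏ r ∈ Finset.range i, (σ + 0) / (σ + (-r - j))) *
    ∏ r ∈ Finset.range j, (-(1 / 2) * ((σ + 0) / (σ + -r))) * ((σ + 0) / (σ + (m / 2 - 1 - r)))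

theorem raiseInv_mul {m : ℕ} {σ : ℂ} (hσ : Gen m σ) (i j : ℕ) :
    raiseInv m i j σ * (σ⁻¹ ^ i * (σ⁻¹ * σ⁻¹) ^ j) * raiseCoeff m σ i j = 1 := by
  have h0 : σ ≠ 0 := by simpa using hσ.sub_ne_zero 0
  have e1 : (∏ r ∈ Finset.range i, (σ + 0) / (σ + (-r - j))) * σ⁻¹ ^ i *
      ∏ r ∈ Finset.range i, (σ - r - j) = 1 := by
    rw [← Finset.card_range i, ← Finset.prod_const, Finset.card_range, ← Finset.prod_mul_distrib,
      ← Finset.prod_mul_distrib]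
    refine Finset.prod_eq_one fun r _ => ?_
    have h1 := hσ.sub_ne_zero (r + j)
    push_cast at h1
    rw [show σ - r - j = σ - (r + j) by ring, show σ + (-(r : ℂ) - j) = σ - (r + j) by ring, add_zero]
    field_simp
  have e2 : (∏ r ∈ Finset.range j, (-(1 / 2) * ((σ + 0) / (σ + -r))) * ((σ + 0) / (σ + (m / 2 - 1 - r)))) *
      (σ⁻¹ * σ⁻¹) ^ j * ∏ r ∈ Finset.range j, (-2 * (σ - r) * (σ + m / 2 - 1 - r)) = 1 := by
    rw [← Finset.card_range j, ← Finset.prod_const, Finset.card_range, ← Finset.prod_mul_distrib,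
      ← Finset.prod_mul_distrib]
    refine Finset.prod_eq_one fun r _ => ?_
    have h1 := hσ.sub_ne_zero r
    have h2 := hσ.add_sub_ne_zero (1 + r)
    push_cast at h1 h2
    rw [show σ + m / 2 - 1 - r = σ + m / 2 - (1 + r) by ring, show σ + -(r : ℂ) = σ - r by ring,
      show σ + (m / 2 - 1 - (r : ℂ)) = σ + m / 2 - (1 + r) by ring, add_zero]
    generalize σ - (r : ℂ) = u at h1 ⊢
    generalize σ + m / 2 - (1 + (r : ℂ)) = v at h2 ⊢
    field_simp
  rw [raiseInv, raiseCoeff]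
  have e3 : _ * _ = (1 : ℂ) * 1 := congrArg₂ (· * ·) e1 e2
  linear_combination e3

theorem asy_raiseInv {l : Filter ℝ} (hl : l ≤ atBot) (m i j : ℕ) :
    ∃ e₀ e₁, Asy l (fun σ : ℝ => raiseInv m i j σ) e₀ e₁ := by
  have hprod : ∀ (k : ℕ) (f : ℕ → ℝ → ℂ), (∀ r, ∃ e₀ e₁, Asy l (f r) e₀ e₁) →
      ∃ e₀ e₁, Asy l (fun σ => ∏ r ∈ Finset.range k, f r σ) e₀ e₁ := by
    intro k f hf
    induction k with
    | zero => exact ⟨1, 0, (Asy.const 1).of_eq (fun σ => Finset.prod_range_zero _) rfl rfl⟩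
    | succ k ih =>
      obtain ⟨_, _, h1⟩ := ih
      obtain ⟨_, _, h2⟩ := hf k
      exact ⟨_, _, (h1.mul hl h2).of_eq (fun σ => Finset.prod_range_succ _ _) rfl rfl⟩
  obtain ⟨_, _, h1⟩ := hprod i _ fun r => ⟨_, _, Asy.div hl 0 (-(r : ℂ) - j)⟩
  obtain ⟨_, _, h2⟩ := hprod j _ fun r => ⟨_, _, ((Asy.const (-(1 / 2))).mul hl (Asy.div hl 0 (-(r : ℂ)))).mul hl
    (Asy.div hl 0 ((m : ℂ) / 2 - 1 - r))⟩
  exact ⟨_, _, h1.mul hl h2⟩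

theorem star_asymptotics (hp : 2 ≤ p) (hm : p ≤ m) {n : ℂ} (hn : n = m + 2)
    {M : ℝ → polyOmega p m →ₗ[ℂ] polyOmega p m →ₗ[ℂ] polyOmega p m}
    (hM : ∀ σ : ℝ, Gen m (σ : ℂ) → ∀ A ∈ algL p m σ, M σ (A 1) = A) (F₁ F₂ : polyOmega p m) (z : Omega p m) :
    Asy (toMinusInfty n) (fun σ => (M σ F₁ F₂).1 z) (F₁.1 z * F₂.1 z) (gam F₁.1 F₂.1 z) := by
  have hl : toMinusInfty n ≤ atBot := inf_le_left
  have hnb := toMinusInfty_neBot hn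
  have hF : F₁ ∈ Submodule.span ℂ (eSet p m) := by rw [span_eSet hp hm]; trivial
  induction hF using Submodule.span_induction with
  | mem F h =>
    obtain ⟨α, β, i, j, h, rfl⟩ := h
    set E := EOm p α β i j
    let L : (Row m) → ℝ → Module.End ℂ (polyOmega p m) := fun b σ =>
      (σ : ℂ)⁻¹ • LS p (σ : ℂ) (wedge p α b)
    let A : ℝ → Module.End ℂ (polyOmega p m) := fun σ =>
      L β σ ^ i * (∑ k, (lam p k : ℂ) • (L (bas k) σ * L (bas k) σ)) ^ j
    have hL : ∀ b, IsSymbol (L b) (tauS p (wedge p α b)) := fun b => isSymbol_LS hp hm (wedge_mem _ _)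
    obtain ⟨g, hg⟩ := ((hL β).pow hp hm i).mul hp hm ((IsSymbol.sum hp hm Finset.univ (fun k => (lam p k : ℂ))
      fun k => (hL (bas k)).mul hp hm (hL (bas k))).pow hp hm j)
    generalize hf : tauS p (wedge p α β) ^ i * (∑ k, (lam p k : ℂ) •
      (tauS p (wedge p α (bas k)) * tauS p (wedge p α (bas k)))) ^ j = f at hg
    have hA : ∀ σ : ℝ, A σ = ((σ : ℂ)⁻¹ ^ i * ((σ : ℂ)⁻¹ * (σ : ℂ)⁻¹) ^ j) •
        (LS p (σ : ℂ) (wedge p α β) ^ i * LW p (σ : ℂ) α ^ j) := by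
      intro σ
      have e : ∑ k, (lam p k : ℂ) • (L (bas k) σ * L (bas k) σ) =
          ((σ : ℂ)⁻¹ * (σ : ℂ)⁻¹) • LW p (σ : ℂ) α := by
        rw [LW, Finset.smul_sum]
        refine Finset.sum_congr rfl fun k _ => ?_
        simp only [L, smul_mul_smul_comm, smul_comm (lam p k : ℂ)]
      change L β σ ^ i * (∑ k, (lam p k : ℂ) • (L (bas k) σ * L (bas k) σ)) ^ j = _
      rw [e]
      simp only [L, smul_pow, smul_mul_smul_comm]
    have hA1 : ∀ σ : ℝ, Gen m (σ : ℂ) → (raiseInv m i j σ • A σ) 1 = E := by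
      intro σ hσ
      rw [hA, LinearMap.smul_apply, LinearMap.smul_apply, LW_pow_one hp hm h]
      exact (congrArg _ (smul_smul _ _ _)).trans ((smul_smul _ _ _).trans (by
        rw [← mul_assoc, raiseInv_mul hσ, one_smul]))
    have hME : ∀ σ : ℝ, Gen m (σ : ℂ) → M σ E = raiseInv m i j σ • A σ := by
      intro σ hσ
      have h1 : raiseInv m i j σ • A σ ∈ algL p m σ := by
        rw [hA]
        exact (algL p m (σ : ℂ)).smul_mem ((algL p m (σ : ℂ)).smul_mem (mul_mem
          (pow_mem (LS_mem_algL (wedge_mem α β) _) i) (pow_mem (LW_mem_algL _ α) j)) _) _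
      rw [← hM σ hσ _ h1, hA1 σ hσ]
    obtain ⟨e₀, e₁, he⟩ := asy_raiseInv hl m i j
    have hAF : ∀ (F : polyOmega p m) (z : Omega p m), Asy (toMinusInfty n) (fun σ => (A σ F).1 z) (f.1 z * F.1 z)
        (gam f.1 F.1 z + g z * F.1 z) := by
      intro F z
      obtain ⟨G, R, hR, e, eG⟩ := hg F
      rw [← eG]
      have h1 := (isBigO_inv_sq (l := toMinusInfty n) 1).mul (isBigO_invPoly hl hR z)
      simp only [mul_one, one_mul] at h1
      refine IsBigO.congr' h1 ?_ EventuallyEq.rfl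
      filter_upwards [(eventually_lt_atBot 0).filter_mono hl] with σ hσ
      rw [show A σ F = _ from e σ hσ.ne]
      change _ = f.1 z * F.1 z + (σ : ℂ)⁻¹ * G.1 z + ((σ : ℂ)⁻¹) ^ 2 * (R σ).1 z - _
      ring
    have hMF : ∀ (F : polyOmega p m) (z : Omega p m), Asy (toMinusInfty n) (fun σ => (M σ E F).1 z) (e₀ * (f.1 z * F.1 z))
        (e₀ * (gam f.1 F.1 z + g z * F.1 z) + e₁ * (f.1 z * F.1 z)) := by
      intro F z
      refine (he.mul hl (hAF F z)).congr ?_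
      filter_upwards [eventually_gen hn] with σ hσ
      rw [hME σ hσ]; rfl
    have h1 : ∀ z, Asy (toMinusInfty n) (fun σ => (M σ E 1).1 z) (E.1 z) 0 := by
      intro z
      refine (Asy.const (E.1 z)).congr ?_
      filter_upwards [eventually_gen hn] with σ hσ
      rw [hME σ hσ, hA1 σ hσ]
    have hone : (1 : polyOmega p m).1 = fun _ => 1 := rfl
    have hf1 : gam f.1 (1 : polyOmega p m).1 z = 0 := by
      have := gam_mul_right hp hm f 1 1 z
      rw [mul_one, hone] at this
      rw [hone]
      linear_combination -this
    have hEf : E = e₀ • f := Subtype.ext (funext fun z => by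
      have := ((h1 z).unique hl (hMF 1 z)).1
      rw [hone, mul_one] at this
      exact this)
    have hu := ((h1 z).unique hl (hMF 1 z)).2
    rw [hf1, hone] at hu
    refine (hMF F₂ z).of_eq (fun _ => rfl) ?_ ?_
    · rw [hEf]; exact mul_assoc _ _ _
    · rw [hEf, gam_smul_left hp hm]
      linear_combination F₂.1 z * hu
  | zero =>
    have h0 := gam_smul_left hp hm 0 0 F₂ z
    rw [zero_smul, zero_mul] at h0
    refine (Asy.const 0).of_eq (fun σ => by rw [map_zero]; rfl) (zero_mul _) h0
  | add F G _ _ hF hG =>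
    refine (hF.add hG).of_eq (fun σ => by rw [map_add]; rfl) (add_mul _ _ _) (gam_add_left hp hm _ _ _ _)
  | smul c F _ hF =>
    refine ((Asy.const c).mul hl hF).of_eq (fun σ => by rw [map_smul]; rfl) (mul_assoc _ _ _) ?_
    rw [gam_smul_left hp hm, zero_mul, add_zero]

end Star

end ParaHermitian

end

open ParaHermitian Filter Topology Asymptotics

theorem mainTheorem11 (p q m : ℕ) (hp : 2 ≤ p) (hq : 2 ≤ q) (hm : m + 2 = p + q)
    (n : ℂ) (hn : n = p + q) (ε : Fin 2) :
    ∃ (B : ℂ → polyOmega p m →ₗ[ℂ] polyOmega p m)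
      (M : ℂ → polyOmega p m →ₗ[ℂ] polyOmega p m →ₗ[ℂ] polyOmega p m),
      -- for generic `σ`, the Berezin transform and the multiplication of symbols exist on
      -- `S(G/H)` and are unique
      (∀ σ : ℂ, Generic n σ →
        (IsBerezin σ ε (B σ) ∧ ∀ B', IsBerezin σ ε B' → B' = B σ) ∧
        (IsStar σ ε (M σ) ∧ ∀ M', IsStar σ ε M' → M' = M σ)) ∧
      -- the radial parts of the Laplace operators
      (∀ F : polyOmega p m, NInvariant F.1 →
        ∀ (t₁ t₂ : ℝ) (z : Omega p m),
          z.1 = NormedSpace.exp (-cartan m t₁ t₂) * z₀ p m * NormedSpace.exp (cartan m t₁ t₂) →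
          laplace₂ F.1 z = 1 / 2 * (opD₁ n (radialFun F.1) t₁ t₂ + opD₂ n (radialFun F.1) t₁ t₂ -
              (n - 4) * (n - 6) * radialFun F.1 t₁ t₂) ∧
          laplace₄ F.1 z = opD₁ n (opD₂ n (radialFun F.1)) t₁ t₂ +
              2 * (n - 4) ^ 3 * radialFun F.1 t₁ t₂) ∧
      -- `S(G/H)` is spanned by joint eigenfunctions, on which `B` is the Gamma ratio
      (Submodule.span ℂ {F : polyOmega p m | ∃ a b : ℂ, JointEigen n a b F.1} = ⊤) ∧
      (∀ σ : ℂ, Generic n σ → ∀ (a b : ℂ) (F : polyOmega p m), JointEigen n a b F.1 →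
        B σ F = gammaRatio n σ a b • F) ∧
      (∀ σ : ℂ, Generic n σ → ∀ (a b : ℂ) (F : polyOmega p m), NInvariant F.1 →
        (∀ t₁ t₂, opD₁ n (radialFun F.1) t₁ t₂ = d₁ n a b * radialFun F.1 t₁ t₂) →
        (∀ t₁ t₂, opD₂ n (radialFun F.1) t₁ t₂ = d₂ n a b * radialFun F.1 t₁ t₂) →
        B σ F = gammaRatio n σ a b • F) ∧
      -- the first two terms of the asymptotic expansion of `B`
      (∀ (F : polyOmega p m) (z : Omega p m),
        (fun σ : ℝ => (B σ F).1 z - (F.1 z - 1 / (2 * (σ : ℂ)) * laplace₂ F.1 z))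
          =O[toMinusInfty n] (fun σ : ℝ => (σ ^ 2)⁻¹)) ∧
      -- the correspondence principle
      (∀ (F₁ F₂ : polyOmega p m) (z : Omega p m),
        Tendsto (fun σ : ℝ => (M σ F₁ F₂).1 z) (toMinusInfty n) (𝓝 (F₁.1 z * F₂.1 z)) ∧
        Tendsto (fun σ : ℝ => -(σ : ℂ) * ((M σ F₁ F₂).1 z - (M σ F₂ F₁).1 z))
          (toMinusInfty n) (𝓝 (poisson F₁.1 F₂.1 z))) := by
  have hpm : p ≤ m := by omega
  have hn' : n = m + 2 := by rw [hn]; exact_mod_cast hm.symm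
  have hS := span_eSet hp hpm
  classical
  let M : ℂ → polyOmega p m →ₗ[ℂ] polyOmega p m →ₗ[ℂ] polyOmega p m := fun σ =>
    if h : Gen m σ then (exists_star hp hpm hS h).choose else 0
  have hM : ∀ σ, Gen m σ → ∀ A ∈ algL p m σ, M σ (A 1) = A := by
    intro σ h
    simp only [M, dif_pos h]
    exact (exists_star hp hpm hS h).choose_spec
  have hl : toMinusInfty n ≤ atBot := inf_le_left
  have hMas := star_asymptotics hp hpm hn' fun σ => hM σ
  refine ⟨berezin hp hpm, M, fun σ hσ => ?_, fun F hF t₁ t₂ z hz => radial_parts hp hpm hn' hF hz, ?_,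
    fun σ _ a b F hF => berezin_jointEigen hp hpm hn' hF,
    fun σ _ a b F hF h₁ h₂ => berezin_jointEigen hp hpm hn' (jointEigen_of_radial hp hpm hn' hF h₁ h₂),
    fun F z => ?_, fun F₁ F₂ z => ⟨((hMas F₁ F₂ z).tendsto hl).1, ?_⟩⟩
  · have hG := hσ.gen hn'
    have hB := isBerezin_of hp hpm ε (berezin_one hp hpm hG) fun X hX F => berezin_RS hp hpm hG hX F
    have hM' := isStar_of hp hpm ε (hM σ hG)
    exact ⟨⟨hB, fun B' hB' => isBerezin_unique hp hpm hS hG ε hB hB'⟩,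
      hM', fun M' hMM => isStar_unique hp hpm hS hG ε hM' hMM⟩
  · rw [eq_top_iff, ← hS]
    refine Submodule.span_mono ?_
    rintro _ ⟨α, β, i, j, h, rfl⟩
    exact ⟨_, _, jointEigen_EOm hp hpm hn' h i j⟩
  · refine (berezin_asymptotics hp hpm hn' F z).congr_left fun σ => ?_
    rw [one_div, one_div, mul_inv]
    ring
  · have h := (((hMas F₁ F₂ z).tendsto hl).2.sub ((hMas F₂ F₁ z).tendsto hl).2).neg
    rw [neg_sub, ← poisson_eq_gam] at h
    refine h.congr fun σ => ?_
    ring
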